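/- Let $k$ be a commutative ring and let $A$ be a $k$-algebra, possibly noncommutative. Let $U$ be a left bialgebroid over $A$, with source map $s\colon A\to U$, target map $t\colon A^{\mathrm{op}}\to U$, coproduct $\Delta(u)=u_{(1)}\otimes_A u_{(2)}$ with values in $U\otimes_A U=U\otimes_k U/(t(a)u\otimes v-u\otimes s(a)v)$, and counit $\varepsilon\colon U\to A$. Assume that $U$ is a left Hopf algebroid, that is, the Galois map $u\otimes v\mapsto u_{(1)}\otimes u_{(2)}v$ from $U\otimes_{A^{\mathrm{op}}}U=U\otimes_k U/(u\,t(a)\otimes v-u\otimes t(a)v)$ to $U\otimes_A U$ is bijective; write $u_+\otimes u_-$ for the preimage of $u\otimes 1$. Let $M$ be a module-comodule: a right $U$-module with a left $U$-coaction $m\mapsto m_{(-1)}\otimes m_{(0)}\in U\otimes_A M$ (coassociative, counital and left $A$-linear), where $a\in A$ acts on $M$ from the left by $m\mapsto m\,t(a)$; no further compatibility of action and coaction is assumed. Write $a\blacktriangleright u=u\,t(a)$ and $a\blacktriangleright m=m\,t(a)$. *Cochains.* $C^p(U,A)$ is the space of right $A$-linear maps $\varphi\colon U^{\otimes_{A^{\mathrm{op}}}p}\to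 A$, so $\varphi(t(a)u^1,u^2,\dots)=\varphi(u^1,u^2,\dots)a$, and $C^0(U,A)=A$. Put $$\delta\varphi(u^1,\dots,u^{p+1})=\varepsilon\big(u^1s(\varphi(u^2,\dots,u^{p+1}))\big)+\sum_{i=1}^p(-1)^i\varphi(\dots,u^iu^{i+1},\dots)+(-1)^{p+1}\varphi(u^1,\dots,\varepsilon(u^{p+1})\blacktriangleright u^p)$$ (for $p=0$: $\delta a(u)=\varepsilon(u\,s(a))-a\varepsilon(u)$) and $$(\varphi\smallsmile\psi)(u^1,\dots,u^{p+q})=\varphi(u^1,\dots,u^{p-1},\psi(u^{p+1},\dots,u^{p+q})\blacktriangleright u^p)$$ (for $p=0$: the product $\varphi\,\psi(u^1,\dots,u^q)$ in $A$). Put $D_\varphi(u^1,\dots,u^p)=s\big(\varphi(u^1_{(1)},\dots,u^p_{(1)})\big)u^1_{(2)}\cdots u^p_{(2)}$ and $$(\varphi\circ_i\psi)(u^1,\dots,u^{p+q-1})=\varphi(u^1,\dots,u^{i-1},D_\psi(u^i,\dots,u^{i+q-1}),u^{i+q},\dots,u^{p+q-1}),$$ $$\varphi\,\bar\circ\,\psi=(-1)^{(p-1)(q-1)}\sum_{i=1}^p(-1)^{(q-1)(i-1)}\varphi\circ_i\psi,\qquad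 \{\varphi,\psi\}=\varphi\,\bar\circ\,\psi-(-1)^{(p-1)(q-1)}\psi\,\bar\circ\,\varphi .$$ *Chains.* $C_n(U,M)=M\otimes_{A^{\mathrm{op}}}U^{\otimes_{A^{\mathrm{op}}}n}$. Put $\mathsf b=\sum_{i=0}^n(-1)^i\mathsf d_i$ on $C_n(U,M)$, where $\mathsf d_0(m,u^1,\dots,u^n)=(m,u^1,\dots,\varepsilon(u^n)\blacktriangleright u^{n-1})$ (for $n=1$: $\varepsilon(u^1)\blacktriangleright m$), $\mathsf d_i$ replaces $u^{n-i},u^{n-i+1}$ by their product for $0<i<n$, and $\mathsf d_n(m,u^1,\dots,u^n)=(mu^1,u^2,\dots,u^n)$. Put $$\mathsf t(m,u^1,\dots,u^n)=(m_{(0)}u^1_+,u^2_+,\dots,u^n_+,u^n_-\cdots u^1_-m_{(-1)})\quad(\text{for }n=0:\ \mathsf t(m)=m_{(0)}m_{(-1)}),\qquad \mathsf T=\mathsf t^{n+1},$$ $$\mathsf s_n(m,u^1,\dots,u^n)=(m,1,u^1,\dots,u^n),\quad \mathsf s_{-1}=\mathsf t\,\mathsf s_n,\quad \mathsf N=\sum_{i=0}^n(-1)^{in}\mathsf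 t^i,\quad \mathsf B=\mathsf s_{-1}\mathsf N .$$ For $\varphi\in C^p(U,A)$, $p\le n$ and $1\le i\le n-p+1$ put $$\mathsf D^i_\varphi(m,u^1,\dots,u^n)=(m,u^1,\dots,u^{i-1},D_\varphi(u^i,\dots,u^{i+p-1}),u^{i+p},\dots,u^n),\qquad \mathsf D'_\varphi=\mathsf D_\varphi^{n-p+1},$$ $$\iota_\varphi(m,u^1,\dots,u^n)=(m,u^1,\dots,u^{n-p-1},\varphi(u^{n-p+1},\dots,u^n)\blacktriangleright u^{n-p})$$ (for $p=n$: $\varphi(u^1,\dots,u^n)\blacktriangleright m$; for $p>n$: $\iota_\varphi=0$), and define $\mathcal L_\varphi\colon C_n(U,M)\to C_{n-p+1}(U,M)$ for $p\le n$ by $$\mathcal L_\varphi=\sum_{i=1}^{n-p+1}(-1)^{(p-1)(n-i+1)}\mathsf t^{\,n-p+1-i}\,\mathsf D'_\varphi\,\mathsf t^{\,i+p}+\sum_{i=1}^p(-1)^{n(i-1)+p-1}\mathsf t^{\,n-p+1}\,\mathsf D'_\varphi\,\mathsf t^{\,i},$$ for $p=n+1$ by $\mathcal L_\varphi=(-1)^{p-1}\iota_\varphi\mathsf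 B$, and for $p>n+1$ by $\mathcal L_\varphi=0$. *(Co)homology.* Let $C_M^p(U)$ be the set of those $\varphi\in C^p(U,A)$ with $\mathsf D^i_\varphi(\mathrm{im}(\mathrm{id}-\mathsf T))\subseteq\mathrm{im}(\mathrm{id}-\mathsf T)$ for all $n\ge p$ and all $i$, and put $C^{\mathrm{cyc}}_\bullet(U,M)=C_\bullet(U,M)/\mathrm{im}(\mathrm{id}-\mathsf T)$. **Theorem.** $(C^\bullet_M(U),\delta)$ is a cochain complex, and $\mathsf b$ induces a differential on $C^{\mathrm{cyc}}_\bullet(U,M)$. Let $H_M^\bullet(U)$ be the cohomology of the former and $H^M_\bullet(U)$ the homology of the latter complex. Then the pair $(H_M^\bullet(U),H^M_\bullet(U))$ is a differential calculus whose operations are induced by the above formulas: for cocycles $\varphi,\psi$ in $C_M^\bullet(U)$ and $x\in C_n(U,M)$ that represents a cycle of $C^{\mathrm{cyc}}_\bullet(U,M)$, the elements $\varphi\smallsmile\psi$ and $\{\varphi,\psi\}$ are cocycles in $C_M^\bullet(U)$, the elements $\iota_\varphi x$, $\mathcal L_\varphi x$, $\mathsf Bx$ represent cycles of $C^{\mathrm{cyc}}_\bullet(U,M)$,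 and the operations $$[\varphi]\smallsmile[\psi]=[\varphi\smallsmile\psi],\quad \{[\varphi],[\psi]\}=[\{\varphi,\psi\}],\quad [\varphi]\smallfrown[x]=[\iota_\varphi x],\quad \mathcal L_{[\varphi]}[x]=[\mathcal L_\varphi x],\quad \mathsf B[x]=[\mathsf Bx]$$ are well defined and have the following properties; moreover $\mathsf B[x]=[(\mathrm{id}-\mathsf t)\mathsf s_{-1}\mathsf Nx]$. 1. $V=H_M^\bullet(U)$ is a Gerstenhaber algebra: $(V,\smallsmile)$ is a unital (with unit the class of $1\in A=C^0(U,A)$) associative graded algebra with $\alpha\smallsmile\beta=(-1)^{pq}\beta\smallsmile\alpha$ for $\alpha\in V^p$, $\beta\in V^q$; the bracket maps $V^p\otimes V^q$ to $V^{p+q-1}$ and satisfies, for $\alpha\in V^p$, $\beta\in V^q$ and all $\gamma$, $\{\alpha,\beta\}=-(-1)^{(p-1)(q-1)}\{\beta,\alpha\}$, $\{\alpha,\{\beta,\gamma\}\}=\{\{\alpha,\beta\},\gamma\}+(-1)^{(p-1)(q-1)}\{\beta,\{\alpha,\gamma\}\}$, and $\{\alpha,\beta\smallsmile\gamma\}=\{\alpha,\beta\}\smallsmile\gamma+(-1)^{(p-1)q}\beta\smallsmile\{\alpha,\gamma\}$.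 2. $\Omega=H^M_\bullet(U)$ is a Gerstenhaber module over $V$: a unital graded $(V,\smallsmile)$-module with $V^p\smallfrown\Omega_n\subseteq\Omega_{n-p}$, and for $\alpha\in V^p$, $\beta\in V^q$, $x\in\Omega$ one has $\mathcal L_\alpha(\Omega_n)\subseteq\Omega_{n-p+1}$, $\mathcal L_{\{\alpha,\beta\}}=\mathcal L_\alpha\mathcal L_\beta-(-1)^{(p-1)(q-1)}\mathcal L_\beta\mathcal L_\alpha$, and $\beta\smallfrown\mathcal L_\alpha(x)=\{\beta,\alpha\}\smallfrown x+(-1)^{(p-1)q}\mathcal L_\alpha(\beta\smallfrown x)$. 3. It is a Batalin–Vilkovisky module: $\mathsf B\colon\Omega_n\to\Omega_{n+1}$ is $k$-linear with $\mathsf B\mathsf B=0$, and $\mathcal L_\alpha(x)=\mathsf B(\alpha\smallfrown x)-(-1)^p\alpha\smallfrown\mathsf B(x)$ for $\alpha\in V^p$. -/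

import Mathlib

open scoped TensorProduct DirectSum

universe v u

namespace HopfCalculus

/-- The sign `(-1)^n` for an integer `n`. -/
def sg (n : ℤ) : ℤ := (Int.negOnePow n : ℤ)

/-! ## Balanced tensor products over a noncommutative algebra -/

section Balanced

variable {k : Type v} [CommRing k] {A X Y Z : Type*}
  [AddCommGroup X] [Module k X] [AddCommGroup Y] [Module k Y] [AddCommGroup Z] [Module k Z]

/-- The relations `(x · a) ⊗ y = x ⊗ (a · y)`. -/
def balRel (ρ : A → X →ₗ[k] X) (l : A → Y →ₗ[k] Y) : Submodule k (X ⊗[k] Y) :=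
  Submodule.span k {z | ∃ a x y, z = ρ a x ⊗ₜ[k] y - x ⊗ₜ[k] l a y}

/-- The balanced tensor product: `X ⊗_k Y` modulo `(x · a) ⊗ y = x ⊗ (a · y)`. -/
abbrev Bal (ρ : A → X →ₗ[k] X) (l : A → Y →ₗ[k] Y) : Type _ := (X ⊗[k] Y) ⧸ balRel ρ l

/-- The canonical projection from the tensor product over `k`. -/
def Bal.proj (ρ : A → X →ₗ[k] X) (l : A → Y →ₗ[k] Y) : X ⊗[k] Y →ₗ[k] Bal ρ l :=
  (balRel ρ l).mkQ

/-- The class of the elementary tensor `x ⊗ y`. -/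
def Bal.mk (ρ : A → X →ₗ[k] X) (l : A → Y →ₗ[k] Y) : X →ₗ[k] Y →ₗ[k] Bal ρ l :=
  (TensorProduct.mk k X Y).compr₂ (Bal.proj ρ l)

variable {ρ : A → X →ₗ[k] X} {l : A → Y →ₗ[k] Y}

theorem Bal.proj_tmul (x : X) (y : Y) : Bal.proj ρ l (x ⊗ₜ[k] y) = Bal.mk ρ l x y := rfl

theorem Bal.mk_bal (a : A) (x : X) (y : Y) : Bal.mk ρ l (ρ a x) y = Bal.mk ρ l x (l a y) := by
  rw [← Bal.proj_tmul, ← Bal.proj_tmul]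
  exact (Submodule.Quotient.eq _).2 (Submodule.subset_span ⟨a, x, y, rfl⟩)

/-- The linear map on the balanced tensor product induced by a balanced bilinear map. -/
def Bal.lift (f : X →ₗ[k] Y →ₗ[k] Z) (hf : ∀ a x y, f (ρ a x) y = f x (l a y)) :
    Bal ρ l →ₗ[k] Z :=
  (balRel ρ l).liftQ (TensorProduct.lift f) (by
    rw [balRel, Submodule.span_le]
    rintro _ ⟨a, x, y, rfl⟩
    simp [hf])

@[simp] theorem Bal.lift_mk (f : X →ₗ[k] Y →ₗ[k] Z) (hf) (x : X) (y : Y) :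
    Bal.lift (ρ := ρ) (l := l) f hf (Bal.mk ρ l x y) = f x y := by
  rw [← Bal.proj_tmul, Bal.lift, Bal.proj, Submodule.mkQ_apply, Submodule.liftQ_apply,
    TensorProduct.lift.tmul]

theorem Bal.hom_ext {f g : Bal ρ l →ₗ[k] Z}
    (h : ∀ x y, f (Bal.mk ρ l x y) = g (Bal.mk ρ l x y)) : f = g := by
  apply Submodule.linearMap_qext
  apply TensorProduct.ext'
  intro x y
  exact h x y

theorem Bal.proj_surjective : Function.Surjective (Bal.proj ρ l) := Submodule.mkQ_surjective _

end Balanced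

/-! ## Bialgebroids and left Hopf algebroids -/

section Bialgebroid

variable {k : Type v} {A U M : Type u} [CommRing k] [Ring A] [Algebra k A] [Ring U] [Algebra k U]

/-- The source map `s(a) = η(a ⊗ 1)`. -/
def src (η : A ⊗[k] Aᵐᵒᵖ →ₐ[k] U) : A →ₗ[k] U :=
  η.toLinearMap ∘ₗ (TensorProduct.mk k A Aᵐᵒᵖ).flip 1

/-- The target map `t(a) = η(1 ⊗ a)`. -/
def tgt (η : A ⊗[k] Aᵐᵒᵖ →ₐ[k] U) : A →ₗ[k] U :=
  η.toLinearMap ∘ₗ TensorProduct.mk k A Aᵐᵒᵖ 1 ∘ₗ (MulOpposite.opLinearEquiv k).toLinearMap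

variable (η : A ⊗[k] Aᵐᵒᵖ →ₐ[k] U)

theorem src_apply (a : A) : src η a = η (a ⊗ₜ 1) := rfl
theorem tgt_apply (a : A) : tgt η a = η (1 ⊗ₜ MulOpposite.op a) := rfl

theorem tgt_mul (a b : A) : tgt η (a * b) = tgt η b * tgt η a := by
  simp [tgt_apply, ← map_mul]

theorem src_mul (a b : A) : src η (a * b) = src η a * src η b := by
  simp [src_apply, ← map_mul]

@[simp] theorem src_one : src η 1 = 1 := by
  rw [src_apply, ← Algebra.TensorProduct.one_def, map_one]

@[simp] theorem tgt_one : tgt η 1 = 1 := by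
  rw [tgt_apply, MulOpposite.op_one, ← Algebra.TensorProduct.one_def, map_one]

theorem src_tgt_comm (a b : A) : src η a * tgt η b = tgt η b * src η a := by
  simp [src_apply, tgt_apply, ← map_mul]

/-- `U ⊗_A U`, with `t(a) u ⊗ v = u ⊗ s(a) v`. -/
abbrev TensA : Type u :=
  Bal (fun a => LinearMap.mulLeft k (tgt η a)) (fun a => LinearMap.mulLeft k (src η a))

/-- The projection `U ⊗_k U → U ⊗_A U`. -/
abbrev projA : U ⊗[k] U →ₗ[k] TensA η :=
  Bal.proj (fun a => LinearMap.mulLeft k (tgt η a)) (fun a => LinearMap.mulLeft k (src η a))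

/-- `U ⊗_{A^op} U`, with `u t(a) ⊗ v = u ⊗ t(a) v`. -/
abbrev TensOp : Type u :=
  Bal (fun a => LinearMap.mulRight k (tgt η a)) (fun a => LinearMap.mulLeft k (tgt η a))

/-- The relations that present `U ⊗_A U ⊗_A N` as a quotient of `U ⊗_k U ⊗_k N`; here `N` is a
left `A`-module with action `ν`. -/
def tripleRel {N : Type u} [AddCommGroup N] [Module k N] (ν : A → N →ₗ[k] N) :
    Submodule k (U ⊗[k] (U ⊗[k] N)) :=
  Submodule.span k
    ({z | ∃ a x y n, z = (tgt η a * x) ⊗ₜ[k] (y ⊗ₜ[k] n) - x ⊗ₜ[k] ((src η a * y) ⊗ₜ[k] n)} ∪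
     {z | ∃ a x y n, z = x ⊗ₜ[k] ((tgt η a * y) ⊗ₜ[k] n) - x ⊗ₜ[k] (y ⊗ₜ[k] ν a n)})

variable (k A U) in
/-- A left bialgebroid `U` over `A`. Identities between elements of `U ⊗_A U` are expressed
through arbitrary representatives `z` of `Δ(u)` in `U ⊗_k U`; none of them depends on the
representative that is chosen. -/
structure LeftBialgebroid where
  /-- the structure map `A ⊗ A^op → U` -/
  η : A ⊗[k] Aᵐᵒᵖ →ₐ[k] U
  /-- the coproduct -/
  comul : U →ₗ[k] TensA η
  /-- the counit -/
  counit : U →ₗ[k] A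
  /-- `Δ(s(a) t(b) u) = s(a) u₁ ⊗ t(b) u₂` -/
  comul_bimod : ∀ (a b : A) (u : U) (z : U ⊗[k] U), projA η z = comul u →
    comul (src η a * tgt η b * u) = projA η ((src η a ⊗ₜ tgt η b) * z)
  /-- `ε(s(a) t(b) u) = a ε(u) b` -/
  counit_bimod : ∀ (a b : A) (u : U), counit (src η a * tgt η b * u) = a * counit u * b
  /-- coassociativity `(Δ ⊗ id) Δ(u) = (id ⊗ Δ) Δ(u)` in `U ⊗_A U ⊗_A U` -/
  coassoc : ∀ (u : U) (z : U ⊗[k] U), projA η z = comul u →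
    ∀ y : (U ⊗[k] U) ⊗[k] U, (projA η).rTensor U y = comul.rTensor U z →
    ∀ y' : U ⊗[k] (U ⊗[k] U), (projA η).lTensor U y' = comul.lTensor U z →
      TensorProduct.assoc k U U U y - y' ∈
        tripleRel η (fun a => LinearMap.mulLeft k (src η a))
  /-- `s(ε(u₁)) u₂ = u` -/
  counit_left : ∀ (u : U) (z : U ⊗[k] U), projA η z = comul u →
    LinearMap.mul' k U (TensorProduct.map (src η ∘ₗ counit) LinearMap.id z) = u
  /-- `t(ε(u₂)) u₁ = u` -/
  counit_right : ∀ (u : U) (z : U ⊗[k] U), projA η z = comul u →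
    LinearMap.mul' k U (TensorProduct.map (tgt η ∘ₗ counit) LinearMap.id
      (TensorProduct.comm k U U z)) = u
  /-- `Δ` takes values in the Sweedler-Takeuchi product: `u₁ t(a) ⊗ u₂ = u₁ ⊗ u₂ s(a)` -/
  takeuchi : ∀ (a : A) (u : U) (z : U ⊗[k] U), projA η z = comul u →
    projA η (z * (tgt η a ⊗ₜ 1)) = projA η (z * (1 ⊗ₜ src η a))
  /-- `Δ(1) = 1 ⊗ 1` -/
  comul_one : comul 1 = projA η 1
  /-- `Δ(u v) = Δ(u) Δ(v)` -/
  comul_mul : ∀ (u v : U) (z w : U ⊗[k] U), projA η z = comul u → projA η w = comul v →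
    comul (u * v) = projA η (z * w)
  /-- `ε(1) = 1` -/
  counit_one : counit 1 = 1
  /-- `ε(u v) = ε(u s(ε(v)))` -/
  counit_mul_src : ∀ u v : U, counit (u * v) = counit (u * src η (counit v))
  /-- `ε(u v) = ε(u t(ε(v)))` -/
  counit_mul_tgt : ∀ u v : U, counit (u * v) = counit (u * tgt η (counit v))

variable {η}

/-- `f ⊗ g` on `U ⊗_A U`. -/
def TensA.map (f g : U →ₗ[k] U) (hf : ∀ a x, f (tgt η a * x) = tgt η a * f x)
    (hg : ∀ a x, g (src η a * x) = src η a * g x) : TensA η →ₗ[k] TensA η :=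
  Bal.lift ((Bal.mk (fun a => LinearMap.mulLeft k (tgt η a))
      (fun a => LinearMap.mulLeft k (src η a))).compl₁₂ f g) (by
    intro a x y
    simp only [LinearMap.compl₁₂_apply, LinearMap.mulLeft_apply, hf, hg]
    exact Bal.mk_bal (ρ := fun a => LinearMap.mulLeft k (tgt η a))
      (l := fun a => LinearMap.mulLeft k (src η a)) a (f x) (g y))

theorem TensA.map_proj (f g : U →ₗ[k] U) (hf) (hg) (z : U ⊗[k] U) :
    TensA.map (η := η) f g hf hg (projA η z) = projA η (TensorProduct.map f g z) := by
  induction z with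
  | zero => simp
  | tmul x y =>
    rw [TensorProduct.map_tmul, Bal.proj_tmul, Bal.proj_tmul, TensA.map, Bal.lift_mk]
    rfl
  | add x y hx hy => simp only [map_add, hx, hy]

theorem map_mulRight (a b : U) (z : U ⊗[k] U) :
    TensorProduct.map (LinearMap.mulRight k a) (LinearMap.mulRight k b) z = z * (a ⊗ₜ b) := by
  induction z with
  | zero => simp
  | tmul x y => simp
  | add x y hx hy => simp only [map_add, hx, hy, add_mul]

theorem map_mulLeft (a b : U) (z : U ⊗[k] U) :
    TensorProduct.map (LinearMap.mulLeft k a) (LinearMap.mulLeft k b) z = (a ⊗ₜ b) * z := by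
  induction z with
  | zero => simp
  | tmul x y => simp
  | add x y hx hy => simp only [map_add, hx, hy, mul_add]

/-- Right multiplication `x ⊗ y ↦ x a ⊗ y b` on `U ⊗_A U`. -/
def TensA.rmul (a b : U) : TensA η →ₗ[k] TensA η :=
  TensA.map (LinearMap.mulRight k a) (LinearMap.mulRight k b)
    (fun _ _ => by simp [mul_assoc]) (fun _ _ => by simp [mul_assoc])

/-- Left multiplication `x ⊗ y ↦ s(a) x ⊗ t(b) y` on `U ⊗_A U`. -/
def TensA.lmul (a b : A) : TensA η →ₗ[k] TensA η :=
  TensA.map (LinearMap.mulLeft k (src η a)) (LinearMap.mulLeft k (tgt η b))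
    (fun c x => by simp only [LinearMap.mulLeft_apply, ← mul_assoc, src_tgt_comm])
    (fun c x => by simp only [LinearMap.mulLeft_apply, ← mul_assoc, src_tgt_comm])

theorem TensA.rmul_proj (a b : U) (z : U ⊗[k] U) :
    TensA.rmul (η := η) a b (projA η z) = projA η (z * (a ⊗ₜ b)) := by
  exact (TensA.map_proj _ _ _ _ z).trans (by rw [map_mulRight])

theorem TensA.lmul_proj (a b : A) (z : U ⊗[k] U) :
    TensA.lmul (η := η) a b (projA η z) = projA η ((src η a ⊗ₜ tgt η b) * z) := by
  exact (TensA.map_proj _ _ _ _ z).trans (by rw [map_mulLeft])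

namespace LeftBialgebroid

variable (H : LeftBialgebroid k A U)

theorem exists_rep (u : U) : ∃ z : U ⊗[k] U, projA H.η z = H.comul u := Bal.proj_surjective _

theorem comul_tgt_mul (a : A) (u : U) : H.comul (tgt H.η a * u) = TensA.lmul 1 a (H.comul u) := by
  obtain ⟨z, hz⟩ := H.exists_rep u
  have := H.comul_bimod 1 a u z hz
  rw [src_one, one_mul] at this
  rw [this, ← hz, TensA.lmul_proj, src_one]

theorem comul_tgt (a : A) : H.comul (tgt H.η a) = projA H.η (1 ⊗ₜ tgt H.η a) := by
  have := H.comul_tgt_mul a 1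
  rw [mul_one, H.comul_one, TensA.lmul_proj, mul_one, src_one] at this
  exact this

theorem comul_mul_tgt (a : A) (u : U) :
    H.comul (u * tgt H.η a) = TensA.rmul 1 (tgt H.η a) (H.comul u) := by
  obtain ⟨z, hz⟩ := H.exists_rep u
  rw [H.comul_mul u _ z _ hz (H.comul_tgt a).symm, ← hz, TensA.rmul_proj]

theorem comul_takeuchi (a : A) (u : U) :
    TensA.rmul (tgt H.η a) 1 (H.comul u) = TensA.rmul 1 (src H.η a) (H.comul u) := by
  obtain ⟨z, hz⟩ := H.exists_rep u
  rw [← hz, TensA.rmul_proj, TensA.rmul_proj, H.takeuchi a u z hz]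

theorem counit_tgt_mul (a : A) (u : U) : H.counit (tgt H.η a * u) = H.counit u * a := by
  have := H.counit_bimod 1 a u
  rwa [src_one, one_mul, one_mul] at this

theorem counit_tgt (a : A) : H.counit (tgt H.η a) = a := by
  have := H.counit_tgt_mul a 1
  rwa [mul_one, H.counit_one, one_mul] at this

/-- `w ↦ (x ⊗ y ↦ x ⊗ y w)` on `U ⊗_A U`, linear in `w`. -/
def rmulSnd : TensA H.η →ₗ[k] U →ₗ[k] TensA H.η where
  toFun z := { toFun := fun w => TensA.rmul 1 w z
               map_add' := fun w w' => by
                 obtain ⟨z, rfl⟩ := Bal.proj_surjective z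
                 simp only [TensA.rmul_proj, TensorProduct.tmul_add, mul_add, map_add]
               map_smul' := fun c w => by
                 obtain ⟨z, rfl⟩ := Bal.proj_surjective z
                 simp only [TensA.rmul_proj, TensorProduct.tmul_smul, mul_smul_comm, map_smul,
                   RingHom.id_apply] }
  map_add' z z' := by ext; simp
  map_smul' c z := by ext; simp

/-- The Galois map `u ⊗_{A^op} v ↦ u₁ ⊗_A u₂ v`. -/
def galois : TensOp H.η →ₗ[k] TensA H.η :=
  Bal.lift (H.rmulSnd ∘ₗ H.comul) (by
    intro a x y
    obtain ⟨z, hz⟩ := H.exists_rep x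
    simp only [rmulSnd, LinearMap.comp_apply, LinearMap.coe_mk, AddHom.coe_mk,
      LinearMap.mulRight_apply, LinearMap.mulLeft_apply, comul_mul_tgt, ← hz, TensA.rmul_proj,
      mul_assoc, Algebra.TensorProduct.tmul_mul_tmul, one_mul])

theorem galois_mk (u v : U) : H.galois (Bal.mk _ _ u v) = TensA.rmul 1 v (H.comul u) := by
  rw [galois, Bal.lift_mk]; rfl

end LeftBialgebroid

variable (k A U) in
/-- A left Hopf algebroid: a left bialgebroid whose Galois map
`U ⊗_{A^op} U → U ⊗_A U`, `u ⊗ v ↦ u₁ ⊗ u₂ v`, is bijective. -/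
structure LeftHopfAlgebroid extends LeftBialgebroid k A U where
  /-- the Galois map is bijective -/
  galois_bijective : Function.Bijective toLeftBialgebroid.galois

namespace LeftHopfAlgebroid

variable (H : LeftHopfAlgebroid k A U)

/-- The Galois map as a linear equivalence. -/
noncomputable def galoisEquiv : TensOp H.η ≃ₗ[k] TensA H.η :=
  LinearEquiv.ofBijective H.galois H.galois_bijective

/-- The translation map `u ↦ u₊ ⊗_{A^op} u₋`, the preimage of `u ⊗_A 1` under the Galois map. -/
noncomputable def transl : U →ₗ[k] TensOp H.η :=
  H.galoisEquiv.symm.toLinearMap ∘ₗ (Bal.mk _ _).flip 1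

theorem galois_transl (u : U) : H.galois (H.transl u) = Bal.mk _ _ u 1 :=
  H.galoisEquiv.apply_symm_apply _

end LeftHopfAlgebroid

/-- Right multiplication by `u` on a right `U`-module, as a `k`-bilinear map `(u, m) ↦ m u`. -/
def ract (k : Type v) (U M : Type u) [CommRing k] [Ring U] [Algebra k U] [AddCommGroup M]
    [Module k M] [Module Uᵐᵒᵖ M] [IsScalarTower k Uᵐᵒᵖ M] : U →ₗ[k] M →ₗ[k] M where
  toFun u := { toFun := fun m => MulOpposite.op u • m
               map_add' := fun m m' => smul_add _ m m'
               map_smul' := fun c m => by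
                 simp only [RingHom.id_apply]
                 rw [← algebraMap_smul (A := Uᵐᵒᵖ) c m, ← algebraMap_smul (A := Uᵐᵒᵖ) c,
                   smul_smul, smul_smul, Algebra.commutes] }
  map_add' u v := by ext m; simp [add_smul]
  map_smul' c u := by ext m; simp

/-- `U ⊗_A M` for a right `U`-module `M`, with `t(a) u ⊗ m = u ⊗ m t(a)`. -/
abbrev TensAM (η : A ⊗[k] Aᵐᵒᵖ →ₐ[k] U) (M : Type u) [AddCommGroup M] [Module k M]
    [Module Uᵐᵒᵖ M] [IsScalarTower k Uᵐᵒᵖ M] : Type u :=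
  Bal (fun a => LinearMap.mulLeft k (tgt η a)) (fun a => ract k U M (tgt η a))

/-- The projection `U ⊗_k M → U ⊗_A M`. -/
abbrev projAM (η : A ⊗[k] Aᵐᵒᵖ →ₐ[k] U) (M : Type u) [AddCommGroup M] [Module k M]
    [Module Uᵐᵒᵖ M] [IsScalarTower k Uᵐᵒᵖ M] : U ⊗[k] M →ₗ[k] TensAM η M :=
  Bal.proj (fun a => LinearMap.mulLeft k (tgt η a)) (fun a => ract k U M (tgt η a))

/-- A module-comodule over a left bialgebroid: a right `U`-module `M` together with a left
`U`-coaction `m ↦ m₍₋₁₎ ⊗ m₍₀₎` on the left `A`-module `M`, where `a ∈ A` acts by `m ↦ m t(a)`.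
No further compatibility between action and coaction is assumed. As before, identities are
expressed through arbitrary representatives `z` of the coaction in `U ⊗_k M`. -/
structure ModuleComodule (H : LeftBialgebroid k A U) (M : Type u) [AddCommGroup M] [Module k M]
    [Module Uᵐᵒᵖ M] [IsScalarTower k Uᵐᵒᵖ M] where
  /-- the coaction -/
  coact : M →ₗ[k] TensAM H.η M
  /-- left `A`-linearity: `m t(a) ↦ s(a) m₍₋₁₎ ⊗ m₍₀₎` -/
  coact_lin : ∀ (a : A) (m : M) (z : U ⊗[k] M), projAM H.η M z = coact m →
    coact (ract k U M (tgt H.η a) m) =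
      projAM H.η M ((LinearMap.mulLeft k (src H.η a)).rTensor M z)
  /-- coassociativity in `U ⊗_A U ⊗_A M` -/
  coassoc : ∀ (m : M) (z : U ⊗[k] M), projAM H.η M z = coact m →
    ∀ y : (U ⊗[k] U) ⊗[k] M, (projA H.η).rTensor M y = H.comul.rTensor M z →
    ∀ y' : U ⊗[k] (U ⊗[k] M), (projAM H.η M).lTensor U y' = coact.lTensor U z →
      TensorProduct.assoc k U U M y - y' ∈ tripleRel H.η (fun a => ract k U M (tgt H.η a))
  /-- counitality: `m₍₀₎ t(ε(m₍₋₁₎)) = m` -/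
  counit : ∀ (m : M) (z : U ⊗[k] M), projAM H.η M z = coact m →
    TensorProduct.lift (ract k U M ∘ₗ tgt H.η ∘ₗ H.counit) z = m

end Bialgebroid

/-! ## Iterated tensor products and iterated Hom spaces over `A^op` -/

section Iterated

variable {k : Type v} {A U : Type u} [CommRing k] [Ring A] [Algebra k A] [Ring U] [Algebra k U]

/-- A `k`-module with a `k`-bilinear operation of `A`. It is used both for left and for right
`A`-modules; the laws of an action are not part of the structure. -/
structure ActMod (k : Type v) (A : Type u) [CommRing k] [Ring A] [Algebra k A] where
  /-- the underlying type -/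
  carrier : Type u
  [acg : AddCommGroup carrier]
  [mod : Module k carrier]
  /-- the operation of `A` -/
  act : A →ₗ[k] carrier →ₗ[k] carrier

instance : CoeSort (ActMod k A) (Type u) := ⟨ActMod.carrier⟩

attribute [instance] ActMod.acg ActMod.mod

/-- `k`-linear maps that commute with the operation of `A`. -/
structure ActHom (X Y : ActMod k A) where
  /-- the underlying linear map -/
  lin : X →ₗ[k] Y
  /-- compatibility with the operation of `A` -/
  comm : ∀ a x, lin (X.act a x) = Y.act a (lin x)

variable (η : A ⊗[k] Aᵐᵒᵖ →ₐ[k] U)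

/-- The tensor product `X ⊗_{A^op} U`, with `(a ▸ x) ⊗ u = x ⊗ t(a) u`, for a left `A`-module
`(X, ▸)`. -/
abbrev TensU (X : ActMod k A) : Type u :=
  Bal (fun a => X.act a) (fun a => LinearMap.mulLeft k (tgt η a))

/-- The elementary tensor `x ⊗ u` in `X ⊗_{A^op} U`. -/
abbrev TensU.mk (X : ActMod k A) : X →ₗ[k] U →ₗ[k] TensU η X :=
  Bal.mk (fun a => X.act a) (fun a => LinearMap.mulLeft k (tgt η a))

theorem TensU.mk_bal (X : ActMod k A) (a : A) (x : X) (u : U) :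
    TensU.mk η X (X.act a x) u = TensU.mk η X x (tgt η a * u) :=
  Bal.mk_bal (ρ := fun a => X.act a) (l := fun a => LinearMap.mulLeft k (tgt η a)) a x u

/-- Right multiplication `x ⊗ u ↦ x ⊗ u w` by `w ∈ U`. -/
def TensU.rmul (X : ActMod k A) : U →ₗ[k] TensU η X →ₗ[k] TensU η X where
  toFun w := Bal.lift ((TensU.mk η X).compl₂ (LinearMap.mulRight k w)) (fun a x u => by
    simp only [LinearMap.compl₂_apply, LinearMap.mulRight_apply, LinearMap.mulLeft_apply,
      TensU.mk_bal, mul_assoc])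
  map_add' w w' := Bal.hom_ext fun x u => by
    simp [mul_add]
  map_smul' c w := Bal.hom_ext fun x u => by
    simp

@[simp] theorem TensU.rmul_mk (X : ActMod k A) (w : U) (x : X) (u : U) :
    TensU.rmul η X w (TensU.mk η X x u) = TensU.mk η X x (u * w) := by
  simp [TensU.rmul]

/-- Left multiplication `x ⊗ u ↦ x ⊗ s(a) u`. -/
def TensU.lmulSrc (X : ActMod k A) (a : A) : TensU η X →ₗ[k] TensU η X :=
  Bal.lift ((TensU.mk η X).compl₂ (LinearMap.mulLeft k (src η a))) (fun b x u => by
    simp only [LinearMap.compl₂_apply, LinearMap.mulLeft_apply, TensU.mk_bal, ← mul_assoc,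
      src_tgt_comm])

@[simp] theorem TensU.lmulSrc_mk (X : ActMod k A) (a : A) (x : X) (u : U) :
    TensU.lmulSrc η X a (TensU.mk η X x u) = TensU.mk η X x (src η a * u) := by
  simp [TensU.lmulSrc]

/-- `X ⊗_{A^op} U` as a left `A`-module via `a ▸ (x ⊗ u) = x ⊗ u t(a)`. -/
def tens (X : ActMod k A) : ActMod k A where
  carrier := TensU η X
  act := TensU.rmul η X ∘ₗ tgt η

/-- `f ⊗ id` on `X ⊗_{A^op} U`, as a linear map. -/
def tensMapLin {X Y : ActMod k A} (f : ActHom X Y) : TensU η X →ₗ[k] TensU η Y :=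
  Bal.lift ((TensU.mk η Y).comp f.lin) (fun a x u => by
    change TensU.mk η Y (f.lin (X.act a x)) u = TensU.mk η Y (f.lin x) (tgt η a * u)
    rw [f.comm, TensU.mk_bal])

@[simp] theorem tensMapLin_mk {X Y : ActMod k A} (f : ActHom X Y) (x : X) (u : U) :
    tensMapLin η f (TensU.mk η X x u) = TensU.mk η Y (f.lin x) u := by
  simp [tensMapLin]

/-- `f ⊗ id` on `X ⊗_{A^op} U`. -/
def tensMap {X Y : ActMod k A} (f : ActHom X Y) : ActHom (tens η X) (tens η Y) where
  lin := tensMapLin η f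
  comm a z := by
    have h : tensMapLin η f ∘ₗ TensU.rmul η X (tgt η a) =
        TensU.rmul η Y (tgt η a) ∘ₗ tensMapLin η f :=
      Bal.hom_ext fun x u => by simp
    exact LinearMap.congr_fun h z

/-- The iterated tensor products `X ⊗_{A^op} U ⊗_{A^op} ⋯ ⊗_{A^op} U` with `n` factors `U`. -/
def Chain (X : ActMod k A) : ℕ → ActMod k A
  | 0 => X
  | n + 1 => tens η (Chain X n)

/-- `((x, u¹, …, uⁿ), u) ↦ (x, u¹, …, uⁿ, u)` -/
def Chain.snoc (X : ActMod k A) (n : ℕ) : Chain η X n →ₗ[k] U →ₗ[k] Chain η X (n + 1) :=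
  TensU.mk η (Chain η X n)

/-- The maps `f : U → Y` with `f(t(a) u) = f(u) · a`, that is, `Hom_{A^op}(U, Y)`. -/
def homSub (Y : ActMod k A) : Submodule k (U →ₗ[k] Y) where
  carrier := {f | ∀ a u, f (tgt η a * u) = Y.act a (f u)}
  add_mem' := fun {f g} hf hg a u => by
    simp only [LinearMap.add_apply, hf a u, hg a u, map_add]
  zero_mem' := fun a u => by simp
  smul_mem' := fun c f hf a u => by
    simp only [LinearMap.smul_apply, hf a u, map_smul]

/-- `Hom_{A^op}(U, Y)` with the operation `(f · a)(u) = f(u t(a))`. -/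
def homMod (Y : ActMod k A) : ActMod k A where
  carrier := homSub η Y
  act := LinearMap.mk₂ k
    (fun a f => ⟨f.1 ∘ₗ LinearMap.mulRight k (tgt η a), fun b u => by
      simp only [LinearMap.comp_apply, LinearMap.mulRight_apply, mul_assoc, f.2 b]⟩)
    (fun a b f => by ext u; simp [mul_add])
    (fun c a f => by ext u; simp)
    (fun a f g => by ext u; simp)
    (fun c a f => by ext u; simp)

/-- The iterated Hom spaces. The elements of `Coch η Y p` are the `k`-multilinear maps
`φ : U^p → Y` with `φ(…, uⁱ t(a), uⁱ⁺¹, …) = φ(…, uⁱ, t(a) uⁱ⁺¹, …)` and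
`φ(t(a) u¹, u², …) = φ(u¹, …, u^p) · a`, in curried form with the last argument first;
`Coch η Y 0 = Y`. This is `Hom_{A^op}(U^{⊗_{A^op} p}, Y)`. -/
def Coch (Y : ActMod k A) : ℕ → ActMod k A
  | 0 => Y
  | p + 1 => homMod η (Coch Y p)

variable {η}

/-- Evaluation in the last argument: `Coch.app φ u = φ(…, u)`. -/
def Coch.app {Y : ActMod k A} {p : ℕ} :
    Coch η Y (p + 1) →ₗ[k] U →ₗ[k] Coch η Y p :=
  (homSub η (Coch η Y p)).subtype

/-- All values of a cochain: `Coch.eval φ ![u¹, …, u^p] = φ(u¹, …, u^p)`. -/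
def Coch.eval {Y : ActMod k A} : {p : ℕ} → Coch η Y p → (Fin p → U) → Y
  | 0, φ, _ => φ
  | p + 1, φ, u => Coch.eval (p := p) (Coch.app φ (u (Fin.last p))) (fun i => u i.castSucc)

/-- The cochain with given evaluations in the last argument, linear in a parameter. -/
def Coch.lam {X : Type*} [AddCommGroup X] [Module k X] {Y : ActMod k A} {p : ℕ}
    (F : X →ₗ[k] U →ₗ[k] Coch η Y p)
    (h : ∀ x a u, F x (tgt η a * u) = (Coch η Y p).act a (F x u)) :
    X →ₗ[k] Coch η Y (p + 1) :=
  LinearMap.codRestrict (homSub η (Coch η Y p)) F h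

@[simp] theorem Coch.app_lam {X : Type*} [AddCommGroup X] [Module k X] {Y : ActMod k A} {p : ℕ}
    (F : X →ₗ[k] U →ₗ[k] Coch η Y p) (h) (x : X) (u : U) :
    Coch.app (Coch.lam F h x) u = F x u := rfl

theorem Coch.app_tgt {Y : ActMod k A} {p : ℕ} (φ : Coch η Y (p + 1)) (a : A) (u : U) :
    Coch.app φ (tgt η a * u) = (Coch η Y p).act a (Coch.app φ u) := φ.2 a u

theorem Coch.app_act {Y : ActMod k A} {p : ℕ} (φ : Coch η Y (p + 1)) (a : A) (u : U) :
    Coch.app ((Coch η Y (p + 1)).act a φ) u = Coch.app φ (u * tgt η a) := rfl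

theorem Coch.ext {Y : ActMod k A} {p : ℕ} {φ ψ : Coch η Y (p + 1)}
    (h : ∀ u, Coch.app φ u = Coch.app ψ u) : φ = ψ :=
  Subtype.ext (LinearMap.ext h)

theorem Chain.hom_ext {X : ActMod k A} {n : ℕ} {Z : Type*} [AddCommGroup Z] [Module k Z]
    {f g : Chain η X (n + 1) →ₗ[k] Z}
    (h : ∀ x u, f (Chain.snoc η X n x u) = g (Chain.snoc η X n x u)) : f = g :=
  Bal.hom_ext h

/-- The linear map out of `Chain η X (n + 1)` defined by a balanced bilinear map. -/
def Chain.lift {X : ActMod k A} {n : ℕ} {Z : Type*} [AddCommGroup Z] [Module k Z]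
    (f : Chain η X n →ₗ[k] U →ₗ[k] Z)
    (h : ∀ a x u, f ((Chain η X n).act a x) u = f x (tgt η a * u)) :
    Chain η X (n + 1) →ₗ[k] Z :=
  Bal.lift f h

@[simp] theorem Chain.lift_snoc {X : ActMod k A} {n : ℕ} {Z : Type*} [AddCommGroup Z] [Module k Z]
    (f : Chain η X n →ₗ[k] U →ₗ[k] Z) (h) (x : Chain η X n) (u : U) :
    Chain.lift f h (Chain.snoc η X n x u) = f x u := Bal.lift_mk f h x u

theorem Chain.snoc_bal {X : ActMod k A} {n : ℕ} (a : A) (x : Chain η X n) (u : U) :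
    Chain.snoc η X n ((Chain η X n).act a x) u = Chain.snoc η X n x (tgt η a * u) :=
  TensU.mk_bal η _ a x u

theorem Chain.act_snoc {X : ActMod k A} {n : ℕ} (a : A) (x : Chain η X n) (u : U) :
    (Chain η X (n + 1)).act a (Chain.snoc η X n x u) = Chain.snoc η X n x (u * tgt η a) :=
  TensU.rmul_mk η _ _ x u

/-- Transport of chains along an equality of degrees. -/
def Chain.cast {X : ActMod k A} {n m : ℕ} (h : n = m) : Chain η X n →ₗ[k] Chain η X m :=
  h ▸ LinearMap.id

/-- Transport of cochains along an equality of degrees. -/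
def Coch.cast {Y : ActMod k A} {p q : ℕ} (h : p = q) : Coch η Y p →ₗ[k] Coch η Y q :=
  h ▸ LinearMap.id

/-- From a balanced pairing `P` of `p`-cochains with `n`-chains, the pairing
`(φ, (x, u)) ↦ P(φ(…, u), x)` of `(p + 1)`-cochains with `(n + 1)`-chains. -/
def pairStep {X Y : ActMod k A} {Z : Type u} [AddCommGroup Z] [Module k Z] {n p : ℕ}
    (P : Coch η Y p →ₗ[k] Chain η X n →ₗ[k] Z)
    (hP : ∀ c φ x, P φ ((Chain η X n).act c x) = P ((Coch η Y p).act c φ) x) :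
    Coch η Y (p + 1) →ₗ[k] Chain η X (n + 1) →ₗ[k] Z where
  toFun φ := Chain.lift ((P ∘ₗ Coch.app φ).flip) (fun c x u => by
    change P (Coch.app φ u) ((Chain η X n).act c x) = P (Coch.app φ (tgt η c * u)) x
    rw [Coch.app_tgt, hP])
  map_add' φ ψ := Chain.hom_ext fun x u => by simp
  map_smul' c φ := Chain.hom_ext fun x u => by simp

theorem pairStep_snoc {X Y : ActMod k A} {Z : Type u} [AddCommGroup Z] [Module k Z] {n p : ℕ}
    (P : Coch η Y p →ₗ[k] Chain η X n →ₗ[k] Z) (hP) (φ : Coch η Y (p + 1)) (x : Chain η X n)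
    (u : U) : pairStep P hP φ (Chain.snoc η X n x u) = P (Coch.app φ u) x :=
  Bal.lift_mk ((P ∘ₗ Coch.app φ).flip) (fun c x u => by
    change P (Coch.app φ u) ((Chain η X n).act c x) = P (Coch.app φ (tgt η c * u)) x
    rw [Coch.app_tgt, hP]) x u

theorem pairStep_bal {X Y : ActMod k A} {Z : Type u} [AddCommGroup Z] [Module k Z] {n p : ℕ}
    (P : Coch η Y p →ₗ[k] Chain η X n →ₗ[k] Z) (hP) (c : A) (φ : Coch η Y (p + 1))
    (x : Chain η X (n + 1)) : pairStep P hP φ ((Chain η X (n + 1)).act c x) =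
      pairStep P hP ((Coch η Y (p + 1)).act c φ) x := by
  have h : pairStep P hP φ ∘ₗ (Chain η X (n + 1)).act c =
      pairStep P hP ((Coch η Y (p + 1)).act c φ) := Chain.hom_ext fun x u => by
    rw [LinearMap.comp_apply, Chain.act_snoc, pairStep_snoc, pairStep_snoc, Coch.app_act]
  exact LinearMap.congr_fun h x

/-- For a balanced bilinear map `β : X' × Y → Z`, where `X'` is the space of `a`-chains, and for a
cochain `φ` with values in `Y`, the map `(x, u¹, …, u^p) ↦ β(x, φ(u¹, …, u^p))`. -/
def pairAux {X Y : ActMod k A} {Z : Type u} [AddCommGroup Z] [Module k Z] {a : ℕ}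
    (β : Chain η X a →ₗ[k] Y →ₗ[k] Z)
    (hβ : ∀ c x y, β ((Chain η X a).act c x) y = β x (Y.act c y)) :
    (p : ℕ) → {P : Coch η Y p →ₗ[k] Chain η X (a + p) →ₗ[k] Z //
      ∀ c φ x, P φ ((Chain η X (a + p)).act c x) = P ((Coch η Y p).act c φ) x}
  | 0 => ⟨β.flip, fun c φ x => hβ c x φ⟩
  | p + 1 => ⟨pairStep (n := a + p) (pairAux β hβ p).1 (pairAux β hβ p).2,
      pairStep_bal (n := a + p) (pairAux β hβ p).1 (pairAux β hβ p).2⟩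

/-- `(x, u¹, …, u^p) ↦ β(x, φ(u¹, …, u^p))`, see `pairAux`. -/
def pair {X Y : ActMod k A} {Z : Type u} [AddCommGroup Z] [Module k Z] {a : ℕ}
    (β : Chain η X a →ₗ[k] Y →ₗ[k] Z)
    (hβ : ∀ c x y, β ((Chain η X a).act c x) y = β x (Y.act c y)) (p : ℕ) :
    Coch η Y p →ₗ[k] Chain η X (a + p) →ₗ[k] Z :=
  (pairAux β hβ p).1

/-- The step in the recursive definition of `post`: from `P`, the map
`(φ, x) ↦ (u ↦ P(φ(…, u), x))`. -/
def postStep {X : Type u} [AddCommGroup X] [Module k X] {Y Y' : ActMod k A} {n q : ℕ}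
    (P : Coch η Y q →ₗ[k] X →ₗ[k] Coch η Y' n)
    (hP : ∀ c φ x, P ((Coch η Y q).act c φ) x = (Coch η Y' n).act c (P φ x)) :
    Coch η Y (q + 1) →ₗ[k] X →ₗ[k] Coch η Y' (n + 1) where
  toFun φ := Coch.lam ((P ∘ₗ Coch.app φ).flip) (fun x c u => by
    change P (Coch.app φ (tgt η c * u)) x = (Coch η Y' n).act c (P (Coch.app φ u) x)
    rw [Coch.app_tgt, hP])
  map_add' φ ψ := LinearMap.ext fun x => Coch.ext fun u => by simp
  map_smul' c φ := LinearMap.ext fun x => Coch.ext fun u => by simp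

/-- For a bilinear map `β : Y × X → Coch η Y' a` commuting with the operation of `A` on `Y`, the
map that sends a `Y`-valued `q`-cochain `E` and `x ∈ X` to the `(a + q)`-cochain
`(u¹, …, u^{a+q}) ↦ β(E(u^{a+1}, …, u^{a+q}), x)(u¹, …, u^a)`. -/
def postAux {X : Type u} [AddCommGroup X] [Module k X] {Y Y' : ActMod k A} {a : ℕ}
    (β : Y →ₗ[k] X →ₗ[k] Coch η Y' a)
    (hβ : ∀ c y x, β (Y.act c y) x = (Coch η Y' a).act c (β y x)) :
    (q : ℕ) → {P : Coch η Y q →ₗ[k] X →ₗ[k] Coch η Y' (a + q) //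
      ∀ c φ x, P ((Coch η Y q).act c φ) x = (Coch η Y' (a + q)).act c (P φ x)}
  | 0 => ⟨β, hβ⟩
  | q + 1 => ⟨postStep (n := a + q) (postAux β hβ q).1 (postAux β hβ q).2,
      fun _ _ _ => Coch.ext (p := a + q) fun _ => rfl⟩

/-- `(E, x) ↦ β(E(u^{a+1}, …, u^{a+q}), x)(u¹, …, u^a)`, see `postAux`. -/
def post {X : Type u} [AddCommGroup X] [Module k X] {Y Y' : ActMod k A} {a : ℕ}
    (β : Y →ₗ[k] X →ₗ[k] Coch η Y' a)
    (hβ : ∀ c y x, β (Y.act c y) x = (Coch η Y' a).act c (β y x)) (q : ℕ) :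
    Coch η Y q →ₗ[k] X →ₗ[k] Coch η Y' (a + q) :=
  (postAux β hβ q).1

theorem post_act {X : Type u} [AddCommGroup X] [Module k X] {Y Y' : ActMod k A} {a : ℕ}
    (β : Y →ₗ[k] X →ₗ[k] Coch η Y' a) (hβ) (q : ℕ) (c : A) (φ : Coch η Y q) (x : X) :
    post β hβ q ((Coch η Y q).act c φ) x = (Coch η Y' (a + q)).act c (post β hβ q φ x) :=
  (postAux β hβ q).2 c φ x

theorem post_app {X : Type u} [AddCommGroup X] [Module k X] {Y Y' : ActMod k A} {a : ℕ}
    (β : Y →ₗ[k] X →ₗ[k] Coch η Y' a) (hβ) (q : ℕ) (φ : Coch η Y (q + 1)) (x : X) (u : U) :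
    Coch.app (p := a + q) (post β hβ (q + 1) φ x) u = post β hβ q (Coch.app φ u) x := rfl

theorem pair_snoc {X Y : ActMod k A} {Z : Type u} [AddCommGroup Z] [Module k Z] {a : ℕ}
    (β : Chain η X a →ₗ[k] Y →ₗ[k] Z) (hβ) (p : ℕ) (φ : Coch η Y (p + 1))
    (x : Chain η X (a + p)) (u : U) :
    pair β hβ (p + 1) φ (Chain.snoc η X (a + p) x u) = pair β hβ p (Coch.app φ u) x :=
  pairStep_snoc (n := a + p) (pairAux β hβ p).1 (pairAux β hβ p).2 φ x u

theorem pair_act {X Y : ActMod k A} {Z : Type u} [AddCommGroup Z] [Module k Z] {a : ℕ}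
    (β : Chain η X a →ₗ[k] Y →ₗ[k] Z) (hβ) (p : ℕ) (c : A) (φ : Coch η Y p)
    (x : Chain η X (a + p)) :
    pair β hβ p φ ((Chain η X (a + p)).act c x) = pair β hβ p ((Coch η Y p).act c φ) x :=
  (pairAux β hβ p).2 c φ x

end Iterated

/-! ## Cochains and the operations on them -/

section Cochains

variable {k : Type v} {A U : Type u} [CommRing k] [Ring A] [Algebra k A] [Ring U] [Algebra k U]

/-- `A` as a right `A`-module. -/
def baseA (k : Type v) (A : Type u) [CommRing k] [Ring A] [Algebra k A] : ActMod k A where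
  carrier := A
  act := (LinearMap.mul k A).flip

/-- `U` with the right `A`-action `u ◁ a = t(a) u`. -/
def baseU (η : A ⊗[k] Aᵐᵒᵖ →ₐ[k] U) : ActMod k A where
  carrier := U
  act := LinearMap.mul k U ∘ₗ tgt η

/-- Right multiplication of the values of a `U`-valued cochain by `w ∈ U`. -/
def rmulAux (η : A ⊗[k] Aᵐᵒᵖ →ₐ[k] U) :
    (q : ℕ) → {R : U →ₗ[k] Coch η (baseU η) q →ₗ[k] Coch η (baseU η) q //
      (∀ w a φ, R w ((Coch η (baseU η) q).act a φ) = (Coch η (baseU η) q).act a (R w φ)) ∧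
      (∀ w w' φ, R w' (R w φ) = R (w * w') φ)}
  | 0 => ⟨(LinearMap.mul k U).flip, fun w a φ => @mul_assoc U _ (tgt η a) φ w,
      fun w w' φ => @mul_assoc U _ φ w w'⟩
  | q + 1 =>
    let R := rmulAux η q
    ⟨LinearMap.mk₂ k
      (fun w φ => Coch.lam (Coch.app.compr₂ (R.1 w)) (fun φ a u => by
        change R.1 w (Coch.app φ (tgt η a * u)) =
          (Coch η (baseU η) q).act a (R.1 w (Coch.app φ u))
        rw [Coch.app_tgt, R.2.1]) φ)
      (fun w w' φ => Coch.ext fun u => by simp)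
      (fun c w φ => Coch.ext fun u => by simp)
      (fun w φ ψ => Coch.ext fun u => by simp)
      (fun c w φ => Coch.ext fun u => by simp),
      fun w a φ => Coch.ext fun u => rfl,
      fun w w' φ => Coch.ext fun u => R.2.2 w w' (Coch.app φ u)⟩

/-- `E ↦ E(⋅) w` for `U`-valued cochains `E` and `w ∈ U`. -/
def rmulU (η : A ⊗[k] Aᵐᵒᵖ →ₐ[k] U) (q : ℕ) :
    U →ₗ[k] Coch η (baseU η) q →ₗ[k] Coch η (baseU η) q :=
  (rmulAux η q).1

theorem rmulU_act (η : A ⊗[k] Aᵐᵒᵖ →ₐ[k] U) (q : ℕ) (w : U) (a : A) (φ : Coch η (baseU η) q) :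
    rmulU η q w ((Coch η (baseU η) q).act a φ) = (Coch η (baseU η) q).act a (rmulU η q w φ) :=
  (rmulAux η q).2.1 w a φ

theorem rmulU_rmulU (η : A ⊗[k] Aᵐᵒᵖ →ₐ[k] U) (q : ℕ) (w w' : U) (φ : Coch η (baseU η) q) :
    rmulU η q w' (rmulU η q w φ) = rmulU η q (w * w') φ :=
  (rmulAux η q).2.2 w w' φ

theorem rmulU_app (η : A ⊗[k] Aᵐᵒᵖ →ₐ[k] U) (q : ℕ) (w u : U) (φ : Coch η (baseU η) (q + 1)) :
    Coch.app (rmulU η (q + 1) w φ) u = rmulU η q w (Coch.app φ u) := rfl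

variable (H : LeftBialgebroid k A U)

/-- The space `C^p(U, A)` of `p`-cochains. -/
abbrev Cochain (p : ℕ) : ActMod k A := Coch H.η (baseA k A) p

/-- The step in the recursive definition of `φ ↦ D_φ`: the map
`φ ↦ (u ↦ D(φ(…, u₍₁₎)) u₍₂₎)`. -/
def opDStep {q : ℕ} (D : Cochain H q →ₗ[k] Coch H.η (baseU H.η) q)
    (hD : ∀ a φ, D ((Cochain H q).act a φ) = rmulU H.η q (src H.η a) (D φ)) :
    Cochain H (q + 1) →ₗ[k] TensA H.η →ₗ[k] Coch H.η (baseU H.η) q where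
  toFun φ := Bal.lift ((rmulU H.η q).flip ∘ₗ D ∘ₗ Coch.app φ) (fun a x y => by
    change rmulU H.η q y (D (Coch.app φ (tgt H.η a * x))) =
      rmulU H.η q (src H.η a * y) (D (Coch.app φ x))
    rw [Coch.app_tgt, hD, rmulU_rmulU])
  map_add' φ ψ := Bal.hom_ext fun x y => by simp
  map_smul' c φ := Bal.hom_ext fun x y => by simp

theorem opDStep_mk {q : ℕ} (D : Cochain H q →ₗ[k] Coch H.η (baseU H.η) q) (hD)
    (φ : Cochain H (q + 1)) (x y : U) :
    opDStep H D hD φ (projA H.η (x ⊗ₜ y)) = rmulU H.η q y (D (Coch.app φ x)) :=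
  Bal.lift_mk ((rmulU H.η q).flip ∘ₗ D ∘ₗ Coch.app φ) (fun a x y => by
    change rmulU H.η q y (D (Coch.app φ (tgt H.η a * x))) =
      rmulU H.η q (src H.η a * y) (D (Coch.app φ x))
    rw [Coch.app_tgt, hD, rmulU_rmulU]) x y

theorem opDStep_lmul {q : ℕ} (D : Cochain H q →ₗ[k] Coch H.η (baseU H.η) q) (hD)
    (hD' : ∀ a φ, (Coch H.η (baseU H.η) q).act a (D φ) = rmulU H.η q (tgt H.η a) (D φ))
    (φ : Cochain H (q + 1)) (a : A) (z : TensA H.η) :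
    opDStep H D hD φ (TensA.lmul 1 a z) =
      (Coch H.η (baseU H.η) q).act a (opDStep H D hD φ z) := by
  obtain ⟨z, rfl⟩ := Bal.proj_surjective z
  induction z with
  | zero => simp
  | add x y hx hy => simp only [map_add, hx, hy]
  | tmul x y =>
    rw [TensA.lmul_proj, Algebra.TensorProduct.tmul_mul_tmul, src_one, one_mul, opDStep_mk,
      opDStep_mk, ← rmulU_act, hD', rmulU_rmulU]

theorem opDStep_rmul {q : ℕ} (D : Cochain H q →ₗ[k] Coch H.η (baseU H.η) q) (hD)
    (φ : Cochain H (q + 1)) (w : U) (z : TensA H.η) :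
    opDStep H D hD φ (TensA.rmul 1 w z) = rmulU H.η q w (opDStep H D hD φ z) := by
  obtain ⟨z, rfl⟩ := Bal.proj_surjective z
  induction z with
  | zero => simp
  | add x y hx hy => simp only [map_add, hx, hy]
  | tmul x y =>
    rw [TensA.rmul_proj, Algebra.TensorProduct.tmul_mul_tmul, mul_one, opDStep_mk,
      opDStep_mk, rmulU_rmulU]

theorem opDStep_act {q : ℕ} (D : Cochain H q →ₗ[k] Coch H.η (baseU H.η) q) (hD)
    (φ : Cochain H (q + 1)) (a : A) (z : TensA H.η) :
    opDStep H D hD ((Cochain H (q + 1)).act a φ) z =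
      opDStep H D hD φ (TensA.rmul (tgt H.η a) 1 z) := by
  obtain ⟨z, rfl⟩ := Bal.proj_surjective z
  induction z with
  | zero => simp
  | add x y hx hy => simp only [map_add, hx, hy]
  | tmul x y =>
    rw [TensA.rmul_proj, Algebra.TensorProduct.tmul_mul_tmul, mul_one, opDStep_mk,
      opDStep_mk, Coch.app_act]

/-- The map `φ ↦ D_φ` together with its linearity properties, see `opD`. -/
def opDAux : (q : ℕ) → {D : Cochain H q →ₗ[k] Coch H.η (baseU H.η) q //
      (∀ a φ, D ((Cochain H q).act a φ) = rmulU H.η q (src H.η a) (D φ)) ∧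
      (∀ a φ, (Coch H.η (baseU H.η) q).act a (D φ) = rmulU H.η q (tgt H.η a) (D φ))}
  | 0 => ⟨(src H.η : A →ₗ[k] U), fun a φ => @src_mul k A U _ _ _ _ _ H.η φ a,
      fun a φ => (@src_tgt_comm k A U _ _ _ _ _ H.η φ a).symm⟩
  | q + 1 =>
    ⟨Coch.lam ((LinearMap.lcomp k (Coch H.η (baseU H.η) q) H.comul) ∘ₗ
        opDStep H (opDAux q).1 (opDAux q).2.1)
      (fun φ a u =>
        (congrArg (opDStep H (opDAux q).1 (opDAux q).2.1 φ) (H.comul_tgt_mul a u)).trans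
          (opDStep_lmul H (opDAux q).1 (opDAux q).2.1 (opDAux q).2.2 φ a (H.comul u))),
      fun a φ => Coch.ext fun u =>
        (opDStep_act H (opDAux q).1 (opDAux q).2.1 φ a (H.comul u)).trans
          ((congrArg (opDStep H (opDAux q).1 (opDAux q).2.1 φ) (H.comul_takeuchi a u)).trans
            (opDStep_rmul H (opDAux q).1 (opDAux q).2.1 φ (src H.η a) (H.comul u))),
      fun a φ => Coch.ext fun u =>
        (congrArg (opDStep H (opDAux q).1 (opDAux q).2.1 φ) (H.comul_mul_tgt a u)).trans
          (opDStep_rmul H (opDAux q).1 (opDAux q).2.1 φ (tgt H.η a) (H.comul u))⟩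

/-- The map `φ ↦ D_φ`, where
`D_φ(u¹, …, u^q) = s(φ(u¹₍₁₎, …, u^q₍₁₎)) u¹₍₂₎ ⋯ u^q₍₂₎`, and `D_a = s(a)` for `a ∈ C⁰(U, A) = A`;
recursively, `D_φ(…, u) = D_{φ(…, u₍₁₎)}(…) u₍₂₎`. -/
def opD (q : ℕ) : Cochain H q →ₗ[k] Coch H.η (baseU H.η) q := (opDAux H q).1

theorem opD_act (q : ℕ) (a : A) (φ : Cochain H q) :
    opD H q ((Cochain H q).act a φ) = rmulU H.η q (src H.η a) (opD H q φ) :=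
  (opDAux H q).2.1 a φ

theorem act_opD (q : ℕ) (a : A) (φ : Cochain H q) :
    (Coch H.η (baseU H.η) q).act a (opD H q φ) = rmulU H.η q (tgt H.η a) (opD H q φ) :=
  (opDAux H q).2.2 a φ

theorem Cochain.act_act {p : ℕ} (b c : A) (φ : Cochain H p) :
    (Cochain H p).act (b * c) φ = (Cochain H p).act c ((Cochain H p).act b φ) := by
  cases p with
  | zero => exact (@mul_assoc A _ φ b c).symm
  | succ p =>
    refine Coch.ext fun u => ?_
    rw [Coch.app_act, Coch.app_act, Coch.app_act, tgt_mul, mul_assoc]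

/-- The cup product `(φ ⌣ ψ)(u¹, …, u^{p+q}) = φ(u¹, …, u^{p-1}, ψ(u^{p+1}, …, u^{p+q}) ▸ u^p)`,
where `a ▸ u = u t(a)`; for `p = 0` it is `φ ψ(u¹, …, u^q)`. -/
def cup (p q : ℕ) : Cochain H p →ₗ[k] Cochain H q →ₗ[k] Cochain H (p + q) :=
  (post (Y := baseA k A) (Cochain H p).act (fun c b φ => Cochain.act_act H b c φ) q).flip

/-- The unit cochain `1 ∈ C⁰(U, A) = A`. -/
def unitCochain : Cochain H 0 := (1 : A)

/-- The coface `φ ↦ φ(u¹, …, u^{p-1}, ε(u^{p+1}) ▸ u^p)`. -/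
def coface0 (p : ℕ) : Cochain H p →ₗ[k] Cochain H (p + 1) :=
  Coch.lam ((Cochain H p).act ∘ₗ H.counit).flip (fun φ a u => by
    change (Cochain H p).act (H.counit (tgt H.η a * u)) φ =
      (Cochain H p).act a ((Cochain H p).act (H.counit u) φ)
    rw [H.counit_tgt_mul, Cochain.act_act])

/-- The bilinear map `(a, u) ↦ ε(u s(a))`. -/
def counitMulSrc : A →ₗ[k] U →ₗ[k] A :=
  ((LinearMap.mul k U).compr₂ H.counit).flip ∘ₗ src H.η

theorem counitMulSrc_tgt (b a : A) (u : U) :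
    counitMulSrc H b (tgt H.η a * u) = counitMulSrc H b u * a := by
  change H.counit (tgt H.η a * u * src H.η b) = H.counit (u * src H.η b) * a
  rw [mul_assoc, H.counit_tgt_mul]

theorem LeftBialgebroid.counit_mul_src_tgt (u : U) (a : A) :
    H.counit (u * tgt H.η a) = H.counit (u * src H.η a) := by
  rw [H.counit_mul_src, H.counit_tgt]

theorem counitMulSrc_mul (b a : A) (u : U) :
    counitMulSrc H (b * a) u = counitMulSrc H b (u * tgt H.η a) := by
  change H.counit (u * src H.η (b * a)) = H.counit (u * tgt H.η a * src H.η b)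
  rw [mul_assoc, ← src_tgt_comm, ← mul_assoc, H.counit_mul_src_tgt, mul_assoc, ← src_mul]

/-- The coface `C⁰(U, A) → C¹(U, A)`, `a ↦ (u ↦ ε(u s(a)))`. -/
def cofaceBase : Cochain H 0 →ₗ[k] Cochain H 1 :=
  Coch.lam (Y := baseA k A) (p := 0) (counitMulSrc H : A →ₗ[k] U →ₗ[k] A)
    (fun b a u => @counitMulSrc_tgt k A U _ _ _ _ _ H b a u)

theorem cofaceBase_act (a : A) (φ : Cochain H 0) :
    cofaceBase H ((Cochain H 0).act a φ) = (Cochain H 1).act a (cofaceBase H φ) :=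
  Coch.ext fun u => @counitMulSrc_mul k A U _ _ _ _ _ H φ a u

/-- The coface that multiplies the last two arguments, `φ ↦ φ(u¹, …, u^p u^{p+1})`. -/
def cofaceMul (p : ℕ) : Cochain H (p + 1) →ₗ[k] Cochain H (p + 2) :=
  Coch.lam (p := p + 1)
    (LinearMap.mk₂ k
      (fun φ v => (⟨Coch.app φ ∘ₗ LinearMap.mulRight k v, fun a u => by
        simp only [LinearMap.comp_apply, LinearMap.mulRight_apply, mul_assoc, Coch.app_tgt]⟩ :
          Cochain H (p + 1)))
      (fun φ ψ v => rfl) (fun c φ v => rfl)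
      (fun φ v w => Coch.ext fun u => by
        change Coch.app φ (u * (v + w)) = Coch.app φ (u * v) + Coch.app φ (u * w)
        rw [mul_add, map_add])
      (fun c φ v => Coch.ext fun u => by
        change Coch.app φ (u * (c • v)) = c • Coch.app φ (u * v)
        rw [mul_smul_comm, map_smul]))
    (fun φ a v => Coch.ext fun u => by
      change Coch.app φ (u * (tgt H.η a * v)) = Coch.app φ (u * tgt H.η a * v)
      rw [mul_assoc])

theorem cofaceMul_act (p : ℕ) (a : A) (φ : Cochain H (p + 1)) :
    cofaceMul H p ((Cochain H (p + 1)).act a φ) =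
      (Cochain H (p + 2)).act a (cofaceMul H p φ) := by
  refine Coch.ext fun v => Coch.ext fun u => ?_
  change Coch.app φ (u * v * tgt H.η a) = Coch.app φ (u * (v * tgt H.η a))
  rw [mul_assoc]

/-- From a map `K` of cochains, the map `φ ↦ (v ↦ K(φ(…, v)))`. -/
def cofaceStep {p q : ℕ} (K : Cochain H p →ₗ[k] Cochain H q)
    (hK : ∀ a φ, K ((Cochain H p).act a φ) = (Cochain H q).act a (K φ)) :
    Cochain H (p + 1) →ₗ[k] Cochain H (q + 1) :=
  Coch.lam (Coch.app.compr₂ K) (fun φ a u => by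
    change K (Coch.app φ (tgt H.η a * u)) = (Cochain H q).act a (K (Coch.app φ u))
    rw [Coch.app_tgt, hK])

/-- The cofaces other than `coface0`, see `coface`. -/
def cofaceAux : (p j : ℕ) → {K : Cochain H p →ₗ[k] Cochain H (p + 1) //
    ∀ a φ, K ((Cochain H p).act a φ) = (Cochain H (p + 1)).act a (K φ)}
  | 0, _ => ⟨cofaceBase H, cofaceBase_act H⟩
  | p + 1, 0 => ⟨cofaceMul H p, cofaceMul_act H p⟩
  | p + 1, j + 1 => ⟨cofaceStep H (cofaceAux p j).1 (cofaceAux p j).2,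
      fun _ _ => Coch.ext fun _ => rfl⟩

/-- The cofaces `C^p(U, A) → C^{p+1}(U, A)`, counted from the last argument: for `j = 0`, the map
`φ ↦ φ(u¹, …, ε(u^{p+1}) ▸ u^p)`; for `0 < j ≤ p`, the map
`φ ↦ φ(u¹, …, uⁱ uⁱ⁺¹, …, u^{p+1})` with `i = p + 1 - j`; for `j = p + 1`, the map
`φ ↦ ε(u¹ s(φ(u², …, u^{p+1})))`. -/
def coface (p : ℕ) : ℕ → Cochain H p →ₗ[k] Cochain H (p + 1)
  | 0 => coface0 H p
  | j + 1 => (cofaceAux H p j).1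

/-- The coboundary `δ`. -/
def dCochain (p : ℕ) : Cochain H p →ₗ[k] Cochain H (p + 1) :=
  ∑ j ∈ Finset.range (p + 2), sg (p + 1 - j : ℤ) • coface H p j

/-- Evaluation in the last argument, as a map on `U`. -/
def appU (a : ℕ) : U →ₗ[k] Cochain H (a + 1) →ₗ[k] Cochain H a := (Coch.app (p := a)).flip

/-- The operation `(E, φ) ↦ φ(u¹, …, u^a, E(u^{a+1}, …, u^{a+q}))` for `U`-valued `q`-cochains
`E` and `φ ∈ C^{a+1}(U, A)`. -/
def insLast (a q : ℕ) :
    Coch H.η (baseU H.η) q →ₗ[k] Cochain H (a + 1) →ₗ[k] Cochain H (a + q) :=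
  post (Y := baseU H.η) (appU H a) (fun c u φ => Coch.app_tgt φ c u) q

theorem insLast_act (a q : ℕ) (c : A) (E : Coch H.η (baseU H.η) q) (φ : Cochain H (a + 1)) :
    insLast H a q E ((Cochain H (a + 1)).act c φ) =
      insLast H a q (rmulU H.η q (tgt H.η c) E) φ := by
  induction q with
  | zero => exact Coch.app_act φ c E
  | succ q ih => exact Coch.ext (p := a + q) fun u => ih (Coch.app E u)

theorem insLast_opD (a q : ℕ) (c : A) (ψ : Cochain H q) (φ : Cochain H (a + 1)) :
    insLast H a q (opD H q ψ) ((Cochain H (a + 1)).act c φ) =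
      (Cochain H (a + q)).act c (insLast H a q (opD H q ψ) φ) := by
  rw [insLast_act, ← act_opD]
  exact post_act _ _ q c _ φ

/-- The insertion `φ ∘_{a+1} ψ`, together with its linearity property, see `circ`. -/
def circAux (a q : ℕ) (ψ : Cochain H q) :
    (r : ℕ) → {K : Cochain H (a + 1 + r) →ₗ[k] Cochain H (a + q + r) //
      ∀ c φ, K ((Cochain H (a + 1 + r)).act c φ) = (Cochain H (a + q + r)).act c (K φ)}
  | 0 => ⟨insLast H a q (opD H q ψ), fun c φ => insLast_opD H a q c ψ φ⟩
  | r + 1 => ⟨cofaceStep H (p := a + 1 + r) (q := a + q + r) (circAux a q ψ r).1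
      (circAux a q ψ r).2, fun _ _ => Coch.ext (p := a + q + r) fun _ => rfl⟩

/-- The insertion `φ ∘_{a+1} ψ`: for `φ ∈ C^{a+1+r}(U, A)` and `ψ ∈ C^q(U, A)`, the cochain
`φ(u¹, …, u^a, D_ψ(u^{a+1}, …, u^{a+q}), u^{a+q+1}, …, u^{a+q+r})`. -/
def circ (a q r : ℕ) (φ : Cochain H (a + 1 + r)) (ψ : Cochain H q) : Cochain H (a + q + r) :=
  (circAux H a q ψ r).1 φ

/-- The sum `φ ∘̄ ψ = (-1)^{(p-1)(q-1)} ∑_{i=1}^p (-1)^{(q-1)(i-1)} φ ∘_i ψ` for `φ ∈ C^p(U, A)`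
and `ψ ∈ C^q(U, A)`, where `p + q = n + 1`. The summation index is `j = i - 1`. -/
def barCirc {p q n : ℕ} (h : p + q = n + 1) (φ : Cochain H p) (ψ : Cochain H q) : Cochain H n :=
  sg ((p - 1 : ℤ) * (q - 1)) • ∑ j : Fin p, sg ((q - 1 : ℤ) * j) •
    Coch.cast (by omega : j + q + (p - 1 - j) = n)
      (circ H j q (p - 1 - j) (Coch.cast (by omega : p = j + 1 + (p - 1 - j)) φ) ψ)

/-- The Gerstenhaber bracket `{φ, ψ} = φ ∘̄ ψ - (-1)^{(p-1)(q-1)} ψ ∘̄ φ` for `φ ∈ C^p(U, A)` and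
`ψ ∈ C^q(U, A)`, where `p + q = n + 1`. -/
def bracket {p q n : ℕ} (h : p + q = n + 1) (φ : Cochain H p) (ψ : Cochain H q) : Cochain H n :=
  barCirc H h φ ψ - sg ((p - 1 : ℤ) * (q - 1)) • barCirc H (by omega : q + p = n + 1) ψ φ

end Cochains

/-! ## Chains and the operations on them -/

section Transl

variable {k : Type v} {A U : Type u} [CommRing k] [Ring A] [Algebra k A] [Ring U] [Algebra k U]

/-- `f ⊗ g` on `U ⊗_{A^op} U`. -/
def TensOp.map {η : A ⊗[k] Aᵐᵒᵖ →ₐ[k] U} (f g : U →ₗ[k] U)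
    (hf : ∀ a x, f (x * tgt η a) = f x * tgt η a) (hg : ∀ a x, g (tgt η a * x) = tgt η a * g x) :
    TensOp η →ₗ[k] TensOp η :=
  Bal.lift ((Bal.mk (fun a => LinearMap.mulRight k (tgt η a))
      (fun a => LinearMap.mulLeft k (tgt η a))).compl₁₂ f g) (by
    intro a x y
    simp only [LinearMap.compl₁₂_apply, LinearMap.mulRight_apply, LinearMap.mulLeft_apply, hf, hg]
    exact Bal.mk_bal (ρ := fun a => LinearMap.mulRight k (tgt η a))
      (l := fun a => LinearMap.mulLeft k (tgt η a)) a (f x) (g y))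

@[simp] theorem TensOp.map_mk {η : A ⊗[k] Aᵐᵒᵖ →ₐ[k] U} (f g : U →ₗ[k] U) (hf) (hg) (x y : U) :
    TensOp.map (η := η) f g hf hg (Bal.mk _ _ x y) = Bal.mk _ _ (f x) (g y) := by
  rw [TensOp.map, Bal.lift_mk]
  rfl

variable (H : LeftHopfAlgebroid k A U)

theorem TensA.rmul_rmul (a b c d : U) (z : TensA H.η) :
    TensA.rmul c d (TensA.rmul a b z) = TensA.rmul (a * c) (b * d) z := by
  obtain ⟨z, rfl⟩ := Bal.proj_surjective z
  rw [TensA.rmul_proj, TensA.rmul_proj, TensA.rmul_proj, mul_assoc,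
    Algebra.TensorProduct.tmul_mul_tmul]

theorem TensA.rmul_lmul (a b : U) (c d : A) (z : TensA H.η) :
    TensA.rmul a b (TensA.lmul c d z) = TensA.lmul c d (TensA.rmul a b z) := by
  obtain ⟨z, rfl⟩ := Bal.proj_surjective z
  rw [TensA.rmul_proj, TensA.lmul_proj, TensA.lmul_proj, TensA.rmul_proj, mul_assoc]

/-- `x ⊗ y ↦ t(a) x ⊗ y` on `U ⊗_{A^op} U`. -/
def TensOp.lmulFst (a : A) : TensOp H.η →ₗ[k] TensOp H.η :=
  TensOp.map (LinearMap.mulLeft k (tgt H.η a)) LinearMap.id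
    (fun _ _ => by simp [mul_assoc]) (fun _ _ => rfl)

/-- `x ⊗ y ↦ x ⊗ y w` on `U ⊗_{A^op} U`. -/
def TensOp.rmulSnd (w : U) : TensOp H.η →ₗ[k] TensOp H.η :=
  TensOp.map LinearMap.id (LinearMap.mulRight k w) (fun _ _ => rfl)
    (fun _ _ => by simp [mul_assoc])

/-- `x ⊗ y ↦ x ⊗ s(a) y` on `U ⊗_{A^op} U`. -/
def TensOp.lmulSnd (a : A) : TensOp H.η →ₗ[k] TensOp H.η :=
  TensOp.map LinearMap.id (LinearMap.mulLeft k (src H.η a)) (fun _ _ => rfl)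
    (fun _ _ => by simp only [LinearMap.mulLeft_apply, ← mul_assoc, src_tgt_comm])

theorem TensOp.lmulFst_mk (a : A) (x y : U) :
    TensOp.lmulFst H a (Bal.mk _ _ x y) = Bal.mk _ _ (tgt H.η a * x) y := rfl

theorem galois_lmulFst (a : A) (z : TensOp H.η) :
    H.galois (TensOp.lmulFst H a z) = TensA.lmul 1 a (H.galois z) := by
  have h : H.galois ∘ₗ TensOp.lmulFst H a = TensA.lmul 1 a ∘ₗ H.galois :=
    Bal.hom_ext fun x y => by
      refine (congrArg H.galois (TensOp.lmulFst_mk H a x y)).trans ?_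
      simp only [LinearMap.comp_apply, H.galois_mk, H.comul_tgt_mul, TensA.rmul_lmul]
  exact LinearMap.congr_fun h z

theorem TensOp.rmulSnd_mk (w : U) (x y : U) :
    TensOp.rmulSnd H w (Bal.mk _ _ x y) = Bal.mk _ _ x (y * w) := rfl

theorem galois_rmulSnd (w : U) (z : TensOp H.η) :
    H.galois (TensOp.rmulSnd H w z) = TensA.rmul 1 w (H.galois z) := by
  have h : H.galois ∘ₗ TensOp.rmulSnd H w = TensA.rmul 1 w ∘ₗ H.galois :=
    Bal.hom_ext fun x y => by
      refine (congrArg H.galois (TensOp.rmulSnd_mk H w x y)).trans ?_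
      simp only [LinearMap.comp_apply, H.galois_mk, TensA.rmul_rmul, one_mul]
  exact LinearMap.congr_fun h z

theorem TensOp.lmulSnd_mk (a : A) (x y : U) :
    TensOp.lmulSnd H a (Bal.mk _ _ x y) = Bal.mk _ _ x (src H.η a * y) := rfl

theorem galois_lmulSnd (a : A) (z : TensOp H.η) :
    H.galois (TensOp.lmulSnd H a z) = TensA.rmul (tgt H.η a) 1 (H.galois z) := by
  have h : H.galois ∘ₗ TensOp.lmulSnd H a = TensA.rmul (tgt H.η a) 1 ∘ₗ H.galois :=
    Bal.hom_ext fun x y => by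
      have h1 : TensA.rmul 1 (src H.η a * y) (H.comul x) =
          TensA.rmul (tgt H.η a) y (H.comul x) := by
        have := congrArg (TensA.rmul 1 y) (H.comul_takeuchi a x)
        simpa only [TensA.rmul_rmul, one_mul, mul_one] using this.symm
      refine (congrArg H.galois (TensOp.lmulSnd_mk H a x y)).trans ?_
      simp only [LinearMap.comp_apply, H.galois_mk, TensA.rmul_rmul, one_mul, mul_one, h1]
  exact LinearMap.congr_fun h z

theorem transl_lmulFst (a : A) (u : U) :
    TensOp.lmulFst H a (H.transl u) = TensOp.rmulSnd H (tgt H.η a) (H.transl u) := by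
  apply H.galois_bijective.injective
  rw [galois_lmulFst, galois_rmulSnd, H.galois_transl, ← Bal.proj_tmul, TensA.lmul_proj,
    TensA.rmul_proj]
  simp

theorem transl_tgt_mul (a : A) (u : U) :
    H.transl (tgt H.η a * u) = TensOp.rmulSnd H (src H.η a) (H.transl u) := by
  apply H.galois_bijective.injective
  rw [galois_rmulSnd, H.galois_transl, H.galois_transl, ← Bal.proj_tmul, ← Bal.proj_tmul,
    TensA.rmul_proj, Algebra.TensorProduct.tmul_mul_tmul, Bal.proj_tmul, Bal.proj_tmul, one_mul,
    mul_one]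
  exact (Bal.mk_bal (ρ := fun a => LinearMap.mulLeft k (tgt H.η a))
    (l := fun a => LinearMap.mulLeft k (src H.η a)) a u 1).trans (by simp)

theorem transl_mul_tgt (a : A) (u : U) :
    H.transl (u * tgt H.η a) = TensOp.lmulSnd H a (H.transl u) := by
  apply H.galois_bijective.injective
  rw [galois_lmulSnd, H.galois_transl, H.galois_transl, ← Bal.proj_tmul, ← Bal.proj_tmul,
    TensA.rmul_proj]
  simp

end Transl

section Chains

variable {k : Type v} {A U M : Type u} [CommRing k] [Ring A] [Algebra k A] [Ring U] [Algebra k U]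
  [AddCommGroup M] [Module k M] [Module Uᵐᵒᵖ M] [IsScalarTower k Uᵐᵒᵖ M]

theorem ract_ract (u v : U) (m : M) : ract k U M v (ract k U M u m) = ract k U M (u * v) m := by
  change MulOpposite.op v • MulOpposite.op u • m = MulOpposite.op (u * v) • m
  rw [smul_smul, MulOpposite.op_mul]

variable (η : A ⊗[k] Aᵐᵒᵖ →ₐ[k] U)

variable (M) in
/-- `M` as a left `A`-module via `a ▸ m = m t(a)`. -/
def baseM : ActMod k A where
  carrier := M
  act := ract k U M ∘ₗ tgt η

variable (M) in
/-- The space of `n`-chains `C_n(U, M) = M ⊗_{A^op} U ⊗_{A^op} ⋯ ⊗_{A^op} U`, with `n` factors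
`U`. -/
abbrev Ch (n : ℕ) : ActMod k A := Chain η (baseM M η) n

theorem Ch.act_act {n : ℕ} (a b : A) (x : Ch M η n) :
    (Ch M η n).act (a * b) x = (Ch M η n).act a ((Ch M η n).act b x) := by
  cases n with
  | zero =>
    have := @ract_ract k U M _ _ _ _ _ _ _ (tgt η b) (tgt η a) x
    rw [← tgt_mul] at this
    exact this.symm
  | succ n =>
    have h : (Ch M η (n + 1)).act (a * b) =
        (Ch M η (n + 1)).act a ∘ₗ (Ch M η (n + 1)).act b := Chain.hom_ext fun x u => by
      rw [LinearMap.comp_apply, Chain.act_snoc, Chain.act_snoc, Chain.act_snoc, tgt_mul,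
        mul_assoc]
    exact LinearMap.congr_fun h x

/-- The action of `U` on `M = C_0(U, M)`. -/
def actM : Ch M η 0 →ₗ[k] U →ₗ[k] Ch M η 0 := (ract k U M).flip

theorem actM_mul (m : Ch M η 0) (u v : U) : actM η (actM η m u) v = actM η m (u * v) :=
  @ract_ract k U M _ _ _ _ _ _ _ u v m

theorem actM_tgt (m : Ch M η 0) (a : A) : actM η m (tgt η a) = (Ch M η 0).act a m := rfl

theorem actM_act (m : Ch M η 0) (a : A) (u : U) :
    actM η ((Ch M η 0).act a m) u = actM η m (tgt η a * u) := by
  rw [← actM_tgt, actM_mul]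

variable (M) in
/-- The face `(m, u¹) ↦ m u¹`. -/
def faceAct : ActHom (Ch M η 1) (Ch M η 0) where
  lin := Chain.lift (n := 0) (actM η) (fun a m u => actM_act η m a u)
  comm a x := by
    have h : Chain.lift (n := 0) (actM (M := M) η) (fun a m u => actM_act η m a u) ∘ₗ
        (Ch M η 1).act a = (Ch M η 0).act a ∘ₗ
        Chain.lift (n := 0) (actM η) (fun a m u => actM_act η m a u) :=
      Chain.hom_ext fun m u => by
        rw [LinearMap.comp_apply, Chain.act_snoc, Chain.lift_snoc, LinearMap.comp_apply,
          Chain.lift_snoc, ← actM_tgt, actM_mul]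
    exact LinearMap.congr_fun h x

/-- The map `(x, u, v) ↦ (x, u v)` on `X ⊗_{A^op} U ⊗_{A^op} U`. -/
def mulLin (X : ActMod k A) : TensU η (tens η X) →ₗ[k] TensU η X :=
  Bal.lift (TensU.rmul η X).flip (fun a x u => by
    have h : TensU.rmul η X u ∘ₗ TensU.rmul η X (tgt η a) = TensU.rmul η X (tgt η a * u) :=
      Bal.hom_ext fun y w => by simp [mul_assoc]
    exact LinearMap.congr_fun h x)

theorem mulLin_mk (X : ActMod k A) (x : X) (u v : U) :
    mulLin η X (TensU.mk η (tens η X) (TensU.mk η X x u) v) = TensU.mk η X x (u * v) :=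
  (Bal.lift_mk _ _ _ _).trans (TensU.rmul_mk η X v x u)

/-- The map `(x, u, v) ↦ (x, u v)` on `X ⊗_{A^op} U ⊗_{A^op} U`, as an `A`-linear map. -/
def faceMul (X : ActMod k A) : ActHom (tens η (tens η X)) (tens η X) where
  lin := mulLin η X
  comm a x := by
    have h : mulLin η X ∘ₗ TensU.rmul η (tens η X) (tgt η a) =
        TensU.rmul η X (tgt η a) ∘ₗ mulLin η X :=
      Bal.hom_ext fun y v => by
        have h2 : mulLin η X ∘ₗ (TensU.mk η (tens η X)).flip (v * tgt η a) =
            TensU.rmul η X (tgt η a) ∘ₗ mulLin η X ∘ₗ (TensU.mk η (tens η X)).flip v :=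
          Bal.hom_ext fun x u => by
            refine (mulLin_mk η X x u (v * tgt η a)).trans ?_
            refine Eq.trans ?_ (congrArg (TensU.rmul η X (tgt η a)) (mulLin_mk η X x u v)).symm
            rw [TensU.rmul_mk, mul_assoc]
        refine (congrArg (mulLin η X) (TensU.rmul_mk η (tens η X) (tgt η a) y v)).trans ?_
        exact LinearMap.congr_fun h2 y
    exact LinearMap.congr_fun h x

variable (M) in
/-- The faces `C_{n+1}(U, M) → C_n(U, M)` other than `face0`, see `face`. -/
def faceAux : (n i : ℕ) → ActHom (Ch M η (n + 1)) (Ch M η n)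
  | 0, _ => faceAct M η
  | n + 1, 0 => faceMul η (Ch M η n)
  | n + 1, i + 1 => tensMap η (faceAux n i)

/-- `(m, u¹, …, uⁿ) ↦ (m, 1, u¹, …, uⁿ)` -/
def degLastBase : ActHom (Ch M η 0) (Ch M η 1) where
  lin := (Chain.snoc η (baseM M η) 0).flip 1
  comm a m := by
    change Chain.snoc η (baseM M η) 0 ((Ch M η 0).act a m) 1 =
      (Ch M η 1).act a (Chain.snoc η (baseM M η) 0 m 1)
    rw [Chain.act_snoc, Chain.snoc_bal, one_mul, mul_one]

variable (M) in
/-- The degeneracy `s_n : C_n(U, M) → C_{n+1}(U, M)`,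
`(m, u¹, …, uⁿ) ↦ (m, 1, u¹, …, uⁿ)`, as an `A`-linear map. -/
def degLastHom : (n : ℕ) → ActHom (Ch M η n) (Ch M η (n + 1))
  | 0 => degLastBase η
  | n + 1 => tensMap η (degLastHom n)

section Bialgebroid

variable (H : LeftBialgebroid k A U)

variable (M) in
/-- The face `(m, u¹, …, u^{n+1}) ↦ (m, u¹, …, ε(u^{n+1}) ▸ uⁿ)`; for `n = 0` it is
`(m, u) ↦ m t(ε(u))`. -/
def face0 (n : ℕ) : Ch M H.η (n + 1) →ₗ[k] Ch M H.η n :=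
  Chain.lift ((Ch M H.η n).act ∘ₗ H.counit).flip (fun a x u => by
    change (Ch M H.η n).act (H.counit u) ((Ch M H.η n).act a x) =
      (Ch M H.η n).act (H.counit (tgt H.η a * u)) x
    rw [H.counit_tgt_mul, Ch.act_act])

variable (M) in
/-- The faces `d_i : C_{n+1}(U, M) → C_n(U, M)`: `d_0` is
`(m, u¹, …, u^{n+1}) ↦ (m, u¹, …, ε(u^{n+1}) ▸ uⁿ)`; for `0 < i ≤ n`, `d_i` multiplies
`u^j u^{j+1}` with `j = n + 1 - i`; and `d_{n+1}` is `(m, u¹, …, u^{n+1}) ↦ (m u¹, u², …, u^{n+1})`. -/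
def face (n : ℕ) : ℕ → Ch M H.η (n + 1) →ₗ[k] Ch M H.η n
  | 0 => face0 M H n
  | i + 1 => (faceAux M H.η n i).lin

variable (M) in
/-- The Hochschild boundary `b = ∑_{i=0}^{n+1} (-1)^i d_i : C_{n+1}(U, M) → C_n(U, M)`. -/
def bdry (n : ℕ) : Ch M H.η (n + 1) →ₗ[k] Ch M H.η n :=
  ∑ i ∈ Finset.range (n + 2), sg i • face M H n i

variable (M) in
/-- The degeneracy `s_n : C_n(U, M) → C_{n+1}(U, M)`, `(m, u¹, …, uⁿ) ↦ (m, 1, u¹, …, uⁿ)`. -/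
def degLast (n : ℕ) : Ch M H.η n →ₗ[k] Ch M H.η (n + 1) := (degLastHom M H.η n).lin

/-- The pairing `(x, c) ↦ c ▸ x` of `a`-chains with elements of `A`. -/
def actPair (a : ℕ) : Ch M H.η a →ₗ[k] baseA k A →ₗ[k] Ch M H.η a := (Ch M H.η a).act.flip

variable (M) in
/-- The cap product `ι_φ(m, u¹, …, u^{a+p}) = (m, u¹, …, φ(u^{a+1}, …, u^{a+p}) ▸ u^a)` for
`φ ∈ C^p(U, A)`; for `a = 0`, the value is `m t(φ(u¹, …, u^p))`. -/
def capChain (p a : ℕ) : Cochain H p →ₗ[k] Ch M H.η (a + p) →ₗ[k] Ch M H.η a :=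
  pair (Y := baseA k A) (actPair H a) (fun c x y => (Ch.act_act H.η y c x).symm) p

/-- The pairing `(x, u) ↦ (x, u)` of `a`-chains with elements of `U`. -/
def snocPair (a : ℕ) : Ch M H.η a →ₗ[k] baseU H.η →ₗ[k] Ch M H.η (a + 1) :=
  Chain.snoc H.η (baseM M H.η) a

variable (M) in
/-- The pairing `(m, u¹, …, u^{a+q}) ↦ (m, u¹, …, u^a, E(u^{a+1}, …, u^{a+q}))` for `U`-valued
cochains `E`. -/
def insPair (q a : ℕ) : Coch H.η (baseU H.η) q →ₗ[k] Ch M H.η (a + q) →ₗ[k] Ch M H.η (a + 1) :=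
  pair (Y := baseU H.η) (snocPair H a) (fun c x u => Chain.snoc_bal c x u) q

theorem insPair_rmul (q a : ℕ) (c : A) (E : Coch H.η (baseU H.η) q) (x : Ch M H.η (a + q)) :
    insPair M H q a (rmulU H.η q (tgt H.η c) E) x =
      (Ch M H.η (a + 1)).act c (insPair M H q a E x) := by
  induction q with
  | zero => exact (Chain.act_snoc c x E).symm
  | succ q ih =>
    have h : insPair M H (q + 1) a (rmulU H.η (q + 1) (tgt H.η c) E) =
        (Ch M H.η (a + 1)).act c ∘ₗ insPair M H (q + 1) a E :=
      Chain.hom_ext (n := a + q) fun x u =>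
        (pair_snoc (snocPair (M := M) H a) _ q (rmulU H.η (q + 1) (tgt H.η c) E) x u).trans
          ((ih (Coch.app E u) x).trans
            (congrArg ((Ch M H.η (a + 1)).act c) (pair_snoc (snocPair H a) _ q E x u).symm))
    exact LinearMap.congr_fun h x

theorem insPair_opD (q a : ℕ) (c : A) (φ : Cochain H q) (x : Ch M H.η (a + q)) :
    insPair M H q a (opD H q φ) ((Ch M H.η (a + q)).act c x) =
      (Ch M H.η (a + 1)).act c (insPair M H q a (opD H q φ) x) := by
  rw [← insPair_rmul, ← act_opD]
  exact pair_act _ _ q c _ x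

/-- From a family `P` of `A`-linear maps `X → X'`, depending linearly on a parameter `φ`, the
family `P_φ ⊗ id`. -/
def tensFam {V : Type u} [AddCommGroup V] [Module k V] {X X' : ActMod k A}
    (P : V →ₗ[k] X →ₗ[k] X') (hP : ∀ φ c x, P φ (X.act c x) = X'.act c (P φ x)) :
    V →ₗ[k] tens η X →ₗ[k] tens η X' where
  toFun φ := (tensMap η ⟨P φ, hP φ⟩).lin
  map_add' φ ψ := Bal.hom_ext fun x u => by
    change TensU.mk η X' (P (φ + ψ) x) u =
      TensU.mk η X' (P φ x) u + TensU.mk η X' (P ψ x) u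
    simp only [map_add, LinearMap.add_apply]
  map_smul' c φ := Bal.hom_ext fun x u => by
    change TensU.mk η X' (P (c • φ) x) u = c • TensU.mk η X' (P φ x) u
    simp only [map_smul, LinearMap.smul_apply]

variable (M) in
/-- The insertion of `D_φ` into chains, together with its linearity, see `opIns`. -/
def opInsAux (p a : ℕ) : (r : ℕ) →
    {P : Cochain H p →ₗ[k] Ch M H.η (a + p + r) →ₗ[k] Ch M H.η (a + 1 + r) //
      ∀ φ c x, P φ ((Ch M H.η (a + p + r)).act c x) = (Ch M H.η (a + 1 + r)).act c (P φ x)}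
  | 0 => ⟨insPair M H p a ∘ₗ opD H p, fun φ c x => insPair_opD H p a c φ x⟩
  | r + 1 => ⟨tensFam H.η (opInsAux p a r).1 (opInsAux p a r).2, fun φ c x =>
      (tensMap H.η ⟨(opInsAux p a r).1 φ, (opInsAux p a r).2 φ⟩).comm c x⟩

variable (M) in
/-- For `φ ∈ C^p(U, A)`, the map
`(m, u¹, …, u^{a+p+r}) ↦ (m, u¹, …, u^a, D_φ(u^{a+1}, …, u^{a+p}), u^{a+p+1}, …, u^{a+p+r})`. -/
def opIns (p a r : ℕ) : Cochain H p →ₗ[k] Ch M H.η (a + p + r) →ₗ[k] Ch M H.η (a + 1 + r) :=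
  (opInsAux M H p a r).1

end Bialgebroid

section Cyclic

variable (H : LeftHopfAlgebroid k A U)

variable (M) in
/-- The flip `U ⊗_A M → M ⊗_{A^op} U`, `u ⊗ m ↦ (m, u)`. -/
def flipAM : TensAM H.η M →ₗ[k] Ch M H.η 1 :=
  Bal.lift (Chain.snoc H.η (baseM M H.η) 0 : M →ₗ[k] U →ₗ[k] Ch M H.η 1).flip (fun a u m =>
    (Chain.snoc_bal (X := baseM M H.η) (n := 0) a m u).symm)

/-- The map `y ↦ (x ⊗ z ↦ ((y, x), z))`, from `Y` to the linear maps from `U ⊗_{A^op} U` to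
`Y ⊗_{A^op} U ⊗_{A^op} U`. -/
def insTransl (Y : ActMod k A) : Y →ₗ[k] TensOp H.η →ₗ[k] TensU H.η (tens H.η Y) where
  toFun y := Bal.lift ((TensU.mk H.η (tens H.η Y)) ∘ₗ (TensU.mk H.η Y y)) (fun a x z => by
    refine Eq.trans ?_ (TensU.mk_bal H.η (tens H.η Y) a (TensU.mk H.η Y y x) z)
    exact congrArg (fun w => TensU.mk H.η (tens H.η Y) w z)
      (TensU.rmul_mk H.η Y (tgt H.η a) y x).symm)
  map_add' y y' := Bal.hom_ext fun x z => by
    change TensU.mk H.η (tens H.η Y) (TensU.mk H.η Y (y + y') x) z =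
      TensU.mk H.η (tens H.η Y) (TensU.mk H.η Y y x) z +
        TensU.mk H.η (tens H.η Y) (TensU.mk H.η Y y' x) z
    rw [map_add, LinearMap.add_apply]
    exact LinearMap.congr_fun (map_add (TensU.mk H.η (tens H.η Y)) _ _) z
  map_smul' c y := Bal.hom_ext fun x z => by
    change TensU.mk H.η (tens H.η Y) (TensU.mk H.η Y (c • y) x) z =
      c • TensU.mk H.η (tens H.η Y) (TensU.mk H.η Y y x) z
    rw [map_smul, LinearMap.smul_apply]
    exact LinearMap.congr_fun (map_smul (TensU.mk H.η (tens H.η Y)) c _) z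

theorem insTransl_mk (Y : ActMod k A) (y : Y) (x z : U) :
    insTransl H Y y (Bal.mk _ _ x z) = TensU.mk H.η (tens H.η Y) (TensU.mk H.η Y y x) z := rfl

theorem insTransl_rmulSnd (Y : ActMod k A) (y : Y) (w : U) (z : TensOp H.η) :
    insTransl H Y y (TensOp.rmulSnd H w z) =
      TensU.rmul H.η (tens H.η Y) w (insTransl H Y y z) := by
  have h : insTransl H Y y ∘ₗ TensOp.rmulSnd H w =
      TensU.rmul H.η (tens H.η Y) w ∘ₗ insTransl H Y y := Bal.hom_ext fun x z => rfl
  exact LinearMap.congr_fun h z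

theorem insTransl_lmulSnd (Y : ActMod k A) (y : Y) (a : A) (z : TensOp H.η) :
    insTransl H Y y (TensOp.lmulSnd H a z) =
      TensU.lmulSrc H.η (tens H.η Y) a (insTransl H Y y z) := by
  have h : insTransl H Y y ∘ₗ TensOp.lmulSnd H a =
      TensU.lmulSrc H.η (tens H.η Y) a ∘ₗ insTransl H Y y := Bal.hom_ext fun x z => rfl
  exact LinearMap.congr_fun h z

theorem insTransl_act (Y : ActMod k A) (y : Y) (a : A) (z : TensOp H.η) :
    insTransl H Y (Y.act a y) z = insTransl H Y y (TensOp.lmulFst H a z) := by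
  have h : insTransl H Y (Y.act a y) = insTransl H Y y ∘ₗ TensOp.lmulFst H a :=
    Bal.hom_ext fun x z => congrArg (fun w => TensU.mk H.η (tens H.η Y) w z)
      (TensU.mk_bal H.η Y a y x)
  exact LinearMap.congr_fun h z

theorem TensU.rmul_rmul (η : A ⊗[k] Aᵐᵒᵖ →ₐ[k] U) (X : ActMod k A) (v w : U) (z : TensU η X) :
    TensU.rmul η X w (TensU.rmul η X v z) = TensU.rmul η X (v * w) z := by
  have h : TensU.rmul η X w ∘ₗ TensU.rmul η X v = TensU.rmul η X (v * w) :=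
    Bal.hom_ext fun x u => by
      simp only [LinearMap.comp_apply, TensU.rmul_mk, mul_assoc]
  exact LinearMap.congr_fun h z

theorem TensU.rmul_lmulSrc (η : A ⊗[k] Aᵐᵒᵖ →ₐ[k] U) (X : ActMod k A) (v : U) (a : A)
    (z : TensU η X) : TensU.rmul η X v (TensU.lmulSrc η X a z) =
      TensU.lmulSrc η X a (TensU.rmul η X v z) := by
  have h : TensU.rmul η X v ∘ₗ TensU.lmulSrc η X a = TensU.lmulSrc η X a ∘ₗ TensU.rmul η X v :=
    Bal.hom_ext fun x u => by
      simp only [LinearMap.comp_apply, TensU.rmul_mk, TensU.lmulSrc_mk, mul_assoc]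
  exact LinearMap.congr_fun h z

/-- The map `((y, w), u) ↦ ((y, u₊), u₋ w)`. -/
noncomputable def spread (Y : ActMod k A) :
    TensU H.η Y →ₗ[k] U →ₗ[k] TensU H.η (tens H.η Y) :=
  Bal.lift
    (LinearMap.mk₂ k (fun y w => TensU.rmul H.η (tens H.η Y) w ∘ₗ insTransl H Y y ∘ₗ H.transl)
      (fun y y' w => by simp only [map_add, LinearMap.add_comp, LinearMap.comp_add])
      (fun c y w => by simp only [map_smul, LinearMap.smul_comp, LinearMap.comp_smul])
      (fun y w w' => by simp only [map_add, LinearMap.add_comp])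
      (fun c y w => by simp only [map_smul, LinearMap.smul_comp]))
    (fun a y w => LinearMap.ext fun u => by
      change TensU.rmul H.η (tens H.η Y) w (insTransl H Y (Y.act a y) (H.transl u)) =
        TensU.rmul H.η (tens H.η Y) (tgt H.η a * w) (insTransl H Y y (H.transl u))
      rw [insTransl_act, transl_lmulFst, insTransl_rmulSnd, TensU.rmul_rmul])

theorem spread_mk (Y : ActMod k A) (y : Y) (w u : U) :
    spread H Y (TensU.mk H.η Y y w) u =
      TensU.rmul H.η (tens H.η Y) w (insTransl H Y y (H.transl u)) := rfl

theorem spread_lmulSrc (Y : ActMod k A) (a : A) (z : TensU H.η Y) (u : U) :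
    spread H Y (TensU.lmulSrc H.η Y a z) u = spread H Y z (tgt H.η a * u) := by
  have h : (spread H Y).flip u ∘ₗ TensU.lmulSrc H.η Y a = (spread H Y).flip (tgt H.η a * u) :=
    Bal.hom_ext fun y w => by
      rw [LinearMap.comp_apply, TensU.lmulSrc_mk]
      rw [LinearMap.flip_apply, LinearMap.flip_apply, spread_mk, spread_mk, transl_tgt_mul,
        insTransl_rmulSnd, TensU.rmul_rmul]
  exact LinearMap.congr_fun h z

theorem spread_mul_tgt (Y : ActMod k A) (a : A) (z : TensU H.η Y) (u : U) :
    spread H Y z (u * tgt H.η a) = TensU.lmulSrc H.η (tens H.η Y) a (spread H Y z u) := by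
  have h : (spread H Y).flip (u * tgt H.η a) =
      TensU.lmulSrc H.η (tens H.η Y) a ∘ₗ (spread H Y).flip u :=
    Bal.hom_ext fun y w => by
      rw [LinearMap.comp_apply, LinearMap.flip_apply, LinearMap.flip_apply, spread_mk, spread_mk,
        transl_mul_tgt, insTransl_lmulSnd, TensU.rmul_lmulSrc]
  exact LinearMap.congr_fun h z

/-- From `τ : X → Y ⊗_{A^op} U` with `τ(x) = (y, w)`, the map
`X ⊗_{A^op} U → Y ⊗_{A^op} U ⊗_{A^op} U`, `(x, u) ↦ (y, u₊, u₋ w)`. -/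
noncomputable def cycStep {X Y : ActMod k A} (τ : X →ₗ[k] TensU H.η Y)
    (hτ : ∀ a x, τ (X.act a x) = TensU.lmulSrc H.η Y a (τ x)) :
    TensU H.η X →ₗ[k] TensU H.η (tens H.η Y) :=
  Bal.lift (spread H Y ∘ₗ τ) (fun a x u => by
    rw [LinearMap.comp_apply, LinearMap.comp_apply, hτ, spread_lmulSrc]
    rfl)

theorem cycStep_rmul {X Y : ActMod k A} (τ : X →ₗ[k] TensU H.η Y) (hτ) (a : A)
    (x : TensU H.η X) : cycStep H τ hτ (TensU.rmul H.η X (tgt H.η a) x) =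
      TensU.lmulSrc H.η (tens H.η Y) a (cycStep H τ hτ x) := by
  have h : cycStep H τ hτ ∘ₗ TensU.rmul H.η X (tgt H.η a) =
      TensU.lmulSrc H.η (tens H.η Y) a ∘ₗ cycStep H τ hτ :=
    Bal.hom_ext fun x u => spread_mul_tgt H Y a (τ x) u
  exact LinearMap.congr_fun h x

variable (C : ModuleComodule H.toLeftBialgebroid M)

/-- The coaction as a map `M → M ⊗_{A^op} U`, `m ↦ (m₍₀₎, m₍₋₁₎)`. -/
def coactFlip : Ch M H.η 0 →ₗ[k] Ch M H.η 1 := flipAM M H ∘ₗ C.coact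

theorem coactFlip_act (a : A) (m : Ch M H.η 0) :
    coactFlip H C ((Ch M H.η 0).act a m) =
      TensU.lmulSrc H.η (baseM M H.η) a (coactFlip H C m) := by
  obtain ⟨z, hz⟩ := Bal.proj_surjective (C.coact m)
  change flipAM M H (C.coact (ract k U M (tgt H.η a) m)) =
    TensU.lmulSrc H.η (baseM M H.η) a (flipAM M H (C.coact m))
  have h : flipAM M H ∘ₗ projAM H.η M ∘ₗ (LinearMap.mulLeft k (src H.η a)).rTensor M =
      TensU.lmulSrc H.η (baseM M H.η) a ∘ₗ flipAM M H ∘ₗ projAM H.η M :=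
    TensorProduct.ext' fun u m => rfl
  rw [C.coact_lin a m z hz, ← hz]
  exact LinearMap.congr_fun h z

/-- The map `cycExt`, together with its linearity property. -/
noncomputable def cycExtAux : (n : ℕ) → {τ : Ch M H.η n →ₗ[k] Ch M H.η (n + 1) //
    ∀ a x, τ ((Ch M H.η n).act a x) = TensU.lmulSrc H.η (Ch M H.η n) a (τ x)}
  | 0 => ⟨coactFlip H C, coactFlip_act H C⟩
  | n + 1 => ⟨cycStep H (cycExtAux n).1 (cycExtAux n).2,
      cycStep_rmul H (cycExtAux n).1 (cycExtAux n).2⟩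

/-- The map `C_n(U, M) → C_{n+1}(U, M)`,
`(m, u¹, …, uⁿ) ↦ (m₍₀₎, u¹₊, …, uⁿ₊, uⁿ₋ ⋯ u¹₋ m₍₋₁₎)`. -/
noncomputable def cycExt (n : ℕ) : Ch M H.η n →ₗ[k] Ch M H.η (n + 1) := (cycExtAux H C n).1

/-- The cyclic operator
`t(m, u¹, …, uⁿ) = (m₍₀₎ u¹₊, u²₊, …, uⁿ₊, uⁿ₋ ⋯ u¹₋ m₍₋₁₎)` on `C_n(U, M)`; for `n = 0` it is
`m ↦ m₍₀₎ m₍₋₁₎`. -/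
noncomputable def cyc (n : ℕ) : Module.End k (Ch M H.η n) :=
  face M H.toLeftBialgebroid n (n + 1) ∘ₗ cycExt H C n

/-- `T = t^{n+1}` on `C_n(U, M)`. -/
noncomputable def cycT (n : ℕ) : Module.End k (Ch M H.η n) := cyc H C n ^ (n + 1)

/-- The submodule `im(1 - T)` of `C_n(U, M)`. -/
noncomputable def imT (n : ℕ) : Submodule k (Ch M H.η n) := LinearMap.range (1 - cycT H C n)

/-- The norm operator `N = ∑_{i=0}^n (-1)^{in} tⁱ` on `C_n(U, M)`. -/
noncomputable def normOp (n : ℕ) : Module.End k (Ch M H.η n) :=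
  ∑ i ∈ Finset.range (n + 1), sg (i * n) • cyc H C n ^ i

/-- The extra degeneracy `s_{-1} = t s_n : C_n(U, M) → C_{n+1}(U, M)`. -/
noncomputable def extraDeg (n : ℕ) : Ch M H.η n →ₗ[k] Ch M H.η (n + 1) :=
  cyc H C (n + 1) ∘ₗ degLast M H.toLeftBialgebroid n

/-- The operator `s_{-1} N : C_n(U, M) → C_{n+1}(U, M)`, which induces Connes' operator `B` on
`C^{cyc}(U, M)`. -/
noncomputable def opB (n : ℕ) : Ch M H.η n →ₗ[k] Ch M H.η (n + 1) :=
  extraDeg H C n ∘ₗ normOp H C n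

/-- The operator `(id - t) s_{-1} N : C_n(U, M) → C_{n+1}(U, M)`. -/
noncomputable def opB' (n : ℕ) : Ch M H.η n →ₗ[k] Ch M H.η (n + 1) :=
  (1 - cyc H C (n + 1)) ∘ₗ extraDeg H C n ∘ₗ normOp H C n

end Cyclic

end Chains
section Complexes

variable {k : Type v} {A U M : Type u} [CommRing k] [Ring A] [Algebra k A] [Ring U] [Algebra k U]
  [AddCommGroup M] [Module k M] [Module Uᵐᵒᵖ M] [IsScalarTower k Uᵐᵒᵖ M]
variable (H : LeftHopfAlgebroid k A U) (C : ModuleComodule H.toLeftBialgebroid M)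

/-- The cap product `ι_φ : C_n(U, M) → C_m(U, M)` for `φ ∈ C^p(U, A)` and `m + p = n`. -/
def cap {m p n : ℕ} (h : m + p = n) (φ : Cochain H.toLeftBialgebroid p) :
    Ch M H.η n →ₗ[k] Ch M H.η m :=
  capChain M H.toLeftBialgebroid p m φ ∘ₗ Chain.cast h.symm

/-- The operator `D'_φ : C_{e+p}(U, M) → C_{e+1}(U, M)`,
`(m, u¹, …, u^{e+p}) ↦ (m, u¹, …, u^e, D_φ(u^{e+1}, …, u^{e+p}))`, with `e + p = n`. -/
def opD' {e p n : ℕ} (h : e + p = n) (φ : Cochain H.toLeftBialgebroid p) :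
    Ch M H.η n →ₗ[k] Ch M H.η (e + 1) :=
  opIns M H.toLeftBialgebroid p e 0 φ ∘ₗ Chain.cast h.symm

/-- The Lie derivative `L_φ : C_n(U, M) → C_m(U, M)` for `φ ∈ C^p(U, A)` and `m + p = n + 1`, that
is, `m = n - p + 1`. For `m = 0` it is `(-1)^{p-1} ι_φ B`; for `m = e + 1` it is
`∑_{i=1}^m (-1)^{(p-1)(n-i+1)} t^{m-i} D'_φ t^{i+p} + ∑_{i=1}^p (-1)^{n(i-1)+p-1} t^m D'_φ tⁱ`. -/
noncomputable def lie {p n : ℕ} :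
    {m : ℕ} → m + p = n + 1 → Cochain H.toLeftBialgebroid p → (Ch M H.η n →ₗ[k] Ch M H.η m)
  | 0, h, φ => sg (p - 1) • (cap H h φ ∘ₗ opB H C n)
  | e + 1, h, φ =>
    (∑ i ∈ Finset.Icc 1 (e + 1), sg ((p - 1 : ℤ) * (n - (i - 1))) •
      ((cyc H C (e + 1) ^ (e + 1 - i)) ∘ₗ opD' H (by omega : e + p = n) φ ∘ₗ
        (cyc H C n ^ (i + p)))) +
    ∑ i ∈ Finset.Icc 1 p, sg ((n : ℤ) * (i - 1) + (p - 1)) •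
      ((cyc H C (e + 1) ^ (e + 1)) ∘ₗ opD' H (by omega : e + p = n) φ ∘ₗ (cyc H C n ^ i))

/-- The space `C^p_M(U)` of those `φ ∈ C^p(U, A)` for which all the operators
`(m, u¹, …, uⁿ) ↦ (m, u¹, …, u^a, D_φ(u^{a+1}, …, u^{a+p}), u^{a+p+1}, …, uⁿ)`, `n = a + p + r`,
map `im(1 - T)` to `im(1 - T)`. -/
noncomputable def CM (p : ℕ) : Submodule k (Cochain H.toLeftBialgebroid p) where
  carrier := {φ | ∀ a r : ℕ, ∀ x ∈ imT H C (a + p + r),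
    opIns M H.toLeftBialgebroid p a r φ x ∈ imT H C (a + 1 + r)}
  add_mem' := fun hφ hψ a r x hx => by
    rw [map_add]
    exact add_mem (hφ a r x hx) (hψ a r x hx)
  zero_mem' := fun a r x hx => by
    rw [map_zero]
    exact zero_mem _
  smul_mem' := fun c φ hφ a r x hx => by
    rw [map_smul]
    exact Submodule.smul_mem _ c (hφ a r x hx)

/-- The `p`-cocycles of the complex `(C_M(U), δ)`. -/
noncomputable def cocycles (p : ℕ) : Submodule k (Cochain H.toLeftBialgebroid p) :=
  CM H C p ⊓ LinearMap.ker (dCochain H.toLeftBialgebroid p)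

/-- The `p`-coboundaries of the complex `(C_M(U), δ)`. -/
noncomputable def coboundaries : (p : ℕ) → Submodule k (Cochain H.toLeftBialgebroid p)
  | 0 => ⊥
  | p + 1 => (CM H C p).map (dCochain H.toLeftBialgebroid p)

/-- The cohomology `H_M^p(U)` of the complex `(C_M(U), δ)`. -/
abbrev HCo (p : ℕ) : Type u := cocycles H C p ⧸ (coboundaries H C p).submoduleOf (cocycles H C p)

/-- The chains in `C_n(U, M)` whose classes are cycles of the complex
`C^{cyc}(U, M) = C(U, M) / im(1 - T)` with the differential induced by `b`. -/
noncomputable def cycles : (n : ℕ) → Submodule k (Ch M H.η n)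
  | 0 => ⊤
  | n + 1 => (imT H C n).comap (bdry M H.toLeftBialgebroid n)

/-- The chains in `C_n(U, M)` whose classes are boundaries of the complex `C^{cyc}(U, M)`. -/
noncomputable def boundaries (n : ℕ) : Submodule k (Ch M H.η n) :=
  LinearMap.range (bdry M H.toLeftBialgebroid n) ⊔ imT H C n

/-- The homology `H^M_n(U)` of the complex `C^{cyc}(U, M)`. -/
abbrev HCyc (n : ℕ) : Type u := cycles H C n ⧸ (boundaries H C n).submoduleOf (cycles H C n)

/-- The class of a cocycle in the total cohomology `⨁_p H_M^p(U)`. -/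
noncomputable def coclass {p : ℕ} (φ : Cochain H.toLeftBialgebroid p)
    (h : φ ∈ cocycles H C p) : ⨁ p, HCo H C p :=
  DirectSum.lof k ℕ (HCo H C) p (Submodule.Quotient.mk ⟨φ, h⟩)

/-- The class of a cycle in the total homology `⨁_n H^M_n(U)`. -/
noncomputable def cycclass {n : ℕ} (x : Ch M H.η n) (h : x ∈ cycles H C n) : ⨁ n, HCyc H C n :=
  DirectSum.lof k ℕ (HCyc H C) n (Submodule.Quotient.mk ⟨x, h⟩)

end Complexes

/-! ## Gerstenhaber algebras and Batalin-Vilkovisky modules -/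

section Calculus

variable (k : Type v) [CommRing k] (V : ℕ → Type u) [∀ p, AddCommGroup (V p)]
  [∀ p, Module k (V p)] (W : ℕ → Type u) [∀ n, AddCommGroup (W n)] [∀ n, Module k (W n)]

/-- The homogeneous elements of degree `p ∈ ℤ` of `⨁_{p ∈ ℕ} V^p`, where `V^p = 0` for `p < 0`. -/
def homog : ℤ → Submodule k (⨁ p, V p)
  | Int.ofNat p => LinearMap.range (DirectSum.lof k ℕ V p)
  | Int.negSucc _ => ⊥

/-- A Gerstenhaber algebra structure on the graded `k`-module `V = ⨁_{p ∈ ℕ} V^p`: a graded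
commutative `k`-algebra structure, and a bracket of degree `-1` that is a graded Lie bracket
on the desuspension of `V` and satisfies the graded Leibniz rule. -/
structure GerstenhaberAlgebra where
  /-- the unit -/
  one : ⨁ p, V p
  /-- the product -/
  mul : (⨁ p, V p) →ₗ[k] (⨁ p, V p) →ₗ[k] ⨁ p, V p
  /-- the bracket -/
  bracket : (⨁ p, V p) →ₗ[k] (⨁ p, V p) →ₗ[k] ⨁ p, V p
  one_mem : one ∈ homog k V 0
  mul_mem : ∀ (p q : ℤ), ∀ α ∈ homog k V p, ∀ β ∈ homog k V q, mul α β ∈ homog k V (p + q)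
  bracket_mem : ∀ (p q : ℤ), ∀ α ∈ homog k V p, ∀ β ∈ homog k V q,
    bracket α β ∈ homog k V (p + q - 1)
  one_mul : ∀ α, mul one α = α
  mul_one : ∀ α, mul α one = α
  mul_assoc : ∀ α β γ, mul (mul α β) γ = mul α (mul β γ)
  mul_comm : ∀ (p q : ℤ), ∀ α ∈ homog k V p, ∀ β ∈ homog k V q,
    mul α β = sg (p * q) • mul β α
  antisymm : ∀ (p q : ℤ), ∀ α ∈ homog k V p, ∀ β ∈ homog k V q,
    bracket α β = -(sg ((p - 1) * (q - 1)) • bracket β α)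
  jacobi : ∀ (p q : ℤ), ∀ α ∈ homog k V p, ∀ β ∈ homog k V q, ∀ γ,
    bracket α (bracket β γ) =
      bracket (bracket α β) γ + sg ((p - 1) * (q - 1)) • bracket β (bracket α γ)
  leibniz : ∀ (p q : ℤ), ∀ γ ∈ homog k V p, ∀ α ∈ homog k V q, ∀ β,
    bracket γ (mul α β) = mul (bracket γ α) β + sg ((p - 1) * q) • mul α (bracket γ β)

variable {k V}

/-- A Gerstenhaber module structure on the graded `k`-module `W = ⨁_{n ∈ ℕ} W_n` over a
Gerstenhaber algebra `V`. -/
structure GerstenhaberModule (G : GerstenhaberAlgebra k V) where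
  /-- the module structure `α ⌢ x` -/
  cap : (⨁ p, V p) →ₗ[k] (⨁ n, W n) →ₗ[k] ⨁ n, W n
  /-- the Lie derivative `L_α(x)` -/
  lie : (⨁ p, V p) →ₗ[k] (⨁ n, W n) →ₗ[k] ⨁ n, W n
  cap_mem : ∀ (p n : ℤ), ∀ α ∈ homog k V p, ∀ x ∈ homog k W n, cap α x ∈ homog k W (n - p)
  lie_mem : ∀ (p n : ℤ), ∀ α ∈ homog k V p, ∀ x ∈ homog k W n, lie α x ∈ homog k W (n - (p - 1))
  one_cap : ∀ x, cap G.one x = x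
  mul_cap : ∀ α β x, cap (G.mul α β) x = cap α (cap β x)
  lie_bracket : ∀ (p q : ℤ), ∀ α ∈ homog k V p, ∀ β ∈ homog k V q, ∀ x,
    lie (G.bracket α β) x = lie α (lie β x) - sg ((p - 1) * (q - 1)) • lie β (lie α x)
  mixed : ∀ (p q : ℤ), ∀ α ∈ homog k V p, ∀ β ∈ homog k V q, ∀ x,
    cap β (lie α x) = cap (G.bracket β α) x + sg ((p - 1) * q) • lie α (cap β x)

/-- A Batalin-Vilkovisky module structure over a Gerstenhaber algebra: a Gerstenhaber module with
a differential `B` of degree `1` that satisfies the homotopy formula. -/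
structure BVModule (G : GerstenhaberAlgebra k V) extends GerstenhaberModule W G where
  /-- the differential -/
  B : (⨁ n, W n) →ₗ[k] ⨁ n, W n
  B_mem : ∀ n : ℤ, ∀ x ∈ homog k W n, B x ∈ homog k W (n + 1)
  B_B : ∀ x, B (B x) = 0
  homotopy : ∀ p : ℤ, ∀ α ∈ homog k V p, ∀ x,
    lie α x = B (cap α x) - sg p • cap α (B x)

end Calculus

end HopfCalculus

namespace HopfCalculus

section Sweedler

variable {k : Type v} {A U : Type u} [CommRing k] [Ring A] [Algebra k A] [Ring U] [Algebra k U]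

/-- A family of balanced bilinear maps depending linearly on a parameter, as a linear map. -/
def Bal.liftP {X Y Z P : Type*} {B : Type*}
    [AddCommGroup X] [Module k X] [AddCommGroup Y] [Module k Y] [AddCommGroup Z] [Module k Z]
    [AddCommGroup P] [Module k P] {ρ : B → X →ₗ[k] X} {l : B → Y →ₗ[k] Y}
    (f : P →ₗ[k] X →ₗ[k] Y →ₗ[k] Z) (hf : ∀ p a x y, f p (ρ a x) y = f p x (l a y)) :
    P →ₗ[k] Bal ρ l →ₗ[k] Z where
  toFun p := Bal.lift (f p) (hf p)
  map_add' p q := Bal.hom_ext fun x y => by simp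
  map_smul' c p := Bal.hom_ext fun x y => by simp

@[simp] theorem Bal.liftP_mk {X Y Z P : Type*} {B : Type*}
    [AddCommGroup X] [Module k X] [AddCommGroup Y] [Module k Y] [AddCommGroup Z] [Module k Z]
    [AddCommGroup P] [Module k P] {ρ : B → X →ₗ[k] X} {l : B → Y →ₗ[k] Y}
    (f : P →ₗ[k] X →ₗ[k] Y →ₗ[k] Z) (hf) (p : P) (x : X) (y : Y) :
    Bal.liftP (ρ := ρ) (l := l) f hf p (Bal.mk ρ l x y) = f p x y :=
  Bal.lift_mk (f p) (hf p) x y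

variable {η : A ⊗[k] Aᵐᵒᵖ →ₐ[k] U}

variable (η) in
/-- The elementary tensor in `U ⊗_A U`. -/
abbrev mkA : U →ₗ[k] U →ₗ[k] TensA η :=
  Bal.mk (fun a => LinearMap.mulLeft k (tgt η a)) (fun a => LinearMap.mulLeft k (src η a))

variable (η) in
/-- The elementary tensor in `U ⊗_{A^op} U`. -/
abbrev mkOp : U →ₗ[k] U →ₗ[k] TensOp η :=
  Bal.mk (fun a => LinearMap.mulRight k (tgt η a)) (fun a => LinearMap.mulLeft k (tgt η a))

theorem mkA_bal (a : A) (x y : U) : mkA η (tgt η a * x) y = mkA η x (src η a * y) :=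
  Bal.mk_bal (ρ := fun a => LinearMap.mulLeft k (tgt η a))
    (l := fun a => LinearMap.mulLeft k (src η a)) a x y

theorem mkOp_bal (a : A) (x y : U) : mkOp η (x * tgt η a) y = mkOp η x (tgt η a * y) :=
  Bal.mk_bal (ρ := fun a => LinearMap.mulRight k (tgt η a))
    (l := fun a => LinearMap.mulLeft k (tgt η a)) a x y

theorem TensA.hom_ext {Z : Type*} [AddCommGroup Z] [Module k Z] {f g : TensA η →ₗ[k] Z}
    (h : ∀ x y, f (mkA η x y) = g (mkA η x y)) : f = g := Bal.hom_ext h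

theorem TensOp.hom_ext {Z : Type*} [AddCommGroup Z] [Module k Z] {f g : TensOp η →ₗ[k] Z}
    (h : ∀ x y, f (mkOp η x y) = g (mkOp η x y)) : f = g := Bal.hom_ext h

/-- The linear map on `U ⊗_A U` induced by a balanced bilinear map. -/
def liftA {Z : Type*} [AddCommGroup Z] [Module k Z] (f : U →ₗ[k] U →ₗ[k] Z)
    (hf : ∀ a x y, f (tgt η a * x) y = f x (src η a * y)) : TensA η →ₗ[k] Z := Bal.lift f hf

@[simp] theorem liftA_mk {Z : Type*} [AddCommGroup Z] [Module k Z] (f : U →ₗ[k] U →ₗ[k] Z)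
    (hf) (x y : U) : liftA (η := η) f hf (mkA η x y) = f x y := Bal.lift_mk f hf x y

/-- The linear map on `U ⊗_{A^op} U` induced by a balanced bilinear map. -/
def liftOp {Z : Type*} [AddCommGroup Z] [Module k Z] (f : U →ₗ[k] U →ₗ[k] Z)
    (hf : ∀ a x y, f (x * tgt η a) y = f x (tgt η a * y)) : TensOp η →ₗ[k] Z := Bal.lift f hf

@[simp] theorem liftOp_mk {Z : Type*} [AddCommGroup Z] [Module k Z] (f : U →ₗ[k] U →ₗ[k] Z)
    (hf) (x y : U) : liftOp (η := η) f hf (mkOp η x y) = f x y := Bal.lift_mk f hf x y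

@[simp] theorem TensA.rmul_mk (a b x y : U) :
    TensA.rmul (η := η) a b (mkA η x y) = mkA η (x * a) (y * b) := by
  rw [← Bal.proj_tmul, TensA.rmul_proj, Algebra.TensorProduct.tmul_mul_tmul, Bal.proj_tmul]

@[simp] theorem TensA.lmul_mk (a b : A) (x y : U) :
    TensA.lmul (η := η) a b (mkA η x y) = mkA η (src η a * x) (tgt η b * y) := by
  rw [← Bal.proj_tmul, TensA.lmul_proj, Algebra.TensorProduct.tmul_mul_tmul, Bal.proj_tmul]

namespace LeftBialgebroid

variable (H : LeftBialgebroid k A U)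

/-- Coassociativity, evaluated on a trilinear map `F`. -/
theorem coassoc_lift {Z : Type*} [AddCommGroup Z] [Module k Z] (F : U →ₗ[k] U →ₗ[k] U →ₗ[k] Z)
    (a b : TensA H.η →ₗ[k] Z)
    (ha : ∀ y, ∃ c : TensA H.η →ₗ[k] Z, (∀ p q, c (mkA H.η p q) = F p q y) ∧
      ∀ x, a (mkA H.η x y) = c (H.comul x))
    (hb : ∀ x, ∃ c : TensA H.η →ₗ[k] Z, (∀ p q, c (mkA H.η p q) = F x p q) ∧
      ∀ y, b (mkA H.η x y) = c (H.comul y)) (u : U) :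
    a (H.comul u) = b (H.comul u) := by
  have h1 : ∀ e x y z, F (tgt H.η e * x) y z = F x (src H.η e * y) z := by
    intro e x y z
    obtain ⟨c, hc, -⟩ := ha z
    rw [← hc, ← hc, mkA_bal]
  have h2 : ∀ e x y z, F x (tgt H.η e * y) z = F x y (src H.η e * z) := by
    intro e x y z
    obtain ⟨c, hc, -⟩ := hb x
    rw [← hc, ← hc, mkA_bal]
  obtain ⟨z, hz⟩ := H.exists_rep u
  obtain ⟨y, hy⟩ := LinearMap.rTensor_surjective U (g := projA H.η) Bal.proj_surjective
    (H.comul.rTensor U z)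
  obtain ⟨y', hy'⟩ := LinearMap.lTensor_surjective U (g := projA H.η) Bal.proj_surjective
    (H.comul.lTensor U z)
  let Φ : U ⊗[k] (U ⊗[k] U) →ₗ[k] Z := TensorProduct.lift
    (TensorProduct.lift.equiv (RingHom.id k) U U Z ∘ₗ F)
  have hΦ : ∀ x y z, Φ (x ⊗ₜ (y ⊗ₜ z)) = F x y z := fun x y z => rfl
  have key : Φ (TensorProduct.assoc k U U U y) = Φ y' := by
    rw [← sub_eq_zero, ← map_sub, ← LinearMap.mem_ker]
    refine (Submodule.span_le (p := LinearMap.ker Φ)).2 ?_ (H.coassoc u z hz y hy y' hy')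
    rintro _ (⟨e, x, y, n, rfl⟩ | ⟨e, x, y, n, rfl⟩)
    · simp only [SetLike.mem_coe, LinearMap.mem_ker, map_sub, hΦ, h1, sub_self]
    · simp only [SetLike.mem_coe, LinearMap.mem_ker, map_sub, hΦ, LinearMap.mulLeft_apply, h2,
        sub_self]
  let C1 : U →ₗ[k] TensA H.η →ₗ[k] Z :=
    Bal.liftP (LinearMap.lflip.toLinearMap ∘ₗ F).flip (fun p e x y => by
      simpa using h1 e x y p)
  have hC1 : ∀ y x x', C1 y (mkA H.η x x') = F x x' y := fun y x x' => Bal.liftP_mk _ _ _ _ _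
  let C2 : U →ₗ[k] TensA H.η →ₗ[k] Z := Bal.liftP F (fun p e x y => h2 e p x y)
  have hC2 : ∀ y x x', C2 y (mkA H.η x x') = F y x x' := fun y x x' => Bal.liftP_mk _ _ _ _ _
  have e1 : Φ (TensorProduct.assoc k U U U y) =
      TensorProduct.lift C1.flip (H.comul.rTensor U z) := by
    rw [← hy]
    have : Φ ∘ₗ (TensorProduct.assoc k U U U).toLinearMap =
        TensorProduct.lift C1.flip ∘ₗ (projA H.η).rTensor U := by
      apply TensorProduct.ext_threefold
      intro x y z
      simpa [Bal.proj_tmul] using (hΦ x y z).trans (hC1 z x y).symm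
    exact LinearMap.congr_fun this y
  have e2 : Φ y' = TensorProduct.lift C2 (H.comul.lTensor U z) := by
    rw [← hy']
    have : Φ = TensorProduct.lift C2 ∘ₗ (projA H.η).lTensor U := by
      apply TensorProduct.ext'
      intro x w
      induction w with
      | zero => simp
      | add w w' h h' => simp only [TensorProduct.tmul_add, map_add, h, h']
      | tmul y z => simpa [Bal.proj_tmul] using (hΦ x y z).trans (hC2 x y z).symm
    exact LinearMap.congr_fun this y'
  have e3 : a ∘ₗ projA H.η = TensorProduct.lift C1.flip ∘ₗ H.comul.rTensor U := by
    apply TensorProduct.ext'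
    intro x y
    obtain ⟨c, hc, hc'⟩ := ha y
    have : c = C1 y := TensA.hom_ext fun p q => by rw [hc, hC1]
    simp only [LinearMap.comp_apply, Bal.proj_tmul, hc', this, LinearMap.rTensor_tmul,
      TensorProduct.lift.tmul, LinearMap.flip_apply]
  have e4 : b ∘ₗ projA H.η = TensorProduct.lift C2 ∘ₗ H.comul.lTensor U := by
    apply TensorProduct.ext'
    intro x y
    obtain ⟨c, hc, hc'⟩ := hb x
    have : c = C2 x := TensA.hom_ext fun p q => by rw [hc, hC2]
    simp only [LinearMap.comp_apply, Bal.proj_tmul, hc', this, LinearMap.lTensor_tmul,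
      TensorProduct.lift.tmul]
  rw [← hz]
  exact (LinearMap.congr_fun e3 z).trans (e1.symm.trans (key.trans
    (e2.trans (LinearMap.congr_fun e4 z).symm)))

theorem counit_left_lift (c : TensA H.η →ₗ[k] U)
    (hc : ∀ x y, c (mkA H.η x y) = src H.η (H.counit x) * y) (u : U) : c (H.comul u) = u := by
  obtain ⟨z, hz⟩ := H.exists_rep u
  have h : c ∘ₗ projA H.η = LinearMap.mul' k U ∘ₗ
      TensorProduct.map (src H.η ∘ₗ H.counit) LinearMap.id :=
    TensorProduct.ext' fun x y => by
      rw [LinearMap.comp_apply, Bal.proj_tmul, hc]; simp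
  rw [← hz]
  exact (LinearMap.congr_fun h z).trans (H.counit_left u z hz)

theorem counit_right_lift (c : TensA H.η →ₗ[k] U)
    (hc : ∀ x y, c (mkA H.η x y) = tgt H.η (H.counit y) * x) (u : U) : c (H.comul u) = u := by
  obtain ⟨z, hz⟩ := H.exists_rep u
  have h : c ∘ₗ projA H.η = LinearMap.mul' k U ∘ₗ
      TensorProduct.map (tgt H.η ∘ₗ H.counit) LinearMap.id ∘ₗ
        (TensorProduct.comm k U U).toLinearMap :=
    TensorProduct.ext' fun x y => by
      rw [LinearMap.comp_apply, Bal.proj_tmul, hc]; simp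
  rw [← hz]
  exact (LinearMap.congr_fun h z).trans (H.counit_right u z hz)

/-- Left multiplication by `Δ(p)` on `U ⊗_A U`. -/
def lmulComul (p : U) : TensA H.η →ₗ[k] TensA H.η :=
  liftA (LinearMap.mk₂ k (fun x y => TensA.rmul x y (H.comul p))
    (fun x x' y => by
      obtain ⟨z, hz⟩ := H.exists_rep p
      simp only [← hz, TensA.rmul_proj, TensorProduct.add_tmul, mul_add, map_add])
    (fun c x y => by
      obtain ⟨z, hz⟩ := H.exists_rep p
      simp only [← hz, TensA.rmul_proj, ← TensorProduct.smul_tmul', mul_smul_comm, map_smul])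
    (fun x y y' => by
      obtain ⟨z, hz⟩ := H.exists_rep p
      simp only [← hz, TensA.rmul_proj, TensorProduct.tmul_add, mul_add, map_add])
    (fun c x y => by
      obtain ⟨z, hz⟩ := H.exists_rep p
      simp only [← hz, TensA.rmul_proj, TensorProduct.tmul_smul, mul_smul_comm, map_smul]))
    (fun a x y => by
      have := congrArg (TensA.rmul x y) (H.comul_takeuchi a p)
      obtain ⟨z, hz⟩ := H.exists_rep p
      simp only [← hz, TensA.rmul_proj, mul_assoc, Algebra.TensorProduct.tmul_mul_tmul,
        one_mul, LinearMap.mk₂_apply] at this ⊢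
      exact this)

@[simp] theorem lmulComul_mk (p x y : U) :
    H.lmulComul p (mkA H.η x y) = TensA.rmul x y (H.comul p) := by
  rw [lmulComul, liftA_mk]; rfl

theorem lmulComul_proj (p : U) (z w : U ⊗[k] U) (hz : projA H.η z = H.comul p) :
    H.lmulComul p (projA H.η w) = projA H.η (z * w) := by
  induction w with
  | zero => simp
  | tmul x y => rw [Bal.proj_tmul, lmulComul_mk, ← hz, TensA.rmul_proj]
  | add x y hx hy => simp only [map_add, hx, hy, mul_add]

theorem comul_mul' (u v : U) : H.comul (u * v) = H.lmulComul u (H.comul v) := by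
  obtain ⟨z, hz⟩ := H.exists_rep u
  obtain ⟨w, hw⟩ := H.exists_rep v
  rw [H.comul_mul u v z w hz hw, ← hw, H.lmulComul_proj u z w hz]

theorem lmulComul_rmul (p a b : U) (z : TensA H.η) :
    H.lmulComul p (TensA.rmul a b z) = TensA.rmul a b (H.lmulComul p z) := by
  obtain ⟨w, hw⟩ := H.exists_rep p
  obtain ⟨z, rfl⟩ := Bal.proj_surjective z
  rw [TensA.rmul_proj, H.lmulComul_proj p w _ hw, H.lmulComul_proj p w _ hw, TensA.rmul_proj,
    mul_assoc]

theorem comul_src_mul (a : A) (u : U) : H.comul (src H.η a * u) = TensA.lmul a 1 (H.comul u) := by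
  obtain ⟨z, hz⟩ := H.exists_rep u
  have := H.comul_bimod a 1 u z hz
  rw [tgt_one, mul_one] at this
  rw [this, ← hz, TensA.lmul_proj, tgt_one]

theorem comul_one' : H.comul 1 = mkA H.η 1 1 := H.comul_one

theorem comul_src (a : A) : H.comul (src H.η a) = mkA H.η (src H.η a) 1 := by
  have := H.comul_src_mul a 1
  rw [mul_one, H.comul_one', TensA.lmul_mk, tgt_one, mul_one, mul_one] at this
  exact this

theorem counit_src_mul (a : A) (u : U) : H.counit (src H.η a * u) = a * H.counit u := by
  have := H.counit_bimod a 1 u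
  rwa [tgt_one, mul_one, mul_one] at this

theorem counit_src (a : A) : H.counit (src H.η a) = a := by
  have := H.counit_src_mul a 1
  rwa [mul_one, H.counit_one, mul_one] at this

theorem galois_mk' (u v : U) : H.galois (mkOp H.η u v) = TensA.rmul 1 v (H.comul u) :=
  H.galois_mk u v

end LeftBialgebroid

namespace LeftHopfAlgebroid

variable (H : LeftHopfAlgebroid k A U)

/-- The inverse of the Galois map. -/
noncomputable def galoisInv : TensA H.η →ₗ[k] TensOp H.η := H.galoisEquiv.symm.toLinearMap

theorem galois_inj {x y : TensOp H.η} (h : H.galois x = H.galois y) : x = y :=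
  H.galois_bijective.injective h

theorem galois_galoisInv (z : TensA H.η) : H.galois (H.galoisInv z) = z :=
  H.galoisEquiv.apply_symm_apply z

theorem galoisInv_galois (z : TensOp H.η) : H.galoisInv (H.galois z) = z :=
  H.galoisEquiv.symm_apply_apply z

theorem galois_transl' (u : U) : H.galois (H.transl u) = mkA H.η u 1 := H.galois_transl u

theorem galoisInv_mk (x y : U) :
    H.galoisInv (mkA H.η x y) = TensOp.rmulSnd H y (H.transl x) := by
  apply H.galois_inj
  rw [galois_galoisInv, galois_rmulSnd, galois_transl', TensA.rmul_mk, mul_one, one_mul]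

theorem galoisInv_comul (u : U) : H.galoisInv (H.comul u) = mkOp H.η u 1 := by
  apply H.galois_inj
  rw [galois_galoisInv, H.galois_mk']
  obtain ⟨z, hz⟩ := H.exists_rep u
  rw [← hz, TensA.rmul_proj, ← Algebra.TensorProduct.one_def, mul_one]

/-- The map `x ⊗ y ↦ p x ⊗ y q` on `U ⊗_{A^op} U`. -/
def opMul (p q : U) : TensOp H.η →ₗ[k] TensOp H.η :=
  TensOp.map (LinearMap.mulLeft k p) (LinearMap.mulRight k q)
    (fun _ _ => by simp [mul_assoc]) (fun _ _ => by simp [mul_assoc])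

@[simp] theorem opMul_mk (p q x y : U) :
    H.opMul p q (mkOp H.η x y) = mkOp H.η (p * x) (y * q) := rfl

theorem galois_opMul (p q : U) (w : TensOp H.η) :
    H.galois (H.opMul p q w) = H.lmulComul p (TensA.rmul 1 q (H.galois w)) := by
  have h : H.galois ∘ₗ H.opMul p q = H.lmulComul p ∘ₗ TensA.rmul 1 q ∘ₗ H.galois :=
    TensOp.hom_ext fun x y => by
      simp only [LinearMap.comp_apply, opMul_mk, H.galois_mk', TensA.rmul_rmul, one_mul,
        H.lmulComul_rmul, H.comul_mul']
  exact LinearMap.congr_fun h w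

/-- `(u v)₊ ⊗ (u v)₋ = u₊ v₊ ⊗ v₋ u₋` -/
theorem transl_mul (u v : U) (c : TensOp H.η →ₗ[k] TensOp H.η)
    (hc : ∀ p q, c (mkOp H.η p q) = H.opMul p q (H.transl v)) :
    H.transl (u * v) = c (H.transl u) := by
  apply H.galois_inj
  have h : H.galois ∘ₗ c = TensA.rmul v 1 ∘ₗ H.galois := TensOp.hom_ext fun p q => by
    rw [LinearMap.comp_apply, hc, galois_opMul, galois_transl', TensA.rmul_mk,
      LeftBialgebroid.lmulComul_mk, LinearMap.comp_apply, H.galois_mk', TensA.rmul_rmul]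
    simp
  have h2 := LinearMap.congr_fun h (H.transl u)
  rw [LinearMap.comp_apply, LinearMap.comp_apply, galois_transl', TensA.rmul_mk, one_mul] at h2
  rw [galois_transl', h2]

theorem transl_src_mul (a : A) (u : U) : H.transl (src H.η a * u) =
    H.opMul (src H.η a) 1 (H.transl u) := by
  apply H.galois_inj
  rw [galois_opMul, galois_transl', galois_transl', TensA.rmul_mk, LeftBialgebroid.lmulComul_mk,
    H.comul_src, TensA.rmul_mk]
  simp

theorem transl_one : H.transl 1 = mkOp H.η 1 1 := by
  apply H.galois_inj
  rw [galois_transl', H.galois_mk', H.comul_one', TensA.rmul_mk, mul_one]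

/-- `u₊ u₋ = s(ε(u))` -/
theorem transl_mul_lift (c : TensOp H.η →ₗ[k] U) (hc : ∀ x y, c (mkOp H.η x y) = x * y) (u : U) :
    c (H.transl u) = src H.η (H.counit u) := by
  let m : TensA H.η →ₗ[k] U := liftA (LinearMap.mul k U ∘ₗ src H.η ∘ₗ H.counit) (fun a x y => by
    simp [H.counit_tgt_mul, src_mul, mul_assoc])
  have hm : ∀ x y, m (mkA H.η x y) = src H.η (H.counit x) * y := fun x y => liftA_mk _ _ x y
  have h : m ∘ₗ H.galois = c := TensOp.hom_ext fun x y => by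
    rw [LinearMap.comp_apply, H.galois_mk', hc]
    have h2 : m ∘ₗ TensA.rmul 1 y = LinearMap.mulRight k y ∘ₗ m := TensA.hom_ext fun p q => by
      simp [hm, mul_assoc]
    refine (LinearMap.congr_fun h2 _).trans ?_
    rw [LinearMap.comp_apply, H.counit_left_lift m hm, LinearMap.mulRight_apply]
  rw [← h, LinearMap.comp_apply, galois_transl', hm, mul_one]

/-- `u₊ t(ε(u₋)) = u` -/
theorem transl_counit_lift (c : TensOp H.η →ₗ[k] U)
    (hc : ∀ x y, c (mkOp H.η x y) = x * tgt H.η (H.counit y)) (u : U) : c (H.transl u) = u := by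
  let m : TensA H.η →ₗ[k] U := liftA (LinearMap.mul k U ∘ₗ tgt H.η ∘ₗ H.counit).flip (fun a x y => by
    simp [H.counit_src_mul, tgt_mul, mul_assoc])
  have hm : ∀ x y, m (mkA H.η x y) = tgt H.η (H.counit y) * x := fun x y => liftA_mk _ _ x y
  have h : m ∘ₗ H.galois = c := TensOp.hom_ext fun x y => by
    rw [LinearMap.comp_apply, H.galois_mk', hc]
    have h2 : m ∘ₗ TensA.rmul 1 y = m ∘ₗ TensA.rmul 1 (tgt H.η (H.counit y)) :=
      TensA.hom_ext fun p q => by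
        simp [hm, H.counit_mul_tgt q y]
    refine (LinearMap.congr_fun h2 _).trans ?_
    rw [LinearMap.comp_apply, ← H.comul_mul_tgt, H.counit_right_lift m hm]
  rw [← h, LinearMap.comp_apply, galois_transl', hm, H.counit_one, tgt_one, one_mul]

theorem galoisInv_rmul_comul (w u : U) :
    H.galoisInv (TensA.rmul 1 w (H.comul u)) = mkOp H.η u w := by
  rw [← H.galois_mk', galoisInv_galois]

/-- `u₁ ⊗ u₂₊ ⊗ u₂₋ = u₊₁ ⊗ u₊₂ ⊗ u₋` -/
theorem comul_transl_lift {Z : Type*} [AddCommGroup Z] [Module k Z]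
    (F : U →ₗ[k] U →ₗ[k] U →ₗ[k] Z) (a : TensA H.η →ₗ[k] Z) (b : TensOp H.η →ₗ[k] Z)
    (ha : ∀ x, ∃ c : TensOp H.η →ₗ[k] Z, (∀ p q, c (mkOp H.η p q) = F x p q) ∧
      ∀ y, a (mkA H.η x y) = c (H.transl y))
    (hb : ∀ q, ∃ c : TensA H.η →ₗ[k] Z, (∀ x p, c (mkA H.η x p) = F x p q) ∧
      ∀ p, b (mkOp H.η p q) = c (H.comul p)) (u : U) :
    a (H.comul u) = b (H.transl u) := by
  have h1 : ∀ e x y z, F (tgt H.η e * x) y z = F x (src H.η e * y) z := by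
    intro e x y z
    obtain ⟨c, hc, -⟩ := hb z
    rw [← hc, ← hc, mkA_bal]
  have h2 : ∀ x e y z, F x (y * tgt H.η e) z = F x y (tgt H.η e * z) := by
    intro x e y z
    obtain ⟨c, hc, -⟩ := ha x
    rw [← hc, ← hc, mkOp_bal]
  let C : U →ₗ[k] TensOp H.η →ₗ[k] Z := Bal.liftP F h2
  have hC : ∀ x p q, C x (mkOp H.η p q) = F x p q := fun x p q => Bal.liftP_mk _ _ _ _ _
  have hC1 : ∀ e x w, C (tgt H.η e * x) w = C x (H.opMul (src H.η e) 1 w) := by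
    intro e x w
    have : C (tgt H.η e * x) = C x ∘ₗ H.opMul (src H.η e) 1 := TensOp.hom_ext fun p q => by
      rw [LinearMap.comp_apply, opMul_mk, hC, hC, h1, mul_one]
    exact LinearMap.congr_fun this w
  have hs : ∀ e y w, H.galoisInv (mkA H.η (src H.η e * y) w) =
      H.opMul (src H.η e) 1 (H.galoisInv (mkA H.η y w)) := by
    intro e y w
    rw [galoisInv_mk, galoisInv_mk, transl_src_mul]
    have : TensOp.rmulSnd H w ∘ₗ H.opMul (src H.η e) 1 =
        H.opMul (src H.η e) 1 ∘ₗ TensOp.rmulSnd H w := TensOp.hom_ext fun p q => by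
      rw [LinearMap.comp_apply, LinearMap.comp_apply, opMul_mk, TensOp.rmulSnd_mk,
        TensOp.rmulSnd_mk, opMul_mk, mul_one, mul_one]
    exact LinearMap.congr_fun this _
  let K : U →ₗ[k] TensA H.η →ₗ[k] Z := Bal.liftP
    (LinearMap.mk₂ k (fun b x => C x ∘ₗ H.galoisInv ∘ₗ (mkA H.η).flip b)
      (fun _ _ _ => by simp [LinearMap.comp_add]) (fun _ _ _ => by simp [LinearMap.comp_smul])
      (fun _ _ _ => by simp [LinearMap.add_comp]) (fun _ _ _ => by simp [LinearMap.smul_comp]))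
    (fun b e x y => by
      simp only [LinearMap.mk₂_apply, LinearMap.comp_apply, LinearMap.flip_apply,
        LinearMap.mulLeft_apply]
      rw [hC1, hs])
  have hK : ∀ b x y, K b (mkA H.η x y) = C x (H.galoisInv (mkA H.η y b)) :=
    fun b x y => Bal.liftP_mk _ _ _ _ _
  let J : TensA H.η →ₗ[k] Z := liftA (K.flip ∘ₗ H.comul) (fun e x y => by
    have : K y ∘ₗ TensA.lmul 1 e = K (src H.η e * y) := TensA.hom_ext fun p q => by
      rw [LinearMap.comp_apply, TensA.lmul_mk, hK, hK, mkA_bal, src_one, one_mul]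
    rw [LinearMap.comp_apply, LinearMap.flip_apply, H.comul_tgt_mul, LinearMap.comp_apply,
      LinearMap.flip_apply, ← this, LinearMap.comp_apply])
  have hJ : ∀ x y, J (mkA H.η x y) = K y (H.comul x) := fun x y => liftA_mk _ _ x y
  have e1 : J ∘ₗ H.galois = b := TensOp.hom_ext fun p q => by
    obtain ⟨c, hc, hc'⟩ := hb q
    rw [LinearMap.comp_apply, H.galois_mk', hc']
    refine H.coassoc_lift (LinearMap.mk₂ k
      (fun x y => C x ∘ₗ H.galoisInv ∘ₗ (mkA H.η y) ∘ₗ LinearMap.mulRight k q)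
      (fun _ _ _ => by simp [LinearMap.add_comp]) (fun _ _ _ => by simp [LinearMap.smul_comp])
      (fun _ _ _ => by simp [LinearMap.comp_add, LinearMap.add_comp])
      (fun _ _ _ => by simp [LinearMap.comp_smul, LinearMap.smul_comp]))
      (J ∘ₗ TensA.rmul 1 q) c (fun z => ⟨K (z * q), fun x y => hK _ _ _, fun x => ?_⟩)
      (fun x => ⟨C x ∘ₗ H.galoisInv ∘ₗ TensA.rmul 1 q, fun y z => ?_, fun y => ?_⟩) p
    · rw [LinearMap.comp_apply, TensA.rmul_mk, mul_one, hJ]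
    · rw [LinearMap.comp_apply, LinearMap.comp_apply, TensA.rmul_mk, mul_one]; rfl
    · rw [LinearMap.comp_apply, LinearMap.comp_apply, galoisInv_rmul_comul, hC, hc]
  have e2 : K 1 = a := TensA.hom_ext fun x y => by
    obtain ⟨c, hc, hc'⟩ := ha x
    have : c = C x := TensOp.hom_ext fun p q => by rw [hc, hC]
    rw [hK, hc', this, ← galois_transl', galoisInv_galois]
  rw [← e1, LinearMap.comp_apply, galois_transl', hJ, e2]

/-- `u₊₊ ⊗ u₋ ⊗ u₊₋ = u₊ ⊗ u₋₁ ⊗ u₋₂` -/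
theorem transl_comul_lift {Z : Type*} [AddCommGroup Z] [Module k Z]
    (F : U →ₗ[k] U →ₗ[k] U →ₗ[k] Z) (a b : TensOp H.η →ₗ[k] Z)
    (ha : ∀ y, ∃ c : TensOp H.η →ₗ[k] Z, (∀ x z, c (mkOp H.η x z) = F x y z) ∧
      ∀ p, a (mkOp H.η p y) = c (H.transl p))
    (hb : ∀ x, ∃ c : TensA H.η →ₗ[k] Z, (∀ y z, c (mkA H.η y z) = F x y z) ∧
      ∀ v, b (mkOp H.η x v) = c (H.comul v)) (u : U) :
    a (H.transl u) = b (H.transl u) := by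
  have h1 : ∀ e x y z, F (x * tgt H.η e) y z = F x y (tgt H.η e * z) := by
    intro e x y z
    obtain ⟨c, hc, -⟩ := ha y
    rw [← hc, ← hc, mkOp_bal]
  have h2 : ∀ x e y z, F x (tgt H.η e * y) z = F x y (src H.η e * z) := by
    intro x e y z
    obtain ⟨c, hc, -⟩ := hb x
    rw [← hc, ← hc, mkA_bal]
  obtain ⟨C, hC⟩ : ∃ C : U →ₗ[k] TensOp H.η →ₗ[k] Z, ∀ y x z, C y (mkOp H.η x z) = F x y z := ⟨Bal.liftP F.flip (fun p e x y => h1 e x p y), fun x p q => Bal.liftP_mk _ _ _ _ _⟩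
  obtain ⟨N, hN⟩ : ∃ N : U →ₗ[k] TensOp H.η →ₗ[k] Z, ∀ c p q, N c (mkOp H.η p q) = C q (H.galoisInv (mkA H.η p c)) := ⟨Bal.liftP
    (LinearMap.mk₂ k (fun c p => C.flip (H.galoisInv (mkA H.η p c)))
      (fun _ _ _ => by simp) (fun _ _ _ => by simp)
      (fun _ _ _ => by simp) (fun _ _ _ => by simp))
    (fun c e p q => by
      simp only [LinearMap.mk₂_apply, LinearMap.flip_apply, LinearMap.mulLeft_apply,
        LinearMap.mulRight_apply]
      have : C (tgt H.η e * q) ∘ₗ TensOp.rmulSnd H c =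
          C q ∘ₗ TensOp.rmulSnd H c ∘ₗ TensOp.lmulSnd H e := TensOp.hom_ext fun x z => by
        simp only [LinearMap.comp_apply, TensOp.rmulSnd_mk, TensOp.lmulSnd_mk, hC, h2, mul_assoc]
      rw [galoisInv_mk, galoisInv_mk, transl_mul_tgt]
      exact (LinearMap.congr_fun this _).symm), fun b x y => Bal.liftP_mk _ _ _ _ _⟩
  obtain ⟨Jx, hJx⟩ : ∃ Jx : U →ₗ[k] TensA H.η →ₗ[k] Z, ∀ x y z, Jx x (mkA H.η y z) = N z (H.galoisInv (mkA H.η x y)) := ⟨Bal.liftP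
    (LinearMap.mk₂ k (fun x y => N.flip (H.galoisInv (mkA H.η x y)))
      (fun _ _ _ => by simp) (fun _ _ _ => by simp)
      (fun _ _ _ => by simp) (fun _ _ _ => by simp))
    (fun x e y z => by
      simp only [LinearMap.mk₂_apply, LinearMap.flip_apply, LinearMap.mulLeft_apply]
      have h : N z ∘ₗ TensOp.rmulSnd H y ∘ₗ TensOp.lmulFst H e =
          N (src H.η e * z) ∘ₗ TensOp.rmulSnd H y := TensOp.hom_ext fun p q => by
        simp only [LinearMap.comp_apply, TensOp.rmulSnd_mk, TensOp.lmulFst_mk, hN, mkA_bal]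
      have h' : TensOp.rmulSnd H (tgt H.η e * y) =
          TensOp.rmulSnd H y ∘ₗ TensOp.rmulSnd H (tgt H.η e) := TensOp.hom_ext fun p q => by
        simp only [LinearMap.comp_apply, TensOp.rmulSnd_mk, mul_assoc]
      rw [galoisInv_mk, galoisInv_mk, h', LinearMap.comp_apply, ← transl_lmulFst]
      exact LinearMap.congr_fun h _), fun b x y => Bal.liftP_mk _ _ _ _ _⟩
  have hJl : ∀ e x, Jx (tgt H.η e * x) = Jx x ∘ₗ TensA.lmul e 1 := fun e x =>
    TensA.hom_ext fun y z => by
      rw [LinearMap.comp_apply, TensA.lmul_mk, hJx, hJx, mkA_bal, tgt_one, one_mul]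
  obtain ⟨J, hJ⟩ : ∃ J : TensA H.η →ₗ[k] Z, ∀ x y, J (mkA H.η x y) = Jx x (H.comul y) := ⟨liftA (LinearMap.lcomp k Z H.comul ∘ₗ Jx) (fun e x y => by
    simp only [LinearMap.comp_apply, LinearMap.lcomp_apply, hJl, H.comul_src_mul]), fun x y => liftA_mk _ _ x y⟩
  have e1 : J ∘ₗ H.galois = b := TensOp.hom_ext fun x v => by
    obtain ⟨c, hc, hc'⟩ := hb x
    rw [LinearMap.comp_apply, H.galois_mk', hc']
    obtain ⟨P, hP⟩ : ∃ P : U →ₗ[k] TensA H.η →ₗ[k] TensA H.η, ∀ p w, P p w = H.lmulComul p w :=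
      ⟨{ toFun := H.lmulComul
         map_add' := fun p p' => TensA.hom_ext fun x y => by simp
         map_smul' := fun r p => TensA.hom_ext fun x y => by simp }, fun _ _ => rfl⟩
    obtain ⟨Q, hQ⟩ : ∃ Q : TensA H.η →ₗ[k] TensA H.η →ₗ[k] Z, ∀ w x y, Q w (mkA H.η x y) = Jx x (H.lmulComul y w) := ⟨Bal.liftP
      (LinearMap.mk₂ k (fun w x => Jx x ∘ₗ P.flip w)
        (fun _ _ _ => by simp [LinearMap.comp_add]) (fun _ _ _ => by simp [LinearMap.comp_smul])
        (fun _ _ _ => by simp [LinearMap.add_comp]) (fun _ _ _ => by simp [LinearMap.smul_comp]))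
      (fun w e x y => by
        simp only [LinearMap.mk₂_apply, LinearMap.comp_apply, LinearMap.flip_apply,
          LinearMap.mulLeft_apply, hJl]
        have : TensA.lmul e 1 ∘ₗ P y = P (src H.η e * y) := TensA.hom_ext fun p q => by
          rw [LinearMap.comp_apply, hP, hP, LeftBialgebroid.lmulComul_mk, LeftBialgebroid.lmulComul_mk, H.comul_src_mul,
            TensA.rmul_lmul]
        rw [← this, LinearMap.comp_apply]), fun w x y => (Bal.liftP_mk _ _ _ _ _).trans (congrArg (Jx x) (hP _ _))⟩
    have hQ2 : Q.flip (H.comul x) = c := TensA.hom_ext fun y z => by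
      rw [hc, LinearMap.flip_apply]
      symm
      have e3 : (C y ∘ₗ H.galoisInv ∘ₗ TensA.rmul 1 z) (H.comul x) = F x y z := by
        rw [LinearMap.comp_apply, LinearMap.comp_apply, galoisInv_rmul_comul, hC]
      rw [← e3]
      refine H.coassoc_lift (((mkA H.η).compl₂ (LinearMap.mulRight k y)).compr₂
        (LinearMap.lcomp k Z (LinearMap.mulRight k z) ∘ₗ N.flip ∘ₗ H.galoisInv)) _ _
        (fun w => ⟨N (w * z) ∘ₗ H.galoisInv ∘ₗ TensA.rmul 1 y, fun p q => ?_, fun p => ?_⟩)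
        (fun p => ⟨Jx p ∘ₗ TensA.rmul y z, fun q w => ?_, fun q => ?_⟩) x
      · rw [LinearMap.comp_apply, LinearMap.comp_apply, TensA.rmul_mk, mul_one]; rfl
      · rw [LinearMap.comp_apply, LinearMap.comp_apply, LinearMap.comp_apply, LinearMap.comp_apply,
          galoisInv_rmul_comul, TensA.rmul_mk, mul_one, hN]
      · rw [LinearMap.comp_apply, TensA.rmul_mk, hJx]; rfl
      · rw [hQ, LeftBialgebroid.lmulComul_mk]; rfl
    rw [← hQ2, LinearMap.flip_apply]
    have : J ∘ₗ TensA.rmul 1 v = Q (H.comul v) := TensA.hom_ext fun p q => by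
      rw [LinearMap.comp_apply, TensA.rmul_mk, mul_one, hJ, hQ, H.comul_mul']
    exact LinearMap.congr_fun this _
  have e2 : N 1 = a := TensOp.hom_ext fun p q => by
    obtain ⟨c, hc, hc'⟩ := ha q
    have : c = C q := TensOp.hom_ext fun p r => by rw [hc, hC]
    rw [hN, hc', this, ← galois_transl', galoisInv_galois]
  rw [← e1, LinearMap.comp_apply, galois_transl', hJ, H.comul_one', hJx, ← galois_transl',
    galoisInv_galois, e2]

end LeftHopfAlgebroid
end Sweedler
end HopfCalculus

namespace HopfCalculus

section TensLemmas

variable {k : Type v} {A U : Type u} [CommRing k] [Ring A] [Algebra k A] [Ring U] [Algebra k U]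

section Basic

variable (η : A ⊗[k] Aᵐᵒᵖ →ₐ[k] U)

/-- The elementary tensors in `X ⊗_{A^op} U`. -/
def tmk (X : ActMod k A) : X →ₗ[k] U →ₗ[k] tens η X := TensU.mk η X

/-- Right multiplication on `X ⊗_{A^op} U`. -/
def trm (X : ActMod k A) : U →ₗ[k] tens η X →ₗ[k] tens η X := TensU.rmul η X

/-- Left multiplication `x ⊗ u ↦ x ⊗ s(a) u`. -/
def tsr (X : ActMod k A) (a : A) : tens η X →ₗ[k] tens η X := TensU.lmulSrc η X a

/-- `f ⊗ id` on `X ⊗_{A^op} U`. -/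
def tmap {X Y : ActMod k A} (f : ActHom X Y) : tens η X →ₗ[k] tens η Y := tensMapLin η f

variable {η}

theorem tens_hom_ext {X : ActMod k A} {Z : Type*} [AddCommGroup Z] [Module k Z]
    {f g : tens η X →ₗ[k] Z} (h : ∀ x u, f (tmk η X x u) = g (tmk η X x u)) : f = g :=
  Bal.hom_ext h

theorem tmk_bal (X : ActMod k A) (a : A) (x : X) (u : U) :
    tmk η X (X.act a x) u = tmk η X x (tgt η a * u) := TensU.mk_bal η X a x u

@[simp] theorem trm_mk (X : ActMod k A) (w : U) (x : X) (u : U) :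
    trm η X w (tmk η X x u) = tmk η X x (u * w) := TensU.rmul_mk η X w x u

@[simp] theorem tsr_mk (X : ActMod k A) (a : A) (x : X) (u : U) :
    tsr η X a (tmk η X x u) = tmk η X x (src η a * u) := TensU.lmulSrc_mk η X a x u

@[simp] theorem tmap_mk {X Y : ActMod k A} (f : ActHom X Y) (x : X) (u : U) :
    tmap η f (tmk η X x u) = tmk η Y (f.lin x) u := tensMapLin_mk η f x u

theorem tens_act (X : ActMod k A) (a : A) (x : tens η X) :
    (tens η X).act a x = trm η X (tgt η a) x := rfl

theorem trm_trm (X : ActMod k A) (v w : U) (z : tens η X) :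
    trm η X w (trm η X v z) = trm η X (v * w) z := by
  have h : trm η X w ∘ₗ trm η X v = trm η X (v * w) :=
    tens_hom_ext fun x u => by simp [mul_assoc]
  exact LinearMap.congr_fun h z

theorem trm_one (X : ActMod k A) (z : tens η X) : trm η X 1 z = z := by
  have h : trm η X 1 = LinearMap.id := tens_hom_ext fun x u => by simp
  exact LinearMap.congr_fun h z

theorem tmap_trm {X Y : ActMod k A} (f : ActHom X Y) (w : U) (z : tens η X) :
    tmap η f (trm η X w z) = trm η Y w (tmap η f z) := by
  have h : tmap η f ∘ₗ trm η X w = trm η Y w ∘ₗ tmap η f := tens_hom_ext fun x u => by simp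
  exact LinearMap.congr_fun h z

/-- The linear maps out of `X ⊗_{A^op} U`. -/
def tlift {X : ActMod k A} {Z : Type*} [AddCommGroup Z] [Module k Z] (f : X →ₗ[k] U →ₗ[k] Z)
    (h : ∀ a x u, f (X.act a x) u = f x (tgt η a * u)) : tens η X →ₗ[k] Z := Bal.lift f h

@[simp] theorem tlift_mk {X : ActMod k A} {Z : Type*} [AddCommGroup Z] [Module k Z]
    (f : X →ₗ[k] U →ₗ[k] Z) (h) (x : X) (u : U) : tlift (η := η) f h (tmk η X x u) = f x u :=
  Bal.lift_mk f h x u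

end Basic

variable (H : LeftHopfAlgebroid k A U)

/-- The map `x ↦ (p ⊗ q ↦ (x p, q))` from `X = Y ⊗_{A^op} U` to the linear maps from
`U ⊗_{A^op} U` to `X ⊗_{A^op} U`. -/
def insMul (Y : ActMod k A) :
    tens H.η Y →ₗ[k] TensOp H.η →ₗ[k] tens H.η (tens H.η Y) :=
  Bal.liftP ((LinearMap.compRight k (tmk H.η (tens H.η Y))) ∘ₗ (trm H.η Y).flip)
    (fun x a p q => by
      refine Eq.trans ?_ (tmk_bal (tens H.η Y) a (trm H.η Y p x) q)
      rw [tens_act, trm_trm]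
      rfl)

@[simp] theorem insMul_mk (Y : ActMod k A) (x : tens H.η Y) (p q : U) :
    insMul H Y x (mkOp H.η p q) = tmk H.η (tens H.η Y) (trm H.η Y p x) q :=
  Bal.liftP_mk _ _ _ _ _

/-- The map `y ↦ (p ⊗ q ↦ ((y, p), q))`. -/
noncomputable def insT (Y : ActMod k A) : Y →ₗ[k] TensOp H.η →ₗ[k] tens H.η (tens H.η Y) :=
  insTransl H Y

@[simp] theorem insT_mk (Y : ActMod k A) (y : Y) (p q : U) :
    insT H Y y (mkOp H.η p q) = tmk H.η (tens H.η Y) (tmk H.η Y y p) q := rfl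

theorem trm_insMul (Y : ActMod k A) (x : tens H.η Y) (w : U) (z : TensOp H.η) :
    trm H.η (tens H.η Y) w (insMul H Y x z) = insMul H Y x (TensOp.rmulSnd H w z) := by
  have h : trm H.η (tens H.η Y) w ∘ₗ insMul H Y x = insMul H Y x ∘ₗ TensOp.rmulSnd H w :=
    TensOp.hom_ext fun p q => by
      rw [LinearMap.comp_apply, LinearMap.comp_apply, TensOp.rmulSnd_mk, insMul_mk, insMul_mk,
        trm_mk]
  exact LinearMap.congr_fun h z

theorem trm_insT (Y : ActMod k A) (y : Y) (w : U) (z : TensOp H.η) :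
    trm H.η (tens H.η Y) w (insT H Y y z) = insT H Y y (TensOp.rmulSnd H w z) :=
  (insTransl_rmulSnd H Y y w z).symm

theorem insMul_trm_tgt (Y : ActMod k A) (a : A) (x : tens H.η Y) (z : TensOp H.η) :
    insMul H Y (trm H.η Y (tgt H.η a) x) z = insMul H Y x (TensOp.lmulFst H a z) := by
  have h : insMul H Y (trm H.η Y (tgt H.η a) x) = insMul H Y x ∘ₗ TensOp.lmulFst H a :=
    TensOp.hom_ext fun p q => by
      rw [LinearMap.comp_apply, TensOp.lmulFst_mk, insMul_mk, insMul_mk, trm_trm]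
  exact LinearMap.congr_fun h z

/-- The map `((y, v), z) ↦ ((y, v u₊), u₋ z)`. -/
noncomputable def mulSpread (Y : ActMod k A) :
    U →ₗ[k] tens H.η (tens H.η Y) →ₗ[k] tens H.η (tens H.η Y) :=
  Bal.liftP ((LinearMap.compRight k (trm H.η (tens H.η Y)).flip) ∘ₗ
      ((insMul H Y).flip ∘ₗ H.transl))
    (fun u a x z => by
      change trm H.η (tens H.η Y) z (insMul H Y (trm H.η Y (tgt H.η a) x) (H.transl u)) =
        trm H.η (tens H.η Y) (tgt H.η a * z) (insMul H Y x (H.transl u))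
      rw [insMul_trm_tgt, transl_lmulFst, ← trm_insMul, trm_trm])

@[simp] theorem mulSpread_mk (Y : ActMod k A) (u : U) (x : tens H.η Y) (z : U) :
    mulSpread H Y u (tmk H.η (tens H.η Y) x z) =
      trm H.η (tens H.η Y) z (insMul H Y x (H.transl u)) :=
  Bal.liftP_mk _ _ _ _ _

/-- The map `((y, w), u) ↦ ((y, u₊), u₋ w)`. -/
noncomputable def tspread (Y : ActMod k A) :
    tens H.η Y →ₗ[k] U →ₗ[k] tens H.η (tens H.η Y) := spread H Y

@[simp] theorem tspread_mk (Y : ActMod k A) (y : Y) (w u : U) :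
    tspread H Y (tmk H.η Y y w) u = trm H.η (tens H.η Y) w (insT H Y y (H.transl u)) := rfl

theorem tspread_trm (Y : ActMod k A) (w : U) (z : tens H.η Y) (u : U) :
    tspread H Y (trm H.η Y w z) u = trm H.η (tens H.η Y) w (tspread H Y z u) := by
  have h : (tspread H Y).flip u ∘ₗ trm H.η Y w =
      trm H.η (tens H.η Y) w ∘ₗ (tspread H Y).flip u := tens_hom_ext fun y v => by
    simp [trm_trm]
  exact LinearMap.congr_fun h z

/-- The map `(p, q) ↦ (x ⊗ y ↦ p x ⊗ y q)`, with `x ⊗ y = u₊ ⊗ u₋`, on `U ⊗_{A^op} U`. -/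
theorem exists_opMul_transl (u : U) : ∃ c : TensOp H.η →ₗ[k] TensOp H.η,
    ∀ p q, c (mkOp H.η p q) = H.opMul p q (H.transl u) :=
  ⟨liftOp (LinearMap.mk₂ k (fun p q => H.opMul p q (H.transl u))
    (fun p p' q => by
      have : H.opMul (p + p') q = H.opMul p q + H.opMul p' q :=
        TensOp.hom_ext fun _ _ => by simp [add_mul]
      rw [this, LinearMap.add_apply])
    (fun r p q => by
      have : H.opMul (r • p) q = r • H.opMul p q := TensOp.hom_ext fun _ _ => by simp
      rw [this, LinearMap.smul_apply])
    (fun p q q' => by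
      have : H.opMul p (q + q') = H.opMul p q + H.opMul p q' :=
        TensOp.hom_ext fun _ _ => by simp [mul_add]
      rw [this, LinearMap.add_apply])
    (fun r p q => by
      have : H.opMul p (r • q) = r • H.opMul p q := TensOp.hom_ext fun _ _ => by simp
      rw [this, LinearMap.smul_apply]))
    (fun a p q => by
      have h1 : H.opMul (p * tgt H.η a) q = H.opMul p q ∘ₗ TensOp.lmulFst H a :=
        TensOp.hom_ext fun _ _ => by
          rw [LinearMap.comp_apply, TensOp.lmulFst_mk, H.opMul_mk, H.opMul_mk, mul_assoc]
      have h2 : H.opMul p (tgt H.η a * q) = H.opMul p q ∘ₗ TensOp.rmulSnd H (tgt H.η a) :=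
        TensOp.hom_ext fun _ _ => by
          rw [LinearMap.comp_apply, TensOp.rmulSnd_mk, H.opMul_mk, H.opMul_mk, mul_assoc]
      rw [LinearMap.mk₂_apply, LinearMap.mk₂_apply, h1, h2, LinearMap.comp_apply,
        LinearMap.comp_apply, transl_lmulFst]),
    fun p q => liftOp_mk _ _ _ _⟩

theorem insMul_tmk (Y : ActMod k A) (y : Y) (p q : U) (z : TensOp H.η) :
    trm H.η (tens H.η Y) q (insMul H Y (tmk H.η Y y p) z) = insT H Y y (H.opMul p q z) := by
  have h : trm H.η (tens H.η Y) q ∘ₗ insMul H Y (tmk H.η Y y p) =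
      insT H Y y ∘ₗ H.opMul p q := TensOp.hom_ext fun p' q' => by
    rw [LinearMap.comp_apply, LinearMap.comp_apply, insMul_mk, H.opMul_mk, insT_mk, trm_mk, trm_mk]
  exact LinearMap.congr_fun h z

theorem tspread_mul (Y : ActMod k A) (z : tens H.η Y) (v u : U) :
    tspread H Y z (v * u) = mulSpread H Y u (tspread H Y z v) := by
  have h : (tspread H Y).flip (v * u) = mulSpread H Y u ∘ₗ (tspread H Y).flip v :=
    tens_hom_ext fun y w => by
      rw [LinearMap.comp_apply, LinearMap.flip_apply, LinearMap.flip_apply, tspread_mk, tspread_mk]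
      obtain ⟨c, hc⟩ := exists_opMul_transl H u
      rw [H.transl_mul v u c hc]
      have : trm H.η (tens H.η Y) w ∘ₗ insT H Y y ∘ₗ c =
          mulSpread H Y u ∘ₗ trm H.η (tens H.η Y) w ∘ₗ insT H Y y :=
        TensOp.hom_ext fun p q => by
          rw [LinearMap.comp_apply, LinearMap.comp_apply, LinearMap.comp_apply,
            LinearMap.comp_apply, hc, insT_mk, trm_mk, mulSpread_mk, ← insMul_tmk, trm_trm]
      exact LinearMap.congr_fun this (H.transl v)
  exact LinearMap.congr_fun h z

theorem tmap_insT {Y Y' : ActMod k A} (f : ActHom Y Y') (y : Y) (z : TensOp H.η) :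
    tmap H.η (tensMap H.η f) (insT H Y y z) = insT H Y' (f.lin y) z := by
  have h : tmap H.η (tensMap H.η f) ∘ₗ insT H Y y = insT H Y' (f.lin y) :=
    TensOp.hom_ext fun p q => by
      rw [LinearMap.comp_apply, insT_mk, insT_mk, tmap_mk]
      exact congrArg (fun w => tmk H.η (tens H.η Y') w q) (tmap_mk f y p)
  exact LinearMap.congr_fun h z

theorem tmap_tspread {Y Y' : ActMod k A} (f : ActHom Y Y') (z : tens H.η Y) (u : U) :
    tmap H.η (tensMap H.η f) (tspread H Y z u) = tspread H Y' (tmap H.η f z) u := by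
  have h : tmap H.η (tensMap H.η f) ∘ₗ (tspread H Y).flip u =
      (tspread H Y').flip u ∘ₗ tmap H.η f := tens_hom_ext fun y v => by
    rw [LinearMap.comp_apply, LinearMap.comp_apply, LinearMap.flip_apply, LinearMap.flip_apply,
      tmap_mk, tspread_mk, tspread_mk, tmap_trm, tmap_insT]
  exact LinearMap.congr_fun h z

/-- The map `(x, u, v) ↦ (x, u v)`. -/
def tmul (X : ActMod k A) : tens H.η (tens H.η X) →ₗ[k] tens H.η X := (faceMul H.η X).lin

@[simp] theorem tmul_mk (X : ActMod k A) (x : tens H.η X) (v : U) :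
    tmul H X (tmk H.η (tens H.η X) x v) = trm H.η X v x := rfl

theorem tmul_trm (X : ActMod k A) (w : U) (z : tens H.η (tens H.η X)) :
    tmul H X (trm H.η (tens H.η X) w z) = trm H.η X w (tmul H X z) := by
  have h : tmul H X ∘ₗ trm H.η (tens H.η X) w = trm H.η X w ∘ₗ tmul H X :=
    tens_hom_ext fun x v => by simp [trm_trm]
  exact LinearMap.congr_fun h z

/-- `u₊ u₋ = s(ε(u))`, in the last argument of a chain. -/
theorem tmul_tspread (Y : ActMod k A) (z : tens H.η Y) (u : U) :
    tmul H Y (tspread H Y z u) = tsr H.η Y (H.counit u) z := by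
  have h : tmul H Y ∘ₗ (tspread H Y).flip u = tsr H.η Y (H.counit u) :=
    tens_hom_ext fun y w => by
      obtain ⟨c, hc⟩ : ∃ c : TensOp H.η →ₗ[k] U, ∀ x y, c (mkOp H.η x y) = x * y :=
        ⟨liftOp (LinearMap.mul k U) (fun a x y => by simp [mul_assoc]), fun x y => liftOp_mk _ _ x y⟩
      have : tmul H Y ∘ₗ insT H Y y = tmk H.η Y y ∘ₗ c := TensOp.hom_ext fun p q => by
        rw [LinearMap.comp_apply, insT_mk, tmul_mk, trm_mk, LinearMap.comp_apply, hc]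
      rw [LinearMap.comp_apply, LinearMap.flip_apply, tspread_mk, tmul_trm,
        ← LinearMap.comp_apply (tmul H Y), this, LinearMap.comp_apply, H.transl_mul_lift c hc,
        trm_mk, tsr_mk]
  exact LinearMap.congr_fun h z

/-- The map `(x, u) ↦ ε(u) ▸ x`, for a left `A`-module `X`. -/
noncomputable def tcounit (X : ActMod k A)
    (hX : ∀ a b x, X.act (a * b) x = X.act a (X.act b x)) : tens H.η X →ₗ[k] X :=
  tlift (X.act ∘ₗ H.counit).flip (fun a x u => by
    change X.act (H.counit u) (X.act a x) = X.act (H.counit (tgt H.η a * u)) x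
    rw [H.counit_tgt_mul, hX])

@[simp] theorem tcounit_mk (X : ActMod k A) (hX) (x : X) (u : U) :
    tcounit H X hX (tmk H.η X x u) = X.act (H.counit u) x := tlift_mk _ _ _ _

theorem tens_act_act (X : ActMod k A) (a b : A) (x : tens H.η X) :
    (tens H.η X).act (a * b) x = (tens H.η X).act a ((tens H.η X).act b x) := by
  rw [tens_act, tens_act, tens_act, trm_trm, tgt_mul]

theorem tcounit_trm (X : ActMod k A) (hX') (w : U) (z : tens H.η (tens H.η X)) :
    tcounit H (tens H.η X) hX' (trm H.η (tens H.η X) w z) =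
      tcounit H (tens H.η X) hX' (trm H.η (tens H.η X) (tgt H.η (H.counit w)) z) := by
  have h : tcounit H (tens H.η X) hX' ∘ₗ trm H.η (tens H.η X) w =
      tcounit H (tens H.η X) hX' ∘ₗ trm H.η (tens H.η X) (tgt H.η (H.counit w)) :=
    tens_hom_ext fun x u => by simp [← H.counit_mul_tgt]
  exact LinearMap.congr_fun h z

/-- `u₊ t(ε(u₋)) = u`, in the last argument of a chain. -/
theorem tcounit_tspread (Y : ActMod k A) (hY hY') (z : tens H.η Y) (u : U) :
    tcounit H (tens H.η Y) hY' (tspread H Y z u) = tmk H.η Y (tcounit H Y hY z) u := by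
  have h : tcounit H (tens H.η Y) hY' ∘ₗ (tspread H Y).flip u =
      (tmk H.η Y).flip u ∘ₗ tcounit H Y hY := tens_hom_ext fun y w => by
    obtain ⟨c, hc⟩ : ∃ c : TensOp H.η →ₗ[k] U,
        ∀ x y, c (mkOp H.η x y) = x * tgt H.η (H.counit y) :=
      ⟨liftOp ((LinearMap.mul k U).compl₂ (tgt H.η ∘ₗ H.counit)) (fun a x y => by
        simp [H.counit_tgt_mul, tgt_mul, mul_assoc]), fun x y => liftOp_mk _ _ x y⟩
    have : tcounit H (tens H.η Y) hY' ∘ₗ insT H Y y = tmk H.η Y y ∘ₗ c :=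
      TensOp.hom_ext fun p q => by
        rw [LinearMap.comp_apply, insT_mk, tcounit_mk, tens_act, trm_mk, LinearMap.comp_apply, hc]
    rw [LinearMap.comp_apply, LinearMap.flip_apply, tspread_mk, tcounit_trm H Y, trm_insT,
      ← transl_lmulFst, ← LinearMap.comp_apply (tcounit _ _ _), this, LinearMap.comp_apply]
    have h2 : c ∘ₗ TensOp.lmulFst H (H.counit w) =
        LinearMap.mulLeft k (tgt H.η (H.counit w)) ∘ₗ c := TensOp.hom_ext fun p q => by
      rw [LinearMap.comp_apply, TensOp.lmulFst_mk, LinearMap.comp_apply, hc, hc, mul_assoc]; rfl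
    rw [← LinearMap.comp_apply c, h2, LinearMap.comp_apply, H.transl_counit_lift c hc,
      LinearMap.comp_apply, LinearMap.flip_apply, tcounit_mk, tmk_bal]
    rfl
  exact LinearMap.congr_fun h z

theorem tspread_src (Y : ActMod k A) (z : tens H.η Y) (b : A) :
    tspread H Y z (src H.η b) = tmap H.η
      ⟨(tmk H.η Y).flip (src H.η b), fun a y => by
        rw [LinearMap.flip_apply, LinearMap.flip_apply, tmk_bal, tens_act, trm_mk,
          src_tgt_comm]⟩ z := by
  have hs : H.transl (src H.η b) = mkOp H.η (src H.η b) 1 := by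
    have := H.transl_src_mul b 1
    rwa [mul_one, H.transl_one, H.opMul_mk, mul_one, mul_one] at this
  have h : (tspread H Y).flip (src H.η b) = tmap H.η
      ⟨(tmk H.η Y).flip (src H.η b), fun a y => by
        rw [LinearMap.flip_apply, LinearMap.flip_apply, tmk_bal, tens_act, trm_mk,
          src_tgt_comm]⟩ := tens_hom_ext fun y w => by
    rw [LinearMap.flip_apply, tspread_mk, hs, insT_mk, trm_mk, tmap_mk, one_mul]
    rfl
  exact LinearMap.congr_fun h z

theorem tspread_mul_tgt (Y : ActMod k A) (a : A) (z : tens H.η Y) (u : U) :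
    tspread H Y z (u * tgt H.η a) = tsr H.η (tens H.η Y) a (tspread H Y z u) :=
  spread_mul_tgt H Y a z u

theorem tspread_tsr (Y : ActMod k A) (a : A) (z : tens H.η Y) (u : U) :
    tspread H Y (tsr H.η Y a z) u = tspread H Y z (tgt H.η a * u) := spread_lmulSrc H Y a z u

/-- The map `(y, v) ↦ (y, u₊, u₋ v)`, as an `A`-linear map. -/
noncomputable def spreadHom (Y : ActMod k A) (u : U) :
    ActHom (tens H.η Y) (tens H.η (tens H.η Y)) where
  lin := (tspread H Y).flip u
  comm _ x := tspread_trm H Y _ x u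

theorem tmap_spreadHom_insT (Y : ActMod k A) (u : U) (y : Y) (z : TensOp H.η) :
    tmap H.η (spreadHom H Y u) (insT H Y y z) = insMul H (tens H.η Y) (insT H Y y (H.transl u)) z := by
  have h : tmap H.η (spreadHom H Y u) ∘ₗ insT H Y y =
      insMul H (tens H.η Y) (insT H Y y (H.transl u)) := TensOp.hom_ext fun p q => by
    rw [LinearMap.comp_apply, insT_mk, tmap_mk, insMul_mk]
    rfl
  exact LinearMap.congr_fun h z

/-- Two successive spreadings. -/
theorem tspread_tspread (Y : ActMod k A) (W : tens H.η Y) (w u : U)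
    (c : TensOp H.η →ₗ[k] tens H.η (tens H.η (tens H.η Y)))
    (hc : ∀ p q, c (mkOp H.η p q) = tspread H (tens H.η Y) (tspread H Y W p) (q * w)) :
    c (H.transl u) = tmap H.η (spreadHom H Y u) (tspread H Y W w) := by
  obtain ⟨D, hD⟩ : ∃ D : tens H.η Y →ₗ[k] TensOp H.η →ₗ[k] tens H.η (tens H.η (tens H.η Y)),
      ∀ W p q, D W (mkOp H.η p q) = tspread H (tens H.η Y) (tspread H Y W p) (q * w) :=
    ⟨Bal.liftP ((LinearMap.compRight k
        ((tspread H (tens H.η Y)).compl₂ (LinearMap.mulRight k w))) ∘ₗ tspread H Y)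
      (fun W a p q => by
        change tspread H (tens H.η Y) (tspread H Y W (p * tgt H.η a)) (q * w) =
          tspread H (tens H.η Y) (tspread H Y W p) (tgt H.η a * q * w)
        rw [tspread_mul_tgt, tspread_tsr, mul_assoc]), fun W p q => Bal.liftP_mk _ _ _ _ _⟩
  have hcD : c = D W := TensOp.hom_ext fun p q => by rw [hc, hD]
  rw [hcD]
  have h : D.flip (H.transl u) = tmap H.η (spreadHom H Y u) ∘ₗ (tspread H Y).flip w :=
    tens_hom_ext fun y v => by
      rw [LinearMap.flip_apply, LinearMap.comp_apply, LinearMap.flip_apply, tspread_mk, tmap_trm,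
        tmap_spreadHom_insT]
      obtain ⟨e, he⟩ := exists_opMul_transl H w
      have hez : ∀ z x, TensOp.rmulSnd H z (e x) = e (TensOp.rmulSnd H z x) := by
        intro z x
        have : TensOp.rmulSnd H z ∘ₗ e = e ∘ₗ TensOp.rmulSnd H z := TensOp.hom_ext fun p q => by
          rw [LinearMap.comp_apply, LinearMap.comp_apply, TensOp.rmulSnd_mk, he, he]
          have : TensOp.rmulSnd H z ∘ₗ H.opMul p q = H.opMul p (q * z) :=
            TensOp.hom_ext fun p q => by
              rw [LinearMap.comp_apply, H.opMul_mk, H.opMul_mk, TensOp.rmulSnd_mk, mul_assoc]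
          exact LinearMap.congr_fun this _
        exact LinearMap.congr_fun this x
      obtain ⟨G, hG⟩ : ∃ G : U →ₗ[k] TensA H.η →ₗ[k] tens H.η (tens H.η (tens H.η Y)),
          ∀ x z, G x z = trm H.η (tens H.η (tens H.η Y)) v
            (insT H (tens H.η Y) (tmk H.η Y y x) (e (H.galoisInv z))) :=
        ⟨((insT H (tens H.η Y) ∘ₗ tmk H.η Y y).compr₂
          (trm H.η (tens H.η (tens H.η Y)) v)).compl₂ (e ∘ₗ H.galoisInv), fun _ _ => rfl⟩
      refine (H.transl_comul_lift
        { toFun := fun x => (mkA H.η).compr₂ (G x)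
          map_add' := fun x x' => LinearMap.ext₂ fun p q => by
            simp only [map_add, LinearMap.compr₂_apply, LinearMap.add_apply]
          map_smul' := fun r x => LinearMap.ext₂ fun p q => by
            simp only [map_smul, LinearMap.compr₂_apply, LinearMap.smul_apply, RingHom.id_apply] }
        (D (tmk H.η Y y v)) (trm H.η (tens H.η (tens H.η Y)) v ∘ₗ
          (insMul H (tens H.η Y)).flip (H.transl w) ∘ₗ insT H Y y)
        (fun q => ⟨(tspread H (tens H.η Y)).flip (q * w) ∘ₗ trm H.η (tens H.η Y) v ∘ₗ insT H Y y,
          fun x z => ?_, fun p => ?_⟩) (fun x => ⟨G x, fun p q => rfl, fun q => ?_⟩) u).trans rfl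
      · change tspread H (tens H.η Y) (trm H.η (tens H.η Y) v (tmk H.η (tens H.η Y) (tmk H.η Y y x) z))
          (q * w) = G x (mkA H.η q z)
        rw [trm_mk, tspread_mk, hG, H.galoisInv_mk, ← hez, ← trm_insT, trm_trm, H.transl_mul q w e he]
      · rw [hD]
        rfl
      · rw [hG, H.galoisInv_comul, he, ← insMul_tmk, trm_one]
        rfl
  exact LinearMap.congr_fun h W

theorem insMul_opMul (Y : ActMod k A) (x : tens H.η Y) (p : U) (z : TensOp H.η) :
    insMul H Y x (H.opMul p 1 z) = insMul H Y (trm H.η Y p x) z := by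
  have h : insMul H Y x ∘ₗ H.opMul p 1 = insMul H Y (trm H.η Y p x) :=
    TensOp.hom_ext fun p' q' => by
      rw [LinearMap.comp_apply, H.opMul_mk, insMul_mk, insMul_mk, trm_trm, mul_one]
  exact LinearMap.congr_fun h z

/-- Compatibility of the spreading with a family of maps that is evaluated on a coproduct. -/
theorem tmap_tspread_comul {Y Y' : ActMod k A} (g : U →ₗ[k] Y →ₗ[k] tens H.η Y')
    (hg : ∀ x a y, g x (Y.act a y) = (tens H.η Y').act a (g x y))
    (hg' : ∀ a x y, g (tgt H.η a * x) y = trm H.η Y' (src H.η a) (g x y))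
    (G : ActHom (tens H.η Y) (tens H.η Y'))
    (hG : ∀ y, ∃ c : TensA H.η →ₗ[k] tens H.η Y', (∀ p q, c (mkA H.η p q) =
      trm H.η Y' q (g p y)) ∧ ∀ u, G.lin (tmk H.η Y y u) = c (H.comul u))
    (X : tens H.η Y) (u : U) (c : TensA H.η →ₗ[k] tens H.η (tens H.η Y'))
    (hc : ∀ p q, c (mkA H.η p q) = mulSpread H Y' q (tmap H.η ⟨g p, hg p⟩ X)) :
    c (H.comul u) = tmap H.η G (tspread H Y X u) := by
  obtain ⟨f, hf⟩ : ∃ f : U →ₗ[k] tens H.η Y →ₗ[k] tens H.η (tens H.η Y'),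
      ∀ p, f p = tmap H.η ⟨g p, hg p⟩ := ⟨tensFam H.η g hg, fun _ => rfl⟩
  have hfm : ∀ p y z, f p (tmk H.η Y y z) = tmk H.η (tens H.η Y') (g p y) z := fun p y z => by
    rw [hf, tmap_mk]
  obtain ⟨D, hD⟩ : ∃ D : tens H.η Y →ₗ[k] TensA H.η →ₗ[k] tens H.η (tens H.η Y'),
      ∀ X p q, D X (mkA H.η p q) = mulSpread H Y' q (f p X) :=
    ⟨Bal.liftP (LinearMap.compRight k (mulSpread H Y').flip ∘ₗ f.flip) (fun X a p q => by
      change mulSpread H Y' q (f (tgt H.η a * p) X) = mulSpread H Y' (src H.η a * q) (f p X)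
      have h : mulSpread H Y' q ∘ₗ f (tgt H.η a * p) = mulSpread H Y' (src H.η a * q) ∘ₗ f p :=
        tens_hom_ext fun y z => by
          rw [LinearMap.comp_apply, LinearMap.comp_apply, hfm, hfm, mulSpread_mk, mulSpread_mk, hg',
            H.transl_src_mul, insMul_opMul]
      exact LinearMap.congr_fun h X), fun X p q => Bal.liftP_mk _ _ _ _ _⟩
  have hcD : c = D X := TensA.hom_ext fun p q => by rw [hc, hD, hf]
  rw [hcD]
  have h : D.flip (H.comul u) = tmap H.η G ∘ₗ (tspread H Y).flip u := tens_hom_ext fun y z => by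
    rw [LinearMap.flip_apply, LinearMap.comp_apply, LinearMap.flip_apply, tspread_mk, tmap_trm]
    obtain ⟨I, hI⟩ : ∃ I : U →ₗ[k] TensOp H.η →ₗ[k] tens H.η (tens H.η Y'),
        ∀ p w, I p w = trm H.η (tens H.η Y') z (insMul H Y' (g p y) w) :=
      ⟨(insMul H Y' ∘ₗ g.flip y).compr₂ (trm H.η (tens H.η Y') z), fun _ _ => rfl⟩
    refine (H.comul_transl_lift
      { toFun := fun x => (mkOp H.η).compr₂ (I x)
        map_add' := fun x x' => LinearMap.ext₂ fun p q => by
          simp only [map_add, LinearMap.compr₂_apply, LinearMap.add_apply]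
        map_smul' := fun r x => LinearMap.ext₂ fun p q => by
          simp only [map_smul, LinearMap.compr₂_apply, LinearMap.smul_apply, RingHom.id_apply] }
      (D (tmk H.η Y y z)) (trm H.η (tens H.η Y') z ∘ₗ tmap H.η G ∘ₗ insT H Y y)
      (fun x => ⟨I x, fun p q => rfl, fun q => ?_⟩)
      (fun q => ?_) u).trans rfl
    · rw [hD, hfm, mulSpread_mk, hI]
    · obtain ⟨c, hc, hc'⟩ := hG y
      refine ⟨trm H.η (tens H.η Y') z ∘ₗ (tmk H.η (tens H.η Y')).flip q ∘ₗ c, fun x p => ?_,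
        fun p => ?_⟩
      · rw [LinearMap.comp_apply, LinearMap.comp_apply, hc]
        change _ = I x (mkOp H.η p q)
        rw [hI, insMul_mk]
        rfl
      · rw [LinearMap.comp_apply, LinearMap.comp_apply, insT_mk, tmap_mk, hc']
        rfl
  exact LinearMap.congr_fun h X

end TensLemmas
end HopfCalculus

namespace HopfCalculus

section ChainLemmas

variable {k : Type v} {A U M : Type u} [CommRing k] [Ring A] [Algebra k A] [Ring U] [Algebra k U]
  [AddCommGroup M] [Module k M] [Module Uᵐᵒᵖ M] [IsScalarTower k Uᵐᵒᵖ M]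

section Bialg

variable (H : LeftBialgebroid k A U)

variable (M) in
/-- The elementary tensors `(x, u)` in `C_{n+1}(U, M)`. -/
def csnoc (n : ℕ) : Ch M H.η n →ₗ[k] U →ₗ[k] Ch M H.η (n + 1) := Chain.snoc H.η (baseM M H.η) n

variable (M) in
/-- Right multiplication in the last tensor factor of a chain. -/
def crm (n : ℕ) : U →ₗ[k] Ch M H.η (n + 1) →ₗ[k] Ch M H.η (n + 1) := trm H.η (Ch M H.η n)

theorem Ch.hom_ext {n : ℕ} {Z : Type*} [AddCommGroup Z] [Module k Z]
    {f g : Ch M H.η (n + 1) →ₗ[k] Z}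
    (h : ∀ x u, f (csnoc M H n x u) = g (csnoc M H n x u)) : f = g := Chain.hom_ext h

theorem crm_csnoc (n : ℕ) (w : U) (x : Ch M H.η n) (u : U) :
    crm M H n w (csnoc M H n x u) = csnoc M H n x (u * w) := trm_mk (Ch M H.η n) w x u

theorem act_csnoc (n : ℕ) (a : A) (x : Ch M H.η n) (u : U) :
    (Ch M H.η (n + 1)).act a (csnoc M H n x u) = csnoc M H n x (u * tgt H.η a) :=
  Chain.act_snoc a x u

theorem insPair_snoc (q a : ℕ) (E : Coch H.η (baseU H.η) (q + 1)) (x : Ch M H.η (a + q)) (u : U) :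
    insPair M H (q + 1) a E (csnoc M H (a + q) x u) = insPair M H q a (Coch.app E u) x :=
  pair_snoc (snocPair (M := M) H a) _ q E x u

/-- Right multiplication of the values of a cochain is right multiplication in the chain. -/
theorem insPair_rmulU (q a : ℕ) (w : U) (E : Coch H.η (baseU H.η) q) (x : Ch M H.η (a + q)) :
    insPair M H q a (rmulU H.η q w E) x = crm M H a w (insPair M H q a E x) := by
  induction q with
  | zero => exact (crm_csnoc H a w x E).symm
  | succ q ih =>
    have h : insPair M H (q + 1) a (rmulU H.η (q + 1) w E) =
        crm M H a w ∘ₗ insPair M H (q + 1) a E :=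
      Ch.hom_ext H (n := a + q) fun x u =>
        (insPair_snoc H q a _ x u).trans ((ih (Coch.app E u) x).trans
          (congrArg (crm M H a w) (insPair_snoc H q a E x u)).symm)
    exact LinearMap.congr_fun h x

theorem app_opD (q : ℕ) (φ : Cochain H (q + 1)) (u : U) :
    Coch.app (opD H (q + 1) φ) u = opDStep H (opD H q) (opD_act H q) φ (H.comul u) := rfl

theorem opDStep_mkA {q : ℕ} (φ : Cochain H (q + 1)) (x y : U) :
    opDStep H (opD H q) (opD_act H q) φ (mkA H.η x y) = rmulU H.η q y (opD H q (Coch.app φ x)) :=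
  opDStep_mk H _ _ φ x y

theorem insPair_opDStep_mkA {q : ℕ} (a : ℕ) (φ : Cochain H (q + 1)) (x y : U)
    (z : Ch M H.η (a + q)) : insPair M H q a (opDStep H (opD H q) (opD_act H q) φ (mkA H.η x y)) z =
      crm M H a y (insPair M H q a (opD H q (Coch.app φ x)) z) := by
  rw [opDStep_mkA, insPair_rmulU]

theorem opIns_zero (p a : ℕ) (φ : Cochain H p) :
    opIns M H p a 0 φ = insPair M H p a (opD H p φ) := rfl

theorem opIns_act (p a r : ℕ) (φ : Cochain H p) (c : A) (x : Ch M H.η (a + p + r)) :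
    opIns M H p a r φ ((Ch M H.η (a + p + r)).act c x) =
      (Ch M H.η (a + 1 + r)).act c (opIns M H p a r φ x) :=
  (opInsAux M H p a r).2 φ c x

theorem face0_csnoc (n : ℕ) (x : Ch M H.η n) (u : U) :
    face0 M H n (csnoc M H n x u) = (Ch M H.η n).act (H.counit u) x := Chain.lift_snoc _ _ _ _

theorem capChain_csnoc (p a : ℕ) (φ : Cochain H (p + 1)) (x : Ch M H.η (a + p)) (u : U) :
    capChain M H (p + 1) a φ (csnoc M H (a + p) x u) = capChain M H p a (Coch.app φ u) x :=
  pair_snoc (actPair (M := M) H a) _ p φ x u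

end Bialg

/-- Coassociativity of a comodule, evaluated on a trilinear map `F`. -/
theorem ModuleComodule.coassoc_lift {H : LeftBialgebroid k A U} (C : ModuleComodule H M)
    {Z : Type*} [AddCommGroup Z] [Module k Z] (F : U →ₗ[k] U →ₗ[k] M →ₗ[k] Z)
    (a b : TensAM H.η M →ₗ[k] Z)
    (ha : ∀ m, ∃ c : TensA H.η →ₗ[k] Z, (∀ p q, c (mkA H.η p q) = F p q m) ∧
      ∀ x, a (projAM H.η M (x ⊗ₜ m)) = c (H.comul x))
    (hb : ∀ x, ∃ c : TensAM H.η M →ₗ[k] Z, (∀ p m, c (projAM H.η M (p ⊗ₜ m)) = F x p m) ∧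
      ∀ m, b (projAM H.η M (x ⊗ₜ m)) = c (C.coact m)) (m : M) :
    a (C.coact m) = b (C.coact m) := by
  have h1 : ∀ e x y z, F (tgt H.η e * x) y z = F x (src H.η e * y) z := by
    intro e x y z
    obtain ⟨c, hc, -⟩ := ha z
    rw [← hc, ← hc, mkA_bal]
  have h2 : ∀ e x y z, F x (tgt H.η e * y) z = F x y (ract k U M (tgt H.η e) z) := by
    intro e x y z
    obtain ⟨c, hc, -⟩ := hb x
    rw [← hc, ← hc]
    exact congrArg c (Bal.mk_bal (ρ := fun a => LinearMap.mulLeft k (tgt H.η a))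
      (l := fun a => ract k U M (tgt H.η a)) e y z)
  obtain ⟨z, hz⟩ : ∃ z, projAM H.η M z = C.coact m := Bal.proj_surjective _
  obtain ⟨y, hy⟩ := LinearMap.rTensor_surjective M (g := projA H.η) Bal.proj_surjective
    (H.comul.rTensor M z)
  obtain ⟨y', hy'⟩ := LinearMap.lTensor_surjective U (g := projAM H.η M) Bal.proj_surjective
    (C.coact.lTensor U z)
  obtain ⟨Φ, hΦ⟩ : ∃ Φ : U ⊗[k] (U ⊗[k] M) →ₗ[k] Z, ∀ x y z, Φ (x ⊗ₜ (y ⊗ₜ z)) = F x y z :=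
    ⟨TensorProduct.lift (TensorProduct.lift.equiv (RingHom.id k) U M Z ∘ₗ F), fun x y z => rfl⟩
  have key : Φ (TensorProduct.assoc k U U M y) = Φ y' := by
    rw [← sub_eq_zero, ← map_sub, ← LinearMap.mem_ker]
    refine (Submodule.span_le (p := LinearMap.ker Φ)).2 ?_ (C.coassoc m z hz y hy y' hy')
    rintro _ (⟨e, x, y, n, rfl⟩ | ⟨e, x, y, n, rfl⟩)
    · simp only [SetLike.mem_coe, LinearMap.mem_ker, map_sub, hΦ, h1, sub_self]
    · simp only [SetLike.mem_coe, LinearMap.mem_ker, map_sub, hΦ, h2, sub_self]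
  obtain ⟨C1, hC1⟩ : ∃ C1 : M →ₗ[k] TensA H.η →ₗ[k] Z, ∀ y x x', C1 y (mkA H.η x x') = F x x' y :=
    ⟨Bal.liftP (LinearMap.lflip.toLinearMap ∘ₗ F).flip (fun p e x y => by
      simpa using h1 e x y p), fun y x x' => Bal.liftP_mk _ _ _ _ _⟩
  obtain ⟨C2, hC2⟩ : ∃ C2 : U →ₗ[k] TensAM H.η M →ₗ[k] Z,
      ∀ y x x', C2 y (projAM H.η M (x ⊗ₜ x')) = F y x x' :=
    ⟨Bal.liftP F (fun p e x y => h2 e p x y), fun y x x' => Bal.liftP_mk _ _ _ _ _⟩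
  have e1 : Φ (TensorProduct.assoc k U U M y) =
      TensorProduct.lift C1.flip (H.comul.rTensor M z) := by
    rw [← hy]
    have : Φ ∘ₗ (TensorProduct.assoc k U U M).toLinearMap =
        TensorProduct.lift C1.flip ∘ₗ (projA H.η).rTensor M := by
      apply TensorProduct.ext_threefold
      intro x y z
      simpa [Bal.proj_tmul] using (hΦ x y z).trans (hC1 z x y).symm
    exact LinearMap.congr_fun this y
  have e2 : Φ y' = TensorProduct.lift C2 (C.coact.lTensor U z) := by
    rw [← hy']
    have : Φ = TensorProduct.lift C2 ∘ₗ (projAM H.η M).lTensor U := by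
      apply TensorProduct.ext'
      intro x w
      induction w with
      | zero => simp
      | add w w' h h' => simp only [TensorProduct.tmul_add, map_add, h, h']
      | tmul y z =>
        rw [hΦ, LinearMap.comp_apply, LinearMap.lTensor_tmul, TensorProduct.lift.tmul, hC2]
    exact LinearMap.congr_fun this y'
  have e3 : a ∘ₗ projAM H.η M = TensorProduct.lift C1.flip ∘ₗ H.comul.rTensor M := by
    apply TensorProduct.ext'
    intro x y
    obtain ⟨c, hc, hc'⟩ := ha y
    have : c = C1 y := TensA.hom_ext fun p q => by rw [hc, hC1]
    rw [LinearMap.comp_apply, hc', this, LinearMap.comp_apply, LinearMap.rTensor_tmul,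
      TensorProduct.lift.tmul, LinearMap.flip_apply]
  have e4 : b ∘ₗ projAM H.η M = TensorProduct.lift C2 ∘ₗ C.coact.lTensor U := by
    apply TensorProduct.ext'
    intro x y
    obtain ⟨c, hc, hc'⟩ := hb x
    have : c = C2 x := Bal.hom_ext fun p q => (hc p q).trans (hC2 x p q).symm
    rw [LinearMap.comp_apply, hc', this, LinearMap.comp_apply, LinearMap.lTensor_tmul,
      TensorProduct.lift.tmul]
  rw [← hz]
  exact (LinearMap.congr_fun e3 z).trans (e1.symm.trans (key.trans
    (e2.trans (LinearMap.congr_fun e4 z).symm)))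

section Hopf

variable (H : LeftHopfAlgebroid k A U) (C : ModuleComodule H.toLeftBialgebroid M)

theorem cycExt_act (n : ℕ) (a : A) (x : Ch M H.η n) :
    cycExt H C n ((Ch M H.η n).act a x) = tsr H.η (Ch M H.η n) a (cycExt H C n x) :=
  (cycExtAux H C n).2 a x

theorem cycExt_crm (n : ℕ) (w : U) (x : Ch M H.η (n + 1)) :
    cycExt H C (n + 1) (crm M H.toLeftBialgebroid n w x) =
      mulSpread H (Ch M H.η n) w (cycExt H C (n + 1) x) := by
  have h : cycExt H C (n + 1) ∘ₗ crm M H.toLeftBialgebroid n w =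
      mulSpread H (Ch M H.η n) w ∘ₗ cycExt H C (n + 1) :=
    Ch.hom_ext H.toLeftBialgebroid fun y v => by
      refine (congrArg (cycExt H C (n + 1)) (crm_csnoc H.toLeftBialgebroid n w y v)).trans ?_
      exact tspread_mul H (Ch M H.η n) (cycExt H C n y) v w
  exact LinearMap.congr_fun h x

theorem cycExt_opIns_zero (p : ℕ) : ∀ (a : ℕ) (φ : Cochain H.toLeftBialgebroid p)
    (x : Ch M H.η (a + p)), cycExt H C (a + 1) (opIns M H.toLeftBialgebroid p a 0 φ x) =
      opIns M H.toLeftBialgebroid p a 1 φ (cycExt H C (a + p) x) := by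
  induction p with
  | zero =>
    intro a b x
    exact tspread_src H (Ch M H.η a) (cycExt H C a x) b
  | succ p ih =>
    intro a φ x
    have key := fun X u c hc => tmap_tspread_comul H (Y := Ch M H.η (a + p)) (Y' := Ch M H.η a)
      (insPair M H.toLeftBialgebroid p a ∘ₗ opD H.toLeftBialgebroid p ∘ₗ Coch.app φ)
      (fun x e y => opIns_act H.toLeftBialgebroid p a 0 (Coch.app φ x) e y)
      (fun e x y => by
        change insPair M H.toLeftBialgebroid p a (opD H.toLeftBialgebroid p
          (Coch.app φ (tgt H.η e * x))) y = _
        rw [Coch.app_tgt, opD_act, insPair_rmulU]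
        rfl)
      ⟨opIns M H.toLeftBialgebroid (p + 1) a 0 φ, opIns_act H.toLeftBialgebroid (p + 1) a 0 φ⟩
      (fun y => ⟨(insPair M H.toLeftBialgebroid p a).flip y ∘ₗ
            opDStep H.toLeftBialgebroid (opD H.toLeftBialgebroid p)
              (opD_act H.toLeftBialgebroid p) φ, fun x1 y1 =>
          insPair_opDStep_mkA H.toLeftBialgebroid a φ x1 y1 y, fun u => insPair_snoc H.toLeftBialgebroid p a _ y u⟩) X u c hc
    have h : cycExt H C (a + 1) ∘ₗ opIns M H.toLeftBialgebroid (p + 1) a 0 φ =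
        opIns M H.toLeftBialgebroid (p + 1) a 1 φ ∘ₗ cycExt H C (a + p + 1) :=
      Ch.hom_ext H.toLeftBialgebroid (n := a + p) fun x u => by
        refine Eq.trans ?_ (key (cycExt H C (a + p) x) u
          (cycExt H C (a + 1) ∘ₗ (insPair M H.toLeftBialgebroid p a).flip x ∘ₗ
            opDStep H.toLeftBialgebroid (opD H.toLeftBialgebroid p)
              (opD_act H.toLeftBialgebroid p) φ) fun x1 y1 => ?_)
        · exact congrArg (cycExt H C (a + 1)) (insPair_snoc H.toLeftBialgebroid p a _ x u)
        · refine (congrArg (cycExt H C (a + 1))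
            (insPair_opDStep_mkA H.toLeftBialgebroid a φ x1 y1 x)).trans ?_
          refine (cycExt_crm H C a y1 _).trans ?_
          exact congrArg (mulSpread H (Ch M H.η a) y1) (ih a (Coch.app φ x1) x)
    exact LinearMap.congr_fun h x

theorem cycExt_opIns (p a r : ℕ) (φ : Cochain H.toLeftBialgebroid p)
    (x : Ch M H.η (a + p + r)) :
    cycExt H C (a + 1 + r) (opIns M H.toLeftBialgebroid p a r φ x) =
      opIns M H.toLeftBialgebroid p a (r + 1) φ (cycExt H C (a + p + r) x) := by
  induction r with
  | zero => exact cycExt_opIns_zero H C p a φ x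
  | succ r ih =>
    have h : cycExt H C (a + 1 + r + 1) ∘ₗ opIns M H.toLeftBialgebroid p a (r + 1) φ =
        opIns M H.toLeftBialgebroid p a (r + 2) φ ∘ₗ cycExt H C (a + p + r + 1) :=
      Ch.hom_ext H.toLeftBialgebroid fun x u => by
        refine (congrArg (fun Z => tspread H (Ch M H.η (a + 1 + r)) Z u) (ih x)).trans ?_
        exact (tmap_tspread H (⟨opIns M H.toLeftBialgebroid p a r φ,
          opIns_act H.toLeftBialgebroid p a r φ⟩ :
          ActHom (Ch M H.η (a + p + r)) (Ch M H.η (a + 1 + r))) (cycExt H C (a + p + r) x) u).symm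
    exact LinearMap.congr_fun h x

theorem cycExt_face0 (n : ℕ) (x : Ch M H.η (n + 1)) :
    cycExt H C n (face0 M H.toLeftBialgebroid n x) =
      tmul H (Ch M H.η n) (cycExt H C (n + 1) x) := by
  have h : cycExt H C n ∘ₗ face0 M H.toLeftBialgebroid n =
      tmul H (Ch M H.η n) ∘ₗ cycExt H C (n + 1) :=
    Ch.hom_ext H.toLeftBialgebroid fun x u => by
      refine (congrArg (cycExt H C n) (face0_csnoc H.toLeftBialgebroid n x u)).trans ?_
      refine (cycExt_act H C n _ x).trans ?_
      exact (tmul_tspread H (Ch M H.η n) (cycExt H C n x) u).symm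
  exact LinearMap.congr_fun h x

theorem face0_cycExt (n : ℕ) (x : Ch M H.η n) :
    face0 M H.toLeftBialgebroid n (cycExt H C n x) = x := by
  induction n with
  | zero =>
    obtain ⟨z, hz⟩ : ∃ z, projAM H.η M z = C.coact x := Bal.proj_surjective _
    have h : face0 M H.toLeftBialgebroid 0 ∘ₗ flipAM M H ∘ₗ projAM H.η M =
        TensorProduct.lift (ract k U M ∘ₗ tgt H.η ∘ₗ H.counit) :=
      TensorProduct.ext' fun u m => rfl
    have h2 := LinearMap.congr_fun h z
    rw [LinearMap.comp_apply, LinearMap.comp_apply, hz] at h2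
    exact h2.trans (C.counit x z hz)
  | succ n ih =>
    have h : face0 M H.toLeftBialgebroid (n + 1) ∘ₗ cycExt H C (n + 1) = LinearMap.id :=
      Ch.hom_ext H.toLeftBialgebroid fun x u => by
        refine (tcounit_tspread H (Ch M H.η n) (fun a b x => Ch.act_act H.η a b x)
          (tens_act_act H (Ch M H.η n)) (cycExt H C n x) u).trans ?_
        exact congrArg (fun w => csnoc M H.toLeftBialgebroid n w u) (ih x)
    exact LinearMap.congr_fun h x

theorem cycExt_cycExt_zero (m : Ch M H.η 0) : cycExt H C 1 (cycExt H C 0 m) =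
    csnoc M H.toLeftBialgebroid 1 (cycExt H C 0 m) 1 := by
  obtain ⟨G, hG⟩ : ∃ G : M →ₗ[k] TensA H.η →ₗ[k] tens H.η (tens H.η (baseM M H.η)),
      ∀ m z, G m z = insT H (baseM M H.η) m (H.galoisInv z) :=
    ⟨(insT H (baseM M H.η) : M →ₗ[k] _ →ₗ[k] _).compl₂ H.galoisInv, fun _ _ => rfl⟩
  refine (C.coassoc_lift
    { toFun := fun x => LinearMap.compl₂ G.flip LinearMap.id ∘ₗ mkA H.η x
      map_add' := fun x x' => LinearMap.ext₂ fun p q => by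
        simp only [map_add, LinearMap.comp_apply, LinearMap.add_apply]
      map_smul' := fun r x => LinearMap.ext₂ fun p q => by
        simp only [map_smul, LinearMap.comp_apply, LinearMap.smul_apply, RingHom.id_apply] }
    ((csnoc M H.toLeftBialgebroid 1).flip 1 ∘ₗ flipAM M H) (cycExt H C 1 ∘ₗ flipAM M H)
    (fun m => ⟨G m, fun p q => rfl, fun x => ?_⟩)
    (fun x => ⟨(tspread H (baseM M H.η)).flip x ∘ₗ flipAM M H, fun p m => ?_, fun m => rfl⟩)
    m).symm
  · rw [hG, H.galoisInv_comul]
    rfl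
  · change trm H.η (tens H.η (baseM M H.η)) p (insT H (baseM M H.η) m (H.transl x)) =
      G m (mkA H.η x p)
    rw [hG, H.galoisInv_mk]
    exact trm_insT H (baseM M H.η) m p (H.transl x)

theorem cycExt_cycExt (n : ℕ) (x : Ch M H.η n) : cycExt H C (n + 1) (cycExt H C n x) =
    csnoc M H.toLeftBialgebroid (n + 1) (cycExt H C n x) 1 := by
  induction n with
  | zero => exact cycExt_cycExt_zero H C x
  | succ n ih =>
    have key : ∀ (u : U) (z : tens H.η (Ch M H.η n)),
        cycExt H C (n + 2) (tspread H (Ch M H.η n) z u) =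
          tmap H.η (spreadHom H (Ch M H.η n) u) (cycExt H C (n + 1) z) := by
      intro u z
      have h : cycExt H C (n + 2) ∘ₗ (tspread H (Ch M H.η n)).flip u =
          tmap H.η (spreadHom H (Ch M H.η n) u) ∘ₗ cycExt H C (n + 1) :=
        tens_hom_ext fun y w => by
          refine Eq.trans ?_ (tspread_tspread H (Ch M H.η n) (cycExt H C n y) w u
            (cycExt H C (n + 2) ∘ₗ trm H.η (tens H.η (Ch M H.η n)) w ∘ₗ
              insT H (Ch M H.η n) y) (fun p q => ?_))
          · rfl
          · exact congrArg (cycExt H C (n + 2)) (trm_mk (tens H.η (Ch M H.η n)) w _ q)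
      exact LinearMap.congr_fun h z
    have h : cycExt H C (n + 2) ∘ₗ cycExt H C (n + 1) =
        (csnoc M H.toLeftBialgebroid (n + 2)).flip 1 ∘ₗ cycExt H C (n + 1) :=
      Ch.hom_ext H.toLeftBialgebroid fun x u => by
        refine (key u (cycExt H C n x)).trans ?_
        refine (congrArg (tmap H.η (spreadHom H (Ch M H.η n) u)) (ih x)).trans ?_
        exact tmap_mk (spreadHom H (Ch M H.η n) u) (cycExt H C n x) (1 : U)
    exact LinearMap.congr_fun h x

end Hopf

end ChainLemmas
end HopfCalculus

namespace HopfCalculus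

section Total

variable {k : Type v} {A U M : Type u} [CommRing k] [Ring A] [Algebra k A] [Ring U] [Algebra k U]
  [AddCommGroup M] [Module k M] [Module Uᵐᵒᵖ M] [IsScalarTower k Uᵐᵒᵖ M]
variable (H : LeftBialgebroid k A U)

variable (M) in
/-- The total space of the chains `C_n(U, M)`, `n ∈ ℕ`. -/
abbrev TX : Type u := ⨁ n, (Ch M H.η n : Type u)

variable (M) in
/-- The inclusion of the chains of degree `n` into the total space. -/
noncomputable def ofX (n : ℕ) : Ch M H.η n →ₗ[k] TX M H :=
  DirectSum.lof k ℕ (fun n => (Ch M H.η n : Type u)) n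

variable {H}

theorem TX.hom_ext {Z : Type*} [AddCommGroup Z] [Module k Z] {f g : TX M H →ₗ[k] Z}
    (h : ∀ n x, f (ofX M H n x) = g (ofX M H n x)) : f = g :=
  DirectSum.linearMap_ext k fun n => LinearMap.ext fun x => h n x

theorem TX.hom_ext' {Z : Type*} [AddCommGroup Z] [Module k Z] {f g : TX M H →ₗ[k] Z}
    (h0 : ∀ x, f (ofX M H 0 x) = g (ofX M H 0 x))
    (h : ∀ n x u, f (ofX M H (n + 1) (csnoc M H n x u)) =
      g (ofX M H (n + 1) (csnoc M H n x u))) : f = g :=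
  TX.hom_ext fun n x => by
    cases n with
    | zero => exact h0 x
    | succ n =>
      have : f ∘ₗ ofX M H (n + 1) = g ∘ₗ ofX M H (n + 1) := Ch.hom_ext H fun x u => h n x u
      exact LinearMap.congr_fun this x

/-- The linear map on the total space with given components. -/
noncomputable def totX {Z : Type*} [AddCommGroup Z] [Module k Z]
    (f : ∀ n, Ch M H.η n →ₗ[k] Z) : TX M H →ₗ[k] Z := DirectSum.toModule k ℕ Z f

@[simp] theorem totX_of {Z : Type*} [AddCommGroup Z] [Module k Z]
    (f : ∀ n, Ch M H.η n →ₗ[k] Z) (n : ℕ) (x : Ch M H.η n) :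
    totX f (ofX M H n x) = f n x :=
  DirectSum.toModule_lof (M := fun n => (Ch M H.η n : Type u)) (φ := f) (R := k) n x

/-- The map on the total space with given components that vanishes in degree zero. -/
noncomputable def totX' {Z : Type*} [AddCommGroup Z] [Module k Z]
    (f : ∀ n, Ch M H.η (n + 1) →ₗ[k] Z) : TX M H →ₗ[k] Z :=
  totX fun n => match n with
    | 0 => 0
    | n + 1 => f n

@[simp] theorem totX'_zero {Z : Type*} [AddCommGroup Z] [Module k Z]
    (f : ∀ n, Ch M H.η (n + 1) →ₗ[k] Z) (x : Ch M H.η 0) :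
    totX' f (ofX M H 0 x) = 0 := totX_of _ 0 x

@[simp] theorem totX'_succ {Z : Type*} [AddCommGroup Z] [Module k Z]
    (f : ∀ n, Ch M H.η (n + 1) →ₗ[k] Z) (n : ℕ) (x : Ch M H.η (n + 1)) :
    totX' f (ofX M H (n + 1) x) = f n x := totX_of _ (n + 1) x

theorem ofX_cast {n m : ℕ} (h : n = m) (x : Ch M H.η n) :
    ofX M H m (Chain.cast h x) = ofX M H n x := by subst h; rfl

variable (M H) in
/-- The elementary tensors in the total space. -/
noncomputable def snocT : U →ₗ[k] TX M H →ₗ[k] TX M H where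
  toFun u := totX fun n => ofX M H (n + 1) ∘ₗ (csnoc M H n).flip u
  map_add' u v := TX.hom_ext fun n x => by simp
  map_smul' c u := TX.hom_ext fun n x => by simp

@[simp] theorem snocT_of (u : U) (n : ℕ) (x : Ch M H.η n) :
    snocT M H u (ofX M H n x) = ofX M H (n + 1) (csnoc M H n x u) := totX_of _ n x

/-- The total space is generated by degree zero under `snocT`. -/
theorem TX.hom_ext_snoc {Z : Type*} [AddCommGroup Z] [Module k Z] {f g : TX M H →ₗ[k] Z}
    (h0 : ∀ x, f (ofX M H 0 x) = g (ofX M H 0 x))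
    (h : ∀ u, f ∘ₗ snocT M H u = g ∘ₗ snocT M H u) : f = g :=
  TX.hom_ext' h0 fun n x u => by
    have := LinearMap.congr_fun (h u) (ofX M H n x)
    rwa [LinearMap.comp_apply, LinearMap.comp_apply, snocT_of] at this

variable (M H) in
/-- Right multiplication in the last tensor factor. -/
noncomputable def rmT : U →ₗ[k] TX M H →ₗ[k] TX M H where
  toFun u := totX' fun n => ofX M H (n + 1) ∘ₗ crm M H n u
  map_add' u v := TX.hom_ext fun n x => by cases n <;> simp
  map_smul' c u := TX.hom_ext fun n x => by cases n <;> simp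

@[simp] theorem rmT_zero (u : U) (x : Ch M H.η 0) : rmT M H u (ofX M H 0 x) = 0 :=
  totX'_zero _ x

@[simp] theorem rmT_succ (u : U) (n : ℕ) (x : Ch M H.η (n + 1)) :
    rmT M H u (ofX M H (n + 1) x) = ofX M H (n + 1) (crm M H n u x) := totX'_succ _ n x

@[simp] theorem rmT_snocT (w u : U) (x : TX M H) :
    rmT M H w (snocT M H u x) = snocT M H (u * w) x := by
  have h : rmT M H w ∘ₗ snocT M H u = snocT M H (u * w) := TX.hom_ext fun n x => by
    simp [crm_csnoc]
  exact LinearMap.congr_fun h x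

theorem rmT_rmT (v w : U) (x : TX M H) : rmT M H w (rmT M H v x) = rmT M H (v * w) x := by
  have h : rmT M H w ∘ₗ rmT M H v = rmT M H (v * w) :=
    TX.hom_ext_snoc (by simp) fun u => LinearMap.ext fun x => by simp [mul_assoc]
  exact LinearMap.congr_fun h x

variable (M H) in
/-- The operation of `A` on the total space. -/
noncomputable def actT : A →ₗ[k] TX M H →ₗ[k] TX M H where
  toFun a := totX fun n => ofX M H n ∘ₗ (Ch M H.η n).act a
  map_add' u v := TX.hom_ext fun n x => by simp
  map_smul' c u := TX.hom_ext fun n x => by simp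

@[simp] theorem actT_of (a : A) (n : ℕ) (x : Ch M H.η n) :
    actT M H a (ofX M H n x) = ofX M H n ((Ch M H.η n).act a x) := totX_of _ n x

theorem actT_snocT (a : A) (u : U) (x : TX M H) :
    actT M H a (snocT M H u x) = snocT M H (u * tgt H.η a) x := by
  have h : actT M H a ∘ₗ snocT M H u = snocT M H (u * tgt H.η a) := TX.hom_ext fun n x => by
    simp [act_csnoc]
  exact LinearMap.congr_fun h x

variable (M H) in
/-- The insertion of `D_φ` with `r` arguments on its right. -/
noncomputable def insAt (r : ℕ) {p : ℕ} : Cochain H p →ₗ[k] TX M H →ₗ[k] TX M H where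
  toFun φ := totX fun n => by
    classical
    exact if h : ∃ a, a + p + r = n then
      ofX M H (h.choose + 1 + r) ∘ₗ opIns M H p h.choose r φ ∘ₗ Chain.cast h.choose_spec.symm
      else 0
  map_add' φ ψ := TX.hom_ext fun n x => by
    simp only [totX_of, LinearMap.add_apply]
    split_ifs <;> simp
  map_smul' c φ := TX.hom_ext fun n x => by
    simp only [totX_of, LinearMap.smul_apply, RingHom.id_apply]
    split_ifs <;> simp

theorem insAt_of (r : ℕ) {p : ℕ} (φ : Cochain H p) (a : ℕ) (x : Ch M H.η (a + p + r)) :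
    insAt M H r φ (ofX M H (a + p + r) x) = ofX M H (a + 1 + r) (opIns M H p a r φ x) := by
  have key : ∀ b (h : b + p + r = a + p + r), ofX M H (b + 1 + r)
      (opIns M H p b r φ (Chain.cast h.symm x)) = ofX M H (a + 1 + r) (opIns M H p a r φ x) := by
    intro b h
    obtain rfl : b = a := by omega
    rfl
  have h : ∃ b, b + p + r = a + p + r := ⟨a, rfl⟩
  refine Eq.trans ?_ (key h.choose h.choose_spec)
  change totX _ _ = _
  rw [totX_of, dif_pos h]
  rfl

theorem insAt_of_lt (r : ℕ) {p n : ℕ} (φ : Cochain H p) (hn : n < p + r) (x : Ch M H.η n) :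
    insAt M H r φ (ofX M H n x) = 0 := by
  change totX _ _ = _
  rw [totX_of, dif_neg (by rintro ⟨a, rfl⟩; omega)]
  rfl

theorem insAt_snocT (r : ℕ) {p : ℕ} (φ : Cochain H p) (u : U) (x : TX M H) :
    insAt M H (r + 1) φ (snocT M H u x) = snocT M H u (insAt M H r φ x) := by
  have h : insAt M H (r + 1) φ ∘ₗ snocT M H u = snocT M H u ∘ₗ insAt M H r φ :=
    TX.hom_ext fun n x => by
      rw [LinearMap.comp_apply, LinearMap.comp_apply, snocT_of]
      rcases lt_or_ge n (p + r) with hn | hn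
      · rw [insAt_of_lt _ _ hn, insAt_of_lt _ _ (by omega), map_zero]
      · obtain ⟨a, rfl⟩ : ∃ a, n = a + p + r := ⟨n - (p + r), by omega⟩
        rw [insAt_of, snocT_of]
        exact insAt_of (r + 1) φ a _
  exact LinearMap.congr_fun h x

theorem insAt_zero_zero (b : Cochain H 0) (x : TX M H) :
    insAt M H 0 b x = snocT M H (src H.η (b : A)) x := by
  have h : insAt M H 0 b = snocT M H (src H.η (b : A)) := TX.hom_ext fun n x => by
    rw [snocT_of]
    exact insAt_of 0 b n x
  exact LinearMap.congr_fun h x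

theorem insAt_succ_rmT (r : ℕ) {p : ℕ} (φ : Cochain H p) (w : U) (x : TX M H) :
    insAt M H (r + 1) φ (rmT M H w x) = rmT M H w (insAt M H (r + 1) φ x) := by
  have h : insAt M H (r + 1) φ ∘ₗ rmT M H w = rmT M H w ∘ₗ insAt M H (r + 1) φ :=
    TX.hom_ext_snoc (fun x => by
      rw [LinearMap.comp_apply, LinearMap.comp_apply, rmT_zero, map_zero,
        insAt_of_lt _ _ (by omega), map_zero]) fun u => LinearMap.ext fun x => by
      simp only [LinearMap.comp_apply, rmT_snocT, insAt_snocT]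
  exact LinearMap.congr_fun h x

theorem insAt_act_cochain {p : ℕ} (a : A) (φ : Cochain H p) (x : TX M H) :
    insAt M H 0 ((Cochain H p).act a φ) x = rmT M H (src H.η a) (insAt M H 0 φ x) := by
  have h : insAt M H 0 ((Cochain H p).act a φ) = rmT M H (src H.η a) ∘ₗ insAt M H 0 φ :=
    TX.hom_ext fun n x => by
      rw [LinearMap.comp_apply]
      rcases lt_or_ge n (p + 0) with hn | hn
      · rw [insAt_of_lt _ _ hn, insAt_of_lt _ _ hn, map_zero]
      · obtain ⟨a, rfl⟩ : ∃ a, n = a + p + 0 := ⟨n - (p + 0), by omega⟩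
        rw [insAt_of, insAt_of]
        refine Eq.trans ?_ (rmT_succ _ _ _).symm
        rw [opIns_zero, opD_act]
        exact congrArg _ (insPair_rmulU H p a _ _ _)
  exact LinearMap.congr_fun h x

theorem insAt_actT (r : ℕ) {p : ℕ} (φ : Cochain H p) (c : A) (x : TX M H) :
    insAt M H r φ (actT M H c x) = actT M H c (insAt M H r φ x) := by
  have h : insAt M H r φ ∘ₗ actT M H c = actT M H c ∘ₗ insAt M H r φ :=
    TX.hom_ext fun n x => by
      rw [LinearMap.comp_apply, LinearMap.comp_apply, actT_of]
      rcases lt_or_ge n (p + r) with hn | hn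
      · rw [insAt_of_lt _ _ hn, insAt_of_lt _ _ hn, map_zero]
      · obtain ⟨a, rfl⟩ : ∃ a, n = a + p + r := ⟨n - (p + r), by omega⟩
        rw [insAt_of, insAt_of, actT_of, opIns_act]
  exact LinearMap.congr_fun h x

variable (M) in
/-- The map `x ↦ (u₁ ⊗ u₂ ↦ (x, D_{φ(…, u₁)}(…) u₂))`. -/
noncomputable def stepT {p : ℕ} (φ : Cochain H (p + 1)) : TX M H →ₗ[k] TensA H.η →ₗ[k] TX M H :=
  Bal.liftP (LinearMap.compRight k (rmT M H).flip ∘ₗ (insAt M H 0 ∘ₗ Coch.app φ).flip)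
    (fun x a u v => by
      change rmT M H v (insAt M H 0 (Coch.app φ (tgt H.η a * u)) x) =
        rmT M H (src H.η a * v) (insAt M H 0 (Coch.app φ u) x)
      rw [Coch.app_tgt, insAt_act_cochain, rmT_rmT])

@[simp] theorem stepT_mk {p : ℕ} (φ : Cochain H (p + 1)) (x : TX M H) (u v : U) :
    stepT M φ x (mkA H.η u v) = rmT M H v (insAt M H 0 (Coch.app φ u) x) :=
  Bal.liftP_mk _ _ _ _ _

theorem insAt_zero_snocT {p : ℕ} (φ : Cochain H (p + 1)) (u : U) (x : TX M H) :
    insAt M H 0 φ (snocT M H u x) = stepT M φ x (H.comul u) := by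
  have h : insAt M H 0 φ ∘ₗ snocT M H u = (stepT M φ).flip (H.comul u) :=
    TX.hom_ext fun n x => by
      rw [LinearMap.comp_apply, snocT_of, LinearMap.flip_apply]
      rcases lt_or_ge n p with hn | hn
      · rw [insAt_of_lt _ _ (by omega)]
        have : stepT M φ (ofX M H n x) = 0 := TensA.hom_ext fun u v => by
          rw [stepT_mk, insAt_of_lt _ _ (by omega), map_zero, LinearMap.zero_apply]
        rw [this, LinearMap.zero_apply]
      · obtain ⟨a, rfl⟩ : ∃ a, n = a + p + 0 := ⟨n - p, by omega⟩
        refine (insAt_of 0 φ a _).trans ?_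
        have : stepT M φ (ofX M H (a + p + 0) x) = ofX M H (a + 1) ∘ₗ
            (insPair M H p a).flip x ∘ₗ opDStep H (opD H p) (opD_act H p) φ :=
          TensA.hom_ext fun u v => by
            rw [stepT_mk, insAt_of, LinearMap.comp_apply]
            refine Eq.trans ?_ (congrArg _ (insPair_opDStep_mkA H a φ u v x).symm)
            exact rmT_succ _ _ _
        rw [this]
        exact congrArg _ (insPair_snoc H p a _ x u)
  exact LinearMap.congr_fun h x

theorem insAt_zero_of_zero {p : ℕ} (φ : Cochain H (p + 1)) (x : Ch M H.η 0) :
    insAt M H 0 φ (ofX M H 0 x) = 0 := insAt_of_lt _ _ (by omega) x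

theorem insAt_succ_of_zero (r : ℕ) {p : ℕ} (φ : Cochain H p) (x : Ch M H.η 0) :
    insAt M H (r + 1) φ (ofX M H 0 x) = 0 := insAt_of_lt _ _ (by omega) x

theorem rmT_one_insAt (r : ℕ) {p : ℕ} (φ : Cochain H p) (x : TX M H) :
    rmT M H 1 (insAt M H r φ x) = insAt M H r φ x := by
  have h1 : ∀ x u, rmT M H 1 (snocT M H u x) = snocT M H u x := by simp
  have h2 : ∀ n (x : Ch M H.η (n + 1)), rmT M H 1 (ofX M H (n + 1) x) = ofX M H (n + 1) x :=
    fun n x => by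
      have : rmT M H 1 ∘ₗ ofX M H (n + 1) = ofX M H (n + 1) := Ch.hom_ext H fun x u => by
        rw [LinearMap.comp_apply, ← snocT_of, h1]
      exact LinearMap.congr_fun this x
  have h : rmT M H 1 ∘ₗ insAt M H r φ = insAt M H r φ := TX.hom_ext fun n x => by
    rw [LinearMap.comp_apply]
    rcases lt_or_ge n (p + r) with hn | hn
    · rw [insAt_of_lt _ _ hn, map_zero]
    · obtain ⟨a, rfl⟩ : ∃ a, n = a + p + r := ⟨n - (p + r), by omega⟩
      rw [insAt_of]
      generalize opIns M H p a r φ x = y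
      obtain ⟨m, hm⟩ : ∃ m, a + 1 + r = m + 1 := ⟨a + r, by omega⟩
      rw [← ofX_cast hm]
      exact h2 m _
  exact LinearMap.congr_fun h x

/-- The trilinear map on `U` given by a family of linear maps on `U ⊗_A U`. -/
def trilinA {Z : Type*} [AddCommGroup Z] [Module k Z] (G : U →ₗ[k] TensA H.η →ₗ[k] Z) :
    U →ₗ[k] U →ₗ[k] U →ₗ[k] Z where
  toFun x := (mkA H.η).compr₂ (G x)
  map_add' x x' := LinearMap.ext₂ fun p q => by
    simp only [map_add, LinearMap.compr₂_apply, LinearMap.add_apply]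
  map_smul' r x := LinearMap.ext₂ fun p q => by
    simp only [map_smul, LinearMap.compr₂_apply, LinearMap.smul_apply, RingHom.id_apply]

theorem stepT_rmul {p : ℕ} (φ : Cochain H (p + 1)) (x : TX M H) (v w : U) (z : TensA H.η) :
    stepT M φ x (TensA.rmul v w z) =
      rmT M H w (stepT M (Coch.app (cofaceMul H p φ) v) x z) := by
  have h : stepT M φ x ∘ₗ TensA.rmul v w =
      rmT M H w ∘ₗ stepT M (Coch.app (cofaceMul H p φ) v) x := TensA.hom_ext fun p q => by
    rw [LinearMap.comp_apply, LinearMap.comp_apply, TensA.rmul_mk, stepT_mk, stepT_mk, rmT_rmT]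
    rfl
  exact LinearMap.congr_fun h z

theorem insAt_zero_rmT {p : ℕ} (φ : Cochain H (p + 1)) (w : U) (x : TX M H) :
    insAt M H 0 φ (rmT M H w x) = stepT M (cofaceMul H p φ) x (H.comul w) := by
  have h : insAt M H 0 φ ∘ₗ rmT M H w = (stepT M (cofaceMul H p φ)).flip (H.comul w) :=
    TX.hom_ext_snoc (fun x => by
      rw [LinearMap.comp_apply, rmT_zero, map_zero, LinearMap.flip_apply]
      have : stepT M (cofaceMul H p φ) (ofX M H 0 x) = 0 := TensA.hom_ext fun u v => by
        rw [stepT_mk, insAt_zero_of_zero, map_zero, LinearMap.zero_apply]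
      rw [this, LinearMap.zero_apply]) fun v => LinearMap.ext fun x => by
      rw [LinearMap.comp_apply, LinearMap.comp_apply, LinearMap.comp_apply, LinearMap.flip_apply,
        rmT_snocT, insAt_zero_snocT, H.comul_mul']
      have : stepT M φ x ∘ₗ H.lmulComul v = stepT M (cofaceMul H p φ) (snocT M H v x) :=
        TensA.hom_ext fun p q => by
          rw [LinearMap.comp_apply, H.lmulComul_mk, stepT_rmul, stepT_mk, insAt_zero_snocT]
      exact LinearMap.congr_fun this _
  exact LinearMap.congr_fun h x

theorem insLast_rmulU (a q : ℕ) (w : U) (E : Coch H.η (baseU H.η) q) (φ : Cochain H (a + 1)) :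
    insLast H a q (rmulU H.η q w E) φ = insLast H a q E (Coch.app (cofaceMul H a φ) w) := by
  induction q with
  | zero => rfl
  | succ q ih => exact Coch.ext (p := a + q) fun u => ih (Coch.app E u)

theorem insAt_insLast (a q : ℕ) : ∀ (φ : Cochain H (a + 1)) (ψ : Cochain H q) (x : TX M H),
    insAt M H 0 (insLast H a q (opD H q ψ) φ) x = insAt M H 0 φ (insAt M H 0 ψ x) := by
  induction q with
  | zero =>
    intro φ b x
    rw [insAt_zero_zero, insAt_zero_snocT]
    refine Eq.trans ?_ (congrArg (stepT M φ x) (H.comul_src (b : A))).symm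
    rw [stepT_mk, rmT_one_insAt]
    rfl
  | succ q ih =>
    intro φ ψ x
    obtain ⟨ω, hω⟩ : ∃ ω : Cochain H (a + q + 1), ω = insLast H a (q + 1) (opD H (q + 1) ψ) φ :=
      ⟨_, rfl⟩
    have hω' : ∀ u, Coch.app ω u = insLast H a q (Coch.app (opD H (q + 1) ψ) u) φ := fun u => by
      rw [hω]; rfl
    have step : ∀ (x : TX M H) (u : U), stepT M ω x (H.comul u) =
        insAt M H 0 φ (stepT M ψ x (H.comul u)) := by
      intro x u
      obtain ⟨G, hG⟩ : ∃ G : U →ₗ[k] TensA H.η →ₗ[k] TX M H,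
          ∀ v, G v = stepT M (cofaceMul H a φ) (insAt M H 0 (Coch.app ψ v) x) :=
        ⟨stepT M (cofaceMul H a φ) ∘ₗ (insAt M H 0).flip x ∘ₗ Coch.app ψ, fun _ => rfl⟩
      refine H.coassoc_lift (trilinA G) (stepT M ω x) (insAt M H 0 φ ∘ₗ stepT M ψ x)
        (fun y => ?_) (fun v => ⟨G v, fun _ _ => rfl, fun y => ?_⟩) u
      · obtain ⟨c, hc⟩ : ∃ c : TensA H.η →ₗ[k] TX M H, ∀ z, c z = rmT M H y (insAt M H 0
            (insLast H a q (opDStep H (opD H q) (opD_act H q) ψ z) φ) x) :=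
          ⟨rmT M H y ∘ₗ (insAt M H 0).flip x ∘ₗ (insLast H a q).flip φ ∘ₗ
            opDStep H (opD H q) (opD_act H q) ψ, fun _ => rfl⟩
        refine ⟨c, fun u v => ?_, fun v => ?_⟩
        · change _ = G u (mkA H.η v y)
          rw [hc, opDStep_mkA, insLast_rmulU, ih, hG, stepT_mk]
        · rw [hc, stepT_mk, hω', app_opD]
      · rw [LinearMap.comp_apply, stepT_mk, insAt_zero_rmT, hG]
    have h : insAt M H 0 ω = insAt M H 0 φ ∘ₗ insAt M H 0 ψ :=
      TX.hom_ext_snoc (fun x => by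
        rw [insAt_zero_of_zero, LinearMap.comp_apply, insAt_zero_of_zero, map_zero])
        fun u => LinearMap.ext fun x => by
          rw [LinearMap.comp_apply, LinearMap.comp_apply, LinearMap.comp_apply, insAt_zero_snocT,
            insAt_zero_snocT, step]
    rw [hω] at h
    exact LinearMap.congr_fun h x

theorem app_circ (a q r : ℕ) (φ : Cochain H (a + 1 + r + 1)) (ψ : Cochain H q) (u : U) :
    Coch.app (p := a + q + r) (circ H a q (r + 1) φ ψ) u = circ H a q r (Coch.app φ u) ψ := rfl

theorem stepT_congr {p q : ℕ} (φ : Cochain H (p + 1)) (ψ : Cochain H (q + 1)) (x y : TX M H)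
    (h : ∀ u, insAt M H 0 (Coch.app φ u) x = insAt M H 0 (Coch.app ψ u) y) :
    stepT M φ x = stepT M ψ y :=
  TensA.hom_ext fun u v => by rw [stepT_mk, stepT_mk, h]

theorem insAt_circ_zero (a q r : ℕ) : ∀ (φ : Cochain H (a + 1 + r)) (ψ : Cochain H q) (x : TX M H),
    insAt M H 0 (circ H a q r φ ψ) x = insAt M H 0 φ (insAt M H r ψ x) := by
  induction r with
  | zero => exact insAt_insLast a q
  | succ r ih =>
    intro φ ψ x
    have h : insAt M H 0 (p := a + q + r + 1) (circ H a q (r + 1) φ ψ) =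
        insAt M H 0 (p := a + 1 + r + 1) φ ∘ₗ insAt M H (r + 1) ψ :=
      TX.hom_ext_snoc (fun x => by
        rw [insAt_zero_of_zero, LinearMap.comp_apply, insAt_succ_of_zero, map_zero])
        fun u => LinearMap.ext fun x => by
          rw [LinearMap.comp_apply, LinearMap.comp_apply, LinearMap.comp_apply, insAt_snocT,
            insAt_zero_snocT, insAt_zero_snocT]
          refine LinearMap.congr_fun (stepT_congr _ _ _ _ fun u => ?_) (H.comul u)
          rw [app_circ, ih]
    exact LinearMap.congr_fun h x

/-- Insertion of a composition of cochains. -/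
theorem insAt_circ (a q r s : ℕ) (φ : Cochain H (a + 1 + r)) (ψ : Cochain H q) (x : TX M H) :
    insAt M H s (circ H a q r φ ψ) x = insAt M H s φ (insAt M H (s + r) ψ x) := by
  induction s generalizing x with
  | zero => rw [Nat.zero_add, insAt_circ_zero]
  | succ s ih =>
    have hs : insAt M H (s + 1 + r) ψ = insAt M H (s + r + 1) ψ := by
      rw [show s + 1 + r = s + r + 1 by omega]
    rw [hs]
    have h : insAt M H (s + 1) (circ H a q r φ ψ) =
        insAt M H (s + 1) φ ∘ₗ insAt M H (s + r + 1) ψ :=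
      TX.hom_ext_snoc (fun x => by
        rw [insAt_succ_of_zero, LinearMap.comp_apply, insAt_succ_of_zero, map_zero])
        fun u => LinearMap.ext fun x => by
          rw [LinearMap.comp_apply, LinearMap.comp_apply, LinearMap.comp_apply, insAt_snocT, insAt_snocT, insAt_snocT, ih]
    exact LinearMap.congr_fun h x

/-- Insertions in disjoint groups of arguments commute. -/
theorem insAt_comm (j r d q : ℕ) (χ : Cochain H d) (ψ : Cochain H q) (x : TX M H) :
    insAt M H (j + 1 + r) ψ (insAt M H r χ x) = insAt M H r χ (insAt M H (j + d + r) ψ x) := by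
  induction r generalizing x with
  | zero =>
    induction d generalizing x with
    | zero => rw [insAt_zero_zero, insAt_zero_zero, add_zero, add_zero, add_zero, insAt_snocT]
    | succ d ih =>
      have h : insAt M H (j + 1) ψ ∘ₗ insAt M H 0 χ =
          insAt M H 0 χ ∘ₗ insAt M H (j + d + 1) ψ :=
        TX.hom_ext_snoc (fun x => by
          rw [LinearMap.comp_apply, LinearMap.comp_apply, insAt_zero_of_zero, insAt_succ_of_zero,
            map_zero, map_zero]) fun u => LinearMap.ext fun x => by
          rw [LinearMap.comp_apply, LinearMap.comp_apply, LinearMap.comp_apply,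
            LinearMap.comp_apply, insAt_snocT, insAt_zero_snocT, insAt_zero_snocT]
          have : insAt M H (j + 1) ψ ∘ₗ stepT M χ x = stepT M χ (insAt M H (j + d) ψ x) :=
            TensA.hom_ext fun u v => by
              rw [LinearMap.comp_apply, stepT_mk, stepT_mk, insAt_succ_rmT]
              exact congrArg _ (ih (Coch.app χ u) x)
          exact LinearMap.congr_fun this (H.comul u)
      exact LinearMap.congr_fun h x
  | succ r ih =>
    have h : insAt M H (j + 1 + r + 1) ψ ∘ₗ insAt M H (r + 1) χ =
        insAt M H (r + 1) χ ∘ₗ insAt M H (j + d + r + 1) ψ :=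
      TX.hom_ext_snoc (fun x => by
        rw [LinearMap.comp_apply, LinearMap.comp_apply, insAt_succ_of_zero, insAt_succ_of_zero,
          map_zero, map_zero]) fun u => LinearMap.ext fun x => by
        rw [LinearMap.comp_apply, LinearMap.comp_apply, LinearMap.comp_apply,
          LinearMap.comp_apply, insAt_snocT, insAt_snocT, insAt_snocT, insAt_snocT, ih]
    exact LinearMap.congr_fun h x

end Total
end HopfCalculus

namespace HopfCalculus

section TotalFaces

variable {k : Type v} {A U M : Type u} [CommRing k] [Ring A] [Algebra k A] [Ring U] [Algebra k U]
  [AddCommGroup M] [Module k M] [Module Uᵐᵒᵖ M] [IsScalarTower k Uᵐᵒᵖ M]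
variable {H : LeftBialgebroid k A U}

variable (M H) in
/-- The face `d₀` on the total space. -/
noncomputable def face0T : TX M H →ₗ[k] TX M H := totX' fun n => ofX M H n ∘ₗ face0 M H n

@[simp] theorem face0T_zero (x : Ch M H.η 0) : face0T M H (ofX M H 0 x) = 0 := totX'_zero _ x

@[simp] theorem face0T_succ (n : ℕ) (x : Ch M H.η (n + 1)) :
    face0T M H (ofX M H (n + 1) x) = ofX M H n (face0 M H n x) := totX'_succ _ n x

theorem face0T_snocT (u : U) (x : TX M H) :
    face0T M H (snocT M H u x) = actT M H (H.counit u) x := by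
  have h : face0T M H ∘ₗ snocT M H u = actT M H (H.counit u) := TX.hom_ext fun n x => by
    rw [LinearMap.comp_apply, snocT_of, face0T_succ, face0_csnoc, actT_of]
  exact LinearMap.congr_fun h x

theorem face0T_rmT (w : U) (x : TX M H) :
    face0T M H (rmT M H w x) = face0T M H (rmT M H (src H.η (H.counit w)) x) := by
  have h : face0T M H ∘ₗ rmT M H w = face0T M H ∘ₗ rmT M H (src H.η (H.counit w)) :=
    TX.hom_ext_snoc (by simp) fun u => LinearMap.ext fun x => by
      simp only [LinearMap.comp_apply, rmT_snocT, face0T_snocT, ← H.counit_mul_src]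
  exact LinearMap.congr_fun h x

theorem face0T_rmT_tgt (w : U) (x : TX M H) :
    face0T M H (rmT M H w x) = face0T M H (rmT M H (tgt H.η (H.counit w)) x) := by
  have h : face0T M H ∘ₗ rmT M H w = face0T M H ∘ₗ rmT M H (tgt H.η (H.counit w)) :=
    TX.hom_ext_snoc (by simp) fun u => LinearMap.ext fun x => by
      simp only [LinearMap.comp_apply, rmT_snocT, face0T_snocT, ← H.counit_mul_tgt]
  exact LinearMap.congr_fun h x

theorem actT_counit_src (a : A) (x : TX M H) :
    actT M H (H.counit (src H.η a)) x = actT M H a x := by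
  rw [H.counit_src]

/-- For a map `g` that sees the last factor only through the counit, the value
`g(…, D_φ(…, u))` is `g(…, D_{φ(…, u)}(…))`. -/
theorem counit_insAt_snocT {Z : Type*} [AddCommGroup Z] [Module k Z] (g : TX M H →ₗ[k] Z)
    (hg : ∀ w x, g (rmT M H w x) = g (rmT M H (src H.η (H.counit w)) x)) {p : ℕ}
    (φ : Cochain H (p + 1)) (u : U) (x : TX M H) :
    g (insAt M H 0 φ (snocT M H u x)) = g (insAt M H 0 (Coch.app φ u) x) := by
  rw [insAt_zero_snocT]
  obtain ⟨c, hc⟩ : ∃ c : TensA H.η →ₗ[k] U,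
      ∀ x y, c (mkA H.η x y) = tgt H.η (H.counit y) * x :=
    ⟨liftA ((LinearMap.mul k U ∘ₗ tgt H.η ∘ₗ H.counit).flip) (fun a x y => by
      simp [H.counit_src_mul, tgt_mul, mul_assoc]), fun x y => liftA_mk _ _ x y⟩
  have h : g ∘ₗ stepT M φ x = g ∘ₗ (insAt M H 0).flip x ∘ₗ Coch.app φ ∘ₗ c :=
    TensA.hom_ext fun p q => by
      rw [LinearMap.comp_apply, stepT_mk, LinearMap.comp_apply, LinearMap.comp_apply,
        LinearMap.comp_apply, hc, Coch.app_tgt, LinearMap.flip_apply, insAt_act_cochain, hg]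
  have h2 := LinearMap.congr_fun h (H.comul u)
  rw [LinearMap.comp_apply, LinearMap.comp_apply, LinearMap.comp_apply, LinearMap.comp_apply,
    H.counit_right_lift c hc, LinearMap.flip_apply] at h2
  exact h2

variable (M) in
/-- The cap product on the total space. -/
noncomputable def capT {p : ℕ} (φ : Cochain H p) : TX M H →ₗ[k] TX M H :=
  face0T M H ∘ₗ insAt M H 0 φ

theorem capT_apply {p : ℕ} (φ : Cochain H p) (x : TX M H) :
    capT M φ x = face0T M H (insAt M H 0 φ x) := rfl

theorem capT_snocT {p : ℕ} (φ : Cochain H (p + 1)) (u : U) (x : TX M H) :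
    capT M φ (snocT M H u x) = capT M (Coch.app φ u) x :=
  counit_insAt_snocT (face0T M H) face0T_rmT φ u x

theorem capT_zero (b : Cochain H 0) (x : TX M H) : capT M b x = actT M H (b : A) x := by
  rw [capT_apply, insAt_zero_zero, face0T_snocT]
  exact actT_counit_src (A := A) b x

theorem capT_of (p : ℕ) : ∀ (a : ℕ) (φ : Cochain H p) (x : Ch M H.η (a + p)),
    capT M φ (ofX M H (a + p) x) = ofX M H a (capChain M H p a φ x) := by
  induction p with
  | zero => exact fun a b x => (capT_zero b _).trans (actT_of (A := A) b a x)
  | succ p ih =>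
    intro a φ x
    have h : capT M φ ∘ₗ ofX M H (a + p + 1) = ofX M H a ∘ₗ capChain M H (p + 1) a φ :=
      Ch.hom_ext H fun x u => by
        rw [LinearMap.comp_apply, ← snocT_of, capT_snocT, ih]
        exact congrArg (ofX M H a) (capChain_csnoc H p a φ x u).symm
    exact LinearMap.congr_fun h x

theorem capT_of_lt {p n : ℕ} (φ : Cochain H p) (h : n < p) (x : Ch M H.η n) :
    capT M φ (ofX M H n x) = 0 := by
  rw [capT_apply, insAt_of_lt _ _ h, map_zero]

theorem capT_actT {p : ℕ} (φ : Cochain H p) (c : A) (x : TX M H) :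
    capT M φ (actT M H c x) = capT M ((Cochain H p).act c φ) x := by
  have h : capT M φ ∘ₗ actT M H c = capT M ((Cochain H p).act c φ) := TX.hom_ext fun n x => by
    rw [LinearMap.comp_apply, actT_of]
    rcases lt_or_ge n p with hn | hn
    · rw [capT_of_lt _ hn, capT_of_lt _ hn]
    · obtain ⟨a, rfl⟩ : ∃ a, n = a + p := ⟨n - p, by omega⟩
      rw [capT_of, capT_of]
      exact congrArg _ (pair_act _ _ p c φ x)
  exact LinearMap.congr_fun h x

theorem face0T_insAt_succ (r : ℕ) {p : ℕ} (φ : Cochain H p) (x : TX M H) :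
    face0T M H (insAt M H (r + 1) φ x) = insAt M H r φ (face0T M H x) := by
  have h : face0T M H ∘ₗ insAt M H (r + 1) φ = insAt M H r φ ∘ₗ face0T M H :=
    TX.hom_ext_snoc (fun x => by
      rw [LinearMap.comp_apply, LinearMap.comp_apply, insAt_succ_of_zero, face0T_zero, map_zero,
        map_zero]) fun u => LinearMap.ext fun x => by
      simp only [LinearMap.comp_apply, insAt_snocT, face0T_snocT, insAt_actT]
  exact LinearMap.congr_fun h x

/-! ### Faithfulness on the chains with coefficients in `U` -/

theorem isScalarTower_op_self : IsScalarTower k Uᵐᵒᵖ U :=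
  ⟨fun r u v => by
    change v * (r • u.unop) = r • (v * u.unop)
    rw [mul_smul_comm]⟩

attribute [local instance] isScalarTower_op_self

theorem eq_of_ract_tgt_one (a b : A)
    (h : ract k U U (tgt H.η a) 1 = ract k U U (tgt H.η b) 1) : a = b := by
  have h1 : tgt H.η a = tgt H.η b := by simpa [ract] using h
  rw [← H.counit_tgt a, h1, H.counit_tgt]

theorem eq_of_capT_eq {p : ℕ} {φ ψ : Cochain H p}
    (h : ∀ x : TX U H, capT U φ x = capT U ψ x) : φ = ψ := by
  induction p with
  | zero =>
    have h1 : ofX U H 0 ((Ch U H.η 0).act (φ : A) (1 : U)) =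
        ofX U H 0 ((Ch U H.η 0).act (ψ : A) (1 : U)) := by
      have h0 := h (ofX U H 0 (1 : U))
      rw [capT_zero, capT_zero] at h0
      exact (actT_of (A := A) (M := U) φ 0 (1 : U)).symm.trans
        (h0.trans (actT_of (A := A) ψ 0 (1 : U)))
    have h2 := congrArg (fun z => DirectSum.component k ℕ (fun n => (Ch U H.η n : Type u)) 0 z) h1
    simp only [ofX, DirectSum.component.lof_self] at h2
    exact eq_of_ract_tgt_one (A := A) (U := U) φ ψ h2
  | succ p ih =>
    refine Coch.ext fun u => ih fun x => ?_
    rw [← capT_snocT, ← capT_snocT, h]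

theorem eq_of_insAt_eq {p : ℕ} {φ ψ : Cochain H p}
    (h : ∀ x : TX U H, insAt U H 0 φ x = insAt U H 0 ψ x) : φ = ψ :=
  eq_of_capT_eq fun x => by rw [capT_apply, capT_apply, h]

/-! ### The multiplication, the counit and the unit as cochains -/

variable (H) in
/-- The cochain `ε`. -/
def counitCochain : Cochain H 1 := coface0 H 0 (unitCochain H)

variable (H) in
/-- The cochain `(u, v) ↦ ε(u v)`. -/
def mulCochain : Cochain H 2 := cofaceMul H 0 (counitCochain H)

theorem insAt_cofaceMul {p : ℕ} (φ : Cochain H (p + 1)) (v : U) (x : TX M H) :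
    insAt M H 0 (cofaceMul H p φ) (snocT M H v x) = insAt M H 0 φ (rmT M H v x) := by
  rw [insAt_zero_rmT, insAt_zero_snocT]

theorem app_counitCochain (u : U) : Coch.app (counitCochain H) u = (H.counit u : A) :=
  @one_mul A _ (H.counit u)

theorem insAt_counit (r n : ℕ) (x : Ch M H.η n) (h : r < n) :
    insAt M H r (counitCochain H) (ofX M H n x) = ofX M H n x := by
  induction r generalizing n with
  | zero =>
    obtain ⟨n, rfl⟩ : ∃ m, n = m + 1 := ⟨n - 1, by omega⟩
    have : insAt M H 0 (counitCochain H) ∘ₗ ofX M H (n + 1) = ofX M H (n + 1) :=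
      Ch.hom_ext H fun x u => by
        rw [LinearMap.comp_apply, ← snocT_of, insAt_zero_snocT]
        obtain ⟨c, hc⟩ : ∃ c : TensA H.η →ₗ[k] U,
            ∀ x y, c (mkA H.η x y) = src H.η (H.counit x) * y :=
          ⟨liftA (LinearMap.mul k U ∘ₗ src H.η ∘ₗ H.counit) (fun a x y => by
            simp [H.counit_tgt_mul, src_mul, mul_assoc]), fun x y => liftA_mk _ _ x y⟩
        have h : stepT M (counitCochain H) (ofX M H n x) =
            (snocT M H).flip (ofX M H n x) ∘ₗ c := TensA.hom_ext fun p q => by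
          rw [stepT_mk, app_counitCochain, LinearMap.comp_apply, hc]
          refine (congrArg (rmT M H q) (insAt_zero_zero _ _)).trans ?_
          exact rmT_snocT _ _ _
        rw [h, LinearMap.comp_apply, H.counit_left_lift c hc, LinearMap.flip_apply]
    exact LinearMap.congr_fun this x
  | succ r ih =>
    obtain ⟨n, rfl⟩ : ∃ m, n = m + 1 := ⟨n - 1, by omega⟩
    have : insAt M H (r + 1) (counitCochain H) ∘ₗ ofX M H (n + 1) = ofX M H (n + 1) :=
      Ch.hom_ext H fun x u => by
        rw [LinearMap.comp_apply, ← snocT_of, insAt_snocT, ih n x (by omega)]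
    exact LinearMap.congr_fun this x

theorem insAt_mul_snocT (v : U) (x : TX M H) :
    insAt M H 0 (mulCochain H) (snocT M H v x) = rmT M H v x := by
  have h : insAt M H 0 (mulCochain H) ∘ₗ snocT M H v = rmT M H v := TX.hom_ext fun n x => by
    rw [LinearMap.comp_apply, mulCochain, insAt_cofaceMul]
    cases n with
    | zero => rw [rmT_zero, map_zero]
    | succ n => rw [rmT_succ, insAt_counit _ _ _ (by omega)]
  exact LinearMap.congr_fun h x

theorem insAt_unit (x : TX M H) : insAt M H 0 (unitCochain H) x = snocT M H 1 x := by
  rw [insAt_zero_zero]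
  exact congrArg (fun w => snocT M H w x) (src_one H.η)

theorem capT_mul (x : TX M H) : capT M (mulCochain H) x = face0T M H (face0T M H x) := by
  have h : capT M (mulCochain H) = face0T M H ∘ₗ face0T M H :=
    TX.hom_ext_snoc (fun x => by
      rw [capT_of_lt _ (by omega), LinearMap.comp_apply, face0T_zero, map_zero])
      fun u => LinearMap.ext fun x => by
      rw [LinearMap.comp_apply, LinearMap.comp_apply, LinearMap.comp_apply, capT_apply,
        insAt_mul_snocT, face0T_snocT, face0T_rmT_tgt]
      have h : face0T M H ∘ₗ rmT M H (tgt H.η (H.counit u)) =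
          face0T M H ∘ₗ actT M H (H.counit u) :=
        TX.hom_ext_snoc (by simp) fun u => LinearMap.ext fun x => by
          simp only [LinearMap.comp_apply, rmT_snocT, actT_snocT]
      exact LinearMap.congr_fun h x
  exact LinearMap.congr_fun h x

/-! ### Cofaces and cup products -/

theorem capT_cup (p q : ℕ) (φ : Cochain H p) : ∀ (ψ : Cochain H q) (x : TX M H),
    capT M (cup H p q φ ψ) x = capT M φ (capT M ψ x) := by
  induction q with
  | zero =>
    intro b x
    rw [capT_zero]
    exact (capT_actT φ (b : A) x).symm
  | succ q ih =>
    intro ψ x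
    have h : capT M (p := p + q + 1) (cup H p (q + 1) φ ψ) = capT M φ ∘ₗ capT M ψ :=
      TX.hom_ext_snoc (fun x => by
        rw [capT_of_lt _ (by omega), LinearMap.comp_apply, capT_of_lt _ (by omega), map_zero])
        fun u => LinearMap.ext fun x => by
          rw [LinearMap.comp_apply, LinearMap.comp_apply, LinearMap.comp_apply, capT_snocT,
            capT_snocT, ← ih]
          rfl
    exact LinearMap.congr_fun h x

theorem capT_coface0 {p : ℕ} (φ : Cochain H p) (x : TX M H) :
    capT M (coface0 H p φ) x = capT M φ (face0T M H x) := by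
  have h : capT M (coface0 H p φ) = capT M φ ∘ₗ face0T M H :=
    TX.hom_ext_snoc (fun x => by
      rw [capT_of_lt _ (by omega), LinearMap.comp_apply, face0T_zero, map_zero])
      fun u => LinearMap.ext fun x => by
        rw [LinearMap.comp_apply, LinearMap.comp_apply, LinearMap.comp_apply, capT_snocT,
          face0T_snocT, capT_actT]
        rfl
  exact LinearMap.congr_fun h x

theorem capT_cofaceMul {p : ℕ} (φ : Cochain H (p + 1)) (x : TX M H) :
    capT M (cofaceMul H p φ) x = capT M φ (insAt M H 0 (mulCochain H) x) := by
  have h : capT M (cofaceMul H p φ) = capT M φ ∘ₗ insAt M H 0 (mulCochain H) :=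
    TX.hom_ext_snoc (fun x => by
      rw [capT_of_lt _ (by omega), LinearMap.comp_apply, insAt_zero_of_zero, map_zero])
      fun u => LinearMap.ext fun x => by
        rw [LinearMap.comp_apply, LinearMap.comp_apply, LinearMap.comp_apply, capT_apply,
          insAt_cofaceMul, insAt_mul_snocT, capT_apply]
  exact LinearMap.congr_fun h x

theorem capT_cofaceAux (p : ℕ) : ∀ (j : ℕ) (_ : j < p) (φ : Cochain H p) (x : TX M H),
    capT M ((cofaceAux H p j).1 φ) x = capT M φ (insAt M H j (mulCochain H) x) := by
  induction p with
  | zero => exact fun j hj => absurd hj (Nat.not_lt_zero j)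
  | succ p ih =>
    intro j hj φ x
    cases j with
    | zero => exact capT_cofaceMul φ x
    | succ j =>
      have h : capT M (p := p + 1 + 1) ((cofaceAux H (p + 1) (j + 1)).1 φ) =
          capT M φ ∘ₗ insAt M H (j + 1) (mulCochain H) :=
        TX.hom_ext_snoc (fun x => by
          rw [capT_of_lt _ (by omega), LinearMap.comp_apply, insAt_succ_of_zero, map_zero])
          fun u => LinearMap.ext fun x => by
            rw [LinearMap.comp_apply, LinearMap.comp_apply, LinearMap.comp_apply, capT_snocT,
              insAt_snocT, capT_snocT, ← ih j (by omega)]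
            rfl
      exact LinearMap.congr_fun h x

theorem capT_cofaceAux_last (p : ℕ) : ∀ (φ : Cochain H p) (x : TX M H),
    capT M ((cofaceAux H p p).1 φ) x = capT M (mulCochain H) (insAt M H 0 φ x) := by
  induction p with
  | zero =>
    intro b x
    have h : capT M (cofaceBase H b) = capT M (mulCochain H) ∘ₗ insAt M H 0 b :=
      TX.hom_ext_snoc (fun x => by
        rw [capT_of_lt _ (by omega), LinearMap.comp_apply, insAt_zero_zero, capT_apply,
          insAt_mul_snocT, rmT_zero, map_zero])
        fun u => LinearMap.ext fun x => by
          rw [LinearMap.comp_apply, LinearMap.comp_apply, LinearMap.comp_apply, insAt_zero_zero,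
            capT_apply (mulCochain H), insAt_mul_snocT, rmT_snocT, face0T_snocT, capT_snocT,
            capT_zero]
          rfl
    exact LinearMap.congr_fun h x
  | succ p ih =>
    intro φ x
    have h : capT M (p := p + 1 + 1) ((cofaceAux H (p + 1) (p + 1)).1 φ) =
        capT M (mulCochain H) ∘ₗ insAt M H 0 φ :=
      TX.hom_ext_snoc (fun x => by
        rw [capT_of_lt _ (by omega), LinearMap.comp_apply, insAt_zero_of_zero, map_zero])
        fun u => LinearMap.ext fun x => by
          rw [LinearMap.comp_apply, LinearMap.comp_apply, LinearMap.comp_apply, capT_snocT]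
          refine Eq.trans (ih (Coch.app φ u) x) (counit_insAt_snocT _ (fun w x => ?_) φ u x).symm
          rw [capT_mul, capT_mul, face0T_rmT]
    exact LinearMap.congr_fun h x

end TotalFaces
end HopfCalculus

namespace HopfCalculus

/-! ## Signs -/

theorem sg_add (a b : ℤ) : sg (a + b) = sg a * sg b := by
  simp [sg, Int.negOnePow_add]

@[simp] theorem sg_zero : sg 0 = 1 := by simp [sg]

@[simp] theorem sg_one : sg 1 = -1 := by simp [sg]

theorem sg_mul_self (a : ℤ) : sg a * sg a = 1 := by
  rw [← sg_add, sg, Int.negOnePow_even _ ⟨a, rfl⟩]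
  rfl

theorem sg_neg (a : ℤ) : sg (-a) = sg a := by simp [sg, Int.negOnePow_neg]

theorem sg_congr {a b : ℤ} (c : ℤ) (h : a = b + 2 * c) : sg a = sg b := by
  rw [h, sg_add, two_mul, sg_add, sg_mul_self, mul_one]

theorem sg_smul_sg_smul {M : Type*} [AddCommGroup M] (a : ℤ) (x : M) : sg a • sg a • x = x := by
  rw [smul_smul, sg_mul_self, one_smul]

/-! ## Operads with signs -/

section Operad

variable (k : Type v) [CommRing k] (O : Type u) [AddCommGroup O] [Module k O]

/-- An operad with multiplication, as a graded module with partial compositions `comp r φ ψ`, where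
the `r` arguments of `φ` on the right of the one that is replaced by `ψ` are counted, and with the
Koszul signs for the degrees `p - 1`. -/
structure Oper where
  /-- the operations with `p` arguments -/
  deg : ℕ → Submodule k O
  /-- the partial compositions -/
  comp : ℕ → O →ₗ[k] O →ₗ[k] O
  comp_mem : ∀ {p q r : ℕ} {φ ψ : O}, φ ∈ deg (p + 1) → ψ ∈ deg q → r < p + 1 →
    comp r φ ψ ∈ deg (p + q)
  seq : ∀ {p q d r j : ℕ} {φ ψ χ : O}, φ ∈ deg p → ψ ∈ deg q → χ ∈ deg d → r < p → j < q →
    comp (r + j) (comp r φ ψ) χ = comp r φ (comp j ψ χ)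
  par : ∀ {p q d r r' : ℕ} {φ ψ χ : O}, φ ∈ deg p → ψ ∈ deg q → χ ∈ deg d → r < r' → r' < p →
    comp r (comp r' φ ψ) χ =
      sg ((q - 1 : ℤ) * (d - 1)) • comp (r' + d - 1) (comp r φ χ) ψ
  /-- the identity operation -/
  one : O
  /-- the multiplication -/
  mul : O
  /-- the unit -/
  unit : O
  one_mem : one ∈ deg 1
  mul_mem : mul ∈ deg 2
  unit_mem : unit ∈ deg 0
  mul_mul : comp 0 mul mul + comp 1 mul mul = 0
  mul_unit_left : comp 0 mul unit = one
  mul_unit_right : comp 1 mul unit = -one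
  one_comp : ∀ {p : ℕ} {φ : O}, φ ∈ deg p → comp 0 one φ = φ

variable {k O}

theorem sum_range_triangle {Z : Type*} [AddCommMonoid Z] (n : ℕ) (g : ℕ → ℕ → Z) :
    ∑ i ∈ Finset.range n, ∑ j ∈ Finset.range i, g j i =
      ∑ j ∈ Finset.range n, ∑ l ∈ Finset.range (n - 1 - j), g j (j + 1 + l) := by
  induction n with
  | zero => simp
  | succ n ih =>
    rw [Finset.sum_range_succ, ih, Finset.sum_range_succ, show n + 1 - 1 - n = 0 by omega,
      Finset.range_zero, Finset.sum_empty, add_zero, ← Finset.sum_add_distrib]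
    refine Finset.sum_congr rfl fun j hj => ?_
    rw [Finset.mem_range] at hj
    rw [show n + 1 - 1 - j = n - 1 - j + 1 by omega, Finset.sum_range_succ,
      show j + 1 + (n - 1 - j) = n by omega]

namespace Oper

variable (S : Oper k O)

/-- The total composition `∑_r φ ∘_r ψ` of an operation `φ` with `p` arguments. -/
def bar (p : ℕ) : O →ₗ[k] O →ₗ[k] O := ∑ r ∈ Finset.range p, S.comp r

theorem bar_apply (p : ℕ) (φ ψ : O) : S.bar p φ ψ = ∑ r ∈ Finset.range p, S.comp r φ ψ := by
  simp [bar, LinearMap.sum_apply]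

/-- The graded commutator of the total composition. -/
def bra (p q : ℕ) (φ ψ : O) : O :=
  S.bar p φ ψ - sg ((p - 1 : ℤ) * (q - 1)) • S.bar q ψ φ

/-- The sum of all simultaneous compositions of `φ` with `β` and, on its right, `γ`. -/
def brace (p : ℕ) (φ β γ : O) : O :=
  ∑ j ∈ Finset.range p, ∑ i ∈ Finset.range j, S.comp i (S.comp j φ β) γ

theorem par' {p q d r l : ℕ} {φ ψ χ : O} (hφ : φ ∈ S.deg p) (hψ : ψ ∈ S.deg q)
    (hχ : χ ∈ S.deg d) (h : r + 1 + l < p) :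
    S.comp (r + d + l) (S.comp r φ χ) ψ =
      sg ((d - 1 : ℤ) * (q - 1)) • S.comp r (S.comp (r + 1 + l) φ ψ) χ := by
  rw [S.par hφ hψ hχ (by omega : r < r + 1 + l) h, show r + 1 + l + d - 1 = r + d + l by omega,
    smul_smul, mul_comm (d - 1 : ℤ), sg_mul_self, one_smul]

/-- The compositions of a composition, sorted by the position of the third operation. -/
theorem sum_comp_comp {Z : Type*} [AddCommGroup Z] (f : ℕ → O →+ Z) {n d p : ℕ} {x ψ β : O}
    (hx : x ∈ S.deg n) (hψ : ψ ∈ S.deg d) (hβ : β ∈ S.deg p) :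
    ∑ i ∈ Finset.range n, ∑ j ∈ Finset.range (n - 1 + d), f j (S.comp j (S.comp i x ψ) β) =
      ∑ j ∈ Finset.range n, ∑ i ∈ Finset.range j, f i (S.comp i (S.comp j x ψ) β) +
      ∑ i ∈ Finset.range n, ∑ j ∈ Finset.range d, f (i + j) (S.comp i x (S.comp j ψ β)) +
      sg ((d - 1 : ℤ) * (p - 1)) • ∑ j ∈ Finset.range n, ∑ i ∈ Finset.range j,
        f (j + d - 1) (S.comp i (S.comp j x β) ψ) := by
  rw [sum_range_triangle n (fun i j => f (j + d - 1) (S.comp i (S.comp j x β) ψ)), Finset.smul_sum,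
    ← Finset.sum_add_distrib, ← Finset.sum_add_distrib]
  refine Finset.sum_congr rfl fun i hi => ?_
  rw [Finset.mem_range] at hi
  rw [show n - 1 + d = i + d + (n - 1 - i) by omega, Finset.sum_range_add, Finset.sum_range_add,
    Finset.smul_sum]
  congr 1
  · congr 1
    refine Finset.sum_congr rfl fun j hj => ?_
    rw [S.seq hx hψ hβ hi (Finset.mem_range.1 hj)]
  · refine Finset.sum_congr rfl fun l hl => ?_
    rw [Finset.mem_range] at hl
    rw [S.par' hx hβ hψ (by omega), map_zsmul, show i + 1 + l + d - 1 = i + d + l by omega]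

/-- The combinatorial identity behind the Leibniz rule and the formula for the commutator of the
cap product and the Lie derivative. -/
theorem sum_comp_comp_below {Z : Type*} [AddCommGroup Z] (f : ℕ → O →+ Z) {n d p : ℕ} {x ψ β : O}
    (hx : x ∈ S.deg n) (hψ : ψ ∈ S.deg d) (hβ : β ∈ S.deg p) :
    ∑ i ∈ Finset.range n, ∑ j ∈ Finset.range (n - 1 + d), ∑ m ∈ Finset.range j,
        f m (S.comp j (S.comp i x ψ) β) =
      ∑ i ∈ Finset.range n, ∑ j ∈ Finset.range d, ∑ m ∈ Finset.range j,
        f (i + m) (S.comp i x (S.comp j ψ β)) +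
      ∑ i ∈ Finset.range n, ∑ j ∈ Finset.range d, ∑ m ∈ Finset.range i,
        f m (S.comp i x (S.comp j ψ β)) +
      sg ((d - 1 : ℤ) * (p - 1)) • (∑ j ∈ Finset.range n, ∑ i ∈ Finset.range j,
        (∑ m ∈ Finset.range d, f (i + m) (S.comp i (S.comp j x β) ψ) -
          ∑ m ∈ Finset.range p, f i (S.comp j x (S.comp m β ψ)) +
          ∑ l ∈ Finset.range (n - 1 + p - 1 - i), f i (S.comp (i + 1 + l) (S.comp j x β) ψ) +
          ∑ m ∈ Finset.range i, f (i + d - 1) (S.comp m (S.comp j x β) ψ))) := by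
  have h1 := S.sum_comp_comp (fun j => ∑ m ∈ Finset.range j, f m) hx hψ hβ
  simp only [AddMonoidHom.finsetSum_apply] at h1
  rw [h1]
  have h2 : ∑ i ∈ Finset.range n, ∑ j ∈ Finset.range d, ∑ m ∈ Finset.range (i + j),
      f m (S.comp i x (S.comp j ψ β)) = ∑ i ∈ Finset.range n, ∑ j ∈ Finset.range d,
        ∑ m ∈ Finset.range j, f (i + m) (S.comp i x (S.comp j ψ β)) +
      ∑ i ∈ Finset.range n, ∑ j ∈ Finset.range d, ∑ m ∈ Finset.range i,
        f m (S.comp i x (S.comp j ψ β)) := by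
    simp only [← Finset.sum_add_distrib]
    refine Finset.sum_congr rfl fun i _ => Finset.sum_congr rfl fun j _ => ?_
    rw [Finset.sum_range_add, add_comm]
  rw [h2]
  have h3 : ∑ j ∈ Finset.range n, ∑ i ∈ Finset.range j, ∑ m ∈ Finset.range i,
      f m (S.comp i (S.comp j x ψ) β) = sg ((d - 1 : ℤ) * (p - 1)) •
      ∑ j ∈ Finset.range n, ∑ i ∈ Finset.range j, ∑ l ∈ Finset.range (n - 1 - j),
        f i (S.comp (j + p + l) (S.comp j x β) ψ) := by
    rw [sum_range_triangle n (fun i j => ∑ m ∈ Finset.range i, f m (S.comp i (S.comp j x ψ) β)),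
      Finset.smul_sum]
    refine Finset.sum_congr rfl fun j hj => ?_
    rw [Finset.mem_range] at hj
    rw [Finset.sum_comm, Finset.smul_sum]
    refine Finset.sum_congr rfl fun i hi => ?_
    rw [Finset.smul_sum]
    refine Finset.sum_congr rfl fun l hl => ?_
    rw [Finset.mem_range] at hl
    rw [S.par' hx hψ hβ (by omega), map_zsmul, mul_comm (p - 1 : ℤ), sg_smul_sg_smul]
  rw [h3]
  have key : ∀ {a b c d e : Z} (z : ℤ), c + d = e → z • c + (a + b) + z • d = a + b + z • e := by
    rintro a b c d e z rfl
    rw [smul_add]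
    abel
  refine key _ ?_
  rw [← Finset.sum_add_distrib]
  refine Finset.sum_congr rfl fun j hj => ?_
  rw [Finset.mem_range] at hj
  have h4 : ∑ i ∈ Finset.range j, ∑ m ∈ Finset.range (j + d - 1),
      f m (S.comp i (S.comp j x β) ψ) = ∑ i ∈ Finset.range j,
        ∑ m ∈ Finset.range d, f (i + m) (S.comp i (S.comp j x β) ψ) +
      (∑ i ∈ Finset.range j, ∑ l ∈ Finset.range (j - 1 - i),
          f i (S.comp (i + 1 + l) (S.comp j x β) ψ) +
        ∑ i ∈ Finset.range j, ∑ m ∈ Finset.range i,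
          f (i + d - 1) (S.comp m (S.comp j x β) ψ)) := by
    rw [← sum_range_triangle j (fun i m => f i (S.comp m (S.comp j x β) ψ)),
      sum_range_triangle j (fun m i => f (i + d - 1) (S.comp m (S.comp j x β) ψ)),
      ← Finset.sum_add_distrib, ← Finset.sum_add_distrib]
    refine Finset.sum_congr rfl fun i hi => ?_
    rw [Finset.mem_range] at hi
    rw [show j + d - 1 = i + d + (j - 1 - i) by omega, Finset.sum_range_add, Finset.sum_range_add]
    rw [add_comm (∑ m ∈ Finset.range i, _) (∑ m ∈ Finset.range d, _), add_assoc]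
    congr 2
    refine Finset.sum_congr rfl fun l hl => ?_
    rw [show i + 1 + l + d - 1 = i + d + l by omega]
  rw [h4, ← Finset.sum_add_distrib, ← Finset.sum_add_distrib, ← Finset.sum_add_distrib]
  refine Finset.sum_congr rfl fun i hi => ?_
  rw [Finset.mem_range] at hi
  have h5 : ∑ l ∈ Finset.range (n - 1 + p - 1 - i), f i (S.comp (i + 1 + l) (S.comp j x β) ψ) =
      ∑ l ∈ Finset.range (j - 1 - i), f i (S.comp (i + 1 + l) (S.comp j x β) ψ) +
      ∑ m ∈ Finset.range p, f i (S.comp j x (S.comp m β ψ)) +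
      ∑ l ∈ Finset.range (n - 1 - j), f i (S.comp (j + p + l) (S.comp j x β) ψ) := by
    rw [show n - 1 + p - 1 - i = j - 1 - i + p + (n - 1 - j) by omega, Finset.sum_range_add,
      Finset.sum_range_add]
    congr 1
    · congr 1
      refine Finset.sum_congr rfl fun m hm => ?_
      rw [← S.seq hx hβ hψ hj (Finset.mem_range.1 hm), show i + 1 + (j - 1 - i + m) = j + m by omega]
    · refine Finset.sum_congr rfl fun l _ => ?_
      rw [show i + 1 + (j - 1 - i + p + l) = j + p + l by omega]
  rw [h5]
  abel

end Oper

end Operad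
end HopfCalculus

namespace HopfCalculus

theorem sg_eq_or (a : ℤ) : sg a = 1 ∨ sg a = -1 := by
  rcases Int.even_or_odd a with h | h
  · left; rw [sg, Int.negOnePow_even _ h]; rfl
  · right; rw [sg, Int.negOnePow_odd _ h]; rfl

section Operad

variable {k : Type v} [CommRing k] {O : Type u} [AddCommGroup O] [Module k O]

namespace Oper

variable (S : Oper k O)

theorem bar_zero (φ ψ : O) : S.bar 0 φ ψ = 0 := by simp [bar_apply]

theorem brace_zero_left (p : ℕ) (β γ : O) : S.brace p 0 β γ = 0 := by simp [brace]

theorem brace_zero_mid (p : ℕ) (φ γ : O) : S.brace p φ 0 γ = 0 := by simp [brace]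

theorem brace_zero_right (p : ℕ) (φ β : O) : S.brace p φ β 0 = 0 := by simp [brace]

theorem brace_sub_left (p : ℕ) (φ φ' β γ : O) :
    S.brace p (φ - φ') β γ = S.brace p φ β γ - S.brace p φ' β γ := by
  simp [brace, Finset.sum_sub_distrib]

theorem brace_sub_mid (p : ℕ) (φ β β' γ : O) :
    S.brace p φ (β - β') γ = S.brace p φ β γ - S.brace p φ β' γ := by
  simp [brace, Finset.sum_sub_distrib]

theorem brace_sub_right (p : ℕ) (φ β γ γ' : O) :
    S.brace p φ β (γ - γ') = S.brace p φ β γ - S.brace p φ β γ' := by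
  simp [brace, Finset.sum_sub_distrib]

theorem brace_zsmul_left (p : ℕ) (c : ℤ) (φ β γ : O) :
    S.brace p (c • φ) β γ = c • S.brace p φ β γ := by
  simp [brace, Finset.smul_sum]

theorem brace_zsmul_mid (p : ℕ) (c : ℤ) (φ β γ : O) :
    S.brace p φ (c • β) γ = c • S.brace p φ β γ := by
  simp [brace, Finset.smul_sum]

theorem brace_zsmul_right (p : ℕ) (c : ℤ) (φ β γ : O) :
    S.brace p φ β (c • γ) = c • S.brace p φ β γ := by
  simp [brace, Finset.smul_sum]

theorem bar_mem {p q n : ℕ} (h : p + q = n + 1) {φ ψ : O} (hφ : φ ∈ S.deg p) (hψ : ψ ∈ S.deg q) :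
    S.bar p φ ψ ∈ S.deg n := by
  rw [bar_apply]
  refine Submodule.sum_mem _ fun r hr => ?_
  rw [Finset.mem_range] at hr
  obtain ⟨p, rfl⟩ : ∃ p', p = p' + 1 := ⟨p - 1, by omega⟩
  obtain rfl : p + q = n := by omega
  exact S.comp_mem hφ hψ hr

theorem bra_mem {p q n : ℕ} (h : p + q = n + 1) {φ ψ : O} (hφ : φ ∈ S.deg p) (hψ : ψ ∈ S.deg q) :
    S.bra p q φ ψ ∈ S.deg n :=
  sub_mem (S.bar_mem h hφ hψ) (zsmul_mem (S.bar_mem (by omega) hψ hφ) _)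

theorem brace_mem {p q d n : ℕ} (h : p + q + d = n + 2) {φ β γ : O} (hφ : φ ∈ S.deg p)
    (hβ : β ∈ S.deg q) (hγ : γ ∈ S.deg d) : S.brace p φ β γ ∈ S.deg n := by
  refine Submodule.sum_mem _ fun j hj => Submodule.sum_mem _ fun i hi => ?_
  rw [Finset.mem_range] at hi hj
  obtain ⟨p, rfl⟩ : ∃ p', p = p' + 2 := ⟨p - 2, by omega⟩
  obtain rfl : p + q + d = n := by omega
  exact S.comp_mem (p := p + q) (by
    have := S.comp_mem hφ hβ hj
    rwa [show p + 1 + q = p + q + 1 by omega] at this) hγ (by omega)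

theorem bra_swap (p q : ℕ) (φ ψ : O) :
    S.bra p q φ ψ = -(sg ((p - 1 : ℤ) * (q - 1)) • S.bra q p ψ φ) := by
  rw [bra, bra, smul_sub, mul_comm (q - 1 : ℤ), sg_smul_sg_smul]
  abel

theorem bra_zero_right (p q : ℕ) (φ : O) : S.bra p q φ 0 = 0 := by simp [bra]

theorem bra_zero_left (p q : ℕ) (φ : O) : S.bra p q 0 φ = 0 := by simp [bra]

/-- The failure of associativity of the total composition. -/
theorem bar_bar {n d p : ℕ} {x ψ β : O}
    (hx : x ∈ S.deg n) (hψ : ψ ∈ S.deg d) (hβ : β ∈ S.deg p) :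
    S.bar (n + d - 1) (S.bar n x ψ) β =
      S.bar n x (S.bar d ψ β) + S.brace n x ψ β +
        sg ((d - 1 : ℤ) * (p - 1)) • S.brace n x β ψ := by
  rcases Nat.eq_zero_or_pos n with rfl | hn
  · simp [bar, brace]
  have h := S.sum_comp_comp (fun _ => AddMonoidHom.id O) hx hψ hβ
  simp only [AddMonoidHom.id_apply] at h
  simp only [bar_apply, brace, map_sum, LinearMap.sum_apply]
  rw [show n + d - 1 = n - 1 + d by omega, h, Finset.sum_comm (s := Finset.range d),
    add_comm (∑ i ∈ Finset.range n, ∑ j ∈ Finset.range d, _)]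

/-- The brace of a total composition. -/
theorem brace_bar {n d p g N : ℕ} (hN : n + d = N + 1) {x ψ β γ : O}
    (hx : x ∈ S.deg n) (hψ : ψ ∈ S.deg d) (hβ : β ∈ S.deg p) (hγ : γ ∈ S.deg g) :
    S.brace N (S.bar n x ψ) β γ =
      S.bar n x (S.brace d ψ β γ) +
      sg ((d - 1 : ℤ) * (p - 1 + (g - 1))) • S.bar (n + p + g - 2) (S.brace n x β γ) ψ +
      S.brace n x (S.bra d p ψ β) γ +
      sg ((d - 1 : ℤ) * (p - 1)) • S.brace n x β (S.bra d g ψ γ) := by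
  rcases Nat.eq_zero_or_pos n with rfl | hn
  · simp [bar, brace]
  obtain rfl : N = n - 1 + d := by omega
  obtain ⟨f, hf⟩ : ∃ f : ℕ → O →+ O, ∀ m y, f m y = S.comp m y γ :=
    ⟨fun m => ((S.comp m).flip γ).toAddMonoidHom, fun _ _ => rfl⟩
  have h := S.sum_comp_comp_below f hx hψ hβ
  simp only [hf] at h
  have e0 : S.brace (n - 1 + d) (S.bar n x ψ) β γ = ∑ i ∈ Finset.range n,
      ∑ j ∈ Finset.range (n - 1 + d), ∑ m ∈ Finset.range j,
        S.comp m (S.comp j (S.comp i x ψ) β) γ := by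
    simp only [bar_apply, brace, map_sum, LinearMap.sum_apply]
    rw [Finset.sum_comm (s := Finset.range n)]
    exact Finset.sum_congr rfl fun j _ => Finset.sum_comm
  have e1 : ∑ i ∈ Finset.range n, ∑ j ∈ Finset.range d, ∑ m ∈ Finset.range j,
        S.comp (i + m) (S.comp i x (S.comp j ψ β)) γ = S.bar n x (S.brace d ψ β γ) := by
    simp only [bar_apply, brace, map_sum]
    rw [Finset.sum_comm (s := Finset.range n)]
    refine Finset.sum_congr rfl fun j hj => Finset.sum_comm.trans <|
      Finset.sum_congr rfl fun m hm => Finset.sum_congr rfl fun i hi => ?_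
    rw [Finset.mem_range] at hi hj hm
    obtain ⟨d, rfl⟩ : ∃ d', d = d' + 1 := ⟨d - 1, by omega⟩
    exact S.seq hx (S.comp_mem hψ hβ hj) hγ hi (by omega)
  have e2 : ∑ i ∈ Finset.range n, ∑ j ∈ Finset.range d, ∑ m ∈ Finset.range i,
        S.comp m (S.comp i x (S.comp j ψ β)) γ = S.brace n x (S.bar d ψ β) γ := by
    simp only [bar_apply, brace, map_sum, LinearMap.sum_apply]
    exact Finset.sum_congr rfl fun i _ => Finset.sum_comm
  have e3 : ∑ j ∈ Finset.range n, ∑ i ∈ Finset.range j, ∑ m ∈ Finset.range d,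
      S.comp (i + m) (S.comp i (S.comp j x β) ψ) γ = S.brace n x β (S.bar d ψ γ) := by
    simp only [bar_apply, brace, map_sum]
    refine Finset.sum_congr rfl fun j hj => Finset.sum_congr rfl fun i hi =>
      Finset.sum_congr rfl fun m hm => ?_
    rw [Finset.mem_range] at hi hj hm
    obtain ⟨n, rfl⟩ : ∃ n', n = n' + 1 := ⟨n - 1, by omega⟩
    exact S.seq (S.comp_mem hx hβ hj) hψ hγ (by omega) hm
  have e4 : ∑ j ∈ Finset.range n, ∑ i ∈ Finset.range j, ∑ m ∈ Finset.range p,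
      S.comp i (S.comp j x (S.comp m β ψ)) γ = S.brace n x (S.bar p β ψ) γ := by
    simp only [bar_apply, brace, map_sum, LinearMap.sum_apply]
  have e5 : ∑ j ∈ Finset.range n, ∑ i ∈ Finset.range j,
      (∑ l ∈ Finset.range (n - 1 + p - 1 - i), S.comp i (S.comp (i + 1 + l) (S.comp j x β) ψ) γ +
        ∑ m ∈ Finset.range i, S.comp (i + d - 1) (S.comp m (S.comp j x β) ψ) γ) =
      sg ((d - 1 : ℤ) * (g - 1)) • (S.bar (n + p + g - 2) (S.brace n x β γ) ψ -
        S.brace n x β (S.bar g γ ψ)) := by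
    simp only [bar_apply, brace, map_sum, LinearMap.sum_apply]
    rw [← Finset.sum_sub_distrib, Finset.smul_sum]
    refine Finset.sum_congr rfl fun j hj => ?_
    rw [← Finset.sum_sub_distrib, Finset.smul_sum]
    refine Finset.sum_congr rfl fun i hi => ?_
    rw [Finset.mem_range] at hi hj
    obtain ⟨n, rfl⟩ : ∃ n', n = n' + 1 := ⟨n - 1, by omega⟩
    have hy := S.comp_mem hx hβ hj
    generalize S.comp j x β = y at *
    rw [show n + 1 + p + g - 2 = i + g + (n + p - 1 - i) by omega, Finset.sum_range_add,
      Finset.sum_range_add, Finset.sum_congr rfl fun m hm => S.seq hy hγ hψ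
        (by omega : i < n + p) (Finset.mem_range.1 hm)]
    rw [add_right_comm, add_sub_cancel_right, add_comm (∑ l ∈ _, _), smul_add, Finset.smul_sum,
      Finset.smul_sum]
    congr 1
    · refine Finset.sum_congr rfl fun m hm => ?_
      rw [Finset.mem_range] at hm
      rw [S.par hy hγ hψ hm (by omega), mul_comm (g - 1 : ℤ), sg_smul_sg_smul]
    · refine Finset.sum_congr (by congr 1) fun l hl => ?_
      rw [Finset.mem_range] at hl
      rw [S.par' hy hψ hγ (by omega), mul_comm (d - 1 : ℤ), sg_smul_sg_smul]
  rw [e0, h, e1, e2]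
  simp only [Finset.sum_add_distrib, Finset.sum_sub_distrib] at e5 ⊢
  rw [e3, e4, add_assoc (_ - _), e5]
  simp only [bra]
  rw [brace_sub_mid, brace_sub_right, brace_zsmul_mid, brace_zsmul_right,
    mul_add (d - 1 : ℤ) (p - 1 : ℤ) (g - 1 : ℤ), sg_add]
  simp only [smul_add, smul_sub, mul_smul]
  abel

end Oper

end Operad
end HopfCalculus

namespace HopfCalculus

section Operad

variable {k : Type v} [CommRing k] {O : Type u} [AddCommGroup O] [Module k O]

namespace Oper

variable (S : Oper k O)

theorem bra_bra_right {p q r : ℕ} {α β γ : O} :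
    S.bra p (q + r - 1) α (S.bra q r β γ) =
      S.bar p α (S.bar q β γ) - sg ((q - 1 : ℤ) * (r - 1)) • S.bar p α (S.bar r γ β) -
      (sg ((p - 1 : ℤ) * (q - 1)) * sg ((p - 1 : ℤ) * (r - 1))) •
        (S.bar (q + r - 1) (S.bar q β γ) α -
          sg ((q - 1 : ℤ) * (r - 1)) • S.bar (r + q - 1) (S.bar r γ β) α) := by
  rcases Nat.eq_zero_or_pos (q + r) with h | h
  · obtain ⟨rfl, rfl⟩ : q = 0 ∧ r = 0 := by omega
    simp [bra, bar_zero]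
  · rw [bra, bra, add_comm r q, ← sg_add]
    simp only [map_sub, map_zsmul, LinearMap.sub_apply, LinearMap.smul_apply]
    rw [show ((p - 1 : ℤ) * ((q + r - 1 : ℕ) - 1)) = (p - 1) * (q - 1) + (p - 1) * (r - 1) by
      rw [Nat.cast_sub h]; push_cast; ring]

/-- The graded Jacobi identity. -/
theorem jacobi {p q r : ℕ} {α β γ : O} (hα : α ∈ S.deg p) (hβ : β ∈ S.deg q) (hγ : γ ∈ S.deg r) :
    S.bra p (q + r - 1) α (S.bra q r β γ) =
      S.bra (p + q - 1) r (S.bra p q α β) γ +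
        sg ((p - 1 : ℤ) * (q - 1)) • S.bra q (p + r - 1) β (S.bra p r α γ) := by
  have h3 : S.bra (p + q - 1) r (S.bra p q α β) γ = -((sg ((r - 1 : ℤ) * (p - 1)) *
      sg ((r - 1 : ℤ) * (q - 1))) • S.bra r (p + q - 1) γ (S.bra p q α β)) := by
    rcases Nat.eq_zero_or_pos (p + q) with h | h
    · obtain ⟨rfl, rfl⟩ : p = 0 ∧ q = 0 := by omega
      simp [bra, bar_zero]
    · rw [bra_swap, ← sg_add, Nat.cast_sub h]
      congr 3
      push_cast
      ring
  rw [h3, bra_bra_right, bra_bra_right, bra_bra_right, S.bar_bar hα hβ hγ, S.bar_bar hα hγ hβ,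
    S.bar_bar hβ hα hγ, S.bar_bar hβ hγ hα, S.bar_bar hγ hα hβ, S.bar_bar hγ hβ hα,
    mul_comm (q - 1 : ℤ) (p - 1), mul_comm (r - 1 : ℤ) (p - 1), mul_comm (r - 1 : ℤ) (q - 1)]
  rcases sg_eq_or ((p - 1 : ℤ) * (q - 1)) with h | h <;>
  rcases sg_eq_or ((p - 1 : ℤ) * (r - 1)) with h' | h' <;>
  rcases sg_eq_or ((q - 1 : ℤ) * (r - 1)) with h'' | h'' <;>
  · rw [h, h', h'']
    simp only [one_smul, neg_smul, mul_one, mul_neg, neg_neg]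
    abel

theorem bar_mul_mul : S.bar 2 S.mul S.mul = 0 := by
  rw [bar_apply, Finset.sum_range_succ, Finset.sum_range_one, S.mul_mul]

/-- The differential given by the multiplication. -/
def diff (p : ℕ) (φ : O) : O := S.bra 2 p S.mul φ

theorem diff_eq (p : ℕ) (φ : O) :
    S.diff p φ = S.bar 2 S.mul φ - sg (p - 1 : ℤ) • S.bar p φ S.mul := by
  rw [diff, bra]
  norm_num

theorem diff_mem {p : ℕ} {φ : O} (h : φ ∈ S.deg p) : S.diff p φ ∈ S.deg (p + 1) :=
  S.bra_mem (by omega) S.mul_mem h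

theorem diff_zero (p : ℕ) : S.diff p 0 = 0 := by simp [diff_eq]

theorem diff_diff {p : ℕ} {φ : O} (h : φ ∈ S.deg p) : S.diff (p + 1) (S.diff p φ) = 0 := by
  have h1 := S.bar_bar S.mul_mem S.mul_mem h
  have h2 := S.bar_bar S.mul_mem h S.mul_mem
  have h3 := S.bar_bar h S.mul_mem S.mul_mem
  rw [S.bar_mul_mul, map_zero, LinearMap.zero_apply] at h1
  rw [S.bar_mul_mul, map_zero] at h3
  rw [show 2 + p - 1 = p + 1 by omega] at h2
  rw [show p + 2 - 1 = p + 1 by omega] at h3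
  rw [diff_eq, diff_eq, show ((p + 1 : ℕ) - 1 : ℤ) = (p - 1) + 1 by push_cast; ring, sg_add, sg_one]
  simp only [map_sub, map_zsmul, LinearMap.sub_apply, LinearMap.smul_apply]
  rw [h2, h3]
  norm_num at h1 h2 h3 ⊢
  rw [add_assoc] at h1
  rw [eq_neg_of_add_eq_zero_left h1.symm]
  rcases sg_eq_or (p - 1 : ℤ) with h' | h' <;>
  · rw [h']
    simp only [one_smul, neg_smul]
    abel

theorem diff_bra {p q : ℕ} {β γ : O} (hβ : β ∈ S.deg p) (hγ : γ ∈ S.deg q) :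
    S.diff (p + q - 1) (S.bra p q β γ) =
      S.bra (p + 1) q (S.diff p β) γ + sg (p - 1 : ℤ) • S.bra p (q + 1) β (S.diff q γ) := by
  have h := S.jacobi S.mul_mem hβ hγ
  rw [show 2 + p - 1 = p + 1 by omega, show 2 + q - 1 = q + 1 by omega] at h
  rw [diff, h, diff, diff]
  norm_num

/-- The cup product, with a sign. -/
def cupM (β γ : O) : O := S.brace 2 S.mul β γ

theorem cupM_mem {p q : ℕ} {β γ : O} (hβ : β ∈ S.deg p) (hγ : γ ∈ S.deg q) :
    S.cupM β γ ∈ S.deg (p + q) :=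
  S.brace_mem (by omega) S.mul_mem hβ hγ

theorem cupM_eq (β γ : O) : S.cupM β γ = S.comp 0 (S.comp 1 S.mul β) γ := by
  simp [cupM, brace, Finset.sum_range_succ]

theorem diff_cupM {p q : ℕ} {β γ : O} (hβ : β ∈ S.deg p) (hγ : γ ∈ S.deg q) :
    S.diff (p + q) (S.cupM β γ) =
      -S.cupM (S.diff p β) γ - sg (p - 1 : ℤ) • S.cupM β (S.diff q γ) := by
  have h := S.brace_bar (N := 3) (by omega) S.mul_mem S.mul_mem hβ hγ
  rw [S.bar_mul_mul, brace_zero_left, show 2 + p + q - 2 = p + q by omega] at h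
  rw [diff_eq, cupM, cupM, cupM, diff, diff]
  norm_num at h ⊢
  rw [add_assoc, add_assoc] at h
  rw [eq_neg_of_add_eq_zero_left h.symm, sg_congr (a := p + q - 1) (b := p - 1 + (q - 1) + 1) 0
    (by ring), sg_add _ 1, sg_one]
  norm_num
  abel

/-- The cup product is commutative up to homotopy. -/
theorem cupM_comm {p q : ℕ} {φ ψ : O} (hφ : φ ∈ S.deg p) (hψ : ψ ∈ S.deg q) :
    S.cupM φ ψ + sg ((p - 1 : ℤ) * (q - 1)) • S.cupM ψ φ =
      S.bar (p + 1) (S.diff p φ) ψ + sg (p - 1 : ℤ) • S.bar p φ (S.diff q ψ) -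
        S.diff (p + q - 1) (S.bar p φ ψ) := by
  have h1 := S.bar_bar S.mul_mem hφ hψ
  have h2 := S.bar_bar hφ S.mul_mem hψ
  have h3 := S.bar_bar hφ hψ S.mul_mem
  rw [show 2 + p - 1 = p + 1 by omega] at h1
  rw [show p + 2 - 1 = p + 1 by omega] at h2
  have h4 : sg ((p + q - 1 : ℕ) - 1 : ℤ) • S.bar (p + q - 1) (S.bar p φ ψ) S.mul =
      (sg (p - 1 : ℤ) * sg (q - 1 : ℤ)) • S.bar (p + q - 1) (S.bar p φ ψ) S.mul := by
    rcases Nat.eq_zero_or_pos (p + q) with h | h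
    · obtain ⟨rfl, rfl⟩ : p = 0 ∧ q = 0 := by omega
      simp [bar_zero]
    · rw [← sg_add, Nat.cast_sub h]
      congr 2
      push_cast
      ring
  rw [diff_eq, diff_eq, diff_eq, h4]
  simp only [map_sub, map_zsmul, LinearMap.sub_apply, LinearMap.smul_apply]
  rw [h1, h2, h3, cupM, cupM]
  norm_num
  rcases sg_eq_or (p - 1 : ℤ) with h | h <;> rcases sg_eq_or (q - 1 : ℤ) with h' | h' <;>
  · rw [h, h']
    simp only [one_smul, neg_smul, mul_one, mul_neg, neg_neg]
    abel

/-- The Leibniz rule for the bracket and the cup product, up to homotopy. -/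
theorem bra_cupM {n p q : ℕ} {α β γ : O} (hα : α ∈ S.deg n) (hβ : β ∈ S.deg p)
    (hγ : γ ∈ S.deg q) :
    sg (n - 1 : ℤ) • S.bra n (p + q) α (S.cupM β γ) =
      S.cupM (S.bra n p α β) γ + sg ((n - 1 : ℤ) * (p - 1)) • S.cupM β (S.bra n q α γ) +
      S.diff (n + p + q - 2) (S.brace n α β γ) -
      S.brace (n + 1) (S.diff n α) β γ -
      sg (n - 1 : ℤ) • S.brace n α (S.diff p β) γ -
      (sg (n - 1 : ℤ) * sg (p - 1 : ℤ)) • S.brace n α β (S.diff q γ) := by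
  have h1 := S.brace_bar (N := n + 1) (by omega) S.mul_mem hα hβ hγ
  have h2 := S.brace_bar (N := n + 1) (by omega) hα S.mul_mem hβ hγ
  rw [show 2 + p + q - 2 = p + q by omega] at h1
  have h4 : sg ((n + p + q - 2 : ℕ) - 1 : ℤ) • S.bar (n + p + q - 2) (S.brace n α β γ) S.mul =
      (sg (n - 1 : ℤ) * (sg (p - 1 : ℤ) * sg (q - 1 : ℤ))) •
        S.bar (n + p + q - 2) (S.brace n α β γ) S.mul := by
    by_cases h : 2 ≤ n
    · rw [← sg_add, ← sg_add, Nat.cast_sub (by omega)]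
      congr 2
      push_cast
      ring
    · have : S.brace n α β γ = 0 := by
        obtain rfl | rfl : n = 0 ∨ n = 1 := by omega
        all_goals simp [brace]
      simp [this]
  rw [S.diff_eq _ (S.brace n α β γ), h4, S.diff_eq n, brace_sub_left, brace_zsmul_left, h1, h2,
    bra, cupM, cupM, cupM, diff, diff]
  have h5 : ((n - 1 : ℤ) * ((p + q : ℕ) - 1)) = (n - 1) * (p - 1) + (n - 1) * (q - 1) + (n - 1) := by
    push_cast
    ring
  have h6 : ((2 : ℕ) - 1 : ℤ) * (p - 1) = p - 1 := by norm_num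
  have h7 : ((2 : ℕ) - 1 : ℤ) * (p - 1 + (q - 1)) = (p - 1) + (q - 1) := by norm_num
  have h8 : ((2 : ℕ) - 1 : ℤ) * (n - 1) = n - 1 := by norm_num
  have h9 : ((n - 1 : ℤ) * (p - 1 + (q - 1))) = (n - 1) * (p - 1) + (n - 1) * (q - 1) := by ring
  rw [h5, h6, h7, h9, sg_add, sg_add, sg_add]
  generalize sg ((n - 1 : ℤ) * (q - 1)) = e at *
  rcases sg_eq_or (n - 1 : ℤ) with h | h <;> rcases sg_eq_or (p - 1 : ℤ) with h' | h' <;>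
  rcases sg_eq_or (q - 1 : ℤ) with h'' | h'' <;>
  · rw [h, h', h'']
    simp only [one_smul, neg_smul, mul_one, mul_neg, neg_neg, smul_sub, smul_add]
    abel

end Oper

end Operad
end HopfCalculus

namespace HopfCalculus

section CycMod

variable {k : Type v} [CommRing k] {O : Type u} [AddCommGroup O] [Module k O]
variable (k) in
/-- A cyclic unital module over an operad with multiplication, as a graded module `X` with the
signed cyclic operator `rot 1` and the operators `G φ` that apply `φ` to the last arguments after
the extra degeneracy. -/
structure CycMod (S : Oper k O) (X : Type u) [AddCommGroup X] [Module k X] where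
  /-- the chains of degree `n` -/
  deg : ℕ → Submodule k X
  /-- the powers of the signed cyclic operator -/
  rot : ℤ → X →ₗ[k] X
  /-- the application of an operation -/
  app : O →ₗ[k] X →ₗ[k] X
  rot_zero : ∀ x, rot 0 x = x
  rot_rot : ∀ a b x, rot a (rot b x) = rot (a + b) x
  rot_mem : ∀ {n x} a, x ∈ deg n → rot a x ∈ deg n
  rot_period : ∀ {n x}, x ∈ deg n → rot (n + 1) x = x
  app_mem : ∀ {m p n φ x}, m + p = n + 1 → φ ∈ S.deg p → x ∈ deg n → app φ x ∈ deg m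
  app_zero : ∀ {p n φ x}, n + 1 < p → φ ∈ S.deg p → x ∈ deg n → app φ x = 0
  app_comp : ∀ {p q n r φ ψ x}, φ ∈ S.deg p → ψ ∈ S.deg q → x ∈ deg n → r < p →
    app (S.comp r φ ψ) x = app φ (rot r (app ψ (rot (-r) x)))
  app_app : ∀ {p q n r : ℕ} {φ ψ x}, φ ∈ S.deg p → ψ ∈ S.deg q → x ∈ deg n → p ≤ r →
    q + r ≤ n + 1 → app φ (rot r (app ψ (rot (-r) x))) =
      sg ((p - 1 : ℤ) * (q - 1)) • rot (r - p + 1) (app ψ (rot (-(r - p + 1)) (app φ x)))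
  app_one : ∀ {n x}, x ∈ deg n → app S.one x = x

namespace CycMod

variable {S : Oper k O} {X : Type u} [AddCommGroup X] [Module k X] (M : CycMod k S X)

theorem rot_add_period {n : ℕ} {x : X} (hx : x ∈ M.deg n) (a : ℤ) :
    M.rot (a + (n + 1)) x = M.rot a x := by
  rw [← M.rot_rot, M.rot_period hx]

theorem rot_sub_period {n : ℕ} {x : X} (hx : x ∈ M.deg n) (a : ℤ) :
    M.rot (a - (n + 1)) x = M.rot a x := by
  rw [← M.rot_add_period hx, sub_add_cancel]

/-- `G_φ t^i` -/
def appRot (i : ℤ) : O →ₗ[k] X →ₗ[k] X := (M.rot i).lcomp k X ∘ₗ M.app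

theorem appRot_apply (i : ℤ) (φ : O) (x : X) : M.appRot i φ x = M.app φ (M.rot i x) := rfl

theorem appRot_mem {m p n : ℕ} (h : m + p = n + 1) (i : ℤ) {φ : O} {x : X} (hφ : φ ∈ S.deg p)
    (hx : x ∈ M.deg n) : M.appRot i φ x ∈ M.deg m :=
  M.app_mem h hφ (M.rot_mem i hx)

/-- `∑_{i < q} G_ψ t^i` -/
def lieTail (q : ℕ) (ψ : O) : X →ₗ[k] X := ∑ i ∈ Finset.range q, M.appRot i ψ

theorem lieTail_apply (q : ℕ) (ψ : O) (x : X) :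
    M.lieTail q ψ x = ∑ i ∈ Finset.range q, M.appRot i ψ x := by
  simp [lieTail, LinearMap.sum_apply]

/-- `∑_{0 < l ≤ n + 1 - q} t^l G_ψ t^{-l}` on chains of degree `n` -/
def lieHead (n q : ℕ) (ψ : O) : X →ₗ[k] X :=
  ∑ l ∈ Finset.range (n + 1 - q), M.rot (l + 1) ∘ₗ M.app ψ ∘ₗ M.rot (-(l + 1))

theorem lieHead_apply (n q : ℕ) (ψ : O) (x : X) : M.lieHead n q ψ x =
    ∑ l ∈ Finset.range (n + 1 - q), M.rot (l + 1) (M.app ψ (M.rot (-(l + 1)) x)) := by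
  simp [lieHead, LinearMap.sum_apply]

/-- The Lie derivative on chains of degree `n` along an operation with `q` arguments. -/
def lieD (n q : ℕ) (ψ : O) : X →ₗ[k] X := M.lieHead n q ψ + M.lieTail q ψ

theorem lieD_apply (n q : ℕ) (ψ : O) (x : X) :
    M.lieD n q ψ x = M.lieHead n q ψ x + M.lieTail q ψ x := rfl

/-- `∑_{i < j < p} G_{χ ∘_j β} t^i` -/
def contr (p : ℕ) (χ β : O) : X →ₗ[k] X :=
  ∑ j ∈ Finset.range p, ∑ i ∈ Finset.range j, M.appRot i (S.comp j χ β)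

theorem contr_apply (p : ℕ) (χ β : O) (x : X) : M.contr p χ β x =
    ∑ j ∈ Finset.range p, ∑ i ∈ Finset.range j, M.appRot i (S.comp j χ β) x := by
  simp [contr, LinearMap.sum_apply]

theorem appRot_appRot {p q n r : ℕ} (i : ℤ) {φ ψ : O} {x : X} (hφ : φ ∈ S.deg p)
    (hψ : ψ ∈ S.deg q) (hx : x ∈ M.deg n) (hr : r < p) :
    M.appRot r φ (M.appRot i ψ x) = M.appRot (r + i) (S.comp r φ ψ) x := by
  rw [appRot_apply, appRot_apply, appRot_apply, M.app_comp hφ hψ (M.rot_mem _ hx) hr, M.rot_rot]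
  congr 5
  ring

theorem appRot_lieHead {p q n i : ℕ} {φ ψ : O} {x : X} (hφ : φ ∈ S.deg p)
    (hψ : ψ ∈ S.deg q) (hx : x ∈ M.deg n) (hi : i < p) :
    ∑ l ∈ Finset.range (p - 1 - i), M.appRot i (S.comp (i + 1 + l) φ ψ) x +
      ∑ r ∈ Finset.range i, M.appRot (i + q - 1 : ℕ) (S.comp r φ ψ) x =
    M.appRot i φ (M.lieHead n q ψ x) -
      sg ((p - 1 : ℤ) * (q - 1)) • M.lieHead (n + 1 - p) q ψ (M.appRot i φ x) := by
  have hc : ∀ r, r < p → S.comp r φ ψ ∈ S.deg (p - 1 + q) := fun r hr => by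
    obtain ⟨p, rfl⟩ : ∃ p', p = p' + 1 := ⟨p - 1, by omega⟩
    exact S.comp_mem hφ hψ hr
  by_cases h : p + q ≤ n + 2
  · have h0 : M.lieHead (n + 1 - p) q ψ (M.appRot i φ x) = ∑ l ∈ Finset.range (n + 2 - p - q),
        M.rot (l + 1) (M.app ψ (M.rot (-(l + 1)) (M.appRot i φ x))) := by
      by_cases hp : p ≤ n + 1
      · rw [lieHead_apply, show n + 1 - p + 1 - q = n + 2 - p - q by omega]
      · rw [appRot_apply, M.app_zero (by omega) hφ (M.rot_mem _ hx)]
        simp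
    rw [h0, lieHead_apply, map_sum,
      show n + 1 - q = (p - 1 - i) + (n + 2 - p - q) + i by omega,
      Finset.sum_range_add, Finset.sum_range_add, Finset.smul_sum, add_right_comm, add_sub_assoc,
      ← Finset.sum_sub_distrib, Finset.sum_eq_zero (s := Finset.range (n + 2 - p - q)), add_zero]
    · congr 1
      · refine Finset.sum_congr rfl fun l hl => ?_
        rw [Finset.mem_range] at hl
        rw [appRot_apply, M.app_comp hφ hψ (M.rot_mem _ hx) (by omega), appRot_apply, M.rot_rot,
          M.rot_rot, show -((i + 1 + l : ℕ) : ℤ) + i = -(l + 1) by push_cast; ring,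
          show ((i + 1 + l : ℕ) : ℤ) = i + (l + 1) by push_cast; ring]
      · refine Finset.sum_congr rfl fun l hl => ?_
        rw [Finset.mem_range] at hl
        have e1 : (((p - 1 - i + (n + 2 - p - q) + l : ℕ) : ℤ) + 1) = l + (n + 2 - q) - i := by
          omega
        have hm := M.app_mem (m := n + 1 - q) (by omega) hψ
          (M.rot_mem (-(l + (n + 2 - q) - i : ℤ)) hx)
        rw [e1, appRot_apply, appRot_apply, M.rot_rot, M.app_comp hφ hψ (M.rot_mem _ hx) (by omega),
          M.rot_rot, show (i : ℤ) + (l + (n + 2 - q) - i) = l + ((n + 1 - q : ℕ) + 1) by omega,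
          M.rot_add_period hm, ← M.rot_sub_period hx (-(l : ℤ) + _)]
        congr 5
        omega
    · intro l hl
      rw [Finset.mem_range] at hl
      have h1 := M.app_app (r := p + l) hφ hψ (M.rot_mem i hx) (by omega) (by omega)
      rw [sub_eq_zero, appRot_apply, appRot_apply, M.rot_rot]
      rw [M.rot_rot] at h1
      convert h1 using 4
      · omega
      · congr 2; omega
      · omega
      · congr 2; omega
  · have h1 : ∀ (r j : ℕ), r < p → M.appRot j (S.comp r φ ψ) x = 0 := fun r j hr => by
      rw [appRot_apply, M.app_zero (by omega) (hc r hr) (M.rot_mem _ hx)]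
    rw [Finset.sum_eq_zero, Finset.sum_eq_zero, lieHead_apply, map_sum, Finset.sum_eq_zero,
      lieHead_apply]
    · by_cases hp : p ≤ n + 1
      · rw [show n + 1 - p + 1 - q = 0 by omega]
        simp
      · rw [appRot_apply, M.app_zero (by omega) hφ (M.rot_mem _ hx)]
        simp
    · intro l hl
      rw [Finset.mem_range] at hl
      rw [appRot_apply, M.app_zero (n := n + 1 - q) (by omega) hφ]
      exact M.rot_mem _ (M.rot_mem _ (M.app_mem (by omega) hψ (M.rot_mem _ hx)))
    · intro r hr
      rw [Finset.mem_range] at hr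
      exact h1 r _ (by omega)
    · intro r hr
      rw [Finset.mem_range] at hr
      exact h1 _ _ (by omega)

/-- The contraction with a total composition. -/
theorem contr_bar {n d p m N : ℕ} (hN : n + d = N + 1) {χ ψ β : O} {x : X} (hχ : χ ∈ S.deg n)
    (hψ : ψ ∈ S.deg d) (hβ : β ∈ S.deg p) (hx : x ∈ M.deg m) :
    M.contr N (S.bar n χ ψ) β x =
      M.lieTail n χ (M.contr d ψ β x) +
      sg ((d - 1 : ℤ) * (p - 1)) • M.contr n χ β (M.lieD m d ψ x) -
      sg ((n - 1 : ℤ) * (d - 1)) • M.lieHead (m + 2 - n - p) d ψ (M.contr n χ β x) +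
      M.contr n χ (S.bra d p ψ β) x := by
  rcases Nat.eq_zero_or_pos n with rfl | hn
  · simp [S.bar_zero, contr_apply, lieTail_apply]
  obtain rfl : N = n - 1 + d := by omega
  obtain ⟨f, hf⟩ : ∃ f : ℕ → O →+ X, ∀ i y, f i y = M.appRot i y x :=
    ⟨fun i => ((M.appRot i).flip x).toAddMonoidHom, fun _ _ => rfl⟩
  have h := S.sum_comp_comp_below f hχ hψ hβ
  simp only [hf] at h
  have e0 : M.contr (n - 1 + d) (S.bar n χ ψ) β x = ∑ i ∈ Finset.range n,
      ∑ j ∈ Finset.range (n - 1 + d), ∑ l ∈ Finset.range j,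
        M.appRot l (S.comp j (S.comp i χ ψ) β) x := by
    simp only [Oper.bar_apply, contr_apply, map_sum, LinearMap.sum_apply]
    rw [Finset.sum_comm (s := Finset.range n)]
    exact Finset.sum_congr rfl fun j _ => Finset.sum_comm
  have e1 : ∑ i ∈ Finset.range n, ∑ j ∈ Finset.range d, ∑ l ∈ Finset.range j,
      M.appRot (i + l : ℕ) (S.comp i χ (S.comp j ψ β)) x = M.lieTail n χ (M.contr d ψ β x) := by
    simp only [lieTail_apply, contr_apply, map_sum]
    rw [Finset.sum_comm (s := Finset.range n)]
    refine Finset.sum_congr rfl fun j hj => Finset.sum_comm.trans <|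
      Finset.sum_congr rfl fun l hl => Finset.sum_congr rfl fun i hi => ?_
    rw [Finset.mem_range] at hi hj hl
    obtain ⟨d, rfl⟩ : ∃ d', d = d' + 1 := ⟨d - 1, by omega⟩
    rw [M.appRot_appRot _ hχ (S.comp_mem hψ hβ hj) hx hi, Nat.cast_add]
  have e2 : ∑ i ∈ Finset.range n, ∑ j ∈ Finset.range d, ∑ l ∈ Finset.range i,
        M.appRot l (S.comp i χ (S.comp j ψ β)) x = M.contr n χ (S.bar d ψ β) x := by
    simp only [Oper.bar_apply, contr_apply, map_sum, LinearMap.sum_apply]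
    exact Finset.sum_congr rfl fun i _ => Finset.sum_comm
  have e3 : ∑ j ∈ Finset.range n, ∑ i ∈ Finset.range j, ∑ l ∈ Finset.range d,
      M.appRot (i + l : ℕ) (S.comp i (S.comp j χ β) ψ) x = M.contr n χ β (M.lieTail d ψ x) := by
    simp only [lieTail_apply, contr_apply, map_sum]
    rw [Finset.sum_comm (s := Finset.range d)]
    refine Finset.sum_congr rfl fun j hj => Finset.sum_comm.trans <|
      Finset.sum_congr rfl fun l hl => Finset.sum_congr rfl fun i hi => ?_
    rw [Finset.mem_range] at hi hj hl
    obtain ⟨n, rfl⟩ : ∃ n', n = n' + 1 := ⟨n - 1, by omega⟩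
    rw [M.appRot_appRot _ (S.comp_mem hχ hβ hj) hψ hx (by omega), Nat.cast_add]
  have e4 : ∑ j ∈ Finset.range n, ∑ i ∈ Finset.range j, ∑ l ∈ Finset.range p,
      M.appRot i (S.comp j χ (S.comp l β ψ)) x = M.contr n χ (S.bar p β ψ) x := by
    simp only [Oper.bar_apply, contr_apply, map_sum, LinearMap.sum_apply]
  have e5 : ∑ j ∈ Finset.range n, ∑ i ∈ Finset.range j,
      (∑ l ∈ Finset.range (n - 1 + p - 1 - i), M.appRot i (S.comp (i + 1 + l) (S.comp j χ β) ψ) x +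
        ∑ l ∈ Finset.range i, M.appRot (i + d - 1 : ℕ) (S.comp l (S.comp j χ β) ψ) x) =
      M.contr n χ β (M.lieHead m d ψ x) -
        (sg ((n - 1 : ℤ) * (d - 1)) * sg ((d - 1 : ℤ) * (p - 1))) •
          M.lieHead (m + 2 - n - p) d ψ (M.contr n χ β x) := by
    rw [contr_apply, contr_apply]
    simp only [map_sum, Finset.smul_sum, ← Finset.sum_sub_distrib]
    refine Finset.sum_congr rfl fun j hj => Finset.sum_congr rfl fun i hi => ?_
    rw [Finset.mem_range] at hi hj
    obtain ⟨n, rfl⟩ : ∃ n', n = n' + 1 := ⟨n - 1, by omega⟩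
    rw [show n + 1 - 1 + p = n + p by omega,
      M.appRot_lieHead (S.comp_mem hχ hβ hj) hψ hx (by omega),
      show m + 1 - (n + p) = m + 2 - (n + 1) - p by omega, ← sg_add]
    congr 3
    push_cast
    ring
  rw [e0, h, e1, e2]
  simp only [Finset.sum_add_distrib, Finset.sum_sub_distrib] at e5 ⊢
  rw [e3, e4, add_assoc (_ - _), e5, lieD_apply, Oper.bra]
  have e6 : M.contr n χ (S.bar d ψ β - sg ((d - 1 : ℤ) * (p - 1)) • S.bar p β ψ) x =
      M.contr n χ (S.bar d ψ β) x - sg ((d - 1 : ℤ) * (p - 1)) • M.contr n χ (S.bar p β ψ) x := by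
    simp [contr_apply, Finset.smul_sum, Finset.sum_sub_distrib]
  rw [e6]
  generalize sg ((n - 1 : ℤ) * (d - 1)) = e
  rcases sg_eq_or ((d - 1 : ℤ) * (p - 1)) with h | h <;>
  · rw [h]
    simp only [one_smul, neg_smul, mul_one, mul_neg, map_add]
    abel

end CycMod
end CycMod
end HopfCalculus

namespace HopfCalculus

section CycMod

variable {k : Type v} [CommRing k] {O : Type u} [AddCommGroup O] [Module k O]

namespace CycMod

variable {S : Oper k O} {X : Type u} [AddCommGroup X] [Module k X] (M : CycMod k S X)

theorem contr_zero_left (p : ℕ) (β : O) (x : X) : M.contr p 0 β x = 0 := by simp [contr_apply]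

theorem contr_zero_mid (p : ℕ) (χ : O) (x : X) : M.contr p χ 0 x = 0 := by simp [contr_apply]

theorem contr_sub_left (p : ℕ) (χ χ' β : O) (x : X) :
    M.contr p (χ - χ') β x = M.contr p χ β x - M.contr p χ' β x := by
  simp [contr_apply, Finset.sum_sub_distrib]

theorem contr_zsmul_left (p : ℕ) (c : ℤ) (χ β : O) (x : X) :
    M.contr p (c • χ) β x = c • M.contr p χ β x := by
  simp [contr_apply, Finset.smul_sum]

/-- The cap product, with a sign. -/
def capD (β : O) : X →ₗ[k] X := M.contr 2 S.mul β

theorem capD_apply (β : O) (x : X) : M.capD β x = M.app (S.comp 1 S.mul β) x := by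
  simp [capD, contr_apply, Finset.sum_range_succ, appRot_apply, M.rot_zero]

theorem comp_one_mul_mem {p : ℕ} {β : O} (hβ : β ∈ S.deg p) : S.comp 1 S.mul β ∈ S.deg (p + 1) := by
  rw [add_comm]
  exact S.comp_mem S.mul_mem hβ (by omega)

theorem capD_mem {m p n : ℕ} (h : m + p = n) {β : O} {x : X} (hβ : β ∈ S.deg p)
    (hx : x ∈ M.deg n) : M.capD β x ∈ M.deg m := by
  rw [capD_apply]
  exact M.app_mem (by omega) (comp_one_mul_mem hβ) hx

theorem capD_of_lt {p n : ℕ} (h : n < p) {β : O} {x : X} (hβ : β ∈ S.deg p)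
    (hx : x ∈ M.deg n) : M.capD β x = 0 := by
  rw [capD_apply]
  exact M.app_zero (by omega) (comp_one_mul_mem hβ) hx

/-- The differential, with a sign. -/
def bd (n : ℕ) : X →ₗ[k] X := M.lieD n 2 S.mul

theorem bd_capD {m p : ℕ} {β : O} {x : X} (hβ : β ∈ S.deg p) (hx : x ∈ M.deg m) :
    M.bd (m - p) (M.capD β x) + sg (p - 1 : ℤ) • M.capD β (M.bd m x) + M.capD (S.diff p β) x = 0 := by
  have h := M.contr_bar (N := 3) (by omega) S.mul_mem S.mul_mem hβ hx
  rw [S.bar_mul_mul, contr_zero_left, show m + 2 - 2 - p = m - p by omega] at h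
  rw [h, bd, capD, capD, bd, lieD_apply, Oper.diff]
  norm_num
  abel

/-- The formula for the commutator of the contraction and the Lie derivative. -/
theorem capD_lieD {n p m : ℕ} {α β : O} {x : X} (hα : α ∈ S.deg n) (hβ : β ∈ S.deg p)
    (hx : x ∈ M.deg m) :
    M.contr (n + 1) (S.diff n α) β x =
      M.bd (m + 2 - n - p) (M.contr n α β x) -
      (sg (n - 1 : ℤ) * sg (p - 1 : ℤ)) • M.contr n α β (M.bd m x) +
      sg ((n - 1 : ℤ) * (p - 1)) • M.capD β (M.lieD m n α x) -
      sg (n - 1 : ℤ) • M.lieD (m - p) n α (M.capD β x) + M.capD (S.bra n p α β) x -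
      sg (n - 1 : ℤ) • M.contr n α (S.diff p β) x := by
  have h1 := M.contr_bar (N := n + 1) (by omega) S.mul_mem hα hβ hx
  have h2 := M.contr_bar (N := n + 1) (by omega) hα S.mul_mem hβ hx
  rw [show m + 2 - 2 - p = m - p by omega] at h1
  have h6 : ((2 : ℕ) - 1 : ℤ) * (p - 1) = p - 1 := by norm_num
  have h7 : ((2 : ℕ) - 1 : ℤ) * (n - 1) = n - 1 := by norm_num
  have h8 : (n - 1 : ℤ) * ((2 : ℕ) - 1) = n - 1 := by norm_num
  rw [h7] at h1
  rw [h6, h8] at h2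
  rw [S.diff_eq n, contr_sub_left, contr_zsmul_left, h1, h2, capD, bd, capD, bd, lieD_apply,
    lieD_apply _ _ _ _ (M.contr 2 S.mul β x),
    lieD_apply _ _ _ _ (M.contr n α β x), Oper.diff]
  generalize sg ((n - 1 : ℤ) * (p - 1)) = e
  rcases sg_eq_or (n - 1 : ℤ) with h | h <;>
  · rw [h]
    simp only [one_smul, neg_smul, smul_add, smul_sub, map_add, one_mul, neg_mul]
    abel

theorem bd_apply {n : ℕ} {x : X} (hx : x ∈ M.deg n) :
    M.bd n x = ∑ i ∈ Finset.range (n + 1), M.rot i (M.app S.mul (M.rot (-i) x)) := by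
  rw [bd, lieD_apply, lieHead_apply, lieTail_apply]
  rcases n with _ | n
  · have h : ∀ a, M.app S.mul (M.rot a x) = 0 := fun a =>
      M.app_zero (by omega) S.mul_mem (M.rot_mem a hx)
    simp [h, appRot_apply]
  · have h := M.app_mem (m := n) (by omega) S.mul_mem (M.rot_mem (-(n + 1)) hx)
    rw [Finset.sum_range_succ _ (n + 1), Finset.sum_range_succ' _ n, show n + 1 + 1 - 2 = n by omega,
      Finset.sum_range_succ _ 1, Finset.sum_range_one, appRot_apply, appRot_apply]
    push_cast
    rw [M.rot_period h, ← M.rot_sub_period hx 1]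
    push_cast
    rw [show (1 : ℤ) - (n + 1 + 1) = -(n + 1) by ring]
    simp only [M.rot_zero, neg_zero]
    abel

theorem bd_mem {n : ℕ} {x : X} (hx : x ∈ M.deg (n + 1)) : M.bd (n + 1) x ∈ M.deg n := by
  rw [bd_apply _ hx]
  exact Submodule.sum_mem _ fun i _ =>
    M.rot_mem _ (M.app_mem (by omega) S.mul_mem (M.rot_mem _ hx))

theorem bd_zero {x : X} (hx : x ∈ M.deg 0) : M.bd 0 x = 0 := by
  rw [bd_apply _ hx]
  exact Finset.sum_eq_zero fun i _ => by
    rw [M.app_zero (by omega) S.mul_mem (M.rot_mem _ hx), map_zero]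

/-- `b'` -/
def bd' (n : ℕ) : X →ₗ[k] X :=
  ∑ i ∈ Finset.range n, M.rot i ∘ₗ M.app S.mul ∘ₗ M.rot (-i)

theorem bd'_apply (n : ℕ) (x : X) :
    M.bd' n x = ∑ i ∈ Finset.range n, M.rot i (M.app S.mul (M.rot (-i) x)) := by
  simp [bd', LinearMap.sum_apply]

/-- The norm operator. -/
def norm (n : ℕ) : X →ₗ[k] X := ∑ i ∈ Finset.range (n + 1), M.rot i

theorem norm_apply (n : ℕ) (x : X) : M.norm n x = ∑ i ∈ Finset.range (n + 1), M.rot i x := by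
  simp [norm, LinearMap.sum_apply]

theorem norm_mem {n : ℕ} {x : X} (hx : x ∈ M.deg n) : M.norm n x ∈ M.deg n := by
  rw [norm_apply]
  exact Submodule.sum_mem _ fun i _ => M.rot_mem _ hx

theorem rot_one_norm {n : ℕ} {x : X} (hx : x ∈ M.deg n) : M.rot 1 (M.norm n x) = M.norm n x := by
  rw [norm_apply, map_sum, Finset.sum_range_succ, Finset.sum_range_succ', M.rot_rot,
    show (1 : ℤ) + n = n + 1 by ring, M.rot_period hx]
  simp [M.rot_rot, M.rot_zero, add_comm]

theorem rot_of_rot_one {x : X} (h : M.rot 1 x = x) (a : ℤ) : M.rot a x = x := by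
  have h' : M.rot (-1) x = x := by
    conv_lhs => rw [← h]
    rw [M.rot_rot, neg_add_cancel, M.rot_zero]
  induction a with
  | zero => exact M.rot_zero x
  | succ i ih => rw [← M.rot_rot, h, ih]
  | pred i ih => rw [sub_eq_add_neg, ← M.rot_rot, h', ih]

theorem rot_norm {n : ℕ} {x : X} (hx : x ∈ M.deg n) (a : ℤ) : M.rot a (M.norm n x) = M.norm n x :=
  M.rot_of_rot_one (M.rot_one_norm hx) a

theorem norm_rot {n : ℕ} {x : X} (hx : x ∈ M.deg n) (a : ℤ) : M.norm n (M.rot a x) = M.norm n x := by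
  rw [← M.rot_norm hx a, norm_apply, norm_apply, map_sum]
  simp only [M.rot_rot, add_comm]

theorem bd'_norm {n : ℕ} {x : X} (hx : x ∈ M.deg (n + 1)) :
    M.bd' (n + 1) (M.norm (n + 1) x) = M.norm n (M.bd (n + 1) x) := by
  have h : ∀ a, M.app S.mul (M.rot a x) ∈ M.deg n := fun a =>
    M.app_mem (by omega) S.mul_mem (M.rot_mem a hx)
  rw [bd'_apply, M.bd_apply hx, map_sum]
  simp only [M.rot_norm hx, M.norm_rot (h _)]
  rw [← map_sum, ← map_sum, ← norm_apply]
  congr 2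
  have h1 : ∑ j ∈ Finset.range (n + 1), M.rot (j + 1 : ℕ) x =
      ∑ j ∈ Finset.range (n + 1), M.rot (-(j + 1 : ℕ)) x := by
    rw [← Finset.sum_range_reflect]
    refine Finset.sum_congr rfl fun j hj => ?_
    rw [Finset.mem_range] at hj
    rw [← M.rot_add_period hx (-_)]
    congr 2
    omega
  rw [norm_apply, Finset.sum_range_succ', Finset.sum_range_succ' _ (n + 1), h1, Nat.cast_zero,
    neg_zero]

theorem bd_app_unit {m : ℕ} {x : X} (hx : x ∈ M.deg m) :
    M.bd (m + 1) (M.app S.unit x) = x - M.rot 1 x - M.app S.unit (M.bd' m x) := by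
  have he := M.app_mem (m := m + 1) (by omega) S.unit_mem hx
  have h0 : ∀ y ∈ M.deg m, M.app S.mul (M.app S.unit y) = y := fun y hy => by
    have h := M.app_comp S.mul_mem S.unit_mem hy (by omega : 0 < 2)
    rw [S.mul_unit_left, M.app_one hy] at h
    simpa [M.rot_zero] using h.symm
  have h1 : M.app S.mul (M.rot 1 (M.app S.unit x)) = -M.rot 1 x := by
    have h := M.app_comp S.mul_mem S.unit_mem (M.rot_mem 1 hx) (by omega : 1 < 2)
    rw [S.mul_unit_right, map_neg, LinearMap.neg_apply, M.app_one (M.rot_mem 1 hx)] at h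
    rw [h, Nat.cast_one, M.rot_rot, neg_add_cancel, M.rot_zero]
  rw [M.bd_apply he, Finset.sum_range_succ', Finset.sum_range_succ, bd'_apply, map_sum]
  have h2 : M.rot ((m + 1 : ℕ)) (M.app S.mul (M.rot (-(m + 1 : ℕ)) (M.app S.unit x))) =
      -M.rot 1 x := by
    rw [← M.rot_add_period he, show -((m + 1 : ℕ) : ℤ) + ((m + 1 : ℕ) + 1) = 1 by ring, h1, map_neg,
      Nat.cast_add, Nat.cast_one, M.rot_period (M.rot_mem 1 hx)]
  rw [h2]
  simp only [Nat.cast_zero, neg_zero, M.rot_zero, h0 x hx]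
  have h3 : ∑ j ∈ Finset.range m, M.rot ((j + 1 : ℕ))
      (M.app S.mul (M.rot (-(j + 1 : ℕ)) (M.app S.unit x))) =
      -∑ j ∈ Finset.range m, M.app S.unit (M.rot j (M.app S.mul (M.rot (-j) x))) := by
    rw [← Finset.sum_neg_distrib]
    refine Finset.sum_congr rfl fun j hj => ?_
    rw [Finset.mem_range] at hj
    obtain ⟨m, rfl⟩ : ∃ m', m = m' + 1 := ⟨m - 1, by omega⟩
    have h4 := M.app_app (r := m + 2 - j) S.mul_mem S.unit_mem (M.rot_mem (m + 2 - j : ℕ) hx)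
      (by omega) (by omega)
    have h5 : M.app S.mul (M.rot (-j) x) ∈ M.deg m :=
      M.app_mem (by omega) S.mul_mem (M.rot_mem _ hx)
    have h6 := M.rot_sub_period h5 j
    have h7 := M.rot_period (M.app_mem (m := m + 1) (by omega) S.unit_mem (M.rot_mem j h5))
    rw [M.rot_rot, neg_add_cancel, M.rot_zero, ← M.rot_sub_period hx ((m + 2 - j : ℕ)),
      show ((m + 2 - j : ℕ) - ((m + 1 : ℕ) + 1) : ℤ) = -j by omega,
      show (-((m + 2 - j : ℕ) - (2 : ℕ) + 1) : ℤ) = j - (m + 1) by omega, h6] at h4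
    rw [← M.rot_add_period he, show -((j + 1 : ℕ) : ℤ) + ((m + 1 + 1 : ℕ) + 1) = (m + 2 - j : ℕ) by
      omega, h4, map_zsmul, M.rot_rot, show ((j + 1 : ℕ) : ℤ) + ((m + 2 - j : ℕ) - (2 : ℕ) + 1) =
      ((m + 1 : ℕ) + 1) by omega, h7]
    norm_num [sg_neg]
  rw [h3]
  abel

theorem rot_sub_bd' {m : ℕ} {x : X} (hx : x ∈ M.deg m) :
    M.bd' m x - M.rot 1 (M.bd' m x) = M.bd m (x - M.rot 1 x) := by
  rw [map_sub, M.bd_apply hx, M.bd_apply (M.rot_mem 1 hx), bd'_apply]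
  rcases m with _ | m
  · have h : ∀ a, M.app S.mul (M.rot a x) = 0 := fun a =>
      M.app_zero (by omega) S.mul_mem (M.rot_mem a hx)
    simp [h, M.rot_rot]
  · have h := M.app_mem (m := m) (by omega) S.mul_mem (M.rot_mem (-((m + 1 : ℕ) : ℤ)) hx)
    have h1 := M.rot_period h
    rw [← M.rot_add_period hx (-((m + 1 : ℕ) : ℤ)), show (-((m + 1 : ℕ) : ℤ) + ((m + 1 : ℕ) + 1)) = 1
      by ring] at h1
    rw [Finset.sum_range_succ _ (m + 1), Finset.sum_range_succ' _ (m + 1), map_sum,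
      ← M.rot_add_period hx (-((m + 1 : ℕ) : ℤ)), show (-((m + 1 : ℕ) : ℤ) + ((m + 1 : ℕ) + 1)) = 1
      by ring, Nat.cast_add m 1, Nat.cast_one, h1]
    simp only [M.rot_rot, M.rot_zero, Nat.cast_zero, neg_zero, Nat.cast_add, Nat.cast_one,
      zero_add, neg_add, neg_add_cancel_right, add_comm (1 : ℤ)]
    abel

end CycMod
end CycMod
end HopfCalculus

namespace HopfCalculus

theorem sum_range_rearrange {Z : Type*} [AddCommMonoid Z] (r N : ℕ) (h : ℤ → ℤ → Z) :
    ∑ l ∈ Finset.range r, (∑ i ∈ Finset.range (l + 1), h (i + 1) (i - l) +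
        ∑ c ∈ Finset.range (r + N - l), h (l + c + 1) (c + 1)) =
      ∑ l ∈ Finset.range r, ∑ c ∈ Finset.range N, h (r + c + 1) (r + c + 1 - l) +
      ∑ c ∈ Finset.range r, ∑ l ∈ Finset.range (r + 1), h (c + 1) (c + 1 - l) := by
  have h1 : ∀ l, l ≤ r → ∑ i ∈ Finset.range l, h (i + 1) (i + 1 - l) +
      ∑ c ∈ Finset.range (r + N - l), h (l + c + 1) (c + 1) =
      ∑ i ∈ Finset.range (r + N), h (i + 1) (i + 1 - l) := fun l hl => by
    conv_rhs => rw [show r + N = l + (r + N - l) by omega, Finset.sum_range_add]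
    congr 1
    refine Finset.sum_congr rfl fun c _ => ?_
    push_cast
    congr 1
    ring
  have h2 : ∑ l ∈ Finset.range r, ∑ i ∈ Finset.range (l + 1), h (i + 1) (i - l) =
      ∑ l ∈ Finset.range r, ∑ i ∈ Finset.range l, h (i + 1) (i + 1 - l) +
        ∑ i ∈ Finset.range r, h (i + 1) (i + 1 - r) := by
    rw [← Finset.sum_range_succ (fun l : ℕ => ∑ i ∈ Finset.range l, h (i + 1) (i + 1 - l)),
      Finset.sum_range_succ', Finset.range_zero, Finset.sum_empty, add_zero]
    refine Finset.sum_congr rfl fun l _ => Finset.sum_congr rfl fun i _ => ?_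
    push_cast
    congr 1
    ring
  rw [Finset.sum_add_distrib, h2, add_right_comm, ← Finset.sum_add_distrib,
    Finset.sum_congr rfl fun l hl => h1 l (Finset.mem_range.1 hl).le,
    Finset.sum_comm (s := Finset.range r) (t := Finset.range (r + 1)), Finset.sum_range_succ,
    ← add_assoc]
  congr 1
  rw [← Finset.sum_add_distrib]
  refine Finset.sum_congr rfl fun l _ => ?_
  rw [Finset.sum_range_add, add_comm]
  push_cast
  rfl

theorem sum_range_band {Z : Type*} [AddCommMonoid Z] (N : ℕ) (f : ℕ → ℕ → Z) :
    ∑ j ∈ Finset.range N, ∑ r ∈ Finset.range (N + 1), f j r =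
      (∑ j ∈ Finset.range N, ∑ r ∈ Finset.range j, f j r +
        ∑ r ∈ Finset.range N, ∑ j ∈ Finset.range r, f j (r + 1)) +
      (∑ j ∈ Finset.range N, f j j + ∑ j ∈ Finset.range N, f j (j + 1)) := by
  rw [sum_range_triangle N (fun j r => f j (r + 1)), ← Finset.sum_add_distrib,
    ← Finset.sum_add_distrib, ← Finset.sum_add_distrib]
  refine Finset.sum_congr rfl fun j hj => ?_
  rw [Finset.mem_range] at hj
  rw [show N + 1 = j + 1 + 1 + (N - 1 - j) by omega, Finset.sum_range_add,
    Finset.sum_range_succ, Finset.sum_range_succ]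
  simp only [add_right_comm _ _ 1]
  abel

section CycMod

variable {k : Type v} [CommRing k] {O : Type u} [AddCommGroup O] [Module k O]

namespace CycMod

variable {S : Oper k O} {X : Type u} [AddCommGroup X] [Module k X] (M : CycMod k S X)

theorem bd_rot_one {m : ℕ} {x : X} (hx : x ∈ M.deg m) :
    M.bd m (M.rot 1 x) = M.app S.mul (M.rot 1 x) + M.rot 1 (M.bd' m x) := by
  have h := M.rot_sub_bd' hx
  rw [map_sub] at h
  have h1 : M.bd m x = M.bd' m x + M.app S.mul (M.rot 1 x) := by
    rw [M.bd_apply hx, bd'_apply, Finset.sum_range_succ]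
    congr 1
    rcases m with _ | m
    · have h : ∀ a, M.app S.mul (M.rot a x) = 0 := fun a =>
        M.app_zero (by omega) S.mul_mem (M.rot_mem a hx)
      rw [h, h, map_zero]
    · have h := M.app_mem (m := m) (by omega) S.mul_mem (M.rot_mem (-((m + 1 : ℕ) : ℤ)) hx)
      have h1 := M.rot_period h
      rw [Nat.cast_add m 1, Nat.cast_one] at *
      rw [h1, ← M.rot_add_period hx (-_)]
      congr 3
      push_cast
      ring
  rw [h1] at h
  rw [eq_comm, ← sub_eq_zero] at h ⊢
  rw [← h]
  abel

/-- Connes' operator. -/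
def connes (n : ℕ) : X →ₗ[k] X := -(M.app S.unit ∘ₗ M.norm n)

theorem connes_apply (n : ℕ) (x : X) : M.connes n x = -M.app S.unit (M.norm n x) := rfl

theorem connes_mem {n : ℕ} {x : X} (hx : x ∈ M.deg n) : M.connes n x ∈ M.deg (n + 1) :=
  neg_mem (M.app_mem (by omega) S.unit_mem (M.norm_mem hx))

theorem bd_connes {n : ℕ} {x : X} (hx : x ∈ M.deg n) :
    M.bd (n + 1) (M.connes n x) = -M.connes (n - 1) (M.bd n x) := by
  rw [connes_apply, map_neg, M.bd_app_unit (M.norm_mem hx), M.rot_one_norm hx, sub_self, zero_sub,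
    neg_neg]
  rcases n with _ | n
  · rw [M.bd_zero hx]
    simp [bd'_apply]
  · rw [M.bd'_norm hx, connes_apply, neg_neg, Nat.add_sub_cancel]

/-- The conjugate `t G_e t^{-1}`. -/
def conjUnit : X →ₗ[k] X := M.rot 1 ∘ₗ M.app S.unit ∘ₗ M.rot (-1)

theorem conjUnit_mem {n : ℕ} {x : X} (hx : x ∈ M.deg n) : M.conjUnit x ∈ M.deg (n + 1) :=
  M.rot_mem _ (M.app_mem (by omega) S.unit_mem (M.rot_mem _ hx))

theorem app_mul_conjUnit {n : ℕ} {x : X} (hx : x ∈ M.deg n) :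
    M.app S.mul (M.conjUnit x) = -x := by
  have h := M.app_comp S.mul_mem S.unit_mem hx (by omega : 1 < 2)
  rw [S.mul_unit_right, map_neg, LinearMap.neg_apply, M.app_one hx] at h
  exact h.symm

theorem bd_conjUnit {n : ℕ} {x : X} (hx : x ∈ M.deg n) :
    M.bd (n + 1) (M.conjUnit x) = M.conjUnit (M.app S.mul x) - M.conjUnit (M.bd n x) := by
  have h1 := M.rot_mem (-1) hx
  have h2 := M.app_mem (m := n + 1) (by omega) S.unit_mem h1
  have h3 := M.bd_rot_one h1
  have h4 := M.rot_sub_bd' h2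
  have h5 := M.app_mul_conjUnit hx
  have h6 := M.bd_app_unit h1
  have h7 := M.bd_rot_one h2
  rw [M.rot_rot, add_neg_cancel, M.rot_zero] at h3 h6
  rw [map_sub, h6, h7] at h4
  rw [h3, map_add]
  change M.bd (n + 1) (M.rot 1 (M.app S.unit (M.rot (-1) x))) = _
  have h8 : M.conjUnit (M.rot 1 (M.bd' n (M.rot (-1) x))) =
      M.rot 1 (M.app S.unit (M.bd' n (M.rot (-1) x))) := by
    change M.rot 1 (M.app S.unit (M.rot (-1) (M.rot 1 _))) = _
    rw [M.rot_rot, neg_add_cancel, M.rot_zero]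
  have h9 : M.app S.mul (M.rot 1 (M.app S.unit (M.rot (-1) x))) = -x := h5
  have h10 : M.bd' (n + 1) (M.app S.unit (M.rot (-1) x)) =
      M.rot (-1) x - M.app S.unit (M.bd' n (M.rot (-1) x)) := by
    rw [h9] at h4
    have := sub_eq_sub_iff_add_eq_add.1 h4
    have h11 : M.bd' (n + 1) (M.app S.unit (M.rot (-1) x)) - (M.rot (-1) x -
        M.app S.unit (M.bd' n (M.rot (-1) x))) = M.rot 1 (M.bd' (n + 1) (M.app S.unit (M.rot (-1) x)))
        - M.rot 1 (M.bd' (n + 1) (M.app S.unit (M.rot (-1) x))) := by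
      rw [sub_eq_sub_iff_add_eq_add] at h4 ⊢
      rw [← sub_eq_zero] at h4 ⊢
      rw [← h4]
      abel
    rwa [sub_self, sub_eq_zero] at h11
  rw [h7, h9, h8, h10, map_sub, M.rot_rot, add_neg_cancel, M.rot_zero]
  abel

/-- `t B x` is the boundary of the image of `B x` under a degeneracy. -/
theorem bd_conjUnit_conjUnit {n : ℕ} {x : X} (hx : x ∈ M.deg n) (h : M.bd n x = 0) :
    M.bd (n + 2) (M.conjUnit (M.conjUnit (M.norm n x))) = M.rot 1 (M.connes n x) := by
  have hz := M.norm_mem hx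
  have h0 : M.bd' n (M.norm n x) = 0 := by
    rcases n with _ | n
    · simp [bd'_apply]
    · rw [M.bd'_norm hx, h, map_zero]
  have h1 := M.bd_rot_one hz
  rw [M.rot_one_norm hx, h0, map_zero, add_zero] at h1
  rw [M.bd_conjUnit (M.conjUnit_mem hz), M.bd_conjUnit hz, h1, sub_self, map_zero, sub_zero,
    M.app_mul_conjUnit hz, connes_apply]
  simp only [conjUnit, LinearMap.comp_apply, map_neg, M.rot_norm hx]

theorem connes_connes {n : ℕ} {x : X} (hx : x ∈ M.deg n) (h : M.bd n x = 0) :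
    M.connes (n + 1) (M.connes n x) =
      -M.bd (n + 3) (M.connes (n + 2) (M.conjUnit (M.conjUnit (M.norm n x)))) := by
  rw [M.bd_connes (M.conjUnit_mem (M.conjUnit_mem (M.norm_mem hx))), neg_neg,
    show n + 1 + 1 = n + 2 from rfl, M.bd_conjUnit_conjUnit hx h, show n + 2 - 1 = n + 1 from rfl,
    connes_apply, connes_apply (n := n + 1), M.norm_rot (M.connes_mem hx)]

/-- The operator `∑_{l < r ≤ n + 1 - q} t^r G_φ t^{-l-1}` behind the Cartan homotopy. -/
def cartan (n q : ℕ) (φ : O) : X →ₗ[k] X :=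
  ∑ r ∈ Finset.range (n + 2 - q), ∑ l ∈ Finset.range r,
    M.rot r ∘ₗ M.app φ ∘ₗ M.rot (-(l + 1))

theorem cartan_apply (n q : ℕ) (φ : O) (x : X) : M.cartan n q φ x =
    ∑ r ∈ Finset.range (n + 2 - q), ∑ l ∈ Finset.range r,
      M.rot r (M.app φ (M.rot (-(l + 1)) x)) := by
  simp [cartan, LinearMap.sum_apply]

theorem cartan_zero (n q : ℕ) (x : X) : M.cartan n q 0 x = 0 := by
  simp [cartan_apply]

theorem cartan_mem {m n q : ℕ} (h : m + q = n + 1) {φ : O} {x : X} (hφ : φ ∈ S.deg q)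
    (hx : x ∈ M.deg n) : M.cartan n q φ x ∈ M.deg m := by
  rw [cartan_apply]
  exact Submodule.sum_mem _ fun r _ => Submodule.sum_mem _ fun l _ =>
    M.rot_mem _ (M.app_mem h hφ (M.rot_mem _ hx))

theorem cartan_sub_rot {m n q : ℕ} (h : m + q = n + 1) {φ : O} {x : X} (hφ : φ ∈ S.deg q)
    (hx : x ∈ M.deg n) :
    M.cartan n q φ x - M.rot 1 (M.cartan n q φ x) = M.lieD n q φ x - M.app φ (M.norm n x) := by
  have hm : ∀ a, M.app φ (M.rot a x) ∈ M.deg m := fun a => M.app_mem h hφ (M.rot_mem a hx)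
  have h1 : M.app φ (M.norm n x) = M.lieTail q φ x +
      ∑ l ∈ Finset.range m, M.app φ (M.rot (-(l + 1)) x) := by
    rw [norm_apply, lieTail_apply, map_sum, ← h, add_comm m q, Finset.sum_range_add,
      ← Finset.sum_range_reflect _ m]
    congr 1
    refine Finset.sum_congr rfl fun j hj => ?_
    rw [Finset.mem_range] at hj
    rw [← M.rot_add_period hx (-_)]
    congr 3
    omega
  rw [h1, lieD_apply, lieHead_apply, cartan_apply, show n + 2 - q = m + 1 by omega,
    show n + 1 - q = m by omega, map_sum, Finset.sum_range_succ', Finset.sum_range_succ _ m]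
  have h2 : M.rot 1 (∑ l ∈ Finset.range m, M.rot m (M.app φ (M.rot (-(l + 1)) x))) =
      ∑ l ∈ Finset.range m, M.app φ (M.rot (-(l + 1)) x) := by
    rw [map_sum]
    refine Finset.sum_congr rfl fun l _ => ?_
    rw [M.rot_rot, add_comm, M.rot_period (hm _)]
  rw [h2]
  have h3 : ∑ r ∈ Finset.range m, ∑ l ∈ Finset.range (r + 1),
      M.rot (r + 1 : ℕ) (M.app φ (M.rot (-(l + 1)) x)) =
      ∑ r ∈ Finset.range m, M.rot 1 (∑ l ∈ Finset.range r, M.rot r (M.app φ (M.rot (-(l + 1)) x))) +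
      ∑ r ∈ Finset.range m, M.rot (r + 1) (M.app φ (M.rot (-(r + 1)) x)) := by
    rw [← Finset.sum_add_distrib]
    refine Finset.sum_congr rfl fun r _ => ?_
    rw [Finset.sum_range_succ, map_sum]
    simp only [M.rot_rot]
    push_cast
    simp only [add_comm (1 : ℤ)]
  rw [h3]
  simp only [Finset.range_zero, Finset.sum_empty]
  abel

end CycMod
end CycMod
end HopfCalculus

namespace HopfCalculus

section CycMod

variable {k : Type v} [CommRing k] {O : Type u} [AddCommGroup O] [Module k O]

namespace CycMod

variable {S : Oper k O} {X : Type u} [AddCommGroup X] [Module k X] (M : CycMod k S X)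

/-- `t^r G_φ t^{-a} G_μ t^b x` -/
def rotApp (φ : O) (x : X) (r a b : ℤ) : X :=
  M.rot r (M.app φ (M.rot (-a) (M.app S.mul (M.rot b x))))

theorem rotApp_eq {φ : O} {x : X} {r a b r' a' b' : ℤ} (h : r' = r) (h' : a' = -a) (h'' : b' = b) :
    M.rot r' (M.app φ (M.rot a' (M.app S.mul (M.rot b' x)))) = M.rotApp φ x r a b := by
  rw [h, h', h'', rotApp]

theorem cartan_bd {N q : ℕ} {φ : O} {x : X} (hφ : φ ∈ S.deg q) (hx : x ∈ M.deg (N + q)) :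
    M.cartan (N + q - 1) q φ (M.bd (N + q) x) =
      ∑ r ∈ Finset.range (N + 1), ∑ l ∈ Finset.range r,
        (∑ i ∈ Finset.range (l + 1), M.rotApp φ x r (i + 1) (i - l) +
          ∑ c ∈ Finset.range (N - l), M.rotApp φ x r (l + c + 1) (c + 1)) +
      M.cartan (N + q) (q + 1) (S.bar q φ S.mul) x := by
  rcases h : N + q with _ | n
  · obtain ⟨rfl, rfl⟩ : N = 0 ∧ q = 0 := by omega
    rw [h] at hx
    rw [M.bd_zero hx, S.bar_zero, cartan_zero, map_zero]
    simp
  · rw [h] at hx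
    rw [cartan_apply, cartan_apply, show n + 1 - 1 + 2 - q = N + 1 by omega,
      show n + 1 + 2 - (q + 1) = N + 1 by omega, ← Finset.sum_add_distrib]
    refine Finset.sum_congr rfl fun r hr => ?_
    rw [← Finset.sum_add_distrib]
    refine Finset.sum_congr rfl fun l hl => ?_
    rw [Finset.mem_range] at hr hl
    have hm : ∀ a, M.app S.mul (M.rot a x) ∈ M.deg n := fun a =>
      M.app_mem (by omega) S.mul_mem (M.rot_mem a hx)
    rw [M.bd_apply hx, map_sum, map_sum, map_sum, show n + 1 + 1 = l + 1 + q + (N - l) by omega,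
      Finset.sum_range_add, Finset.sum_range_add, add_right_comm, S.bar_apply, map_sum,
      LinearMap.sum_apply, map_sum]
    congr 1
    · congr 1
      · rw [← Finset.sum_range_reflect]
        refine Finset.sum_congr rfl fun i hi => ?_
        rw [Finset.mem_range] at hi
        rw [M.rot_rot]
        exact M.rotApp_eq rfl (by omega) (by omega)
      · rw [← Finset.sum_range_reflect]
        refine Finset.sum_congr rfl fun c hc => ?_
        rw [Finset.mem_range] at hc
        rw [M.rot_rot, ← M.rot_sub_period (hm _), ← M.rot_add_period hx (-_)]
        exact M.rotApp_eq rfl (by omega) (by omega)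
    · refine Finset.sum_congr rfl fun c hc => ?_
      rw [Finset.mem_range] at hc
      rw [M.app_comp hφ S.mul_mem (M.rot_mem _ hx) hc, M.rot_rot, M.rot_rot]
      congr 4
      · omega
      · congr 3; omega

theorem bd'_cartan {N q : ℕ} {φ : O} {x : X} (hφ : φ ∈ S.deg q) (hx : x ∈ M.deg (N + q)) :
    M.bd' (N + 1) (M.cartan (N + q) q φ x) =
      sg (q - 1 : ℤ) • M.cartan (N + q - 1) q φ (M.bd (N + q) x) +
      M.norm N (M.app (S.comp 1 S.mul φ) x) + M.cartan (N + q) (q + 1) (S.diff q φ) x := by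
  obtain ⟨f, hf⟩ : ∃ f : ℕ → ℕ → X, ∀ j r, f j r = ∑ l ∈ Finset.range r,
      M.rot j (M.app S.mul (M.rot (r - j) (M.app φ (M.rot (-(l + 1)) x)))) := ⟨_, fun _ _ => rfl⟩
  have h0 : M.bd' (N + 1) (M.cartan (N + q) q φ x) =
      ∑ j ∈ Finset.range (N + 1), ∑ r ∈ Finset.range (N + 1 + 1), f j r := by
    rw [bd'_apply, cartan_apply, show N + q + 2 - q = N + 1 + 1 by omega]
    simp only [map_sum, M.rot_rot, hf, neg_add_eq_sub]
  have h1 : ∑ j ∈ Finset.range (N + 1), f j j =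
      M.cartan (N + q) (q + 1) (S.comp 0 S.mul φ) x := by
    rw [cartan_apply, show N + q + 2 - (q + 1) = N + 1 by omega]
    refine Finset.sum_congr rfl fun j _ => (hf j j).trans <| Finset.sum_congr rfl fun l _ => ?_
    rw [M.app_comp S.mul_mem hφ (M.rot_mem _ hx) (by omega), M.rot_rot, sub_self]
    simp
  have h2 : ∑ j ∈ Finset.range (N + 1), f j (j + 1) =
      M.cartan (N + q) (q + 1) (S.comp 1 S.mul φ) x + M.norm N (M.app (S.comp 1 S.mul φ) x) := by
    rw [cartan_apply, show N + q + 2 - (q + 1) = N + 1 by omega, norm_apply,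
      ← Finset.sum_add_distrib]
    refine Finset.sum_congr rfl fun j _ => (hf j _).trans ?_
    rw [Finset.sum_range_succ']
    congr 1
    · refine Finset.sum_congr rfl fun l _ => ?_
      rw [M.app_comp S.mul_mem hφ (M.rot_mem _ hx) (by omega), M.rot_rot]
      congr 4
      · push_cast; ring
      · congr 3; push_cast; ring
    · rw [M.app_comp S.mul_mem hφ hx (by omega)]
      congr 4
      push_cast
      ring
  have hA : ∀ (r : ℕ) (y : X), y ∈ M.deg (N + q) → 2 ≤ r → r ≤ N + 1 →
      M.app S.mul (M.rot r (M.app φ y)) =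
        sg (q - 1 : ℤ) • M.rot (r - 1) (M.app φ (M.rot (-(r - 1)) (M.app S.mul (M.rot r y)))) := by
    intro r y hy h2 hr
    have h := M.app_app (r := r) S.mul_mem hφ (M.rot_mem r hy) h2 (by omega)
    rw [M.rot_rot, neg_add_cancel, M.rot_zero] at h
    rw [h, show ((2 : ℕ) - 1 : ℤ) * (q - 1) = q - 1 by norm_num,
      show (r - (2 : ℕ) + 1 : ℤ) = r - 1 by push_cast; ring]
  have h3 : ∑ r ∈ Finset.range (N + 1), ∑ j ∈ Finset.range r, f j (r + 1) =
      sg (q - 1 : ℤ) • ∑ r ∈ Finset.range (N + 1), ∑ c ∈ Finset.range r,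
        ∑ l ∈ Finset.range (r + 1), M.rotApp φ x r (c + 1) (c + 1 - l) := by
    rw [Finset.smul_sum]
    refine Finset.sum_congr rfl fun r hr => ?_
    rw [← Finset.sum_range_reflect, Finset.smul_sum]
    refine Finset.sum_congr rfl fun c hc => (hf _ _).trans ?_
    rw [Finset.smul_sum]
    refine Finset.sum_congr rfl fun l hl => ?_
    rw [Finset.mem_range] at hr hc hl
    rw [show ((r + 1 : ℕ) - (r - 1 - c : ℕ) : ℤ) = (c + 2 : ℕ) by omega,
      hA _ _ (M.rot_mem _ hx) (by omega) (by omega), map_zsmul, M.rot_rot, M.rot_rot]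
    exact congrArg _ (M.rotApp_eq (by omega) (by omega) (by omega))
  have h4 : ∑ j ∈ Finset.range (N + 1), ∑ r ∈ Finset.range j, f j r =
      sg (q - 1 : ℤ) • ∑ r ∈ Finset.range (N + 1), ∑ l ∈ Finset.range r,
        ∑ c ∈ Finset.range (N - r), M.rotApp φ x r (r + c + 1) (r + c + 1 - l) := by
    rw [sum_range_triangle (N + 1) (fun r j => f j r), Finset.smul_sum]
    refine Finset.sum_congr rfl fun r hr => ?_
    rw [Finset.sum_comm, ← Finset.sum_range_reflect, Finset.smul_sum,
      show N + 1 - 1 - r = N - r by omega]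
    refine Finset.sum_congr rfl fun c hc => (hf _ _).trans ?_
    rw [Finset.smul_sum]
    refine Finset.sum_congr rfl fun l hl => ?_
    rw [Finset.mem_range] at hr hc hl
    have hy : M.app φ (M.rot (-(l + 1)) x) ∈ M.deg (N + 1) :=
      M.app_mem (by omega) hφ (M.rot_mem _ hx)
    rw [← M.rot_add_period hy, show (r - (r + 1 + (N - r - 1 - c) : ℕ) + ((N + 1 : ℕ) + 1) : ℤ) =
      (r + c + 2 : ℕ) by omega,
      hA _ _ (M.rot_mem _ hx) (by omega) (by omega), map_zsmul, M.rot_rot, M.rot_rot]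
    have hz : M.app φ (M.rot (-((r + c + 2 : ℕ) - 1)) (M.app S.mul
        (M.rot ((r + c + 2 : ℕ) + -(l + 1)) x))) ∈ M.deg N := by
      obtain ⟨n, hn⟩ : ∃ n, N + q = n + 1 := ⟨N + q - 1, by omega⟩
      rw [hn] at hx
      exact M.app_mem (n := n) (by omega) hφ (M.rot_mem _ (M.app_mem (by omega) S.mul_mem
        (M.rot_mem _ hx)))
    rw [← M.rot_sub_period hz]
    exact congrArg _ (M.rotApp_eq (by omega) (by omega) (by omega))
  have h5 : ∀ a b : O, M.cartan (N + q) (q + 1) (a - b) x =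
      M.cartan (N + q) (q + 1) a x - M.cartan (N + q) (q + 1) b x := by
    intro a b
    simp [cartan_apply, Finset.sum_sub_distrib]
  have h6 : ∀ (c : ℤ) (a : O), M.cartan (N + q) (q + 1) (c • a) x =
      c • M.cartan (N + q) (q + 1) a x := by
    intro a b
    simp [cartan_apply, Finset.smul_sum]
  have h7 : S.bar 2 S.mul φ = S.comp 0 S.mul φ - (-1 : ℤ) • S.comp 1 S.mul φ := by
    rw [S.bar_apply, Finset.sum_range_succ, Finset.sum_range_one]
    simp
  have h8 : ∀ r ∈ Finset.range (N + 1), _ := fun r hr => by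
    have := sum_range_rearrange r (N - r) (M.rotApp φ x r)
    rw [Finset.mem_range] at hr
    rw [show r + (N - r) = N by omega] at this
    exact this
  rw [h0, sum_range_band, h1, h2, h3, h4, M.cartan_bd hφ hx, S.diff_eq, h5, h6, h7, h5, h6,
    Finset.sum_congr rfl h8, Finset.sum_add_distrib]
  simp only [smul_add, neg_smul, one_smul]
  abel

/-- The Cartan homotopy formula. -/
theorem lieD_eq {N q : ℕ} {φ : O} {x : X} (hφ : φ ∈ S.deg q) (hx : x ∈ M.deg (N + q)) :
    M.lieD (N + q) q φ x = M.bd (N + 2) (M.app S.unit (M.cartan (N + q) q φ x)) -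
      M.connes N (M.capD φ x) - sg (q - 1 : ℤ) • M.capD φ (M.connes (N + q) x) +
      sg (q - 1 : ℤ) • M.app S.unit (M.cartan (N + q - 1) q φ (M.bd (N + q) x)) +
      M.app S.unit (M.cartan (N + q) (q + 1) (S.diff q φ) x) := by
  have hK := M.cartan_mem (m := N + 1) (by omega) hφ hx
  have h1 := M.cartan_sub_rot (m := N + 1) (by omega) hφ hx
  have h2 := M.bd_app_unit hK
  have h3 : M.app φ (M.norm (N + q) x) = -(sg (q - 1 : ℤ) • M.capD φ (M.connes (N + q) x)) := by
    have h := M.app_comp (r := 0) (comp_one_mul_mem hφ) S.unit_mem (M.norm_mem hx) (by omega)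
    have h' := S.par S.mul_mem hφ S.unit_mem (by omega : 0 < 1) (by omega)
    rw [S.mul_unit_left, S.one_comp hφ, show ((q - 1 : ℤ) * ((0 : ℕ) - 1)) = -(q - 1) by
      push_cast; ring, sg_neg] at h'
    rw [h', Nat.cast_zero, neg_zero, M.rot_zero, M.rot_zero, map_zsmul, LinearMap.smul_apply] at h
    rw [capD_apply, connes_apply, map_neg, ← h, smul_neg, neg_neg, sg_smul_sg_smul]
  rw [M.bd'_cartan hφ hx, map_add, map_add, map_zsmul, h1, h3] at h2
  rw [show N + 2 = N + 1 + 1 from rfl, h2, M.connes_apply N, capD_apply _ φ x]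
  abel

end CycMod
end CycMod
end HopfCalculus

namespace HopfCalculus

section CochainOperad

variable {k : Type v} {A U M : Type u} [CommRing k] [Ring A] [Algebra k A] [Ring U] [Algebra k U]
  [AddCommGroup M] [Module k M] [Module Uᵐᵒᵖ M] [IsScalarTower k Uᵐᵒᵖ M]
variable {H : LeftBialgebroid k A U}

attribute [local instance] isScalarTower_op_self

theorem insAt_cast (r : ℕ) {p q : ℕ} (h : p = q) (φ : Cochain H p) :
    insAt M H r (Coch.cast h φ) = insAt M H r φ := by subst h; rfl

theorem capT_cast {p q : ℕ} (h : p = q) (φ : Cochain H p) :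
    capT M (Coch.cast h φ) = capT M φ := by subst h; rfl

theorem capT_add {p : ℕ} (φ ψ : Cochain H p) : capT M (φ + ψ) = capT M φ + capT M ψ := by
  rw [capT, map_add, LinearMap.comp_add]; rfl

theorem capT_smul {p : ℕ} (c : k) (φ : Cochain H p) : capT M (c • φ) = c • capT M φ := by
  rw [capT, map_smul, LinearMap.comp_smul]; rfl

variable (M) in
/-- The cap product with a cochain, as a linear map in the cochain. -/
noncomputable def capLin (p : ℕ) : Cochain H p →ₗ[k] TX M H →ₗ[k] TX M H where
  toFun φ := capT M φ
  map_add' := capT_add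
  map_smul' := capT_smul

theorem capT_zsmul {p : ℕ} (c : ℤ) (φ : Cochain H p) (x : TX M H) :
    capT M (c • φ) x = c • capT M φ x :=
  congrFun (congrArg DFunLike.coe (map_zsmul (capLin M p) c φ)) x

theorem capT_sub {p : ℕ} (φ ψ : Cochain H p) (x : TX M H) :
    capT M (φ - ψ) x = capT M φ x - capT M ψ x :=
  congrFun (congrArg DFunLike.coe (map_sub (capLin M p) φ ψ)) x

theorem capT_sum {p : ℕ} {ι : Type*} (s : Finset ι) (φ : ι → Cochain H p) (x : TX M H) :
    capT M (∑ i ∈ s, φ i) x = ∑ i ∈ s, capT M (φ i) x :=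
  (congrFun (congrArg DFunLike.coe (map_sum (capLin M p) φ s)) x).trans (by
    rw [LinearMap.sum_apply]; rfl)

theorem capT_circ (a q r : ℕ) (φ : Cochain H (a + 1 + r)) (ψ : Cochain H q) (x : TX M H) :
    capT M (circ H a q r φ ψ) x = capT M φ (insAt M H r ψ x) := by
  rw [capT_apply, capT_apply, insAt_circ, Nat.zero_add]

theorem capT_barCirc {p q n : ℕ} (h : p + q = n + 1) (φ : Cochain H p) (ψ : Cochain H q)
    (x : TX M H) : capT M (barCirc H h φ ψ) x =
      ∑ r ∈ Finset.range p, sg ((q - 1 : ℤ) * r) • capT M φ (insAt M H r ψ x) := by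
  rw [barCirc, capT_zsmul, capT_sum, Finset.sum_fin_eq_sum_range, ← Finset.sum_range_reflect,
    Finset.smul_sum]
  refine Finset.sum_congr rfl fun r hr => ?_
  rw [Finset.mem_range] at hr
  rw [dif_pos (by omega), capT_zsmul, capT_cast, capT_circ, capT_cast, smul_smul, ← sg_add,
    show p - 1 - (p - 1 - r) = r by omega, sg_congr ((p - 1) * (q - 1) - (q - 1) * r)
    (b := (q - 1 : ℤ) * r)]
  rw [show ((p - 1 - r : ℕ) : ℤ) = p - 1 - r by omega]
  ring

theorem capT_bracket {p q n : ℕ} (h : p + q = n + 1) (φ : Cochain H p) (ψ : Cochain H q)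
    (x : TX M H) : capT M (bracket H h φ ψ) x =
      ∑ r ∈ Finset.range p, sg ((q - 1 : ℤ) * r) • capT M φ (insAt M H r ψ x) -
      sg ((p - 1 : ℤ) * (q - 1)) •
        ∑ r ∈ Finset.range q, sg ((p - 1 : ℤ) * r) • capT M ψ (insAt M H r φ x) := by
  rw [bracket, capT_sub, capT_zsmul, capT_barCirc, capT_barCirc]

theorem capT_mul_insAt_one {p : ℕ} (φ : Cochain H p) (x : TX M H) :
    capT M (mulCochain H) (insAt M H 1 φ x) = capT M φ (face0T M H x) := by
  rw [capT_mul, face0T_insAt_succ]; rfl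

theorem dCochain_eq (p : ℕ) (φ : Cochain H p) :
    dCochain H p φ = bracket H (by omega : 2 + p = p + 1 + 1) (mulCochain H) φ := by
  refine eq_of_capT_eq fun x => ?_
  have h1 : dCochain H p φ = ∑ j ∈ Finset.range (p + 2), sg (p + 1 - j : ℤ) • coface H p j φ := by
    rw [dCochain, LinearMap.sum_apply]
    rfl
  rw [h1, capT_sum, capT_bracket, Finset.sum_range_succ', Finset.sum_range_succ,
    Finset.sum_range_succ, Finset.sum_range_one]
  have h2 : ∀ j ∈ Finset.range p, capT U (sg (p + 1 - (j + 1 : ℕ) : ℤ) • coface H p (j + 1) φ) x =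
      -(sg ((2 - 1 : ℤ) * (p - 1)) • sg ((2 - 1 : ℤ) * j) •
        capT U φ (insAt U H j (mulCochain H) x)) := by
    intro j hj
    rw [Finset.mem_range] at hj
    rw [capT_zsmul, smul_smul, ← sg_add, ← neg_smul]
    refine (congrArg _ (capT_cofaceAux p j hj φ x)).trans ?_
    congr 1
    rw [sg_congr (-j) (b := (2 - 1 : ℤ) * (p - 1) + (2 - 1) * j + 1) (by push_cast; ring),
      sg_add _ 1, sg_one, mul_neg_one]
  rw [Finset.sum_congr rfl h2, Finset.sum_neg_distrib, ← Finset.smul_sum]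
  have h3 : capT U (sg (p + 1 - (p + 1 : ℕ) : ℤ) • coface H p (p + 1) φ) x =
      sg ((p - 1 : ℤ) * (0 : ℕ)) • capT U (mulCochain H) (insAt U H 0 φ x) := by
    rw [capT_zsmul]
    refine (congrArg _ (capT_cofaceAux_last p φ x)).trans ?_
    congr 1
    simp
  have h4 : capT U (sg (p + 1 - (0 : ℕ) : ℤ) • coface H p 0 φ) x =
      sg ((p - 1 : ℤ) * (1 : ℕ)) • capT U (mulCochain H) (insAt U H 1 φ x) := by
    rw [capT_zsmul, capT_mul_insAt_one]
    refine (congrArg _ (capT_coface0 φ x)).trans ?_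
    congr 1
    exact sg_congr 1 (by push_cast; ring)
  rw [h3, h4]
  push_cast
  abel

theorem cup_eq (p q : ℕ) (φ : Cochain H p) (ψ : Cochain H q) :
    cup H p q φ ψ = circ H p q 0
      (Coch.cast (by omega : 0 + p + 1 = p + 1 + 0) (circ H 0 p 1 (mulCochain H) φ)) ψ := by
  refine eq_of_capT_eq fun x => ?_
  rw [capT_cup]
  refine Eq.trans ?_ (capT_circ p q 0 _ ψ x).symm
  rw [capT_cast]
  refine Eq.trans ?_ (capT_circ 0 p 1 _ φ _).symm
  rw [capT_mul_insAt_one]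
  rfl

variable (H) in
/-- A family of spaces of cochains that is closed under the operations of the operad. -/
structure ClosedFamily where
  /-- the cochains of degree `p` -/
  mem : ∀ p, Submodule k (Cochain H p)
  circ_mem : ∀ (a q r : ℕ) (φ : Cochain H (a + 1 + r)) (ψ : Cochain H q),
    φ ∈ mem (a + 1 + r) → ψ ∈ mem q → circ H a q r φ ψ ∈ mem (a + q + r)
  unit_mem : unitCochain H ∈ mem 0
  counit_mem : counitCochain H ∈ mem 1
  mul_mem : mulCochain H ∈ mem 2

namespace ClosedFamily

variable (K : ClosedFamily H)

theorem cast_mem {p q : ℕ} (h : p = q) {φ : Cochain H p} (hφ : φ ∈ K.mem p) :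
    Coch.cast h φ ∈ K.mem q := by subst h; exact hφ

theorem barCirc_mem {p q n : ℕ} (h : p + q = n + 1) {φ : Cochain H p} {ψ : Cochain H q}
    (hφ : φ ∈ K.mem p) (hψ : ψ ∈ K.mem q) : barCirc H h φ ψ ∈ K.mem n :=
  zsmul_mem (Submodule.sum_mem _ fun _ _ => zsmul_mem (K.cast_mem _
    (K.circ_mem _ _ _ _ _ (K.cast_mem _ hφ) hψ)) _) _

theorem bracket_mem {p q n : ℕ} (h : p + q = n + 1) {φ : Cochain H p} {ψ : Cochain H q}
    (hφ : φ ∈ K.mem p) (hψ : ψ ∈ K.mem q) : bracket H h φ ψ ∈ K.mem n :=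
  sub_mem (K.barCirc_mem h hφ hψ) (zsmul_mem (K.barCirc_mem _ hψ hφ) _)

theorem dCochain_mem {p : ℕ} {φ : Cochain H p} (hφ : φ ∈ K.mem p) :
    dCochain H p φ ∈ K.mem (p + 1) := by
  rw [dCochain_eq]
  exact K.bracket_mem _ K.mul_mem hφ

theorem cup_mem {p q : ℕ} {φ : Cochain H p} {ψ : Cochain H q} (hφ : φ ∈ K.mem p)
    (hψ : ψ ∈ K.mem q) : cup H p q φ ψ ∈ K.mem (p + q) := by
  rw [cup_eq]
  exact K.circ_mem p q 0 _ _ (K.cast_mem _ (K.circ_mem 0 p 1 _ _ K.mul_mem hφ)) hψ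

/-- The total space of the cochains of a closed family. -/
abbrev Tot : Type u := ⨁ p, (K.mem p : Type u)

/-- The inclusion of the cochains of degree `p`. -/
noncomputable def of (p : ℕ) : K.mem p →ₗ[k] K.Tot :=
  DirectSum.lof k ℕ (fun p => (K.mem p : Type u)) p

/-- Linear maps on the total space. -/
noncomputable def lift {Z : Type*} [AddCommGroup Z] [Module k Z]
    (f : ∀ p, K.mem p →ₗ[k] Z) : K.Tot →ₗ[k] Z := DirectSum.toModule k ℕ Z f

theorem lift_of {Z : Type*} [AddCommGroup Z] [Module k Z]
    (f : ∀ p, K.mem p →ₗ[k] Z) (p : ℕ) (φ : K.mem p) : K.lift f (K.of p φ) = f p φ :=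
  DirectSum.toModule_lof (M := fun p => (K.mem p : Type u)) k p φ

/-- The homogeneous elements. -/
noncomputable def deg (p : ℕ) : Submodule k K.Tot := LinearMap.range (K.of p)

theorem of_mem (p : ℕ) (φ : K.mem p) : K.of p φ ∈ K.deg p := ⟨φ, rfl⟩

theorem of_congr' {p : ℕ} {φ ψ : Cochain H p} (h : φ = ψ) (hφ : φ ∈ K.mem p) (hψ : ψ ∈ K.mem p) :
    K.of p ⟨φ, hφ⟩ = K.of p ⟨ψ, hψ⟩ := by subst h; rfl

variable (M) in
/-- The insertion of a cochain. -/
noncomputable def ins (r : ℕ) : K.Tot →ₗ[k] TX M H →ₗ[k] TX M H :=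
  K.lift fun p => (insAt M H r (p := p)) ∘ₗ (K.mem p).subtype

theorem ins_of (r p : ℕ) (φ : K.mem p) : K.ins M r (K.of p φ) = insAt M H r (φ : Cochain H p) :=
  K.lift_of _ p φ

theorem eq_of_ins_eq {p : ℕ} {φ ψ : K.Tot} (hφ : φ ∈ K.deg p) (hψ : ψ ∈ K.deg p)
    (h : ∀ x : TX U H, K.ins U 0 φ x = K.ins U 0 ψ x) : φ = ψ := by
  obtain ⟨φ, rfl⟩ := hφ
  obtain ⟨ψ, rfl⟩ := hψ
  rw [ins_of, ins_of] at h
  exact congrArg _ (Subtype.ext (eq_of_insAt_eq h))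

end ClosedFamily

end CochainOperad
end HopfCalculus

namespace HopfCalculus

section CochainOper

variable {k : Type v} {A U M : Type u} [CommRing k] [Ring A] [Algebra k A] [Ring U] [Algebra k U]
  [AddCommGroup M] [Module k M] [Module Uᵐᵒᵖ M] [IsScalarTower k Uᵐᵒᵖ M]
variable {H : LeftBialgebroid k A U}

attribute [local instance] isScalarTower_op_self

theorem rmT_one_of_succ (n : ℕ) (x : Ch M H.η (n + 1)) :
    rmT M H 1 (ofX M H (n + 1) x) = ofX M H (n + 1) x := by
  have : rmT M H 1 ∘ₗ ofX M H (n + 1) = ofX M H (n + 1) := Ch.hom_ext H fun x u => by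
    rw [LinearMap.comp_apply, ← snocT_of, rmT_snocT, mul_one]
  exact LinearMap.congr_fun this x

theorem insAt_mul_rmT (v : U) (x : TX M H) :
    insAt M H 0 (mulCochain H) (rmT M H v x) = rmT M H v (insAt M H 0 (mulCochain H) x) := by
  have : insAt M H 0 (mulCochain H) ∘ₗ rmT M H v = rmT M H v ∘ₗ insAt M H 0 (mulCochain H) :=
    TX.hom_ext_snoc (fun x => by
      rw [LinearMap.comp_apply, LinearMap.comp_apply, rmT_zero, insAt_of_lt _ _ (by omega),
        map_zero, map_zero]) fun u => LinearMap.ext fun x => by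
      rw [LinearMap.comp_apply, LinearMap.comp_apply, LinearMap.comp_apply, LinearMap.comp_apply,
        rmT_snocT, insAt_mul_snocT, insAt_mul_snocT, rmT_rmT]
  exact LinearMap.congr_fun this x

theorem insAt_mul_insAt_mul (x : TX M H) :
    insAt M H 0 (mulCochain H) (insAt M H 1 (mulCochain H) x) =
      insAt M H 0 (mulCochain H) (insAt M H 0 (mulCochain H) x) := by
  have : insAt M H 0 (mulCochain H) ∘ₗ insAt M H 1 (mulCochain H) =
      insAt M H 0 (mulCochain H) ∘ₗ insAt M H 0 (mulCochain H) :=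
    TX.hom_ext_snoc (fun x => by
      rw [LinearMap.comp_apply, LinearMap.comp_apply, insAt_of_lt _ _ (by omega),
        insAt_of_lt _ _ (by omega)]) fun u => LinearMap.ext fun x => by
      rw [LinearMap.comp_apply, LinearMap.comp_apply, LinearMap.comp_apply, LinearMap.comp_apply,
        insAt_snocT, insAt_mul_snocT, insAt_mul_snocT, insAt_mul_rmT]
  exact LinearMap.congr_fun this x

theorem insAt_mul_insAt_unit (x : TX M H) :
    insAt M H 0 (mulCochain H) (insAt M H 0 (unitCochain H) x) =
      insAt M H 0 (counitCochain H) x := by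
  rw [insAt_unit, insAt_mul_snocT]
  refine LinearMap.congr_fun (TX.hom_ext fun n x => ?_) x
  cases n with
  | zero => rw [rmT_zero, insAt_of_lt _ _ (by omega)]
  | succ n => rw [rmT_one_of_succ, insAt_counit _ _ _ (by omega)]

theorem insAt_mul_insAt_one_unit (x : TX M H) :
    insAt M H 0 (mulCochain H) (insAt M H 1 (unitCochain H) x) =
      insAt M H 0 (counitCochain H) x := by
  have : insAt M H 0 (mulCochain H) ∘ₗ insAt M H 1 (unitCochain H) =
      insAt M H 0 (counitCochain H) :=
    TX.hom_ext_snoc (fun x => by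
      rw [LinearMap.comp_apply, insAt_of_lt _ _ (by omega), insAt_of_lt _ _ (by omega),
        map_zero]) fun u => TX.hom_ext fun n x => by
      rw [LinearMap.comp_apply, LinearMap.comp_apply, LinearMap.comp_apply, insAt_snocT,
        insAt_unit, insAt_mul_snocT, rmT_snocT, one_mul, snocT_of, insAt_counit _ _ _ (by omega)]
  exact LinearMap.congr_fun this x

theorem insAt_counit_insAt {p : ℕ} (φ : Cochain H p) (x : TX M H) :
    insAt M H 0 (counitCochain H) (insAt M H 0 φ x) = insAt M H 0 φ x := by
  have : insAt M H 0 (counitCochain H) ∘ₗ insAt M H 0 φ = insAt M H 0 φ :=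
    TX.hom_ext fun n x => by
    rw [LinearMap.comp_apply]
    rcases lt_or_ge n p with h | h
    · rw [insAt_of_lt _ _ (by omega), map_zero]
    · obtain ⟨a, rfl⟩ := Nat.exists_eq_add_of_le' h
      exact (congrArg _ (insAt_of 0 φ a x)).trans
        ((insAt_counit 0 (a + 1) _ (by omega)).trans (insAt_of 0 φ a x).symm)
  exact LinearMap.congr_fun this x

/-- The partial composition that leaves `r` arguments on the right. -/
noncomputable def circAt (r : ℕ) {p : ℕ} (q : ℕ) (h : r < p) (φ : Cochain H p)
    (ψ : Cochain H q) : Cochain H (p - 1 + q) :=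
  Coch.cast (by omega : p - 1 - r + q + r = p - 1 + q)
    (circ H (p - 1 - r) q r (Coch.cast (by omega : p = p - 1 - r + 1 + r) φ) ψ)

theorem insAt_circAt (s r : ℕ) {p : ℕ} (q : ℕ) (h : r < p) (φ : Cochain H p)
    (ψ : Cochain H q) (x : TX M H) :
    insAt M H s (circAt r q h φ ψ) x = insAt M H s φ (insAt M H (s + r) ψ x) := by
  rw [circAt, insAt_cast, insAt_circ, insAt_cast]

/-- The partial composition that leaves `r` arguments on the right, as a bilinear map. -/
noncomputable def circLin (r : ℕ) {p : ℕ} (q : ℕ) (h : r < p) :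
    Cochain H p →ₗ[k] Cochain H q →ₗ[k] Cochain H (p - 1 + q) :=
  LinearMap.mk₂ k (circAt r q h)
    (fun φ φ' ψ => eq_of_insAt_eq fun x => by
      rw [map_add, LinearMap.add_apply, insAt_circAt, insAt_circAt, insAt_circAt, map_add]; rfl)
    (fun c φ ψ => eq_of_insAt_eq fun x => by
      rw [map_smul, LinearMap.smul_apply, insAt_circAt, insAt_circAt, map_smul]; rfl)
    (fun φ ψ ψ' => eq_of_insAt_eq fun x => by
      rw [map_add, LinearMap.add_apply, insAt_circAt, insAt_circAt, insAt_circAt, map_add,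
        LinearMap.add_apply, map_add])
    (fun c φ ψ => eq_of_insAt_eq fun x => by
      rw [map_smul, LinearMap.smul_apply, insAt_circAt, insAt_circAt, map_smul,
        LinearMap.smul_apply, map_smul])

namespace ClosedFamily

variable (K : ClosedFamily H)

theorem circAt_mem (r : ℕ) {p : ℕ} (q : ℕ) (h : r < p) {φ : Cochain H p} {ψ : Cochain H q}
    (hφ : φ ∈ K.mem p) (hψ : ψ ∈ K.mem q) : circAt r q h φ ψ ∈ K.mem (p - 1 + q) :=
  K.cast_mem _ (K.circ_mem _ _ _ _ _ (K.cast_mem _ hφ) hψ)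

/-- The partial composition that leaves `r` arguments on the right, in a closed family. -/
noncomputable def circMem (r : ℕ) {p : ℕ} (q : ℕ) (h : r < p) :
    K.mem p →ₗ[k] K.mem q →ₗ[k] K.mem (p - 1 + q) :=
  LinearMap.mk₂ k (fun φ ψ => ⟨circAt r q h φ ψ, K.circAt_mem r q h φ.2 ψ.2⟩)
    (fun φ φ' ψ => Subtype.ext
      ((circLin r q h).map_add₂ (φ : Cochain H p) (φ' : Cochain H p) (ψ : Cochain H q)))
    (fun c φ ψ => Subtype.ext
      ((circLin r q h).map_smul₂ c (φ : Cochain H p) (ψ : Cochain H q)))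
    (fun φ ψ ψ' => Subtype.ext
      (map_add (circLin r q h (φ : Cochain H p)) (ψ : Cochain H q) (ψ' : Cochain H q)))
    (fun c φ ψ => Subtype.ext
      (map_smul (circLin r q h (φ : Cochain H p)) c (ψ : Cochain H q)))

/-- The partial compositions with signs, on homogeneous elements. -/
noncomputable def compHom (r p q : ℕ) : K.mem p →ₗ[k] K.mem q →ₗ[k] K.Tot :=
  if h : r < p then sg ((q - 1 : ℤ) * r) • (K.circMem r q h).compr₂ (K.of (p - 1 + q)) else 0

/-- The partial compositions with signs. -/
noncomputable def comp (r : ℕ) : K.Tot →ₗ[k] K.Tot →ₗ[k] K.Tot :=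
  K.lift (Z := K.Tot →ₗ[k] K.Tot) fun p =>
    (K.lift (Z := K.mem p →ₗ[k] K.Tot) fun q => (K.compHom r p q).flip).flip

theorem comp_of_of (r : ℕ) {p q : ℕ} (h : r < p) (φ : K.mem p) (ψ : K.mem q) :
    K.comp r (K.of p φ) (K.of q ψ) = sg ((q - 1 : ℤ) * r) •
      K.of (p - 1 + q) ⟨circAt r q h φ ψ, K.circAt_mem r q h φ.2 ψ.2⟩ := by
  have h1 : K.comp r (K.of p φ) = (K.lift (Z := K.mem p →ₗ[k] K.Tot)
      fun q => (K.compHom r p q).flip).flip φ := K.lift_of (Z := K.Tot →ₗ[k] K.Tot) _ p φ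
  have h2 : K.lift (Z := K.mem p →ₗ[k] K.Tot) (fun q => (K.compHom r p q).flip) (K.of q ψ) =
      (K.compHom r p q).flip ψ := K.lift_of (Z := K.mem p →ₗ[k] K.Tot) _ q ψ
  rw [h1, LinearMap.flip_apply, h2, LinearMap.flip_apply, compHom, dif_pos h]
  rfl

theorem comp_mem {p q r : ℕ} {φ ψ : K.Tot} (hφ : φ ∈ K.deg p) (hψ : ψ ∈ K.deg q) (h : r < p) :
    K.comp r φ ψ ∈ K.deg (p - 1 + q) := by
  obtain ⟨φ, rfl⟩ := hφ
  obtain ⟨ψ, rfl⟩ := hψ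
  rw [comp_of_of K r h]
  exact zsmul_mem (K.of_mem _ _) _

theorem ins_comp (s : ℕ) {p q r : ℕ} {φ ψ : K.Tot} (hφ : φ ∈ K.deg p) (hψ : ψ ∈ K.deg q)
    (h : r < p) (x : TX M H) : K.ins M s (K.comp r φ ψ) x =
      sg ((q - 1 : ℤ) * r) • K.ins M s φ (K.ins M (s + r) ψ x) := by
  obtain ⟨φ, rfl⟩ := hφ
  obtain ⟨ψ, rfl⟩ := hψ
  rw [comp_of_of K r h, map_zsmul, LinearMap.smul_apply, ins_of, ins_of, ins_of, insAt_circAt]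

theorem ins_comm_of (j r : ℕ) {p q : ℕ} (φ : K.mem p) (ψ : K.mem q) (x : TX M H) :
    K.ins M (j + 1 + r) (K.of q ψ) (K.ins M r (K.of p φ) x) =
      K.ins M r (K.of p φ) (K.ins M (j + p + r) (K.of q ψ) x) := by
  simp only [ins_of]
  exact insAt_comm j r p q _ _ x

theorem ins_comm (j r : ℕ) {p q : ℕ} {φ ψ : K.Tot} (hφ : φ ∈ K.deg p) (hψ : ψ ∈ K.deg q)
    (x : TX M H) :
    K.ins M (j + 1 + r) ψ (K.ins M r φ x) = K.ins M r φ (K.ins M (j + p + r) ψ x) :=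
  hφ.elim fun φ' h => hψ.elim fun ψ' h' => h ▸ h' ▸ K.ins_comm_of j r φ' ψ' x

theorem eq_of_ins_eq' {p q : ℕ} {φ ψ : K.Tot} (hφ : φ ∈ K.deg p) (hψ : ψ ∈ K.deg q) (h' : q = p)
    (h : ∀ x : TX U H, K.ins U 0 φ x = K.ins U 0 ψ x) : φ = ψ := by
  subst h'
  exact K.eq_of_ins_eq hφ hψ h

/-- The operad of the cochains in a closed family. -/
noncomputable def oper : Oper k K.Tot where
  deg := K.deg
  comp := K.comp
  comp_mem hφ hψ h := K.comp_mem hφ hψ h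
  seq {p q d r j φ ψ χ} hφ hψ hχ hr hj := by
    have h1 := K.comp_mem hφ hψ hr
    have h2 := K.comp_mem hψ hχ hj
    refine K.eq_of_ins_eq' (K.comp_mem h1 hχ (by omega)) (K.comp_mem hφ h2 hr) (by omega)
      fun x => ?_
    rw [K.ins_comp 0 h1 hχ (by omega), K.ins_comp 0 hφ hψ hr, K.ins_comp 0 hφ h2 hr,
      K.ins_comp _ hψ hχ hj, map_zsmul, smul_smul, smul_smul, ← sg_add, ← sg_add, Nat.zero_add,
      Nat.zero_add]
    congr 1
    refine sg_congr 0 ?_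
    push_cast [Nat.cast_sub (show 1 ≤ q by omega)]
    ring
  par {p q d r r' φ ψ χ} hφ hψ hχ hr hr' := by
    have h1 := K.comp_mem hφ hψ hr'
    have h2 := K.comp_mem hφ hχ (by omega : r < p)
    refine K.eq_of_ins_eq' (K.comp_mem h1 hχ (by omega))
      (zsmul_mem (K.comp_mem h2 hψ (by omega)) _) (by omega) fun x => ?_
    rw [map_zsmul, LinearMap.smul_apply, K.ins_comp 0 h1 hχ (by omega), K.ins_comp 0 hφ hψ hr',
      K.ins_comp 0 h2 hψ (by omega), K.ins_comp 0 hφ hχ (by omega), smul_smul, smul_smul,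
      smul_smul, ← sg_add, ← sg_add, ← sg_add, Nat.zero_add, Nat.zero_add, Nat.zero_add]
    obtain ⟨l, rfl⟩ := Nat.exists_eq_add_of_lt hr
    rw [show r + l + 1 + d - 1 = l + d + r by omega, ← K.ins_comm l r hχ hψ,
      show r + l + 1 = l + 1 + r by omega]
    congr 1
    refine sg_congr (- (q - 1) * (d - 1)) ?_
    push_cast
    ring
  one := K.of 1 ⟨_, K.counit_mem⟩
  mul := K.of 2 ⟨_, K.mul_mem⟩
  unit := K.of 0 ⟨_, K.unit_mem⟩
  one_mem := K.of_mem _ _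
  mul_mem := K.of_mem _ _
  unit_mem := K.of_mem _ _
  mul_mul := K.eq_of_ins_eq' (add_mem (K.comp_mem (K.of_mem 2 _) (K.of_mem 2 _) (by omega))
      (K.comp_mem (K.of_mem 2 _) (K.of_mem 2 _) (by omega))) (zero_mem (K.deg 3)) rfl fun x => by
    rw [map_add, LinearMap.add_apply, K.ins_comp 0 (K.of_mem 2 _) (K.of_mem 2 _) (by omega),
      K.ins_comp 0 (K.of_mem 2 _) (K.of_mem 2 _) (by omega), ins_of, ins_of, map_zero,
      insAt_mul_insAt_mul]
    simp
  mul_unit_left := K.eq_of_ins_eq' (K.comp_mem (K.of_mem 2 _) (K.of_mem 0 _) (by omega))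
      (K.of_mem 1 _) rfl fun x => by
    rw [K.ins_comp 0 (K.of_mem 2 _) (K.of_mem 0 _) (by omega), ins_of, ins_of, ins_of,
      insAt_mul_insAt_unit]
    simp
  mul_unit_right := K.eq_of_ins_eq' (K.comp_mem (K.of_mem 2 _) (K.of_mem 0 _) (by omega))
      (neg_mem (K.of_mem 1 _)) rfl fun x => by
    rw [K.ins_comp 0 (K.of_mem 2 _) (K.of_mem 0 _) (by omega), ins_of, ins_of, map_neg,
      LinearMap.neg_apply, ins_of, insAt_mul_insAt_one_unit, sg_congr (-1) (b := 1) (by simp), sg_one,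
      neg_one_zsmul]
  one_comp {p φ} hφ := K.eq_of_ins_eq' (K.comp_mem (K.of_mem 1 _) hφ (by omega)) hφ (by omega)
      fun x => by
    rw [K.ins_comp 0 (K.of_mem 1 _) hφ (by omega), ins_of]
    obtain ⟨φ, rfl⟩ := hφ
    rw [ins_of, insAt_counit_insAt]
    simp

end ClosedFamily

end CochainOper
end HopfCalculus

namespace HopfCalculus

section CochainOper

variable {k : Type v} {A U M : Type u} [CommRing k] [Ring A] [Algebra k A] [Ring U] [Algebra k U]
  [AddCommGroup M] [Module k M] [Module Uᵐᵒᵖ M] [IsScalarTower k Uᵐᵒᵖ M]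
variable {H : LeftBialgebroid k A U}

attribute [local instance] isScalarTower_op_self

namespace ClosedFamily

variable (K : ClosedFamily H)

theorem eq_of_cap_eq {p : ℕ} {φ ψ : K.Tot} (hφ : φ ∈ K.deg p) (hψ : ψ ∈ K.deg p)
    (h : ∀ x : TX U H, face0T U H (K.ins U 0 φ x) = face0T U H (K.ins U 0 ψ x)) : φ = ψ := by
  obtain ⟨φ, rfl⟩ := hφ
  obtain ⟨ψ, rfl⟩ := hψ
  rw [ins_of, ins_of] at h
  exact congrArg _ (Subtype.ext (eq_of_capT_eq h))

theorem of_barCirc {p q n : ℕ} (h : p + q = n + 1) (φ : K.mem p) (ψ : K.mem q) :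
    K.of n ⟨barCirc H h φ ψ, K.barCirc_mem h φ.2 ψ.2⟩ =
      K.oper.bar p (K.of p φ) (K.of q ψ) := by
  refine K.eq_of_cap_eq (K.of_mem _ _)
    (K.oper.bar_mem h (K.of_mem p φ) (K.of_mem q ψ)) fun x => ?_
  rw [ins_of]
  refine (capT_barCirc h _ _ x).trans ?_
  rw [Oper.bar_apply, map_sum, LinearMap.sum_apply, map_sum]
  refine Finset.sum_congr rfl fun r hr => ?_
  rw [Finset.mem_range] at hr
  have := K.ins_comp 0 (K.of_mem p φ) (K.of_mem q ψ) hr x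
  rw [Nat.zero_add] at this
  refine Eq.trans ?_ (congrArg (face0T U H) this).symm
  rw [map_zsmul, ins_of, ins_of]
  rfl

theorem of_bracket {p q n : ℕ} (h : p + q = n + 1) (φ : K.mem p) (ψ : K.mem q) :
    K.of n ⟨bracket H h φ ψ, K.bracket_mem h φ.2 ψ.2⟩ =
      K.oper.bra p q (K.of p φ) (K.of q ψ) := by
  rw [Oper.bra, ← K.of_barCirc h, ← K.of_barCirc (by omega : q + p = n + 1)]
  exact (map_sub (K.of n) ⟨_, K.barCirc_mem h φ.2 ψ.2⟩
    (sg ((p - 1 : ℤ) * (q - 1)) • ⟨_, K.barCirc_mem (by omega : q + p = n + 1) ψ.2 φ.2⟩)).trans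
    (congrArg _ (map_zsmul (K.of n) _ _))

theorem of_dCochain {p : ℕ} (φ : K.mem p) :
    K.of (p + 1) ⟨dCochain H p φ, K.dCochain_mem φ.2⟩ = K.oper.diff p (K.of p φ) :=
  (K.of_congr' (dCochain_eq p (φ : Cochain H p)) _ (K.bracket_mem _ K.mul_mem φ.2)).trans
    (K.of_bracket (by omega : 2 + p = p + 1 + 1) ⟨_, K.mul_mem⟩ φ)

theorem of_cup {p q : ℕ} (φ : K.mem p) (ψ : K.mem q) :
    K.of (p + q) ⟨cup H p q φ ψ, K.cup_mem φ.2 ψ.2⟩ =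
      sg (p - 1 : ℤ) • K.oper.cupM (K.of p φ) (K.of q ψ) := by
  have h1 : K.comp 1 (K.of 2 ⟨_, K.mul_mem⟩) (K.of p φ) ∈ K.deg (2 - 1 + p) :=
    K.comp_mem (K.of_mem 2 _) (K.of_mem p φ) (by omega)
  have h2 : K.oper.cupM (K.of p φ) (K.of q ψ) =
      K.comp 0 (K.comp 1 (K.of 2 ⟨_, K.mul_mem⟩) (K.of p φ)) (K.of q ψ) := Oper.cupM_eq _ _ _
  refine K.eq_of_cap_eq (K.of_mem _ _)
    (zsmul_mem (K.oper.cupM_mem (K.of_mem p φ) (K.of_mem q ψ)) _) fun x => ?_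
  rw [ins_of, h2, map_zsmul, LinearMap.smul_apply, K.ins_comp 0 h1 (K.of_mem q ψ) (by omega),
    K.ins_comp 0 (K.of_mem 2 _) (K.of_mem p φ) (by omega), smul_smul, smul_smul, ← sg_add,
    ← sg_add, map_zsmul, ins_of, ins_of, ins_of, sg_congr (p - 1) (b := 0) (by push_cast; ring),
    sg_zero, one_smul]
  refine (capT_cup p q _ _ x).trans ?_
  refine Eq.trans ?_ (capT_mul_insAt_one (φ : Cochain H p) _).symm
  rfl

end ClosedFamily

variable (H) in
/-- The family of all cochains. -/
def allCochains : ClosedFamily H where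
  mem _ := ⊤
  circ_mem _ _ _ _ _ _ _ := trivial
  unit_mem := trivial
  counit_mem := trivial
  mul_mem := trivial

theorem ClosedFamily.of_injective (K : ClosedFamily H) (p : ℕ) :
    Function.Injective (K.of p) := by
  classical
  exact DFinsupp.single_injective (β := fun p => (K.mem p : Type u))

theorem dCochain_dCochain (p : ℕ) (φ : Cochain H p) :
    dCochain H (p + 1) (dCochain H p φ) = 0 := by
  have h := (allCochains H).oper.diff_diff ((allCochains H).of_mem p ⟨φ, trivial⟩)
  rw [← ClosedFamily.of_dCochain, ← ClosedFamily.of_dCochain] at h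
  exact congrArg Subtype.val ((allCochains H).of_injective _ (h.trans (map_zero _).symm))

end CochainOper
end HopfCalculus

namespace HopfCalculus

section LastFace

variable {k : Type v} {A U M : Type u} [CommRing k] [Ring A] [Algebra k A] [Ring U] [Algebra k U]
  [AddCommGroup M] [Module k M] [Module Uᵐᵒᵖ M] [IsScalarTower k Uᵐᵒᵖ M]
variable {H : LeftBialgebroid k A U}

variable (M H) in
/-- The chains of degree `n` in the total space. -/
noncomputable def gradX (n : ℕ) : Submodule k (TX M H) := LinearMap.range (ofX M H n)

theorem ofX_mem (n : ℕ) (x : Ch M H.η n) : ofX M H n x ∈ gradX M H n := ⟨x, rfl⟩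

theorem insAt_mem {n m p r : ℕ} (h : n + 1 = m + p) (hr : r < m) (φ : Cochain H p)
    {x : TX M H} (hx : x ∈ gradX M H n) : insAt M H r φ x ∈ gradX M H m := by
  obtain ⟨a, rfl⟩ : ∃ a, m = a + 1 + r := ⟨m - 1 - r, by omega⟩
  obtain rfl : n = a + p + r := by omega
  obtain ⟨x, rfl⟩ := hx
  rw [insAt_of]
  exact ofX_mem _ _

theorem insAt_eq_zero {n p r : ℕ} (h : n < p + r) (φ : Cochain H p)
    {x : TX M H} (hx : x ∈ gradX M H n) : insAt M H r φ x = 0 := by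
  obtain ⟨x, rfl⟩ := hx
  exact insAt_of_lt r φ h x

theorem face0T_mem {n : ℕ} {x : TX M H} (hx : x ∈ gradX M H (n + 1)) :
    face0T M H x ∈ gradX M H n := by
  obtain ⟨x, rfl⟩ := hx
  rw [face0T_succ]
  exact ofX_mem _ _

theorem eqOn_gradX_succ {n : ℕ} {Z : Type*} [AddCommGroup Z] [Module k Z] {f g : TX M H →ₗ[k] Z}
    (h : ∀ u, ∀ x ∈ gradX M H n, f (snocT M H u x) = g (snocT M H u x)) {x : TX M H}
    (hx : x ∈ gradX M H (n + 1)) : f x = g x := by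
  obtain ⟨x, rfl⟩ := hx
  have : f ∘ₗ ofX M H (n + 1) = g ∘ₗ ofX M H (n + 1) := Ch.hom_ext H fun x u => by
    rw [LinearMap.comp_apply, LinearMap.comp_apply, ← snocT_of]
    exact h u _ (ofX_mem n x)
  exact LinearMap.congr_fun this x

variable (M H) in
/-- The last face on the total space. -/
noncomputable def lastT : TX M H →ₗ[k] TX M H := totX' fun n => ofX M H n ∘ₗ face M H n (n + 1)

theorem lastT_of (n : ℕ) (x : Ch M H.η (n + 1)) :
    lastT M H (ofX M H (n + 1) x) = ofX M H n (face M H n (n + 1) x) := totX'_succ _ n x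

theorem lastT_mem {n : ℕ} {x : TX M H} (hx : x ∈ gradX M H (n + 1)) :
    lastT M H x ∈ gradX M H n := by
  obtain ⟨x, rfl⟩ := hx
  rw [lastT_of]
  exact ofX_mem _ _

theorem lastT_snocT_zero (u : U) (x : Ch M H.η 0) :
    lastT M H (snocT M H u (ofX M H 0 x)) = ofX M H 0 (actM H.η x u) := by
  rw [snocT_of, lastT_of]
  rfl

theorem lastT_snocT {n : ℕ} (u : U) {x : TX M H} (hx : x ∈ gradX M H (n + 1)) :
    lastT M H (snocT M H u x) = snocT M H u (lastT M H x) := by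
  obtain ⟨x, rfl⟩ := hx
  rw [snocT_of, lastT_of, lastT_of, snocT_of]
  rfl

theorem lastT_rmT {n : ℕ} (u : U) {x : TX M H} (hx : x ∈ gradX M H (n + 2)) :
    lastT M H (rmT M H u x) = rmT M H u (lastT M H x) :=
  eqOn_gradX_succ (f := lastT M H ∘ₗ rmT M H u) (g := rmT M H u ∘ₗ lastT M H) (fun v x hx => by
    simp only [LinearMap.comp_apply]
    rw [rmT_snocT, lastT_snocT _ hx, lastT_snocT _ hx, rmT_snocT]) hx

theorem lastT_actT {n : ℕ} (a : A) {x : TX M H} (hx : x ∈ gradX M H (n + 1)) :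
    lastT M H (actT M H a x) = actT M H a (lastT M H x) := by
  obtain ⟨x, rfl⟩ := hx
  rw [actT_of, lastT_of, lastT_of, actT_of]
  exact congrArg _ ((faceAux M H.η n n).comm a x)

theorem face0T_lastT {n : ℕ} {x : TX M H} (hx : x ∈ gradX M H (n + 2)) :
    face0T M H (lastT M H x) = lastT M H (face0T M H x) :=
  eqOn_gradX_succ (f := face0T M H ∘ₗ lastT M H) (g := lastT M H ∘ₗ face0T M H) (fun v x hx => by
    simp only [LinearMap.comp_apply]
    rw [lastT_snocT _ hx, face0T_snocT, face0T_snocT, lastT_actT _ hx]) hx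

theorem lastT_insAt (p r n : ℕ) (h : p + r + 1 ≤ n) (φ : Cochain H p) {x : TX M H}
    (hx : x ∈ gradX M H n) : lastT M H (insAt M H r φ x) = insAt M H r φ (lastT M H x) := by
  induction r generalizing n x with
  | zero =>
    induction p generalizing n x with
    | zero =>
      obtain ⟨n, rfl⟩ := Nat.exists_eq_add_of_le' h
      rw [insAt_zero_zero, insAt_zero_zero, lastT_snocT _ hx]
    | succ p ih =>
      obtain ⟨n, rfl⟩ := Nat.exists_eq_add_of_le' h
      refine eqOn_gradX_succ (f := lastT M H ∘ₗ insAt M H 0 φ) (g := insAt M H 0 φ ∘ₗ lastT M H)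
        (fun u x hx => ?_) hx
      rw [LinearMap.comp_apply, LinearMap.comp_apply, lastT_snocT (n := n + p) _ hx,
        insAt_zero_snocT, insAt_zero_snocT]
      have : lastT M H ∘ₗ stepT M φ x = stepT M φ (lastT M H x) := TensA.hom_ext fun v w => by
        rw [LinearMap.comp_apply, stepT_mk, stepT_mk, ← ih _ (n + p + 1) (by omega) hx]
        exact lastT_rmT w (insAt_mem (n := n + p + 1) (m := n + 2) (by omega) (by omega)
          (Coch.app φ v : Cochain H p) hx)
      exact LinearMap.congr_fun this (H.comul u)
  | succ r ih =>
    obtain ⟨n, rfl⟩ := Nat.exists_eq_add_of_le' h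
    refine eqOn_gradX_succ (f := lastT M H ∘ₗ insAt M H (r + 1) φ)
      (g := insAt M H (r + 1) φ ∘ₗ lastT M H) (fun u x hx => ?_) hx
    rw [LinearMap.comp_apply, LinearMap.comp_apply, lastT_snocT (n := n + (p + r)) _ hx,
      insAt_snocT, insAt_snocT, ← ih (n + (p + r) + 1) (by omega) hx]
    exact lastT_snocT (n := n + r + 1) _
      (insAt_mem (n := n + (p + (r + 1))) (by omega) (by omega) φ hx)

theorem lastT_insAt_mul (n : ℕ) {x : TX M H} (hx : x ∈ gradX M H (n + 2)) :
    lastT M H (insAt M H n (mulCochain H) x) = lastT M H (lastT M H x) := by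
  induction n generalizing x with
  | zero =>
    refine eqOn_gradX_succ (f := lastT M H ∘ₗ insAt M H 0 (mulCochain H))
      (g := lastT M H ∘ₗ lastT M H) (fun v x hx => ?_) hx
    rw [LinearMap.comp_apply, LinearMap.comp_apply, lastT_snocT _ hx, insAt_mul_snocT]
    refine eqOn_gradX_succ (f := lastT M H ∘ₗ rmT M H v)
      (g := lastT M H ∘ₗ snocT M H v ∘ₗ lastT M H) (fun u x hx => ?_) hx
    obtain ⟨x, rfl⟩ := hx
    rw [LinearMap.comp_apply, LinearMap.comp_apply, LinearMap.comp_apply, rmT_snocT,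
      lastT_snocT_zero, lastT_snocT_zero, lastT_snocT_zero, actM_mul]
  | succ n ih =>
    refine eqOn_gradX_succ (f := lastT M H ∘ₗ insAt M H (n + 1) (mulCochain H))
      (g := lastT M H ∘ₗ lastT M H) (fun v x hx => ?_) hx
    rw [LinearMap.comp_apply, LinearMap.comp_apply, lastT_snocT _ hx, insAt_snocT,
      lastT_snocT (n := n) _ (insAt_mem (by omega) (by omega) _ hx), ih hx,
      lastT_snocT (n := n) _ (lastT_mem hx)]

theorem lastT_insAt_unit (n : ℕ) {x : TX M H} (hx : x ∈ gradX M H n) :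
    lastT M H (insAt M H n (unitCochain H) x) = x := by
  induction n generalizing x with
  | zero =>
    obtain ⟨x, rfl⟩ := hx
    rw [insAt_unit, lastT_snocT_zero]
    exact congrArg _ (one_smul (α := M) Uᵐᵒᵖ x)
  | succ n ih =>
    refine eqOn_gradX_succ (f := lastT M H ∘ₗ insAt M H (n + 1) (unitCochain H))
      (g := LinearMap.id) (fun v x hx => ?_) hx
    rw [LinearMap.comp_apply, insAt_snocT,
      lastT_snocT (n := n) _ (insAt_mem (by omega) (by omega) _ hx), ih hx]
    rfl

end LastFace

section CycTot

variable {k : Type v} {A U M : Type u} [CommRing k] [Ring A] [Algebra k A] [Ring U] [Algebra k U]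
  [AddCommGroup M] [Module k M] [Module Uᵐᵒᵖ M] [IsScalarTower k Uᵐᵒᵖ M]
variable (H : LeftHopfAlgebroid k A U) (C : ModuleComodule H.toLeftBialgebroid M)

/-- The map `cycExt` on the total space. -/
noncomputable def extT : TX M H.toLeftBialgebroid →ₗ[k] TX M H.toLeftBialgebroid :=
  totX fun n => ofX M H.toLeftBialgebroid (n + 1) ∘ₗ cycExt H C n

theorem extT_of (n : ℕ) (x : Ch M H.η n) : extT H C (ofX M H.toLeftBialgebroid n x) =
    ofX M H.toLeftBialgebroid (n + 1) (cycExt H C n x) := totX_of _ n x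

theorem extT_mem {n : ℕ} {x : TX M H.toLeftBialgebroid} (hx : x ∈ gradX M H.toLeftBialgebroid n) :
    extT H C x ∈ gradX M H.toLeftBialgebroid (n + 1) := by
  obtain ⟨x, rfl⟩ := hx
  rw [extT_of]
  exact ofX_mem _ _

/-- The cyclic operator on the total space. -/
noncomputable def cycTot : Module.End k (TX M H.toLeftBialgebroid) :=
  lastT M H.toLeftBialgebroid ∘ₗ extT H C

theorem cycTot_apply (x : TX M H.toLeftBialgebroid) :
    cycTot H C x = lastT M H.toLeftBialgebroid (extT H C x) := rfl

theorem cycTot_of (n : ℕ) (x : Ch M H.η n) : cycTot H C (ofX M H.toLeftBialgebroid n x) =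
    ofX M H.toLeftBialgebroid n (cyc H C n x) := by
  rw [cycTot_apply, extT_of, lastT_of]
  rfl

theorem cycTot_pow_of (n i : ℕ) (x : Ch M H.η n) :
    (cycTot H C ^ i) (ofX M H.toLeftBialgebroid n x) =
      ofX M H.toLeftBialgebroid n ((cyc H C n ^ i) x) := by
  induction i with
  | zero => rfl
  | succ i ih =>
    rw [pow_succ', pow_succ', Module.End.mul_apply, ih, cycTot_of]
    rfl

theorem cycTot_mem {n : ℕ} {x : TX M H.toLeftBialgebroid}
    (hx : x ∈ gradX M H.toLeftBialgebroid n) :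
    cycTot H C x ∈ gradX M H.toLeftBialgebroid n := lastT_mem (extT_mem H C hx)

theorem cycTot_pow_mem {n : ℕ} (i : ℕ) {x : TX M H.toLeftBialgebroid}
    (hx : x ∈ gradX M H.toLeftBialgebroid n) :
    (cycTot H C ^ i) x ∈ gradX M H.toLeftBialgebroid n := by
  obtain ⟨x, rfl⟩ := hx
  rw [cycTot_pow_of]
  exact ofX_mem _ _

theorem extT_insAt (r : ℕ) {p : ℕ} (φ : Cochain H.toLeftBialgebroid p)
    (x : TX M H.toLeftBialgebroid) :
    extT H C (insAt M H.toLeftBialgebroid r φ x) =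
      insAt M H.toLeftBialgebroid (r + 1) φ (extT H C x) := by
  have : extT H C ∘ₗ insAt M H.toLeftBialgebroid r φ =
      insAt M H.toLeftBialgebroid (r + 1) φ ∘ₗ extT H C := TX.hom_ext fun n x => by
    rw [LinearMap.comp_apply, LinearMap.comp_apply, extT_of]
    rcases lt_or_ge n (p + r) with h | h
    · rw [insAt_of_lt _ _ h, insAt_of_lt _ _ (by omega), map_zero]
    · obtain ⟨a, rfl⟩ : ∃ a, n = a + p + r := ⟨n - (p + r), by omega⟩
      rw [insAt_of, extT_of, cycExt_opIns]
      exact (insAt_of (r + 1) φ a _).symm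
  exact LinearMap.congr_fun this x

theorem extT_face0T (x : TX M H.toLeftBialgebroid) :
    extT H C (face0T M H.toLeftBialgebroid x) =
      insAt M H.toLeftBialgebroid 0 (mulCochain H.toLeftBialgebroid) (extT H C x) := by
  have h : ∀ n (y : Ch M H.η (n + 2)), insAt M H.toLeftBialgebroid 0
      (mulCochain H.toLeftBialgebroid) (ofX M H.toLeftBialgebroid (n + 2) y) =
      ofX M H.toLeftBialgebroid (n + 1) (tmul H (Ch M H.η n) y) := fun n y => by
    have : insAt M H.toLeftBialgebroid 0 (mulCochain H.toLeftBialgebroid) ∘ₗ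
        ofX M H.toLeftBialgebroid (n + 2) =
        ofX M H.toLeftBialgebroid (n + 1) ∘ₗ tmul H (Ch M H.η n) :=
      Ch.hom_ext H.toLeftBialgebroid fun x u => by
        rw [LinearMap.comp_apply, ← snocT_of, insAt_mul_snocT, rmT_succ]
        rfl
    exact LinearMap.congr_fun this y
  have : extT H C ∘ₗ face0T M H.toLeftBialgebroid =
      insAt M H.toLeftBialgebroid 0 (mulCochain H.toLeftBialgebroid) ∘ₗ extT H C :=
    TX.hom_ext fun n x => by
    rw [LinearMap.comp_apply, LinearMap.comp_apply, extT_of]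
    cases n with
    | zero => rw [insAt_of_lt _ _ (by omega), face0T_zero, map_zero]
    | succ n => rw [face0T_succ, extT_of, h, cycExt_face0]
  exact LinearMap.congr_fun this x

theorem extT_extT (x : TX M H.toLeftBialgebroid) :
    extT H C (extT H C x) = snocT M H.toLeftBialgebroid 1 (extT H C x) := by
  have : extT H C ∘ₗ extT H C = snocT M H.toLeftBialgebroid 1 ∘ₗ extT H C :=
    TX.hom_ext fun n x => by
    rw [LinearMap.comp_apply, LinearMap.comp_apply, extT_of, extT_of, snocT_of, cycExt_cycExt]
  exact LinearMap.congr_fun this x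

theorem face0T_extT (x : TX M H.toLeftBialgebroid) :
    face0T M H.toLeftBialgebroid (extT H C x) = x := by
  have : face0T M H.toLeftBialgebroid ∘ₗ extT H C = LinearMap.id :=
    TX.hom_ext fun n x => by
    rw [LinearMap.comp_apply, extT_of, face0T_succ, face0_cycExt]
    rfl
  exact LinearMap.congr_fun this x

/-- The operator that applies a cochain to the last arguments after `extT`. -/
noncomputable def capExt {p : ℕ} (φ : Cochain H.toLeftBialgebroid p) :
    TX M H.toLeftBialgebroid →ₗ[k] TX M H.toLeftBialgebroid := capT M φ ∘ₗ extT H C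

theorem capExt_apply {p : ℕ} (φ : Cochain H.toLeftBialgebroid p) (x : TX M H.toLeftBialgebroid) :
    capExt H C φ x = face0T M H.toLeftBialgebroid (insAt M H.toLeftBialgebroid 0 φ (extT H C x)) :=
  rfl

theorem extT_capExt {p : ℕ} (φ : Cochain H.toLeftBialgebroid p) (x : TX M H.toLeftBialgebroid) :
    extT H C (capExt H C φ x) = insAt M H.toLeftBialgebroid 0 φ (extT H C x) := by
  rw [capExt_apply, extT_face0T, extT_insAt, extT_extT, insAt_snocT, ← insAt_unit,
    insAt_mul_insAt_unit, insAt_counit_insAt]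

theorem cycTot_capExt {p n : ℕ} (h : p ≤ n) (φ : Cochain H.toLeftBialgebroid p)
    {x : TX M H.toLeftBialgebroid} (hx : x ∈ gradX M H.toLeftBialgebroid n) :
    cycTot H C (capExt H C φ x) = insAt M H.toLeftBialgebroid 0 φ (cycTot H C x) := by
  rw [cycTot_apply, extT_capExt, lastT_insAt p 0 (n + 1) (by omega) φ (extT_mem H C hx)]
  rfl

theorem cycTot_insAt {p n r : ℕ} (h : p + r + 1 ≤ n) (φ : Cochain H.toLeftBialgebroid p)
    {x : TX M H.toLeftBialgebroid} (hx : x ∈ gradX M H.toLeftBialgebroid n) :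
    cycTot H C (insAt M H.toLeftBialgebroid r φ x) =
      insAt M H.toLeftBialgebroid (r + 1) φ (cycTot H C x) := by
  rw [cycTot_apply, extT_insAt, lastT_insAt p (r + 1) (n + 1) (by omega) φ (extT_mem H C hx)]
  rfl

theorem cycTot_pow_capExt {p n r : ℕ} (h : p + r ≤ n) (φ : Cochain H.toLeftBialgebroid p)
    {x : TX M H.toLeftBialgebroid} (hx : x ∈ gradX M H.toLeftBialgebroid n) :
    (cycTot H C ^ (r + 1)) (capExt H C φ x) =
      insAt M H.toLeftBialgebroid r φ ((cycTot H C ^ (r + 1)) x) := by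
  induction r with
  | zero => rw [zero_add, pow_one, cycTot_capExt H C h φ hx]
  | succ r ih =>
    rw [pow_succ', Module.End.mul_apply, ih (by omega),
      cycTot_insAt H C (by omega) φ (cycTot_pow_mem H C _ hx), Module.End.mul_apply]

end CycTot
end HopfCalculus

namespace HopfCalculus

section Faces

variable {k : Type v} {A U M : Type u} [CommRing k] [Ring A] [Algebra k A] [Ring U] [Algebra k U]
  [AddCommGroup M] [Module k M] [Module Uᵐᵒᵖ M] [IsScalarTower k Uᵐᵒᵖ M]
variable {H : LeftBialgebroid k A U}

theorem ofX_injective (n : ℕ) : Function.Injective (ofX M H n) := by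
  classical
  exact DFinsupp.single_injective (β := fun n => (Ch M H.η n : Type u))

variable (M H) in
/-- The faces on the total space, on chains of degree `n`. -/
noncomputable def faceT (n : ℕ) : ℕ → TX M H →ₗ[k] TX M H
  | 0 => face0T M H
  | i + 1 => if i + 1 = n then lastT M H else insAt M H i (mulCochain H)

theorem faceT_zero (n : ℕ) : faceT M H n 0 = face0T M H := rfl

theorem faceT_last (n : ℕ) : faceT M H (n + 1) (n + 1) = lastT M H := if_pos rfl

theorem faceT_succ {n i : ℕ} (h : i + 1 < n) :
    faceT M H n (i + 1) = insAt M H i (mulCochain H) := if_neg (by omega)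

theorem faceT_mem {n i : ℕ} (h : i ≤ n + 1) {x : TX M H} (hx : x ∈ gradX M H (n + 1)) :
    faceT M H (n + 1) i x ∈ gradX M H n := by
  rcases i with _ | i
  · exact face0T_mem hx
  rcases eq_or_lt_of_le h with h | h
  · obtain rfl : i = n := by omega
    rw [faceT_last]
    exact lastT_mem hx
  · rw [faceT_succ h]
    exact insAt_mem (by omega) (by omega) _ hx

theorem insAt_mul_of (n i : ℕ) (h : i < n) (x : Ch M H.η (n + 1)) :
    insAt M H i (mulCochain H) (ofX M H (n + 1) x) = ofX M H n ((faceAux M H.η n i).lin x) := by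
  induction i generalizing n with
  | zero =>
    obtain ⟨n, rfl⟩ := Nat.exists_eq_add_of_le' h
    have : insAt M H 0 (mulCochain H) ∘ₗ ofX M H (n + 2) =
        ofX M H (n + 1) ∘ₗ (faceAux M H.η (n + 1) 0).lin :=
      Ch.hom_ext H fun x u => by
        rw [LinearMap.comp_apply, ← snocT_of, insAt_mul_snocT, rmT_succ]
        rfl
    exact LinearMap.congr_fun this x
  | succ i ih =>
    obtain ⟨n, rfl⟩ : ∃ m, n = m + 1 := ⟨n - 1, by omega⟩
    have : insAt M H (i + 1) (mulCochain H) ∘ₗ ofX M H (n + 2) =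
        ofX M H (n + 1) ∘ₗ (faceAux M H.η (n + 1) (i + 1)).lin :=
      Ch.hom_ext H fun x u => by
        rw [LinearMap.comp_apply, ← snocT_of, insAt_snocT, ih n (by omega) x, snocT_of]
        rfl
    exact LinearMap.congr_fun this x

theorem faceT_of (n i : ℕ) (h : i ≤ n + 1) (x : Ch M H.η (n + 1)) :
    faceT M H (n + 1) i (ofX M H (n + 1) x) = ofX M H n (face M H n i x) := by
  rcases i with _ | i
  · exact face0T_succ n x
  rcases eq_or_lt_of_le h with h | h
  · obtain rfl : i = n := by omega
    rw [faceT_last, lastT_of]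
  · rw [faceT_succ h]
    exact insAt_mul_of n i (by omega) x

theorem insAt_mul_insAt_succ_mul (r : ℕ) (x : TX M H) :
    insAt M H r (mulCochain H) (insAt M H (r + 1) (mulCochain H) x) =
      insAt M H r (mulCochain H) (insAt M H r (mulCochain H) x) := by
  induction r generalizing x with
  | zero => exact insAt_mul_insAt_mul x
  | succ r ih =>
    have : insAt M H (r + 1) (mulCochain H) ∘ₗ insAt M H (r + 2) (mulCochain H) =
        insAt M H (r + 1) (mulCochain H) ∘ₗ insAt M H (r + 1) (mulCochain H) :=
      TX.hom_ext_snoc (fun x => by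
        rw [LinearMap.comp_apply, LinearMap.comp_apply, insAt_of_lt _ _ (by omega),
          insAt_of_lt _ _ (by omega)]) fun u => LinearMap.ext fun x => by
        rw [LinearMap.comp_apply, LinearMap.comp_apply, LinearMap.comp_apply,
          LinearMap.comp_apply, insAt_snocT, insAt_snocT, insAt_snocT, insAt_snocT, ih]
    exact LinearMap.congr_fun this x

theorem faceT_faceT {n i j : ℕ} (hij : i < j) (hj : j ≤ n + 2) {x : TX M H}
    (hx : x ∈ gradX M H (n + 2)) :
    faceT M H (n + 1) i (faceT M H (n + 2) j x) =
      faceT M H (n + 1) (j - 1) (faceT M H (n + 2) i x) := by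
  obtain ⟨j, rfl⟩ : ∃ m, j = m + 1 := ⟨j - 1, by omega⟩
  rw [Nat.add_sub_cancel]
  rcases eq_or_lt_of_le hj with hj | hj
  · obtain rfl : j = n + 1 := by omega
    rw [faceT_last, faceT_last]
    rcases i with _ | i
    · rw [faceT_zero, faceT_zero, face0T_lastT hx]
    rw [faceT_succ (n := n + 2) (by omega)]
    rcases eq_or_lt_of_le (Nat.le_of_lt_succ hij) with h | h
    · obtain rfl : i = n := by omega
      rw [faceT_last, lastT_insAt_mul _ hx]
    · rw [faceT_succ (by omega), lastT_insAt 2 i (n + 2) (by omega) _ hx]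
  · rw [faceT_succ hj]
    rcases i with _ | i
    · rcases j with _ | j
      · rw [faceT_zero, faceT_zero]
        exact capT_mul x
      · rw [faceT_zero, faceT_zero, faceT_succ (by omega), face0T_insAt_succ]
    rw [faceT_succ (by omega), faceT_succ (by omega)]
    obtain ⟨j, rfl⟩ : ∃ m, j = m + 1 := ⟨j - 1, by omega⟩
    rw [faceT_succ (by omega)]
    rcases eq_or_lt_of_le (Nat.le_of_lt_succ hij) with h | h
    · obtain rfl : i = j := by omega
      exact insAt_mul_insAt_succ_mul i x
    · obtain ⟨l, rfl⟩ : ∃ l, j = l + 1 + i := ⟨j - 1 - i, by omega⟩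
      have := insAt_comm (M := M) l i 2 2 (mulCochain H) (mulCochain H) x
      rw [show l + 1 + i + 1 = l + 2 + i by omega]
      exact this.symm

theorem sum_sum_sg_eq_zero {Z : Type*} [AddCommGroup Z] (n : ℕ) (g : ℕ → ℕ → Z)
    (h : ∀ i j, i < j → j ≤ n → g i j = g (j - 1) i) :
    ∑ i ∈ Finset.range n, ∑ j ∈ Finset.range (n + 1), sg (i + j) • g i j = 0 := by
  induction n with
  | zero => simp
  | succ n ih =>
    rw [Finset.sum_congr rfl fun i _ => Finset.sum_range_succ _ (n + 1), Finset.sum_add_distrib,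
      Finset.sum_range_succ _ n, ih fun i j h1 h2 => h i j h1 (by omega), zero_add,
      ← Finset.sum_add_distrib]
    refine Finset.sum_eq_zero fun i hi => ?_
    rw [Finset.mem_range] at hi
    rw [h i (n + 1) hi le_rfl, Nat.add_sub_cancel, ← add_smul,
      show (i + (n + 1 : ℕ) : ℤ) = n + i + 1 by push_cast; ring, sg_add _ 1, sg_one]
    simp

variable (M H) in
/-- The boundary on the total space. -/
noncomputable def bdryT : TX M H →ₗ[k] TX M H := totX' fun n => ofX M H n ∘ₗ bdry M H n

theorem bdryT_zero (x : Ch M H.η 0) : bdryT M H (ofX M H 0 x) = 0 := totX'_zero _ x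

theorem bdryT_of (n : ℕ) (x : Ch M H.η (n + 1)) :
    bdryT M H (ofX M H (n + 1) x) = ofX M H n (bdry M H n x) := totX'_succ _ n x

theorem bdryT_apply {n : ℕ} {x : TX M H} (hx : x ∈ gradX M H (n + 1)) :
    bdryT M H x = ∑ i ∈ Finset.range (n + 2), sg i • faceT M H (n + 1) i x := by
  obtain ⟨x, rfl⟩ := hx
  rw [bdryT_of, bdry, LinearMap.sum_apply, map_sum]
  refine Finset.sum_congr rfl fun i hi => ?_
  rw [Finset.mem_range] at hi
  rw [faceT_of n i (by omega)]
  exact map_zsmul _ _ _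

theorem bdryT_bdryT (x : TX M H) : bdryT M H (bdryT M H x) = 0 := by
  have : bdryT M H ∘ₗ bdryT M H = 0 := TX.hom_ext fun n x => by
    rw [LinearMap.comp_apply]
    rcases n with _ | _ | n
    · rw [bdryT_zero, map_zero]; rfl
    · rw [bdryT_of, bdryT_zero]; rfl
    have hx := ofX_mem (H := H) (n + 2) x
    rw [bdryT_apply hx, map_sum]
    refine Eq.trans (Finset.sum_congr rfl fun j hj => ?_)
      ((Finset.sum_comm).trans (sum_sum_sg_eq_zero (n + 2) (fun i j => faceT M H (n + 1) i
        (faceT M H (n + 2) j (ofX M H (n + 2) x))) fun i j h1 h2 => faceT_faceT h1 h2 hx))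
    rw [Finset.mem_range] at hj
    rw [map_zsmul, bdryT_apply (faceT_mem (by omega) hx), Finset.smul_sum]
    refine Finset.sum_congr rfl fun i _ => ?_
    rw [smul_smul, ← sg_add, add_comm]
  exact LinearMap.congr_fun this x

theorem bdry_bdry (n : ℕ) (x : Ch M H.η (n + 2)) : bdry M H n (bdry M H (n + 1) x) = 0 := by
  apply ofX_injective
  rw [← bdryT_of, ← bdryT_of, bdryT_bdryT, map_zero]

end Faces

section Period

variable {k : Type v} {A U M : Type u} [CommRing k] [Ring A] [Algebra k A] [Ring U] [Algebra k U]
  [AddCommGroup M] [Module k M] [Module Uᵐᵒᵖ M] [IsScalarTower k Uᵐᵒᵖ M]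
variable (H : LeftHopfAlgebroid k A U) (C : ModuleComodule H.toLeftBialgebroid M)

/-- The operator `T` on the total space. -/
noncomputable def perT : TX M H.toLeftBialgebroid →ₗ[k] TX M H.toLeftBialgebroid :=
  totX fun n => ofX M H.toLeftBialgebroid n ∘ₗ cycT H C n

theorem perT_of (n : ℕ) (x : Ch M H.η n) : perT H C (ofX M H.toLeftBialgebroid n x) =
    ofX M H.toLeftBialgebroid n (cycT H C n x) := totX_of _ n x

theorem perT_apply {n : ℕ} {x : TX M H.toLeftBialgebroid}
    (hx : x ∈ gradX M H.toLeftBialgebroid n) : perT H C x = (cycTot H C ^ (n + 1)) x := by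
  obtain ⟨x, rfl⟩ := hx
  rw [perT_of, cycTot_pow_of]
  rfl

theorem perT_cycTot (x : TX M H.toLeftBialgebroid) :
    perT H C (cycTot H C x) = cycTot H C (perT H C x) := by
  have : perT H C ∘ₗ cycTot H C = cycTot H C ∘ₗ perT H C := TX.hom_ext fun n x => by
    have hx := ofX_mem (H := H.toLeftBialgebroid) n x
    rw [LinearMap.comp_apply, LinearMap.comp_apply, perT_apply H C (cycTot_mem H C hx),
      perT_apply H C hx, ← Module.End.mul_apply, ← Module.End.mul_apply, ← pow_succ, ← pow_succ']
  exact LinearMap.congr_fun this x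

theorem face0T_cycTot {n : ℕ} {x : TX M H.toLeftBialgebroid}
    (hx : x ∈ gradX M H.toLeftBialgebroid (n + 1)) :
    face0T M H.toLeftBialgebroid (cycTot H C x) = lastT M H.toLeftBialgebroid x := by
  rw [cycTot_apply, face0T_lastT (extT_mem H C hx), face0T_extT]

theorem cycTot_faceT {n i : ℕ} (h : i ≤ n) {x : TX M H.toLeftBialgebroid}
    (hx : x ∈ gradX M H.toLeftBialgebroid (n + 1)) :
    cycTot H C (faceT M H.toLeftBialgebroid (n + 1) i x) =
      faceT M H.toLeftBialgebroid (n + 1) (i + 1) (cycTot H C x) := by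
  rcases i with _ | i
  · rw [cycTot_apply, faceT_zero, extT_face0T]
    rcases n with _ | n
    · rw [lastT_insAt_mul 0 (extT_mem H C hx), faceT_last]
      rfl
    · rw [faceT_succ (by omega), lastT_insAt 2 0 (n + 3) (by omega) _ (extT_mem H C hx)]
      rfl
  · rw [faceT_succ (by omega), cycTot_apply, extT_insAt]
    rcases eq_or_lt_of_le h with h | h
    · obtain rfl : n = i + 1 := h.symm
      rw [lastT_insAt_mul (i + 1) (extT_mem H C hx), faceT_last]
      rfl
    · rw [faceT_succ (by omega), lastT_insAt 2 (i + 1) (n + 2) (by omega) _ (extT_mem H C hx)]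
      rfl

theorem cycTot_pow_faceT {n i : ℕ} (j : ℕ) (h : i + j ≤ n + 1) {x : TX M H.toLeftBialgebroid}
    (hx : x ∈ gradX M H.toLeftBialgebroid (n + 1)) :
    (cycTot H C ^ j) (faceT M H.toLeftBialgebroid (n + 1) i x) =
      faceT M H.toLeftBialgebroid (n + 1) (i + j) ((cycTot H C ^ j) x) := by
  induction j with
  | zero => rfl
  | succ j ih =>
    rw [pow_succ', Module.End.mul_apply, ih (by omega),
      cycTot_faceT H C (by omega) (cycTot_pow_mem H C _ hx), Module.End.mul_apply]
    rfl

theorem cycTot_pow_pow (i j l : ℕ) (h : l = i + j) (x : TX M H.toLeftBialgebroid) :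
    (cycTot H C ^ i) ((cycTot H C ^ j) x) = (cycTot H C ^ l) x := by
  rw [h, pow_add, Module.End.mul_apply]

theorem perT_faceT {n i : ℕ} (h : i ≤ n + 1) {x : TX M H.toLeftBialgebroid}
    (hx : x ∈ gradX M H.toLeftBialgebroid (n + 1)) :
    perT H C (faceT M H.toLeftBialgebroid (n + 1) i x) =
      faceT M H.toLeftBialgebroid (n + 1) i (perT H C x) := by
  have hm := cycTot_pow_mem H C (n + 1 - i) hx
  rw [perT_apply H C (faceT_mem h hx), perT_apply H C hx,
    ← cycTot_pow_pow H C i (n + 1 - i) (n + 1) (by omega),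
    cycTot_pow_faceT H C (n + 1 - i) (by omega) hx, show i + (n + 1 - i) = n + 1 by omega,
    faceT_last, ← face0T_cycTot H C hm, ← faceT_zero (n + 1),
    cycTot_pow_faceT H C i (by omega) (cycTot_mem H C hm), Nat.zero_add,
    ← cycTot_pow_pow H C i (n + 1 + 1 - i) (n + 1 + 1) (by omega),
    show n + 1 + 1 - i = n + 1 - i + 1 by omega, pow_succ' _ (n + 1 - i)]
  rfl

theorem cycTot_insAt_unit {n : ℕ} {x : TX M H.toLeftBialgebroid}
    (hx : x ∈ gradX M H.toLeftBialgebroid n) :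
    cycTot H C (insAt M H.toLeftBialgebroid n (unitCochain H.toLeftBialgebroid) x) =
      extT H C x := by
  rw [cycTot_apply, extT_insAt, lastT_insAt_unit (n + 1) (extT_mem H C hx)]

theorem cycTot_extT {n : ℕ} {x : TX M H.toLeftBialgebroid}
    (hx : x ∈ gradX M H.toLeftBialgebroid n) :
    cycTot H C (extT H C x) =
      insAt M H.toLeftBialgebroid 0 (unitCochain H.toLeftBialgebroid) (cycTot H C x) := by
  rw [cycTot_apply, extT_extT, lastT_snocT _ (extT_mem H C hx), insAt_unit]
  rfl

theorem cycTot_pow_insAt {n j p : ℕ} (i : ℕ) (h : p + i + j ≤ n)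
    (φ : Cochain H.toLeftBialgebroid p) {x : TX M H.toLeftBialgebroid}
    (hx : x ∈ gradX M H.toLeftBialgebroid n) :
    (cycTot H C ^ j) (insAt M H.toLeftBialgebroid i φ x) =
      insAt M H.toLeftBialgebroid (i + j) φ ((cycTot H C ^ j) x) := by
  induction j with
  | zero => rfl
  | succ j ih =>
    rw [pow_succ', Module.End.mul_apply, ih (by omega),
      cycTot_insAt H C (by omega) φ (cycTot_pow_mem H C _ hx), Module.End.mul_apply]
    rfl

theorem perT_insAt_unit {n i : ℕ} (h : i ≤ n) {x : TX M H.toLeftBialgebroid}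
    (hx : x ∈ gradX M H.toLeftBialgebroid n) :
    perT H C (insAt M H.toLeftBialgebroid i (unitCochain H.toLeftBialgebroid) x) =
      insAt M H.toLeftBialgebroid i (unitCochain H.toLeftBialgebroid) (perT H C x) := by
  have hm := cycTot_pow_mem H C (n - i) hx
  have hi := insAt_mem (m := n + 1) (p := 0) rfl (by omega : i < n + 1)
    (unitCochain H.toLeftBialgebroid) hx
  rw [perT_apply H C hi, perT_apply H C hx, ← cycTot_pow_pow H C (i + 2) (n - i) _ (by omega),
    cycTot_pow_insAt H C i (by omega) _ hx, show i + (n - i) = n by omega, pow_add, pow_two,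
    Module.End.mul_apply, Module.End.mul_apply, cycTot_insAt_unit H C hm, cycTot_extT H C hm,
    cycTot_pow_insAt H C 0 (by omega) _ (cycTot_mem H C hm), Nat.zero_add,
    ← cycTot_pow_pow H C i (n - i + 1) (n + 1) (by omega), pow_succ' _ (n - i)]
  rfl

theorem perT_extT (x : TX M H.toLeftBialgebroid) :
    perT H C (extT H C x) = extT H C (perT H C x) := by
  have : perT H C ∘ₗ extT H C = extT H C ∘ₗ perT H C := TX.hom_ext fun n x => by
    have hx := ofX_mem (H := H.toLeftBialgebroid) n x
    rw [LinearMap.comp_apply, LinearMap.comp_apply, ← cycTot_insAt_unit H C hx, perT_cycTot,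
      perT_insAt_unit H C le_rfl hx, cycTot_insAt_unit H C]
    rw [perT_of]
    exact ofX_mem _ _
  exact LinearMap.congr_fun this x

theorem perT_face0T (x : TX M H.toLeftBialgebroid) :
    perT H C (face0T M H.toLeftBialgebroid x) = face0T M H.toLeftBialgebroid (perT H C x) := by
  have : perT H C ∘ₗ face0T M H.toLeftBialgebroid = face0T M H.toLeftBialgebroid ∘ₗ perT H C :=
    TX.hom_ext fun n x => by
    rw [LinearMap.comp_apply, LinearMap.comp_apply]
    cases n with
    | zero => rw [perT_of, face0T_zero, face0T_zero, map_zero]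
    | succ n => exact perT_faceT H C (i := 0) (by omega) (ofX_mem _ x)
  exact LinearMap.congr_fun this x

theorem perT_bdryT (x : TX M H.toLeftBialgebroid) :
    perT H C (bdryT M H.toLeftBialgebroid x) = bdryT M H.toLeftBialgebroid (perT H C x) := by
  have : perT H C ∘ₗ bdryT M H.toLeftBialgebroid = bdryT M H.toLeftBialgebroid ∘ₗ perT H C :=
    TX.hom_ext fun n x => by
    rw [LinearMap.comp_apply, LinearMap.comp_apply]
    cases n with
    | zero => rw [perT_of, bdryT_zero, bdryT_zero, map_zero]
    | succ n =>
      have hx := ofX_mem (H := H.toLeftBialgebroid) (n + 1) x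
      have hx' : perT H C (ofX M H.toLeftBialgebroid (n + 1) x) ∈
          gradX M H.toLeftBialgebroid (n + 1) := by
        rw [perT_of]
        exact ofX_mem _ _
      rw [bdryT_apply hx, bdryT_apply hx', map_sum]
      refine Finset.sum_congr rfl fun i hi => ?_
      rw [Finset.mem_range] at hi
      rw [map_zsmul, perT_faceT H C (by omega) hx]
  exact LinearMap.congr_fun this x

/-- The image of `1 - T` in the total space. -/
noncomputable def imTot : Submodule k (TX M H.toLeftBialgebroid) :=
  LinearMap.range (LinearMap.id - perT H C)

theorem ofX_mem_imTot {n : ℕ} {x : Ch M H.η n} :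
    ofX M H.toLeftBialgebroid n x ∈ imTot H C ↔ x ∈ imT H C n := by
  constructor
  · rintro ⟨z, hz⟩
    obtain ⟨π, hπ⟩ : ∃ π : TX M H.toLeftBialgebroid →ₗ[k] Ch M H.η n, ∀ m y,
        π (ofX M H.toLeftBialgebroid m y) = if h : m = n then Chain.cast h y else 0 :=
      ⟨totX fun m => if h : m = n then Chain.cast h else 0, fun m y => by
        rw [totX_of]; split_ifs <;> rfl⟩
    have h1 : π ∘ₗ (LinearMap.id - perT H C) = (1 - cycT H C n) ∘ₗ π := TX.hom_ext fun m y => by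
      rw [LinearMap.comp_apply, LinearMap.comp_apply, LinearMap.sub_apply, LinearMap.id_apply,
        perT_of, map_sub, hπ, hπ]
      by_cases h : m = n
      · subst h
        rw [dif_pos rfl, dif_pos rfl]
        rfl
      · rw [dif_neg h, dif_neg h, sub_zero, map_zero]
    have h2 := LinearMap.congr_fun h1 z
    rw [LinearMap.comp_apply, hz, hπ, dif_pos rfl] at h2
    exact ⟨π z, h2.symm⟩
  · rintro ⟨z, rfl⟩
    refine ⟨ofX M H.toLeftBialgebroid n z, ?_⟩
    rw [LinearMap.sub_apply, LinearMap.id_apply, perT_of, ← map_sub]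
    rfl

theorem map_mem_imTot {F : TX M H.toLeftBialgebroid →ₗ[k] TX M H.toLeftBialgebroid}
    (hF : ∀ n x, perT H C (F (ofX M H.toLeftBialgebroid n x)) =
      F (perT H C (ofX M H.toLeftBialgebroid n x))) {x : TX M H.toLeftBialgebroid}
    (hx : x ∈ imTot H C) : F x ∈ imTot H C := by
  obtain ⟨x, rfl⟩ := hx
  have : perT H C ∘ₗ F = F ∘ₗ perT H C := TX.hom_ext hF
  refine ⟨F x, ?_⟩
  rw [LinearMap.sub_apply, LinearMap.sub_apply, LinearMap.id_apply, LinearMap.id_apply, map_sub]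
  exact congrArg _ (LinearMap.congr_fun this x)

theorem bdry_mem_imT (n : ℕ) (x : Ch M H.η (n + 1)) (hx : x ∈ imT H C (n + 1)) :
    bdry M H.toLeftBialgebroid n x ∈ imT H C n := by
  rw [← ofX_mem_imTot] at hx ⊢
  rw [← bdryT_of]
  exact map_mem_imTot H C (fun _ _ => perT_bdryT H C _) hx

theorem mem_CM_iff {p : ℕ} (φ : Cochain H.toLeftBialgebroid p) :
    φ ∈ CM H C p ↔ ∀ r, ∀ x ∈ imTot H C, insAt M H.toLeftBialgebroid r φ x ∈ imTot H C := by
  constructor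
  · rintro hφ r _ ⟨x, rfl⟩
    have : (imTot H C).mkQ ∘ₗ insAt M H.toLeftBialgebroid r φ ∘ₗ (LinearMap.id - perT H C) = 0 :=
      TX.hom_ext fun n x => by
        refine (Submodule.Quotient.mk_eq_zero _).mpr ?_
        rw [LinearMap.comp_apply, LinearMap.sub_apply, perT_of, LinearMap.id_apply, ← map_sub]
        rcases lt_or_ge n (p + r) with h | h
        · rw [insAt_of_lt _ _ h]
          exact zero_mem _
        · obtain ⟨a, rfl⟩ : ∃ a, n = a + p + r := ⟨n - (p + r), by omega⟩
          rw [insAt_of, ofX_mem_imTot]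
          exact hφ a r _ ⟨x, rfl⟩
    exact (Submodule.Quotient.mk_eq_zero _).mp (LinearMap.congr_fun this x)
  · intro hφ a r x hx
    rw [← ofX_mem_imTot] at hx ⊢
    rw [← insAt_of]
    exact hφ r _ hx

/-- The closed family of the spaces `C_M(U)`. -/
noncomputable def cycCochains : ClosedFamily H.toLeftBialgebroid where
  mem := CM H C
  circ_mem a q r φ ψ hφ hψ := by
    rw [mem_CM_iff] at hφ hψ ⊢
    intro s x hx
    rw [insAt_circ]
    exact hφ _ _ (hψ _ _ hx)
  unit_mem := by
    rw [mem_CM_iff]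
    refine fun r x => map_mem_imTot H C fun n x => ?_
    rcases lt_or_ge n r with h | h
    · rw [perT_of, insAt_of_lt _ _ (by omega), insAt_of_lt _ _ (by omega), map_zero]
    · exact perT_insAt_unit H C h (ofX_mem n x)
  counit_mem := by
    rw [mem_CM_iff]
    refine fun r x => map_mem_imTot H C fun n x => ?_
    rw [perT_of]
    rcases lt_or_ge r n with h | h
    · rw [insAt_counit _ _ _ h, insAt_counit _ _ _ h, perT_of]
    · rw [insAt_of_lt _ _ (by omega), insAt_of_lt _ _ (by omega), map_zero]
  mul_mem := by
    rw [mem_CM_iff]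
    refine fun r x => map_mem_imTot H C fun n x => ?_
    rcases lt_or_ge n (2 + r) with h | h
    · rw [perT_of, insAt_of_lt _ _ (by omega), insAt_of_lt _ _ (by omega), map_zero]
    · obtain ⟨n, rfl⟩ : ∃ m, n = m + 1 := ⟨n - 1, by omega⟩
      have := perT_faceT H C (i := r + 1) (by omega) (ofX_mem (H := H.toLeftBialgebroid) (n + 1) x)
      rw [faceT_succ (by omega)] at this
      exact this

end Period
end HopfCalculus

namespace HopfCalculus

section CyclicQuotient

variable {k : Type v} {A U M : Type u} [CommRing k] [Ring A] [Algebra k A] [Ring U] [Algebra k U]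
  [AddCommGroup M] [Module k M] [Module Uᵐᵒᵖ M] [IsScalarTower k Uᵐᵒᵖ M]
variable (H : LeftHopfAlgebroid k A U) (C : ModuleComodule H.toLeftBialgebroid M)

theorem capExt_mem {m n p : ℕ} (h : m + p = n + 1) (φ : Cochain H.toLeftBialgebroid p)
    {x : TX M H.toLeftBialgebroid} (hx : x ∈ gradX M H.toLeftBialgebroid n) :
    capExt H C φ x ∈ gradX M H.toLeftBialgebroid m :=
  face0T_mem (insAt_mem (by omega) (by omega) φ (extT_mem H C hx))

theorem capExt_eq_zero {n p : ℕ} (h : n + 1 < p) (φ : Cochain H.toLeftBialgebroid p)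
    {x : TX M H.toLeftBialgebroid} (hx : x ∈ gradX M H.toLeftBialgebroid n) :
    capExt H C φ x = 0 := by
  rw [capExt_apply, insAt_eq_zero (by omega) φ (extT_mem H C hx), map_zero]

theorem insAt_extT_cycTot_pow {q n r : ℕ} (h : q + r ≤ n + 1) (ψ : Cochain H.toLeftBialgebroid q)
    {x : TX M H.toLeftBialgebroid} (hx : x ∈ gradX M H.toLeftBialgebroid n) :
    insAt M H.toLeftBialgebroid r ψ (extT H C ((cycTot H C ^ r) x)) =
      extT H C ((cycTot H C ^ r) (capExt H C ψ x)) := by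
  cases r with
  | zero => exact (extT_capExt H C ψ x).symm
  | succ r => rw [cycTot_pow_capExt H C (by omega) ψ hx, extT_insAt]

theorem capExt_circAt {p q n r : ℕ} (hr : r < p) (φ : Cochain H.toLeftBialgebroid p)
    (ψ : Cochain H.toLeftBialgebroid q) {x : TX M H.toLeftBialgebroid}
    (hx : x ∈ gradX M H.toLeftBialgebroid n) :
    capExt H C (circAt r q hr φ ψ) ((cycTot H C ^ r) x) =
      capExt H C φ ((cycTot H C ^ r) (capExt H C ψ x)) := by
  rw [capExt_apply, insAt_circAt, Nat.zero_add]
  rcases le_or_gt (q + r) (n + 1) with h | h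
  · rw [insAt_extT_cycTot_pow H C h ψ hx]
    rfl
  · rw [insAt_eq_zero h ψ (extT_mem H C (cycTot_pow_mem H C r hx)), map_zero, map_zero]
    rcases le_or_gt q (n + 1) with h' | h'
    · rw [capExt_eq_zero H C (n := n + 1 - q) (by omega) φ
        (cycTot_pow_mem H C r (capExt_mem H C (by omega) ψ hx))]
    · rw [capExt_eq_zero H C h' ψ hx, map_zero, map_zero]

theorem capExt_cycTot_pow_capExt {p q n s : ℕ} (h : q + (p + s) ≤ n + 1)
    (φ : Cochain H.toLeftBialgebroid p) (ψ : Cochain H.toLeftBialgebroid q)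
    {x : TX M H.toLeftBialgebroid} (hx : x ∈ gradX M H.toLeftBialgebroid n) :
    capExt H C φ ((cycTot H C ^ (p + s)) (capExt H C ψ x)) =
      insAt M H.toLeftBialgebroid s ψ (capExt H C φ ((cycTot H C ^ (p + s)) x)) := by
  have := insAt_comm s 0 p q φ ψ (extT H C ((cycTot H C ^ (p + s)) x))
  rw [add_zero, add_zero] at this
  rw [capExt_apply H C φ, capExt_apply H C φ, ← face0T_insAt_succ, this, Nat.add_comm s p,
    insAt_extT_cycTot_pow H C h ψ hx]

/-- The chains modulo the image of `1 - T`. -/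
abbrev QX : Type u := TX M H.toLeftBialgebroid ⧸ imTot H C

/-- The class of a chain modulo the image of `1 - T`. -/
noncomputable def toQ : TX M H.toLeftBialgebroid →ₗ[k] QX H C := (imTot H C).mkQ

variable {H C} in
/-- The map that a linear map induces modulo the image of `1 - T`. -/
noncomputable def onQ (F : TX M H.toLeftBialgebroid →ₗ[k] TX M H.toLeftBialgebroid)
    (hF : ∀ x ∈ imTot H C, F x ∈ imTot H C) : QX H C →ₗ[k] QX H C :=
  (imTot H C).mapQ (imTot H C) F hF

theorem onQ_toQ (F : TX M H.toLeftBialgebroid →ₗ[k] TX M H.toLeftBialgebroid)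
    (hF : ∀ x ∈ imTot H C, F x ∈ imTot H C) (x : TX M H.toLeftBialgebroid) :
    onQ F hF (toQ H C x) = toQ H C (F x) := rfl

theorem toQ_eq_zero {x : TX M H.toLeftBialgebroid} : toQ H C x = 0 ↔ x ∈ imTot H C :=
  Submodule.Quotient.mk_eq_zero _

theorem toQ_perT (x : TX M H.toLeftBialgebroid) : toQ H C (perT H C x) = toQ H C x := by
  rw [eq_comm, ← sub_eq_zero, ← map_sub, toQ_eq_zero]
  exact ⟨x, rfl⟩

/-- The classes of chains of degree `n`. -/
noncomputable def gradQ (n : ℕ) : Submodule k (QX H C) :=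
  (gradX M H.toLeftBialgebroid n).map (toQ H C)

variable {H C} in
theorem toQ_mem {n : ℕ} {x : TX M H.toLeftBialgebroid}
    (hx : x ∈ gradX M H.toLeftBialgebroid n) : toQ H C x ∈ gradQ H C n := ⟨x, hx, rfl⟩

theorem QX.hom_ext {Z : Type*} [AddCommGroup Z] [Module k Z] {f g : QX H C →ₗ[k] Z}
    (h : ∀ n, ∀ x ∈ gradX M H.toLeftBialgebroid n, f (toQ H C x) = g (toQ H C x)) : f = g :=
  Submodule.linearMap_qext _ (TX.hom_ext fun n x => h n _ (ofX_mem n x))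

/-- The signed cyclic operator on the total space. -/
noncomputable def sgnCyc : Module.End k (TX M H.toLeftBialgebroid) :=
  totX fun n => sg n • (cycTot H C ∘ₗ ofX M H.toLeftBialgebroid n)

theorem sgnCyc_apply {n : ℕ} {x : TX M H.toLeftBialgebroid}
    (hx : x ∈ gradX M H.toLeftBialgebroid n) : sgnCyc H C x = sg n • cycTot H C x := by
  obtain ⟨x, rfl⟩ := hx
  exact totX_of _ n x

theorem sgnCyc_pow {n : ℕ} (i : ℕ) {x : TX M H.toLeftBialgebroid}
    (hx : x ∈ gradX M H.toLeftBialgebroid n) :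
    (sgnCyc H C ^ i) x = sg (n * i) • (cycTot H C ^ i) x := by
  induction i with
  | zero => simp
  | succ i ih =>
    rw [pow_succ', Module.End.mul_apply, ih, map_zsmul,
      sgnCyc_apply H C (cycTot_pow_mem H C i hx), smul_smul, ← sg_add, pow_succ',
      Module.End.mul_apply]
    congr 2

theorem sgnCyc_pow_mem {n : ℕ} (i : ℕ) {x : TX M H.toLeftBialgebroid}
    (hx : x ∈ gradX M H.toLeftBialgebroid n) :
    (sgnCyc H C ^ i) x ∈ gradX M H.toLeftBialgebroid n := by
  rw [sgnCyc_pow H C i hx]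
  exact zsmul_mem (cycTot_pow_mem H C i hx) _

theorem sgnCyc_pow_succ {n : ℕ} {x : TX M H.toLeftBialgebroid}
    (hx : x ∈ gradX M H.toLeftBialgebroid n) : (sgnCyc H C ^ (n + 1)) x = perT H C x := by
  rw [sgnCyc_pow H C (n + 1) hx, perT_apply H C hx, sg, Int.negOnePow_even _ ?_]
  · exact one_smul _ _
  · exact_mod_cast Nat.even_mul_succ_self n

theorem perT_sgnCyc_pow (i n : ℕ) {x : TX M H.toLeftBialgebroid}
    (hx : x ∈ gradX M H.toLeftBialgebroid n) :
    perT H C ((sgnCyc H C ^ i) x) = (sgnCyc H C ^ i) (perT H C x) := by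
  rw [← sgnCyc_pow_succ H C hx, ← sgnCyc_pow_succ H C (sgnCyc_pow_mem H C i hx),
    ← Module.End.mul_apply, ← Module.End.mul_apply, ← pow_add, ← pow_add, add_comm]

/-- The power of the signed cyclic operator that is inverse to it modulo the image of `1 - T`. -/
noncomputable def sgnCycInv : Module.End k (TX M H.toLeftBialgebroid) :=
  totX fun n => (sgnCyc H C ^ n) ∘ₗ ofX M H.toLeftBialgebroid n

theorem sgnCycInv_apply {n : ℕ} {x : TX M H.toLeftBialgebroid}
    (hx : x ∈ gradX M H.toLeftBialgebroid n) : sgnCycInv H C x = (sgnCyc H C ^ n) x := by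
  obtain ⟨x, rfl⟩ := hx
  exact totX_of _ n x

theorem perT_mem {n : ℕ} {x : TX M H.toLeftBialgebroid}
    (hx : x ∈ gradX M H.toLeftBialgebroid n) : perT H C x ∈ gradX M H.toLeftBialgebroid n := by
  rw [← sgnCyc_pow_succ H C hx]
  exact sgnCyc_pow_mem H C _ hx

/-- The signed cyclic operator modulo the image of `1 - T`. -/
noncomputable def rotUnit : (Module.End k (QX H C))ˣ where
  val := onQ (sgnCyc H C) fun _ => map_mem_imTot H C fun n x => by
    have := perT_sgnCyc_pow H C 1 n (ofX_mem n x)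
    rwa [pow_one] at this
  inv := onQ (sgnCycInv H C) fun _ => map_mem_imTot H C fun n x => by
    rw [sgnCycInv_apply H C (ofX_mem n x), sgnCycInv_apply H C (perT_mem H C (ofX_mem n x))]
    exact perT_sgnCyc_pow H C n n (ofX_mem n x)
  val_inv := QX.hom_ext H C fun n x hx => by
    rw [Module.End.mul_apply, onQ_toQ, onQ_toQ, sgnCycInv_apply H C hx, ← Module.End.mul_apply,
      ← pow_succ', sgnCyc_pow_succ H C hx, toQ_perT]
    rfl
  inv_val := QX.hom_ext H C fun n x hx => by
    have := sgnCyc_pow_mem H C 1 hx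
    rw [pow_one] at this
    rw [Module.End.mul_apply, onQ_toQ, onQ_toQ, sgnCycInv_apply H C this, ← Module.End.mul_apply,
      ← pow_succ, sgnCyc_pow_succ H C hx, toQ_perT]
    rfl

/-- The powers of the signed cyclic operator modulo the image of `1 - T`. -/
noncomputable def rotQ (a : ℤ) : Module.End k (QX H C) := (rotUnit H C ^ a : (Module.End k (QX H C))ˣ)

theorem rotQ_zero (x : QX H C) : rotQ H C 0 x = x := by
  rw [rotQ, zpow_zero]
  rfl

theorem rotQ_rotQ (a b : ℤ) (x : QX H C) : rotQ H C a (rotQ H C b x) = rotQ H C (a + b) x := by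
  rw [rotQ, rotQ, rotQ, zpow_add, Units.val_mul, Module.End.mul_apply]

theorem rotQ_one_toQ (x : TX M H.toLeftBialgebroid) :
    rotQ H C 1 (toQ H C x) = toQ H C (sgnCyc H C x) := by
  rw [rotQ, zpow_one]
  rfl

theorem rotQ_natCast_toQ (i : ℕ) (x : TX M H.toLeftBialgebroid) :
    rotQ H C i (toQ H C x) = toQ H C ((sgnCyc H C ^ i) x) := by
  induction i with
  | zero => exact rotQ_zero H C _
  | succ i ih =>
    rw [show ((i + 1 : ℕ) : ℤ) = 1 + i by push_cast; ring, ← rotQ_rotQ, ih, rotQ_one_toQ, pow_succ',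
      Module.End.mul_apply]

theorem rotQ_toQ (i : ℕ) {n : ℕ} {x : TX M H.toLeftBialgebroid}
    (hx : x ∈ gradX M H.toLeftBialgebroid n) :
    rotQ H C i (toQ H C x) = sg (n * i) • toQ H C ((cycTot H C ^ i) x) := by
  rw [rotQ_natCast_toQ, sgnCyc_pow H C i hx, map_zsmul]

theorem rotQ_natCast_mem (i : ℕ) {n : ℕ} {x : QX H C} (hx : x ∈ gradQ H C n) :
    rotQ H C i x ∈ gradQ H C n := by
  obtain ⟨x, hx, rfl⟩ := hx
  rw [rotQ_natCast_toQ]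
  exact toQ_mem (sgnCyc_pow_mem H C i hx)

theorem rotQ_period {n : ℕ} {x : QX H C} (hx : x ∈ gradQ H C n) : rotQ H C (n + 1) x = x := by
  obtain ⟨x, hx, rfl⟩ := hx
  have := rotQ_natCast_toQ H C (n + 1) x
  rw [sgnCyc_pow_succ H C hx, toQ_perT] at this
  exact_mod_cast this

theorem rotQ_neg_natCast_mem (i : ℕ) {n : ℕ} {x : QX H C} (hx : x ∈ gradQ H C n) :
    rotQ H C (-i) x ∈ gradQ H C n := by
  induction i with
  | zero => exact (rotQ_zero H C x).symm ▸ hx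
  | succ i ih =>
    rw [← rotQ_period H C hx, rotQ_rotQ, show -((i + 1 : ℕ) : ℤ) + (n + 1) = n + -i by push_cast; ring,
      ← rotQ_rotQ]
    exact rotQ_natCast_mem H C n ih

theorem rotQ_mem {n : ℕ} {x : QX H C} (a : ℤ) (hx : x ∈ gradQ H C n) :
    rotQ H C a x ∈ gradQ H C n := by
  obtain ⟨i, rfl | rfl⟩ := a.eq_nat_or_neg
  · exact rotQ_natCast_mem H C i hx
  · exact rotQ_neg_natCast_mem H C i hx

theorem insAt_mem_imTot {p : ℕ} {φ : Cochain H.toLeftBialgebroid p} (hφ : φ ∈ CM H C p) (r : ℕ)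
    (x : TX M H.toLeftBialgebroid) (hx : x ∈ imTot H C) :
    insAt M H.toLeftBialgebroid r φ x ∈ imTot H C := (mem_CM_iff H C φ).mp hφ r x hx

theorem capT_mem_imTot {p : ℕ} {φ : Cochain H.toLeftBialgebroid p} (hφ : φ ∈ CM H C p)
    (x : TX M H.toLeftBialgebroid) (hx : x ∈ imTot H C) : capT M φ x ∈ imTot H C :=
  map_mem_imTot H C (fun _ _ => perT_face0T H C _) (insAt_mem_imTot H C hφ 0 x hx)

theorem capExt_mem_imTot {p : ℕ} {φ : Cochain H.toLeftBialgebroid p} (hφ : φ ∈ CM H C p)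
    (x : TX M H.toLeftBialgebroid) (hx : x ∈ imTot H C) : capExt H C φ x ∈ imTot H C :=
  capT_mem_imTot H C hφ _ (map_mem_imTot H C (fun _ _ => perT_extT H C _) hx)

/-- The application of a cochain in `C_M(U)` modulo the image of `1 - T`. -/
noncomputable def appHom (p : ℕ) : (cycCochains H C).mem p →ₗ[k] QX H C →ₗ[k] QX H C where
  toFun φ := sg (p - 1 : ℤ) • onQ (capExt H C φ.1) (capExt_mem_imTot H C φ.2)
  map_add' φ ψ := by
    rw [← smul_add]
    refine congrArg _ (QX.hom_ext H C fun n x _ => ?_)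
    change toQ H C (capT M (φ.1 + ψ.1) (extT H C x)) = _
    rw [capT_add]
    rfl
  map_smul' c φ := by
    rw [RingHom.id_apply, smul_comm c]
    refine congrArg _ (QX.hom_ext H C fun n x _ => ?_)
    change toQ H C (capT M (c • φ.1) (extT H C x)) = _
    rw [capT_smul]
    rfl

/-- The application of elements of `C_M(U)` modulo the image of `1 - T`. -/
noncomputable def appQ : (cycCochains H C).Tot →ₗ[k] QX H C →ₗ[k] QX H C :=
  (cycCochains H C).lift (Z := QX H C →ₗ[k] QX H C) (appHom H C)

theorem appQ_of {p : ℕ} (φ : (cycCochains H C).mem p) (x : TX M H.toLeftBialgebroid) :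
    appQ H C ((cycCochains H C).of p φ) (toQ H C x) =
      sg (p - 1 : ℤ) • toQ H C (capExt H C φ.1 x) := by
  have : appQ H C ((cycCochains H C).of p φ) = appHom H C p φ :=
    (cycCochains H C).lift_of (Z := QX H C →ₗ[k] QX H C) _ p φ
  rw [this]
  rfl

theorem appQ_mem {m p n : ℕ} (h : m + p = n + 1) {φ : (cycCochains H C).Tot} {x : QX H C}
    (hφ : φ ∈ (cycCochains H C).deg p) (hx : x ∈ gradQ H C n) : appQ H C φ x ∈ gradQ H C m := by
  obtain ⟨φ, rfl⟩ := hφ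
  obtain ⟨x, hx, rfl⟩ := hx
  rw [appQ_of]
  exact zsmul_mem (toQ_mem (capExt_mem H C h φ.1 hx)) _

theorem appQ_eq_zero {p n : ℕ} (h : n + 1 < p) {φ : (cycCochains H C).Tot} {x : QX H C}
    (hφ : φ ∈ (cycCochains H C).deg p) (hx : x ∈ gradQ H C n) : appQ H C φ x = 0 := by
  obtain ⟨φ, rfl⟩ := hφ
  obtain ⟨x, hx, rfl⟩ := hx
  rw [appQ_of, capExt_eq_zero H C h φ.1 hx, map_zero, smul_zero]

theorem appQ_comp {p q n r : ℕ} {φ ψ : (cycCochains H C).Tot} {x : QX H C}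
    (hφ : φ ∈ (cycCochains H C).deg p) (hψ : ψ ∈ (cycCochains H C).deg q) (hx : x ∈ gradQ H C n)
    (hr : r < p) : appQ H C ((cycCochains H C).comp r φ ψ) (rotQ H C r x) =
      appQ H C φ (rotQ H C r (appQ H C ψ x)) := by
  obtain ⟨φ, rfl⟩ := hφ
  obtain ⟨ψ, rfl⟩ := hψ
  obtain ⟨x, hx, rfl⟩ := hx
  rw [ClosedFamily.comp_of_of _ r hr, map_zsmul, LinearMap.smul_apply, rotQ_toQ H C r hx, map_zsmul,
    appQ_of, appQ_of, capExt_circAt H C hr φ.1 ψ.1 hx, map_zsmul, map_zsmul]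
  rcases le_or_gt q (n + 1) with h | h
  · rw [rotQ_toQ H C r (capExt_mem H C (m := n + 1 - q) (by omega) ψ.1 hx), map_zsmul, appQ_of]
    simp only [smul_smul, ← sg_add]
    congr 1
    refine sg_congr ((q - 1) * r) ?_
    push_cast [Nat.cast_sub h, Nat.cast_sub (show 1 ≤ p by omega)]
    ring
  · rw [capExt_eq_zero H C h ψ.1 hx]
    simp

theorem appQ_appQ {p q n s : ℕ} (h : q + (p + s) ≤ n + 1) {φ ψ : (cycCochains H C).Tot}
    {x : QX H C} (hφ : φ ∈ (cycCochains H C).deg p) (hψ : ψ ∈ (cycCochains H C).deg q)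
    (hx : x ∈ gradQ H C n) :
    appQ H C φ (rotQ H C (p + s : ℕ) (appQ H C ψ x)) =
      sg ((p - 1 : ℤ) * (q - 1)) • rotQ H C (s + 1 : ℕ) (appQ H C ψ
        (rotQ H C (-(s + 1 : ℕ)) (appQ H C φ (rotQ H C (p + s : ℕ) x)))) := by
  have hw := appQ_mem H C (show n + 1 - p + p = n + 1 by omega) hφ (rotQ_mem H C (p + s : ℕ) hx)
  obtain ⟨v, hv, hv'⟩ := rotQ_mem H C (-(s + 1 : ℕ)) hw
  obtain ⟨φ, rfl⟩ := hφ
  obtain ⟨ψ, rfl⟩ := hψ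
  obtain ⟨x, hx, rfl⟩ := hx
  have e1 : rotQ H C (s + 1 : ℕ) (toQ H C v) =
      appQ H C ((cycCochains H C).of p φ) (rotQ H C (p + s : ℕ) (toQ H C x)) := by
    rw [hv', rotQ_rotQ, add_neg_cancel, rotQ_zero]
  rw [rotQ_toQ H C _ hv, rotQ_toQ H C _ hx, map_zsmul, appQ_of] at e1
  have e2 := congrArg (onQ (insAt M H.toLeftBialgebroid s ψ.1) (insAt_mem_imTot H C ψ.2 s)) e1
  simp only [map_zsmul, onQ_toQ] at e2
  rw [← hv', appQ_of, appQ_of, map_zsmul, map_zsmul, map_zsmul,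
    rotQ_toQ H C _ (capExt_mem H C (show n + 1 - q + q = n + 1 by omega) ψ.1 hx),
    map_zsmul, appQ_of, rotQ_toQ H C _ (capExt_mem H C
      (show n + 2 - p - q + q = n + 1 - p + 1 by omega) ψ.1 hv),
    cycTot_pow_capExt H C (by omega) ψ.1 hv, capExt_cycTot_pow_capExt H C h φ.1 ψ.1 hx]
  have e3 := congrArg (sg ((n + 1 - p : ℕ) * (s + 1 : ℕ)) • ·) e2
  simp only [sg_smul_sg_smul] at e3
  rw [e3]
  simp only [smul_smul, ← sg_add]
  congr 1
  refine sg_congr ((1 - q) * p - (n + 1 - p) * (s + 1) + q - 1) ?_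
  rw [Nat.cast_sub (show q ≤ n + 1 by omega), Nat.cast_sub (show p ≤ n + 1 by omega),
    show ((n + 2 - p - q : ℕ) : ℤ) = n + 2 - p - q by omega]
  push_cast
  ring

/-- The cyclic module of the chains modulo the image of `1 - T`. -/
noncomputable def cycMod : CycMod k (cycCochains H C).oper (QX H C) where
  deg := gradQ H C
  rot := rotQ H C
  app := appQ H C
  rot_zero := rotQ_zero H C
  rot_rot := rotQ_rotQ H C
  rot_mem a hx := rotQ_mem H C a hx
  rot_period hx := rotQ_period H C hx
  app_mem h hφ hx := appQ_mem H C h hφ hx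
  app_zero h hφ hx := appQ_eq_zero H C h hφ hx
  app_comp {p q n r φ ψ x} hφ hψ hx hr := by
    have := appQ_comp H C hφ hψ (rotQ_mem H C (-r) hx) hr
    rwa [rotQ_rotQ, add_neg_cancel, rotQ_zero] at this
  app_app {p q n r φ ψ x} hφ hψ hx hpr hr := by
    obtain ⟨s, rfl⟩ := Nat.exists_eq_add_of_le hpr
    have := appQ_appQ H C (by omega) hφ hψ (rotQ_mem H C (-(p + s : ℕ)) hx)
    rw [rotQ_rotQ, add_neg_cancel, rotQ_zero] at this
    rw [show ((p + s : ℕ) : ℤ) - p + 1 = (s + 1 : ℕ) by push_cast; ring]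
    exact this
  app_one {n x} hx := by
    obtain ⟨x, hx, rfl⟩ := hx
    refine (appQ_of H C ⟨_, (cycCochains H C).counit_mem⟩ x).trans ?_
    obtain ⟨y, hy⟩ := extT_mem H C hx
    rw [capExt_apply, ← hy, insAt_counit _ _ _ (by omega), hy, face0T_extT]
    simp

end CyclicQuotient
end HopfCalculus

namespace HopfCalculus

section Descent

variable {k : Type v} [CommRing k]

theorem dsum_hom_ext {V : ℕ → Type u} [∀ p, AddCommGroup (V p)] [∀ p, Module k (V p)]
    {X : Type*} [AddCommGroup X] [Module k X] {f g : (⨁ p, V p) →ₗ[k] X}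
    (h : ∀ p v, f (DirectSum.lof k ℕ V p v) = g (DirectSum.lof k ℕ V p v)) : f = g :=
  DirectSum.linearMap_ext k fun p => LinearMap.ext fun v => h p v

/-- Bilinear maps on direct sums. -/
noncomputable def dsumLift₂ {V W : ℕ → Type u} [∀ p, AddCommGroup (V p)] [∀ p, Module k (V p)]
    [∀ p, AddCommGroup (W p)] [∀ p, Module k (W p)] {X : Type u} [AddCommGroup X] [Module k X]
    (f : ∀ p q, V p →ₗ[k] W q →ₗ[k] X) : (⨁ p, V p) →ₗ[k] (⨁ q, W q) →ₗ[k] X :=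
  DirectSum.toModule k ℕ ((⨁ q, W q) →ₗ[k] X) fun p =>
    (DirectSum.toModule k ℕ (V p →ₗ[k] X) fun q => (f p q).flip).flip

theorem dsumLift₂_lof {V W : ℕ → Type u} [∀ p, AddCommGroup (V p)] [∀ p, Module k (V p)]
    [∀ p, AddCommGroup (W p)] [∀ p, Module k (W p)] {X : Type u} [AddCommGroup X] [Module k X]
    (f : ∀ p q, V p →ₗ[k] W q →ₗ[k] X) (p q : ℕ) (v : V p) (w : W q) :
    dsumLift₂ f (DirectSum.lof k ℕ V p v) (DirectSum.lof k ℕ W q w) = f p q v w := by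
  rw [dsumLift₂, DirectSum.toModule_lof (M := V) k, LinearMap.flip_apply,
    DirectSum.toModule_lof (M := W) k, LinearMap.flip_apply]

/-- Bilinear maps on quotients. -/
noncomputable def quotLift₂ {V W X : Type u} [AddCommGroup V] [Module k V] [AddCommGroup W]
    [Module k W] [AddCommGroup X] [Module k X] (S : Submodule k V) (T : Submodule k W)
    (f : V →ₗ[k] W →ₗ[k] X) (hS : ∀ v ∈ S, ∀ w, f v w = 0) (hT : ∀ v, ∀ w ∈ T, f v w = 0) :
    V ⧸ S →ₗ[k] W ⧸ T →ₗ[k] X :=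
  (T.liftQ (S.liftQ f fun v hv => LinearMap.ext fun w => hS v hv w).flip fun w hw =>
    Submodule.linearMap_qext _ (LinearMap.ext fun v => hT v w hw)).flip

variable (k) in
/-- Graded subquotients `Z p ⧸ N p`, where `Z p` is mapped to a module `O`. -/
structure Subquot (O : Type u) [AddCommGroup O] [Module k O] (Z : ℕ → Type u)
    [∀ p, AddCommGroup (Z p)] [∀ p, Module k (Z p)] (N : ∀ p, Submodule k (Z p)) where
  /-- the map to `O` -/
  ι : ∀ p, Z p →ₗ[k] O
  ker_le : ∀ p c, ι p c = 0 → c ∈ N p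

namespace Subquot

variable {O : Type u} [AddCommGroup O] [Module k O] {Z : ℕ → Type u}
  [∀ p, AddCommGroup (Z p)] [∀ p, Module k (Z p)] {N : ∀ p, Submodule k (Z p)}
  (D : Subquot k O Z N)

/-- The elements that represent classes of degree `p`. -/
def closed (p : ℕ) : Submodule k O := LinearMap.range (D.ι p)

/-- The elements that represent zero in degree `p`. -/
def exact (p : ℕ) : Submodule k O := (N p).map (D.ι p)

/-- The class in degree `p` that an element represents. -/
noncomputable def cl (p : ℕ) (z : O) : ⨁ p, Z p ⧸ N p := by
  classical
  exact if h : ∃ c, D.ι p c = z then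
    DirectSum.lof k ℕ (fun p => Z p ⧸ N p) p (Submodule.Quotient.mk h.choose) else 0

theorem cl_ι (p : ℕ) (c : Z p) : D.cl p (D.ι p c) =
    DirectSum.lof k ℕ (fun p => Z p ⧸ N p) p (Submodule.Quotient.mk c) := by
  have h : ∃ c', D.ι p c' = D.ι p c := ⟨c, rfl⟩
  rw [cl, dif_pos h]
  refine congrArg _ ((Submodule.Quotient.eq _).mpr (D.ker_le p _ ?_))
  rw [map_sub, h.choose_spec, sub_self]

theorem cl_add {p : ℕ} {z w : O} (hz : z ∈ D.closed p) (hw : w ∈ D.closed p) :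
    D.cl p (z + w) = D.cl p z + D.cl p w := by
  obtain ⟨z, rfl⟩ := hz
  obtain ⟨w, rfl⟩ := hw
  rw [← map_add, cl_ι, cl_ι, cl_ι, ← map_add]
  rfl

theorem cl_smul {p : ℕ} (c : k) {z : O} (hz : z ∈ D.closed p) :
    D.cl p (c • z) = c • D.cl p z := by
  obtain ⟨z, rfl⟩ := hz
  rw [← map_smul, cl_ι, cl_ι, ← map_smul]
  rfl

theorem cl_of_exact {p : ℕ} {z : O} (hz : z ∈ D.exact p) : D.cl p z = 0 := by
  obtain ⟨c, hc, rfl⟩ := hz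
  rw [cl_ι, (Submodule.Quotient.mk_eq_zero _).mpr hc, map_zero]

theorem cl_zero (p : ℕ) : D.cl p 0 = 0 := D.cl_of_exact (zero_mem _)

theorem cl_zsmul {p : ℕ} (c : ℤ) {z : O} (hz : z ∈ D.closed p) :
    D.cl p (c • z) = c • D.cl p z := by
  rw [← Int.cast_smul_eq_zsmul k c z, cl_smul _ _ hz]
  exact Int.cast_smul_eq_zsmul k c (D.cl p z)

theorem cl_neg {p : ℕ} {z : O} (hz : z ∈ D.closed p) : D.cl p (-z) = -D.cl p z := by
  rw [← neg_one_zsmul, cl_zsmul _ _ hz, neg_one_zsmul]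

theorem cl_sub {p : ℕ} {z w : O} (hz : z ∈ D.closed p) (hw : w ∈ D.closed p) :
    D.cl p (z - w) = D.cl p z - D.cl p w := by
  rw [sub_eq_add_neg, cl_add _ hz (neg_mem hw), cl_neg _ hw, sub_eq_add_neg]

theorem exact_le (p : ℕ) : D.exact p ≤ D.closed p := by
  rintro _ ⟨c, _, rfl⟩
  exact ⟨c, rfl⟩

theorem cl_congr {p q : ℕ} {z : O} (h : z ≠ 0 → p = q) : D.cl p z = D.cl q z := by
  by_cases hz : z = 0
  · rw [hz, cl_zero, cl_zero]
  · rw [h hz]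

theorem cl_mem_homog (p : ℕ) (z : O) : D.cl p z ∈ homog k (fun p => Z p ⧸ N p) p := by
  by_cases h : ∃ c, D.ι p c = z
  · obtain ⟨c, rfl⟩ := h
    rw [cl_ι]
    exact ⟨_, rfl⟩
  · rw [cl, dif_neg h]
    exact zero_mem _

theorem lof_eq_cl (p : ℕ) (v : Z p ⧸ N p) :
    ∃ z ∈ D.closed p, DirectSum.lof k ℕ (fun p => Z p ⧸ N p) p v = D.cl p z := by
  obtain ⟨c, rfl⟩ := Submodule.Quotient.mk_surjective _ v
  exact ⟨D.ι p c, ⟨c, rfl⟩, (D.cl_ι p c).symm⟩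

theorem eq_cl_of_homog {p : ℤ} {α : ⨁ p, Z p ⧸ N p}
    (h : α ∈ homog k (fun p => Z p ⧸ N p) p) :
    α = 0 ∨ ∃ n : ℕ, p = n ∧ ∃ z ∈ D.closed n, α = D.cl n z := by
  rcases p with n | n
  · obtain ⟨v, rfl⟩ := h
    exact .inr ⟨n, rfl, D.lof_eq_cl n v⟩
  · exact .inl h

theorem hom_ext {X : Type*} [AddCommGroup X] [Module k X] {f g : (⨁ p, Z p ⧸ N p) →ₗ[k] X}
    (h : ∀ p, ∀ z ∈ D.closed p, f (D.cl p z) = g (D.cl p z)) : f = g :=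
  dsum_hom_ext fun p v => by
    obtain ⟨z, hz, hv⟩ := D.lof_eq_cl p v
    rw [hv]
    exact h p z hz

variable {O₂ : Type u} [AddCommGroup O₂] [Module k O₂] {Z₂ : ℕ → Type u}
  [∀ p, AddCommGroup (Z₂ p)] [∀ p, Module k (Z₂ p)] {N₂ : ∀ p, Submodule k (Z₂ p)}
  (D₂ : Subquot k O₂ Z₂ N₂)

/-- The linear map on classes that is induced by linear maps on representatives. -/
noncomputable def map (ν : ℕ → ℕ) (f : ∀ _ : ℕ, O →ₗ[k] O₂)
    (hc : ∀ p, ∀ z ∈ D.closed p, f p z ∈ D₂.closed (ν p))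
    (hb : ∀ p, ∀ z ∈ D.exact p, f p z ∈ D₂.exact (ν p)) :
    (⨁ p, Z p ⧸ N p) →ₗ[k] (⨁ p, Z₂ p ⧸ N₂ p) :=
  DirectSum.toModule k ℕ (⨁ p, Z₂ p ⧸ N₂ p) fun p => (N p).liftQ
    { toFun := fun c => D₂.cl (ν p) (f p (D.ι p c))
      map_add' := fun c c' => by
        rw [map_add, map_add, cl_add _ (hc p _ ⟨c, rfl⟩) (hc p _ ⟨c', rfl⟩)]
      map_smul' := fun a c => by
        rw [map_smul, map_smul, cl_smul _ _ (hc p _ ⟨c, rfl⟩)]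
        rfl }
    fun c h => D₂.cl_of_exact (hb p _ ⟨c, h, rfl⟩)

theorem map_cl (ν : ℕ → ℕ) (f : ∀ _ : ℕ, O →ₗ[k] O₂)
    (hc : ∀ p, ∀ z ∈ D.closed p, f p z ∈ D₂.closed (ν p))
    (hb : ∀ p, ∀ z ∈ D.exact p, f p z ∈ D₂.exact (ν p)) {p : ℕ} {z : O} (hz : z ∈ D.closed p) :
    D.map D₂ ν f hc hb (D.cl p z) = D₂.cl (ν p) (f p z) := by
  obtain ⟨c, rfl⟩ := hz
  rw [cl_ι, map, DirectSum.toModule_lof (M := fun p => Z p ⧸ N p) k]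
  rfl

variable {O₃ : Type u} [AddCommGroup O₃] [Module k O₃] {Z₃ : ℕ → Type u}
  [∀ p, AddCommGroup (Z₃ p)] [∀ p, Module k (Z₃ p)] {N₃ : ∀ p, Submodule k (Z₃ p)}
  (D₃ : Subquot k O₃ Z₃ N₃)

/-- The bilinear map on classes that is induced by bilinear maps on representatives. -/
noncomputable def map₂ (ν : ℕ → ℕ → ℕ) (f : ∀ _ _ : ℕ, O →ₗ[k] O₂ →ₗ[k] O₃)
    (hc : ∀ p q, ∀ z ∈ D.closed p, ∀ w ∈ D₂.closed q, f p q z w ∈ D₃.closed (ν p q))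
    (hb : ∀ p q, ∀ z ∈ D.exact p, ∀ w ∈ D₂.closed q, f p q z w ∈ D₃.exact (ν p q))
    (hb' : ∀ p q, ∀ z ∈ D.closed p, ∀ w ∈ D₂.exact q, f p q z w ∈ D₃.exact (ν p q)) :
    (⨁ p, Z p ⧸ N p) →ₗ[k] (⨁ p, Z₂ p ⧸ N₂ p) →ₗ[k] (⨁ p, Z₃ p ⧸ N₃ p) :=
  dsumLift₂ fun p q => quotLift₂ (N p) (N₂ q)
    (LinearMap.mk₂ k (fun c d => D₃.cl (ν p q) (f p q (D.ι p c) (D₂.ι q d)))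
      (fun c c' d => by
        rw [map_add, map_add, LinearMap.add_apply,
          cl_add _ (hc p q _ ⟨c, rfl⟩ _ ⟨d, rfl⟩) (hc p q _ ⟨c', rfl⟩ _ ⟨d, rfl⟩)])
      (fun a c d => by
        rw [map_smul, map_smul, LinearMap.smul_apply, cl_smul _ _ (hc p q _ ⟨c, rfl⟩ _ ⟨d, rfl⟩)])
      (fun c d d' => by
        rw [map_add, map_add, cl_add _ (hc p q _ ⟨c, rfl⟩ _ ⟨d, rfl⟩) (hc p q _ ⟨c, rfl⟩ _ ⟨d', rfl⟩)])
      (fun a c d => by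
        rw [map_smul, map_smul, cl_smul _ _ (hc p q _ ⟨c, rfl⟩ _ ⟨d, rfl⟩)]))
    (fun c h d => D₃.cl_of_exact (hb p q _ ⟨c, h, rfl⟩ _ ⟨d, rfl⟩))
    (fun c d h => D₃.cl_of_exact (hb' p q _ ⟨c, rfl⟩ _ ⟨d, h, rfl⟩))

theorem map₂_cl (ν : ℕ → ℕ → ℕ) (f : ∀ _ _ : ℕ, O →ₗ[k] O₂ →ₗ[k] O₃)
    (hc : ∀ p q, ∀ z ∈ D.closed p, ∀ w ∈ D₂.closed q, f p q z w ∈ D₃.closed (ν p q))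
    (hb : ∀ p q, ∀ z ∈ D.exact p, ∀ w ∈ D₂.closed q, f p q z w ∈ D₃.exact (ν p q))
    (hb' : ∀ p q, ∀ z ∈ D.closed p, ∀ w ∈ D₂.exact q, f p q z w ∈ D₃.exact (ν p q))
    {p q : ℕ} {z : O} (hz : z ∈ D.closed p) {w : O₂} (hw : w ∈ D₂.closed q) :
    D.map₂ D₂ D₃ ν f hc hb hb' (D.cl p z) (D₂.cl q w) = D₃.cl (ν p q) (f p q z w) := by
  obtain ⟨c, rfl⟩ := hz
  obtain ⟨d, rfl⟩ := hw
  rw [cl_ι, cl_ι, map₂, dsumLift₂_lof]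
  rfl

end Subquot

end Descent
end HopfCalculus

namespace HopfCalculus

section Gerstenhaber

variable {k : Type v} [CommRing k] {O : Type u} [AddCommGroup O] [Module k O]

namespace Oper

variable (S : Oper k O)

theorem bra_zero_zero (φ ψ : O) : S.bra 0 0 φ ψ = 0 := by
  rw [bra, bar_zero, bar_zero, smul_zero, sub_zero]

/-- The bracket as a bilinear map. -/
def braL (p q : ℕ) : O →ₗ[k] O →ₗ[k] O :=
  S.bar p - sg ((p - 1 : ℤ) * (q - 1)) • (S.bar q).flip

theorem braL_apply (p q : ℕ) (φ ψ : O) : S.braL p q φ ψ = S.bra p q φ ψ := rfl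

/-- The cup product as a bilinear map. -/
def cupL (p : ℕ) : O →ₗ[k] O →ₗ[k] O := sg (p - 1 : ℤ) • (S.comp 0 ∘ₗ S.comp 1 S.mul)

theorem cupL_apply (p : ℕ) (φ ψ : O) : S.cupL p φ ψ = sg (p - 1 : ℤ) • S.cupM φ ψ := by
  rw [cupM_eq]
  rfl

theorem comp_one_mul_mem {p : ℕ} {β : O} (hβ : β ∈ S.deg p) : S.comp 1 S.mul β ∈ S.deg (1 + p) :=
  S.comp_mem S.mul_mem hβ (by omega)

theorem cupM_zero_left (ψ : O) : S.cupM 0 ψ = 0 := by simp [cupM_eq]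

theorem cupM_zero_right (φ : O) : S.cupM φ 0 = 0 := by simp [cupM_eq]

theorem diff_unit : S.diff 0 S.unit = 0 := by
  rw [diff_eq, bar_zero, smul_zero, sub_zero, bar_apply, Finset.sum_range_succ,
    Finset.sum_range_one, S.mul_unit_left, S.mul_unit_right, add_neg_cancel]

theorem unit_cupM {q : ℕ} {ψ : O} (hψ : ψ ∈ S.deg q) : S.cupM S.unit ψ = -ψ := by
  rw [cupM_eq, S.mul_unit_right, map_neg, LinearMap.neg_apply, S.one_comp hψ]

theorem cupM_unit {p : ℕ} {φ : O} (hφ : φ ∈ S.deg p) : S.cupM φ S.unit = sg (p - 1 : ℤ) • φ := by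
  rw [cupM_eq, S.par S.mul_mem hφ S.unit_mem Nat.zero_lt_one one_lt_two, S.mul_unit_left,
    S.one_comp hφ, sg_congr (1 - p) (b := (p - 1 : ℤ)) (by push_cast; ring)]

theorem comp_one_mul_cupM {p q : ℕ} {α β : O} (hα : α ∈ S.deg p) (hβ : β ∈ S.deg q) :
    S.comp 1 S.mul (S.cupM α β) = S.comp 1 (S.comp 2 (S.comp 1 S.mul S.mul) α) β := by
  rw [cupM_eq, ← S.seq S.mul_mem (S.comp_one_mul_mem hα) hβ one_lt_two (by omega),
    ← S.seq S.mul_mem S.mul_mem hα one_lt_two one_lt_two]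
  rfl

theorem comp_zero_comp_one_mul {p q : ℕ} {α β : O} (hα : α ∈ S.deg p) (hβ : β ∈ S.deg q) :
    S.comp 0 (S.comp 1 S.mul α) (S.comp 1 S.mul β) =
      -(sg (p - 1 : ℤ) • S.comp 1 S.mul (S.cupM α β)) := by
  rw [S.comp_one_mul_cupM hα hβ,
    ← S.seq (S.comp_one_mul_mem hα) S.mul_mem hβ (by omega) one_lt_two,
    S.par S.mul_mem hα S.mul_mem Nat.zero_lt_one one_lt_two,
    eq_neg_of_add_eq_zero_left S.mul_mul]
  simp

theorem cupM_assoc {p q r : ℕ} {α β γ : O} (hα : α ∈ S.deg p) (hβ : β ∈ S.deg q)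
    (hγ : γ ∈ S.deg r) :
    S.cupM α (S.cupM β γ) = -(sg (p - 1 : ℤ) • S.cupM (S.cupM α β) γ) := by
  rw [cupM_eq _ α, cupM_eq _ β, cupM_eq _ _ γ,
    ← S.seq (S.comp_one_mul_mem hα) (S.comp_one_mul_mem hβ) hγ (by omega) (by omega),
    S.comp_zero_comp_one_mul hα hβ, map_neg, map_zsmul, LinearMap.neg_apply, LinearMap.smul_apply]

theorem cupL_assoc {p q r : ℕ} {α β γ : O} (hα : α ∈ S.deg p) (hβ : β ∈ S.deg q)
    (hγ : γ ∈ S.deg r) : S.cupL (p + q) (S.cupL p α β) γ = S.cupL p α (S.cupL q β γ) := by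
  have e : sg (p - 1 : ℤ) * sg ((p + q : ℕ) - 1 : ℤ) =
      sg (q - 1 : ℤ) * (sg (p - 1 : ℤ) * -sg (p - 1 : ℤ)) := by
    rw [mul_neg, ← sg_add, ← sg_add, ← mul_neg_one, ← sg_one, ← sg_add, ← sg_add]
    refine sg_congr 0 ?_
    push_cast
    ring
  rw [cupL_apply S p α β, cupL_apply S q β γ, map_zsmul, map_zsmul, LinearMap.smul_apply,
    cupL_apply, cupL_apply, S.cupM_assoc hα hβ hγ, ← neg_smul, smul_smul, smul_smul, smul_smul, e,
    mul_assoc]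

variable {Z : ℕ → Type u} [∀ p, AddCommGroup (Z p)] [∀ p, Module k (Z p)]
  {N : ∀ p, Submodule k (Z p)}

/-- The classes of a graded subquotient are the cohomology classes of an operad. -/
structure IsCohomology (D : Subquot k O Z N) : Prop where
  mem_closed : ∀ {p z}, z ∈ D.closed p ↔ z ∈ S.deg p ∧ S.diff p z = 0
  diff_mem : ∀ {p z}, z ∈ S.deg p → S.diff p z ∈ D.exact (p + 1)
  cases : ∀ {p z}, z ∈ D.exact p → z = 0 ∨ ∃ n, p = n + 1 ∧ ∃ w ∈ S.deg n, z = S.diff n w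

variable {S} {D : Subquot k O Z N} (h : S.IsCohomology D)

namespace IsCohomology

include h in
theorem bra_closed {p q : ℕ} {z w : O} (hz : z ∈ D.closed p) (hw : w ∈ D.closed q) :
    S.bra p q z w ∈ D.closed (p + q - 1) := by
  rw [h.mem_closed] at hz hw
  rcases Nat.eq_zero_or_pos (p + q) with h0 | h0
  · obtain ⟨rfl, rfl⟩ : p = 0 ∧ q = 0 := by omega
    rw [bra_zero_zero]
    exact zero_mem _
  · rw [h.mem_closed, S.diff_bra hz.1 hw.1, hz.2, hw.2, bra_zero_left, bra_zero_right, smul_zero,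
      add_zero]
    exact ⟨S.bra_mem (by omega) hz.1 hw.1, rfl⟩

include h in
theorem bra_exact_left {p q : ℕ} {z w : O} (hz : z ∈ D.exact p) (hw : w ∈ D.closed q) :
    S.bra p q z w ∈ D.exact (p + q - 1) := by
  obtain rfl | ⟨n, rfl, z, hz', rfl⟩ := h.cases hz
  · rw [bra_zero_left]
    exact zero_mem _
  rw [h.mem_closed] at hw
  have h1 := S.diff_bra hz' hw.1
  rw [hw.2, bra_zero_right, smul_zero, add_zero] at h1
  rw [← h1]
  rcases Nat.eq_zero_or_pos (n + q) with h0 | h0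
  · obtain ⟨rfl, rfl⟩ : n = 0 ∧ q = 0 := by omega
    rw [bra_zero_zero, diff_zero]
    exact zero_mem _
  · have := h.diff_mem (S.bra_mem (show n + q = n + q - 1 + 1 by omega) hz' hw.1)
    rwa [show n + 1 + q - 1 = n + q - 1 + 1 by omega]

include h in
theorem bra_exact_right {p q : ℕ} {z w : O} (hz : z ∈ D.closed p) (hw : w ∈ D.exact q) :
    S.bra p q z w ∈ D.exact (p + q - 1) := by
  rw [bra_swap, add_comm p]
  exact neg_mem (zsmul_mem (h.bra_exact_left hw hz) _)

include h in
theorem cupL_closed {p q : ℕ} {z w : O} (hz : z ∈ D.closed p) (hw : w ∈ D.closed q) :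
    S.cupL p z w ∈ D.closed (p + q) := by
  rw [cupL_apply]
  rw [h.mem_closed] at hz hw
  refine zsmul_mem (h.mem_closed.mpr ⟨S.cupM_mem hz.1 hw.1, ?_⟩) _
  rw [S.diff_cupM hz.1 hw.1, hz.2, hw.2, cupM_zero_left, cupM_zero_right, smul_zero, sub_zero,
    neg_zero]

include h in
theorem cupL_exact_left {p q : ℕ} {z w : O} (hz : z ∈ D.exact p) (hw : w ∈ D.closed q) :
    S.cupL p z w ∈ D.exact (p + q) := by
  rw [cupL_apply]
  refine zsmul_mem ?_ _
  obtain rfl | ⟨n, rfl, z, hz', rfl⟩ := h.cases hz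
  · rw [cupM_zero_left]
    exact zero_mem _
  rw [h.mem_closed] at hw
  have h1 := S.diff_cupM hz' hw.1
  rw [hw.2, cupM_zero_right, smul_zero, sub_zero] at h1
  rw [← neg_neg (S.cupM _ _), ← h1, show n + 1 + q = n + q + 1 by omega]
  exact neg_mem (h.diff_mem (S.cupM_mem hz' hw.1))

include h in
theorem cupL_exact_right {p q : ℕ} {z w : O} (hz : z ∈ D.closed p) (hw : w ∈ D.exact q) :
    S.cupL p z w ∈ D.exact (p + q) := by
  rw [cupL_apply]
  obtain rfl | ⟨n, rfl, w, hw', rfl⟩ := h.cases hw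
  · rw [cupM_zero_right, smul_zero]
    exact zero_mem _
  rw [h.mem_closed] at hz
  have h1 := S.diff_cupM hz.1 hw'
  rw [hz.2, cupM_zero_left, neg_zero, zero_sub] at h1
  rw [← neg_neg (_ • S.cupM _ _), ← h1]
  exact neg_mem (h.diff_mem (S.cupM_mem hz.1 hw'))

/-- The cup product on cohomology. -/
noncomputable def mulMap : (⨁ p, Z p ⧸ N p) →ₗ[k] (⨁ p, Z p ⧸ N p) →ₗ[k] (⨁ p, Z p ⧸ N p) :=
  D.map₂ D D (fun p q => p + q) (fun p _ => S.cupL p) (fun _ _ _ hz _ hw => h.cupL_closed hz hw)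
    (fun _ _ _ hz _ hw => h.cupL_exact_left hz hw) (fun _ _ _ hz _ hw => h.cupL_exact_right hz hw)

theorem mulMap_cl {p q : ℕ} {z w : O} (hz : z ∈ D.closed p) (hw : w ∈ D.closed q) :
    h.mulMap (D.cl p z) (D.cl q w) = D.cl (p + q) (S.cupL p z w) := D.map₂_cl _ _ _ _ _ _ _ hz hw

/-- The bracket on cohomology. -/
noncomputable def braMap : (⨁ p, Z p ⧸ N p) →ₗ[k] (⨁ p, Z p ⧸ N p) →ₗ[k] (⨁ p, Z p ⧸ N p) :=
  D.map₂ D D (fun p q => p + q - 1) S.braL (fun _ _ _ hz _ hw => h.bra_closed hz hw)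
    (fun _ _ _ hz _ hw => h.bra_exact_left hz hw) (fun _ _ _ hz _ hw => h.bra_exact_right hz hw)

theorem braMap_cl {p q : ℕ} {z w : O} (hz : z ∈ D.closed p) (hw : w ∈ D.closed q) :
    h.braMap (D.cl p z) (D.cl q w) = D.cl (p + q - 1) (S.bra p q z w) :=
  D.map₂_cl _ _ _ _ _ _ _ hz hw

include h in
theorem unit_closed : S.unit ∈ D.closed 0 := h.mem_closed.mpr ⟨S.unit_mem, S.diff_unit⟩

theorem unit_mulMap (α : ⨁ p, Z p ⧸ N p) : h.mulMap (D.cl 0 S.unit) α = α := by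
  refine LinearMap.congr_fun (g := LinearMap.id) (D.hom_ext fun p z hz => ?_) α
  rw [h.mulMap_cl h.unit_closed hz, cupL_apply, S.unit_cupM (h.mem_closed.mp hz).1, zero_add,
    sg_congr (-1) (b := 1) (by simp), sg_one, neg_one_zsmul, neg_neg]
  rfl

theorem mulMap_unit (α : ⨁ p, Z p ⧸ N p) : h.mulMap α (D.cl 0 S.unit) = α := by
  refine LinearMap.congr_fun (f := h.mulMap.flip (D.cl 0 S.unit)) (g := LinearMap.id)
    (D.hom_ext fun p z hz => ?_) α
  rw [LinearMap.flip_apply, h.mulMap_cl hz h.unit_closed, cupL_apply,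
    S.cupM_unit (h.mem_closed.mp hz).1, sg_smul_sg_smul]
  rfl

theorem mulMap_assoc (α β γ : ⨁ p, Z p ⧸ N p) :
    h.mulMap (h.mulMap α β) γ = h.mulMap α (h.mulMap β γ) := by
  refine LinearMap.congr_fun (f := h.mulMap.flip γ ∘ₗ h.mulMap.flip β)
    (g := h.mulMap.flip (h.mulMap β γ)) (D.hom_ext fun p x hx => ?_) α
  refine LinearMap.congr_fun (f := h.mulMap.flip γ ∘ₗ h.mulMap (D.cl p x))
    (g := h.mulMap (D.cl p x) ∘ₗ h.mulMap.flip γ) (D.hom_ext fun q y hy => ?_) β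
  refine LinearMap.congr_fun (f := h.mulMap (h.mulMap (D.cl p x) (D.cl q y)))
    (g := h.mulMap (D.cl p x) ∘ₗ h.mulMap (D.cl q y)) (D.hom_ext fun r z hz => ?_) γ
  rw [LinearMap.comp_apply, h.mulMap_cl hx hy, h.mulMap_cl hy hz,
    h.mulMap_cl (h.cupL_closed hx hy) hz, h.mulMap_cl hx (h.cupL_closed hy hz), add_assoc]
  rw [S.cupL_assoc (h.mem_closed.mp hx).1 (h.mem_closed.mp hy).1 (h.mem_closed.mp hz).1]

theorem mulMap_comm {p q : ℕ} {z w : O} (hz : z ∈ D.closed p) (hw : w ∈ D.closed q) :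
    h.mulMap (D.cl p z) (D.cl q w) = sg (p * q : ℤ) • h.mulMap (D.cl q w) (D.cl p z) := by
  have hz' := h.mem_closed.mp hz
  have hw' := h.mem_closed.mp hw
  have hx : S.diff (p + q - 1) (S.bar p z w) ∈ D.exact (p + q) := by
    rcases Nat.eq_zero_or_pos p with rfl | hp
    · rw [bar_zero, diff_zero]
      exact zero_mem _
    · have := h.diff_mem (S.bar_mem (show p + q = p + q - 1 + 1 by omega) hz'.1 hw'.1)
      rwa [show p + q - 1 + 1 = p + q by omega] at this
  have h1 := S.cupM_comm hz'.1 hw'.1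
  rw [hz'.2, hw'.2, map_zero, map_zero, LinearMap.zero_apply, smul_zero, add_zero, zero_sub] at h1
  have h2 : S.cupL p z w = sg (p * q : ℤ) • S.cupL q w z -
      sg (p - 1 : ℤ) • S.diff (p + q - 1) (S.bar p z w) := by
    have h3 : sg (p - 1 + (p - 1) * (q - 1) : ℤ) = -sg (p * q + (q - 1) : ℤ) := by
      rw [← mul_neg_one, ← sg_one, ← sg_add]
      exact sg_congr (-q) (by ring)
    rw [cupL_apply, cupL_apply, eq_sub_of_add_eq h1, smul_sub, smul_neg, smul_smul, smul_smul,
      ← sg_add, ← sg_add, h3, neg_smul]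
    abel
  have h3 := h.cupL_closed hw hz
  rw [add_comm q p] at h3
  rw [h.mulMap_cl hz hw, h.mulMap_cl hw hz, add_comm q p, h2,
    D.cl_sub (zsmul_mem h3 _) (zsmul_mem (D.exact_le _ hx) _), D.cl_zsmul _ h3,
    D.cl_of_exact (zsmul_mem hx _), sub_zero]

theorem braMap_swap {p q : ℕ} {z w : O} (hz : z ∈ D.closed p) (hw : w ∈ D.closed q) :
    h.braMap (D.cl p z) (D.cl q w) =
      -(sg ((p - 1) * (q - 1) : ℤ) • h.braMap (D.cl q w) (D.cl p z)) := by
  have h1 := h.bra_closed hw hz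
  rw [add_comm q p] at h1
  rw [h.braMap_cl hz hw, h.braMap_cl hw hz, add_comm q p, bra_swap, D.cl_neg (zsmul_mem h1 _),
    D.cl_zsmul _ h1]

theorem braMap_jacobi {p q r : ℕ} {x y z : O} (hx : x ∈ D.closed p) (hy : y ∈ D.closed q)
    (hz : z ∈ D.closed r) :
    h.braMap (D.cl p x) (h.braMap (D.cl q y) (D.cl r z)) =
      h.braMap (h.braMap (D.cl p x) (D.cl q y)) (D.cl r z) +
      sg ((p - 1) * (q - 1) : ℤ) • h.braMap (D.cl q y) (h.braMap (D.cl p x) (D.cl r z)) := by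
  rw [h.braMap_cl hy hz, h.braMap_cl hx hy, h.braMap_cl hx hz,
    h.braMap_cl hx (h.bra_closed hy hz), h.braMap_cl (h.bra_closed hx hy) hz,
    h.braMap_cl hy (h.bra_closed hx hz)]
  have key : ∀ {a b c : ℕ} {u v w : O}, u ∈ D.closed a → v ∈ D.closed b → w ∈ D.closed c →
      D.cl (a + (b + c - 1) - 1) (S.bra a (b + c - 1) u (S.bra b c v w)) =
        D.cl (a + b + c - 2) (S.bra a (b + c - 1) u (S.bra b c v w)) ∧
      S.bra a (b + c - 1) u (S.bra b c v w) ∈ D.closed (a + b + c - 2) := by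
    intro a b c u v w hu hv hw
    rcases Nat.eq_zero_or_pos (b + c) with h0 | h0
    · obtain ⟨rfl, rfl⟩ : b = 0 ∧ c = 0 := by omega
      rw [bra_zero_zero, bra_zero_right, D.cl_zero, D.cl_zero]
      exact ⟨rfl, zero_mem _⟩
    · have h1 := h.bra_closed hu (h.bra_closed hv hw)
      rw [show a + (b + c - 1) - 1 = a + b + c - 2 by omega] at h1 ⊢
      exact ⟨rfl, h1⟩
  have h1 := key hx hy hz
  have h2 := key hy hx hz
  have h3 := key hz hx hy
  have h4 : D.cl (p + q - 1 + r - 1) (S.bra (p + q - 1) r (S.bra p q x y) z) =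
      D.cl (p + q + r - 2) (S.bra (p + q - 1) r (S.bra p q x y) z) := by
    rcases Nat.eq_zero_or_pos (p + q) with h0 | h0
    · obtain ⟨rfl, rfl⟩ : p = 0 ∧ q = 0 := by omega
      rw [bra_zero_zero, bra_zero_left, D.cl_zero, D.cl_zero]
    · rw [show p + q - 1 + r - 1 = p + q + r - 2 by omega]
  have h5 : S.bra (p + q - 1) r (S.bra p q x y) z ∈ D.closed (p + q + r - 2) := by
    rw [bra_swap, show p + q + r - 2 = r + p + q - 2 by omega]
    exact neg_mem (zsmul_mem h3.2 _)
  have h6 := h2.2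
  rw [show q + p + r - 2 = p + q + r - 2 by omega] at h6
  rw [h1.1, h2.1, h4, show q + p + r - 2 = p + q + r - 2 by omega,
    S.jacobi (h.mem_closed.mp hx).1 (h.mem_closed.mp hy).1 (h.mem_closed.mp hz).1,
    D.cl_add h5 (zsmul_mem h6 _), D.cl_zsmul _ h6]

theorem braMap_mulMap {n p q : ℕ} {x y z : O} (hx : x ∈ D.closed n) (hy : y ∈ D.closed p)
    (hz : z ∈ D.closed q) :
    h.braMap (D.cl n x) (h.mulMap (D.cl p y) (D.cl q z)) =
      h.mulMap (h.braMap (D.cl n x) (D.cl p y)) (D.cl q z) +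
      sg ((n - 1) * p : ℤ) • h.mulMap (D.cl p y) (h.braMap (D.cl n x) (D.cl q z)) := by
  have hx' := h.mem_closed.mp hx
  have hy' := h.mem_closed.mp hy
  have hz' := h.mem_closed.mp hz
  rw [h.mulMap_cl hy hz, h.braMap_cl hx hy, h.braMap_cl hx hz,
    h.braMap_cl hx (h.cupL_closed hy hz), h.mulMap_cl (h.bra_closed hx hy) hz,
    h.mulMap_cl hy (h.bra_closed hx hz)]
  have h1 := S.bra_cupM hx'.1 hy'.1 hz'.1
  rw [hx'.2, hy'.2, hz'.2, brace_zero_left, brace_zero_mid, brace_zero_right, smul_zero, smul_zero,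
    sub_zero, sub_zero, sub_zero] at h1
  have e1 : S.diff (n + p + q - 2) (S.brace n x y z) ∈ D.exact (n + p + q - 1) := by
    rcases lt_or_ge n 2 with hn | hn
    · have : S.brace n x y z = 0 := by
        rcases n with _ | _ | n
        · simp [brace]
        · simp [brace]
        · omega
      rw [this, diff_zero]
      exact zero_mem _
    · have := h.diff_mem (S.brace_mem (show n + p + q = n + p + q - 2 + 2 by omega) hx'.1 hy'.1
        hz'.1)
      rwa [show n + p + q - 2 + 1 = n + p + q - 1 by omega] at this
  have c1 : D.cl (n + p - 1 + q) (S.cupL (n + p - 1) (S.bra n p x y) z) =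
      D.cl (n + p + q - 1) ((sg (n - 1 : ℤ) * sg (p - 1 : ℤ)) • S.cupM (S.bra n p x y) z) ∧
      S.cupM (S.bra n p x y) z ∈ D.closed (n + p + q - 1) := by
    rcases Nat.eq_zero_or_pos (n + p) with h0 | h0
    · obtain ⟨rfl, rfl⟩ : n = 0 ∧ p = 0 := by omega
      rw [bra_zero_zero, map_zero, LinearMap.zero_apply, cupM_zero_left, smul_zero, D.cl_zero,
        D.cl_zero]
      exact ⟨rfl, zero_mem _⟩
    · have h2 := h.cupL_closed (h.bra_closed hx hy) hz
      rw [cupL_apply, show n + p - 1 + q = n + p + q - 1 by omega] at h2 ⊢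
      have h3 := zsmul_mem h2 (sg ((n + p - 1 : ℕ) - 1 : ℤ))
      rw [sg_smul_sg_smul] at h3
      refine ⟨?_, h3⟩
      rw [← sg_add, sg_congr 0]
      rw [show ((n + p - 1 : ℕ) : ℤ) = n + p - 1 by omega]
      ring
  have c2 : D.cl (p + (n + q - 1)) (S.cupL p y (S.bra n q x z)) =
      D.cl (n + p + q - 1) (sg (p - 1 : ℤ) • S.cupM y (S.bra n q x z)) ∧
      S.cupM y (S.bra n q x z) ∈ D.closed (n + p + q - 1) := by
    rcases Nat.eq_zero_or_pos (n + q) with h0 | h0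
    · obtain ⟨rfl, rfl⟩ : n = 0 ∧ q = 0 := by omega
      rw [bra_zero_zero, map_zero, cupM_zero_right, smul_zero, D.cl_zero,
        D.cl_zero]
      exact ⟨rfl, zero_mem _⟩
    · have h2 := h.cupL_closed hy (h.bra_closed hx hz)
      rw [cupL_apply, show p + (n + q - 1) = n + p + q - 1 by omega] at h2 ⊢
      have h3 := zsmul_mem h2 (sg (p - 1 : ℤ))
      rw [sg_smul_sg_smul] at h3
      exact ⟨rfl, h3⟩
  have h4 : S.bra n (p + q) x (S.cupL p y z) =
      (sg (n - 1 : ℤ) * sg (p - 1 : ℤ)) • S.cupM (S.bra n p x y) z +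
      sg ((n - 1) * p : ℤ) • sg (p - 1 : ℤ) • S.cupM y (S.bra n q x z) +
      (sg (n - 1 : ℤ) * sg (p - 1 : ℤ)) • S.diff (n + p + q - 2) (S.brace n x y z) := by
    have h5 := congrArg (sg (n - 1 : ℤ) • ·) h1
    simp only [sg_smul_sg_smul] at h5
    rw [cupL_apply, ← braL_apply, map_zsmul, braL_apply, h5]
    have e2 : sg (p - 1 : ℤ) * (sg (n - 1 : ℤ) * sg ((n - 1) * (p - 1) : ℤ)) =
        sg ((n - 1) * p : ℤ) * sg (p - 1 : ℤ) := by
      rw [← sg_add, ← sg_add, ← sg_add]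
      exact sg_congr 0 (by ring)
    simp only [smul_add, smul_smul]
    rw [mul_comm (sg (p - 1 : ℤ)) (sg (n - 1 : ℤ)), ← e2]
  rw [show n + (p + q) - 1 = n + p + q - 1 by omega, h4, c1.1, c2.1,
    D.cl_add (add_mem (zsmul_mem c1.2 _) (zsmul_mem (zsmul_mem c2.2 _) _))
      (zsmul_mem (D.exact_le _ e1) _),
    D.cl_add (zsmul_mem c1.2 _) (zsmul_mem (zsmul_mem c2.2 _) _), D.cl_of_exact (zsmul_mem e1 _),
    add_zero, D.cl_zsmul _ (zsmul_mem c2.2 _)]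

end IsCohomology

end Oper

end Gerstenhaber
end HopfCalculus

namespace HopfCalculus

section BatalinVilkovisky

variable {k : Type v} [CommRing k] {O X : Type u} [AddCommGroup O] [Module k O] [AddCommGroup X]
  [Module k X]

theorem eq_zero_of_mem_homog {V : ℕ → Type u} [∀ p, AddCommGroup (V p)] [∀ p, Module k (V p)]
    {p : ℤ} (hp : p < 0) {α : ⨁ p, V p} (h : α ∈ homog k V p) : α = 0 := by
  rcases p with p | p
  · exact absurd hp (by simp)
  · exact h

variable {S : Oper k O} {Z : ℕ → Type u} [∀ p, AddCommGroup (Z p)] [∀ p, Module k (Z p)]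
  {N : ∀ p, Submodule k (Z p)} {D : Subquot k O Z N}

/-- The cohomology of an operad with multiplication is a Gerstenhaber algebra. -/
noncomputable def Oper.IsCohomology.gerstenhaber (h : S.IsCohomology D) :
    GerstenhaberAlgebra k (fun p => Z p ⧸ N p) where
  one := D.cl 0 S.unit
  mul := h.mulMap
  bracket := h.braMap
  one_mem := D.cl_mem_homog 0 _
  mul_mem p q α hα β hβ := by
    rcases D.eq_cl_of_homog hα with rfl | ⟨p, rfl, z, hz, rfl⟩
    · rw [map_zero, LinearMap.zero_apply]
      exact zero_mem _
    rcases D.eq_cl_of_homog hβ with rfl | ⟨q, rfl, w, hw, rfl⟩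
    · rw [map_zero]
      exact zero_mem _
    rw [h.mulMap_cl hz hw, ← Nat.cast_add]
    exact D.cl_mem_homog _ _
  bracket_mem p q α hα β hβ := by
    rcases D.eq_cl_of_homog hα with rfl | ⟨p, rfl, z, hz, rfl⟩
    · rw [map_zero, LinearMap.zero_apply]
      exact zero_mem _
    rcases D.eq_cl_of_homog hβ with rfl | ⟨q, rfl, w, hw, rfl⟩
    · rw [map_zero]
      exact zero_mem _
    rw [h.braMap_cl hz hw]
    rcases Nat.eq_zero_or_pos (p + q) with h0 | h0
    · obtain ⟨rfl, rfl⟩ : p = 0 ∧ q = 0 := by omega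
      rw [Oper.bra_zero_zero, D.cl_zero]
      exact zero_mem _
    · rw [show (p + q - 1 : ℤ) = (p + q - 1 : ℕ) by omega]
      exact D.cl_mem_homog _ _
  one_mul := h.unit_mulMap
  mul_one := h.mulMap_unit
  mul_assoc := h.mulMap_assoc
  mul_comm p q α hα β hβ := by
    rcases D.eq_cl_of_homog hα with rfl | ⟨p, rfl, z, hz, rfl⟩
    · simp
    rcases D.eq_cl_of_homog hβ with rfl | ⟨q, rfl, w, hw, rfl⟩
    · simp
    exact h.mulMap_comm hz hw
  antisymm p q α hα β hβ := by
    rcases D.eq_cl_of_homog hα with rfl | ⟨p, rfl, z, hz, rfl⟩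
    · simp
    rcases D.eq_cl_of_homog hβ with rfl | ⟨q, rfl, w, hw, rfl⟩
    · simp
    exact h.braMap_swap hz hw
  jacobi p q α hα β hβ γ := by
    rcases D.eq_cl_of_homog hα with rfl | ⟨p, rfl, z, hz, rfl⟩
    · simp
    rcases D.eq_cl_of_homog hβ with rfl | ⟨q, rfl, w, hw, rfl⟩
    · simp
    exact LinearMap.congr_fun (f := h.braMap (D.cl p z) ∘ₗ h.braMap (D.cl q w))
      (g := h.braMap (h.braMap (D.cl p z) (D.cl q w)) +
        sg ((p - 1) * (q - 1) : ℤ) • (h.braMap (D.cl q w) ∘ₗ h.braMap (D.cl p z)))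
      (D.hom_ext fun r y hy => h.braMap_jacobi hz hw hy) γ
  leibniz p q γ hγ α hα β := by
    rcases D.eq_cl_of_homog hγ with rfl | ⟨p, rfl, z, hz, rfl⟩
    · simp
    rcases D.eq_cl_of_homog hα with rfl | ⟨q, rfl, w, hw, rfl⟩
    · simp
    exact LinearMap.congr_fun (f := h.braMap (D.cl p z) ∘ₗ h.mulMap (D.cl q w))
      (g := h.mulMap (h.braMap (D.cl p z) (D.cl q w)) +
        sg ((p - 1) * q : ℤ) • (h.mulMap (D.cl q w) ∘ₗ h.braMap (D.cl p z)))
      (D.hom_ext fun r y hy => h.braMap_mulMap hz hw hy) β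

namespace CycMod

variable (M : CycMod k S X)

/-- The cap product as a bilinear map. -/
def capL : O →ₗ[k] X →ₗ[k] X := -(M.app ∘ₗ S.comp 1 S.mul)

theorem capL_apply (φ : O) (x : X) : M.capL φ x = -M.capD φ x := by
  rw [capD_apply]
  rfl

theorem capD_zero (x : X) : M.capD 0 x = 0 := contr_zero_mid M 2 S.mul x

theorem contr_mem {m n p l : ℕ} (h : l + n + p = m + 2) {α β : O} {x : X} (hα : α ∈ S.deg n)
    (hβ : β ∈ S.deg p) (hx : x ∈ M.deg m) : M.contr n α β x ∈ M.deg l := by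
  rw [contr_apply]
  refine Submodule.sum_mem _ fun j hj => Submodule.sum_mem _ fun i _ => ?_
  rw [Finset.mem_range] at hj
  obtain ⟨n, rfl⟩ : ∃ n', n = n' + 1 := ⟨n - 1, by omega⟩
  exact M.appRot_mem (by omega) _ (S.comp_mem hα hβ hj) hx

theorem capD_cupL {p q n : ℕ} {α β : O} {x : X} (hα : α ∈ S.deg p) (hβ : β ∈ S.deg q)
    (hx : x ∈ M.deg n) : M.capL (S.cupL p α β) x = M.capL α (M.capL β x) := by
  have h := M.app_comp (comp_one_mul_mem hα) (comp_one_mul_mem hβ) hx (Nat.succ_pos p)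
  rw [S.comp_zero_comp_one_mul hα hβ, map_neg, map_zsmul, LinearMap.neg_apply, LinearMap.smul_apply,
    Nat.cast_zero, neg_zero, M.rot_zero, M.rot_zero] at h
  rw [Oper.cupL_apply, map_zsmul, LinearMap.smul_apply, capL_apply, capL_apply, capL_apply, map_neg,
    neg_neg, capD_apply, capD_apply, capD_apply, ← h, smul_neg]

variable {Z₂ : ℕ → Type u} [∀ p, AddCommGroup (Z₂ p)] [∀ p, Module k (Z₂ p)]
  {N₂ : ∀ p, Submodule k (Z₂ p)}

/-- The classes of a graded subquotient are the homology classes of a cyclic module. -/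
structure IsHomology (E : Subquot k X Z₂ N₂) : Prop where
  mem_closed : ∀ {n x}, x ∈ E.closed n ↔ x ∈ M.deg n ∧ M.bd n x = 0
  bd_mem : ∀ {n x}, x ∈ M.deg (n + 1) → M.bd (n + 1) x ∈ E.exact n
  cases : ∀ {n x}, x ∈ E.exact n → ∃ w ∈ M.deg (n + 1), x = M.bd (n + 1) w

variable {M} {E : Subquot k X Z₂ N₂} (h : S.IsCohomology D) (e : M.IsHomology E)

namespace IsHomology

include h e in
theorem capL_closed {p n : ℕ} {z : O} {x : X} (hz : z ∈ D.closed p) (hx : x ∈ E.closed n) :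
    M.capL z x ∈ E.closed (n - p) := by
  rw [h.mem_closed] at hz
  rw [e.mem_closed] at hx
  rw [capL_apply]
  refine neg_mem ?_
  rcases lt_or_ge n p with hn | hn
  · rw [M.capD_of_lt hn hz.1 hx.1]
    exact zero_mem _
  · have h1 := M.bd_capD hz.1 hx.1
    rw [hx.2, hz.2, map_zero, smul_zero, add_zero, capD_zero, add_zero] at h1
    exact e.mem_closed.mpr ⟨M.capD_mem (by omega) hz.1 hx.1, h1⟩

include h e in
theorem capL_exact_left {p n : ℕ} {z : O} {x : X} (hz : z ∈ D.exact p) (hx : x ∈ E.closed n) :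
    M.capL z x ∈ E.exact (n - p) := by
  rw [e.mem_closed] at hx
  rw [capL_apply]
  obtain rfl | ⟨p, rfl, z, hz', rfl⟩ := h.cases hz
  · rw [capD_zero, neg_zero]
    exact zero_mem _
  rcases lt_or_ge n (p + 1) with hn | hn
  · rw [M.capD_of_lt hn (S.diff_mem hz') hx.1, neg_zero]
    exact zero_mem _
  · have h1 := M.bd_capD hz' hx.1
    rw [hx.2, map_zero, smul_zero, add_zero, show n - p = n - (p + 1) + 1 by omega] at h1
    rw [← eq_neg_of_add_eq_zero_left h1]
    exact e.bd_mem (M.capD_mem (by omega) hz' hx.1)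

include h e in
theorem capL_exact_right {p n : ℕ} {z : O} {x : X} (hz : z ∈ D.closed p) (hx : x ∈ E.exact n) :
    M.capL z x ∈ E.exact (n - p) := by
  rw [h.mem_closed] at hz
  rw [capL_apply]
  obtain ⟨x, hx', rfl⟩ := e.cases hx
  rcases lt_or_ge n p with hn | hn
  · rw [M.capD_of_lt hn hz.1 (M.bd_mem hx'), neg_zero]
    exact zero_mem _
  · have h1 := M.bd_capD hz.1 hx'
    rw [hz.2, capD_zero, add_zero, show n + 1 - p = n - p + 1 by omega] at h1
    rw [← sg_smul_sg_smul (p - 1 : ℤ) (M.capD z _), ← smul_neg,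
      ← eq_neg_of_add_eq_zero_left h1]
    exact zsmul_mem (e.bd_mem (M.capD_mem (by omega) hz.1 hx')) _

include e in
theorem connes_closed {n : ℕ} {x : X} (hx : x ∈ E.closed n) : M.connes n x ∈ E.closed (n + 1) := by
  rw [e.mem_closed] at hx ⊢
  rw [M.bd_connes hx.1, hx.2, map_zero, neg_zero]
  exact ⟨M.connes_mem hx.1, rfl⟩

include e in
theorem connes_exact {n : ℕ} {x : X} (hx : x ∈ E.exact n) : M.connes n x ∈ E.exact (n + 1) := by
  obtain ⟨x, hx', rfl⟩ := e.cases hx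
  have h1 := M.bd_connes hx'
  rw [Nat.add_sub_cancel] at h1
  rw [← neg_neg (M.connes _ _), ← h1]
  exact neg_mem (e.bd_mem (M.connes_mem hx'))

/-- The cap product on homology. -/
noncomputable def capMap : (⨁ p, Z p ⧸ N p) →ₗ[k] (⨁ p, Z₂ p ⧸ N₂ p) →ₗ[k] (⨁ p, Z₂ p ⧸ N₂ p) :=
  D.map₂ E E (fun p n => n - p) (fun _ _ => M.capL) (fun _ _ _ hz _ hx => capL_closed h e hz hx)
    (fun _ _ _ hz _ hx => capL_exact_left h e hz hx)
    (fun _ _ _ hz _ hx => capL_exact_right h e hz hx)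

theorem capMap_cl {p n : ℕ} {z : O} {x : X} (hz : z ∈ D.closed p) (hx : x ∈ E.closed n) :
    capMap h e (D.cl p z) (E.cl n x) = E.cl (n - p) (M.capL z x) := D.map₂_cl _ _ _ _ _ _ _ hz hx

/-- The differential `B` on homology. -/
noncomputable def connesMap : (⨁ p, Z₂ p ⧸ N₂ p) →ₗ[k] (⨁ p, Z₂ p ⧸ N₂ p) :=
  E.map E (fun n => n + 1) M.connes (fun _ _ hx => e.connes_closed hx)
    (fun _ _ hx => e.connes_exact hx)

theorem connesMap_cl {n : ℕ} {x : X} (hx : x ∈ E.closed n) :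
    connesMap e (E.cl n x) = E.cl (n + 1) (M.connes n x) := E.map_cl _ _ _ _ _ hx

/-- The Lie derivative on homology. -/
noncomputable def lieMap : (⨁ p, Z p ⧸ N p) →ₗ[k] (⨁ p, Z₂ p ⧸ N₂ p) →ₗ[k] (⨁ p, Z₂ p ⧸ N₂ p) :=
  DirectSum.toModule k ℕ _ fun p =>
    (LinearMap.llcomp k _ _ _ (connesMap e) ∘ₗ capMap h e +
      ((-sg p : ℤ) : k) • ((connesMap e).lcomp k _ ∘ₗ capMap h e)) ∘ₗ
      DirectSum.lof k ℕ (fun p => Z p ⧸ N p) p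

theorem lieMap_apply {p : ℤ} {α : ⨁ p, Z p ⧸ N p} (hα : α ∈ homog k (fun p => Z p ⧸ N p) p)
    (x : ⨁ p, Z₂ p ⧸ N₂ p) :
    lieMap h e α x = connesMap e (capMap h e α x) - sg p • capMap h e α (connesMap e x) := by
  rcases p with p | p
  · obtain ⟨v, rfl⟩ := hα
    rw [lieMap, DirectSum.toModule_lof (M := fun p => Z p ⧸ N p) k, sub_eq_add_neg, ← neg_smul,
      ← Int.cast_smul_eq_zsmul k]
    rfl
  · rw [show α = 0 from hα]
    simp

theorem connesMap_connesMap (x : ⨁ p, Z₂ p ⧸ N₂ p) : connesMap e (connesMap e x) = 0 := by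
  refine LinearMap.congr_fun (f := connesMap e ∘ₗ connesMap e) (g := 0)
    (E.hom_ext fun n x hx => ?_) x
  have hx' := e.mem_closed.mp hx
  rw [LinearMap.comp_apply, e.connesMap_cl hx, e.connesMap_cl (e.connes_closed hx),
    M.connes_connes hx'.1 hx'.2]
  exact E.cl_of_exact (neg_mem (e.bd_mem (M.connes_mem (M.conjUnit_mem
    (M.conjUnit_mem (M.norm_mem hx'.1))))))

theorem unit_capMap (x : ⨁ p, Z₂ p ⧸ N₂ p) : capMap h e (D.cl 0 S.unit) x = x := by
  refine LinearMap.congr_fun (g := LinearMap.id) (E.hom_ext fun n x hx => ?_) x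
  rw [e.capMap_cl h h.unit_closed hx, capL_apply, capD_apply, S.mul_unit_right, map_neg,
    LinearMap.neg_apply, neg_neg, M.app_one (e.mem_closed.mp hx).1]
  rfl

theorem mulMap_capMap (α β : ⨁ p, Z p ⧸ N p) (x : ⨁ p, Z₂ p ⧸ N₂ p) :
    capMap h e (h.mulMap α β) x = capMap h e α (capMap h e β x) := by
  refine LinearMap.congr_fun (f := (capMap h e).flip x ∘ₗ h.mulMap.flip β)
    (g := (capMap h e).flip (capMap h e β x)) (D.hom_ext fun p z hz => ?_) α
  refine LinearMap.congr_fun (f := (capMap h e).flip x ∘ₗ h.mulMap (D.cl p z))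
    (g := capMap h e (D.cl p z) ∘ₗ (capMap h e).flip x) (D.hom_ext fun q w hw => ?_) β
  refine LinearMap.congr_fun (f := capMap h e (h.mulMap (D.cl p z) (D.cl q w)))
    (g := capMap h e (D.cl p z) ∘ₗ capMap h e (D.cl q w)) (E.hom_ext fun n y hy => ?_) x
  rw [LinearMap.comp_apply, h.mulMap_cl hz hw, e.capMap_cl h (h.cupL_closed hz hw) hy,
    e.capMap_cl h hw hy, e.capMap_cl h hz (e.capL_closed h hw hy),
    M.capD_cupL (h.mem_closed.mp hz).1 (h.mem_closed.mp hw).1 (e.mem_closed.mp hy).1,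
    add_comm p q, Nat.sub_sub]

include h e in
theorem lieD_sub_mem {p n : ℕ} {z : O} {x : X} (hz : z ∈ D.closed p) (hx : x ∈ E.closed n) :
    M.lieD n p z x - (M.connes (n - p) (M.capL z x) - sg p • M.capL z (M.connes n x)) ∈
      E.exact (n + 1 - p) := by
  rw [h.mem_closed] at hz
  rw [e.mem_closed] at hx
  have hs : sg (p - 1 : ℤ) = -sg p := by
    rw [← mul_neg_one, ← sg_one, ← sg_add]
    exact sg_congr (-1) (by ring)
  rw [capL_apply, capL_apply, map_neg, smul_neg]
  rcases lt_trichotomy p (n + 1) with hn | hn | hn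
  · obtain ⟨r, rfl⟩ : ∃ r, n = r + p := ⟨n - p, by omega⟩
    have h1 := M.lieD_eq hz.1 hx.1
    rw [hx.2, hz.2, map_zero, map_zero, smul_zero, cartan_zero, map_zero, add_zero, add_zero,
      hs] at h1
    rw [h1, Nat.add_sub_cancel, show r + p + 1 - p = r + 1 by omega]
    have h3 := e.bd_mem (M.app_mem (m := r + 2) (n := r + 1) (by omega) S.unit_mem
      (M.cartan_mem (m := r + 1) (by omega) hz.1 hx.1))
    convert h3 using 1
    rw [neg_smul]
    abel
  · obtain rfl := hn
    have h1 : M.lieD n (n + 1) z x = M.app z (M.norm n x) := by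
      rw [lieD_apply, lieHead_apply, Nat.sub_self, Finset.range_zero, Finset.sum_empty, zero_add,
        lieTail_apply, norm_apply, map_sum]
      rfl
    have h2 := M.app_comp (comp_one_mul_mem hz.1) S.unit_mem (M.norm_mem hx.1) (Nat.succ_pos _)
    rw [← Oper.cupM_eq, S.cupM_unit hz.1, hs, Nat.cast_zero, neg_zero, M.rot_zero, M.rot_zero,
      map_zsmul, LinearMap.smul_apply] at h2
    rw [h1, M.capD_of_lt (Nat.lt_succ_self n) hz.1 hx.1, map_zero, neg_zero, zero_sub, neg_neg,
      connes_apply, map_neg, smul_neg, capD_apply, ← h2, neg_smul, smul_neg, sg_smul_sg_smul,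
      neg_neg, sub_self]
    exact zero_mem _
  · have h1 : M.lieD n p z x = 0 := by
      rw [lieD_apply, lieHead_apply, show n + 1 - p = 0 by omega, Finset.range_zero,
        Finset.sum_empty, zero_add, lieTail_apply]
      exact Finset.sum_eq_zero fun i _ => M.app_zero hn hz.1 (M.rot_mem _ hx.1)
    rw [h1, M.capD_of_lt (by omega) hz.1 hx.1, M.capD_of_lt hn hz.1 (M.connes_mem hx.1)]
    simp

include h e in
theorem connes_capL_closed {p n : ℕ} {z : O} {x : X} (hz : z ∈ D.closed p) (hx : x ∈ E.closed n) :
    M.connes (n - p) (M.capL z x) ∈ E.closed (n + 1 - p) := by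
  rcases lt_or_ge n p with hn | hn
  · rw [capL_apply, M.capD_of_lt hn (h.mem_closed.mp hz).1 (e.mem_closed.mp hx).1, neg_zero,
      map_zero]
    exact zero_mem _
  · have := e.connes_closed (e.capL_closed h hz hx)
    rwa [show n - p + 1 = n + 1 - p by omega] at this

include h e in
theorem lieD_closed {p n : ℕ} {z : O} {x : X} (hz : z ∈ D.closed p) (hx : x ∈ E.closed n) :
    M.lieD n p z x ∈ E.closed (n + 1 - p) :=
  (Submodule.sub_mem_iff_left _ (sub_mem (e.connes_capL_closed h hz hx)
    (zsmul_mem (e.capL_closed h hz (e.connes_closed hx)) _))).mp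
    (E.exact_le _ (e.lieD_sub_mem h hz hx))

theorem lieMap_cl {p n : ℕ} {z : O} {x : X} (hz : z ∈ D.closed p) (hx : x ∈ E.closed n) :
    lieMap h e (D.cl p z) (E.cl n x) = E.cl (n + 1 - p) (M.lieD n p z x) := by
  have h1 := e.connes_capL_closed h hz hx
  have h2 := e.capL_closed h hz (e.connes_closed hx)
  have h3 : E.cl (n - p + 1) (M.connes (n - p) (M.capL z x)) =
      E.cl (n + 1 - p) (M.connes (n - p) (M.capL z x)) := by
    refine E.cl_congr fun h0 => ?_
    by_contra hn
    refine h0 ?_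
    rw [capL_apply, M.capD_of_lt (by omega) (h.mem_closed.mp hz).1 (e.mem_closed.mp hx).1, neg_zero,
      map_zero]
  rw [e.lieMap_apply h (D.cl_mem_homog p z), e.capMap_cl h hz hx, e.connesMap_cl hx,
    e.connesMap_cl (e.capL_closed h hz hx), e.capMap_cl h hz (e.connes_closed hx), h3,
    ← E.cl_zsmul _ h2, ← E.cl_sub h1 (zsmul_mem h2 _), eq_comm, ← sub_eq_zero,
    ← E.cl_sub (e.lieD_closed h hz hx) (sub_mem h1 (zsmul_mem h2 _))]
  exact E.cl_of_exact (e.lieD_sub_mem h hz hx)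

end IsHomology

end CycMod

end BatalinVilkovisky
end HopfCalculus

namespace HopfCalculus

section BatalinVilkovisky

variable {k : Type v} [CommRing k] {O X : Type u} [AddCommGroup O] [Module k O] [AddCommGroup X]
  [Module k X] {S : Oper k O} {Z : ℕ → Type u} [∀ p, AddCommGroup (Z p)] [∀ p, Module k (Z p)]
  {N : ∀ p, Submodule k (Z p)} {D : Subquot k O Z N} {M : CycMod k S X}
  {Z₂ : ℕ → Type u} [∀ p, AddCommGroup (Z₂ p)] [∀ p, Module k (Z₂ p)]
  {N₂ : ∀ p, Submodule k (Z₂ p)} {E : Subquot k X Z₂ N₂}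

namespace CycMod.IsHomology

variable (h : S.IsCohomology D) (e : M.IsHomology E)

theorem capMap_mem (p n : ℤ) {α : ⨁ p, Z p ⧸ N p} (hα : α ∈ homog k (fun p => Z p ⧸ N p) p)
    {x : ⨁ p, Z₂ p ⧸ N₂ p} (hx : x ∈ homog k (fun p => Z₂ p ⧸ N₂ p) n) :
    capMap h e α x ∈ homog k (fun p => Z₂ p ⧸ N₂ p) (n - p) := by
  rcases D.eq_cl_of_homog hα with rfl | ⟨p, rfl, z, hz, rfl⟩
  · rw [map_zero, LinearMap.zero_apply]
    exact zero_mem _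
  rcases E.eq_cl_of_homog hx with rfl | ⟨n, rfl, w, hw, rfl⟩
  · rw [map_zero]
    exact zero_mem _
  rw [e.capMap_cl h hz hw]
  rcases lt_or_ge n p with hn | hn
  · rw [capL_apply, M.capD_of_lt hn (h.mem_closed.mp hz).1 (e.mem_closed.mp hw).1, neg_zero,
      E.cl_zero]
    exact zero_mem _
  · rw [← Nat.cast_sub hn]
    exact E.cl_mem_homog _ _

theorem connesMap_mem (n : ℤ) {x : ⨁ p, Z₂ p ⧸ N₂ p} (hx : x ∈ homog k (fun p => Z₂ p ⧸ N₂ p) n) :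
    connesMap e x ∈ homog k (fun p => Z₂ p ⧸ N₂ p) (n + 1) := by
  rcases E.eq_cl_of_homog hx with rfl | ⟨n, rfl, w, hw, rfl⟩
  · rw [map_zero]
    exact zero_mem _
  rw [e.connesMap_cl hw]
  exact E.cl_mem_homog (n + 1) _

theorem lieMap_mem (p n : ℤ) {α : ⨁ p, Z p ⧸ N p} (hα : α ∈ homog k (fun p => Z p ⧸ N p) p)
    {x : ⨁ p, Z₂ p ⧸ N₂ p} (hx : x ∈ homog k (fun p => Z₂ p ⧸ N₂ p) n) :
    lieMap h e α x ∈ homog k (fun p => Z₂ p ⧸ N₂ p) (n - (p - 1)) := by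
  have h1 := e.connesMap_mem _ (e.capMap_mem h p n hα hx)
  have h2 := e.capMap_mem h p _ hα (e.connesMap_mem n hx)
  rw [show n - p + 1 = n - (p - 1) by ring] at h1
  rw [show n + 1 - p = n - (p - 1) by ring] at h2
  rw [e.lieMap_apply h hα]
  exact sub_mem h1 (zsmul_mem h2 _)

theorem capMap_lieMap_cl {p q n : ℕ} {α β : O} {x : X} (hα : α ∈ D.closed p) (hβ : β ∈ D.closed q)
    (hx : x ∈ E.closed n) :
    capMap h e (D.cl q β) (lieMap h e (D.cl p α) (E.cl n x)) =
      capMap h e (h.braMap (D.cl q β) (D.cl p α)) (E.cl n x) +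
        sg ((p - 1) * q : ℤ) • lieMap h e (D.cl p α) (capMap h e (D.cl q β) (E.cl n x)) := by
  have hα' := h.mem_closed.mp hα
  have hβ' := h.mem_closed.mp hβ
  have hx' := e.mem_closed.mp hx
  rcases lt_or_ge (n + 1) (p + q) with hn | hn
  · have c1 := e.capMap_mem h q _ (D.cl_mem_homog q β) (e.lieMap_mem h p n (D.cl_mem_homog p α)
      (E.cl_mem_homog n x))
    have c2 := e.capMap_mem h _ n (h.gerstenhaber.bracket_mem q p _ (D.cl_mem_homog q β) _
      (D.cl_mem_homog p α)) (E.cl_mem_homog n x)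
    have c3 := e.lieMap_mem h p _ (D.cl_mem_homog p α) (e.capMap_mem h q n (D.cl_mem_homog q β)
      (E.cl_mem_homog n x))
    have c4 : capMap h e (h.braMap (D.cl q β) (D.cl p α)) (E.cl n x) = 0 :=
      eq_zero_of_mem_homog (by omega) c2
    rw [eq_zero_of_mem_homog (by omega) c1, eq_zero_of_mem_homog (by omega) c3, c4, smul_zero,
      add_zero]
  have d1 := e.capL_closed h hβ (e.lieD_closed h hα hx)
  have d2 : E.cl (n - (q + p - 1)) (M.capL (S.bra q p β α) x) =
      E.cl (n + 1 - p - q) (M.capL (S.bra q p β α) x) ∧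
      M.capL (S.bra q p β α) x ∈ E.closed (n + 1 - p - q) := by
    rcases Nat.eq_zero_or_pos (q + p) with h0 | h0
    · obtain ⟨rfl, rfl⟩ : q = 0 ∧ p = 0 := by omega
      rw [Oper.bra_zero_zero, map_zero, LinearMap.zero_apply, E.cl_zero, E.cl_zero]
      exact ⟨rfl, zero_mem _⟩
    · have := e.capL_closed h (h.bra_closed hβ hα) hx
      rw [show n - (q + p - 1) = n + 1 - p - q by omega] at this ⊢
      exact ⟨rfl, this⟩
  have d3 : E.cl (n - q + 1 - p) (M.lieD (n - q) p α (M.capL β x)) =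
      E.cl (n + 1 - p - q) (M.lieD (n - q) p α (M.capL β x)) ∧
      M.lieD (n - q) p α (M.capL β x) ∈ E.closed (n + 1 - p - q) := by
    rcases lt_or_ge n q with h0 | h0
    · rw [capL_apply, M.capD_of_lt h0 hβ'.1 hx'.1, neg_zero, map_zero, E.cl_zero, E.cl_zero]
      exact ⟨rfl, zero_mem _⟩
    · have := e.lieD_closed h hα (e.capL_closed h hβ hx)
      rw [show n - q + 1 - p = n + 1 - p - q by omega] at this ⊢
      exact ⟨rfl, this⟩
  have d4 : M.bd (n + 2 - p - q) (M.contr p α β x) ∈ E.exact (n + 1 - p - q) := by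
    rw [show n + 2 - p - q = n + 1 - p - q + 1 by omega]
    exact e.bd_mem (M.contr_mem (by omega) hα'.1 hβ'.1 hx'.1)
  have key : M.capL β (M.lieD n p α x) = M.capL (S.bra q p β α) x +
      sg ((p - 1) * q : ℤ) • M.lieD (n - q) p α (M.capL β x) +
      sg ((p - 1) * (q - 1) : ℤ) • M.bd (n + 2 - p - q) (M.contr p α β x) := by
    have h1 := M.capD_lieD hα'.1 hβ'.1 hx'.1
    have h2 : sg ((p - 1) * (q - 1) : ℤ) * sg (p - 1 : ℤ) = sg ((p - 1) * q : ℤ) := by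
      rw [← sg_add]
      exact sg_congr 0 (by ring)
    rw [hx'.2, hα'.2, hβ'.2, map_zero, smul_zero, sub_zero, contr_zero_left, contr_zero_mid,
      smul_zero, sub_zero] at h1
    rw [S.bra_swap q p, map_neg, map_zsmul, LinearMap.neg_apply, LinearMap.smul_apply, capL_apply,
      capL_apply, capL_apply, map_neg, ← h2, mul_comm (q - 1 : ℤ), ← smul_smul]
    have h3 := congrArg (sg ((p - 1) * (q - 1) : ℤ) • ·) h1
    simp only [smul_sub, smul_add, sg_smul_sg_smul, smul_zero] at h3
    rw [smul_neg, smul_neg, smul_neg, neg_neg, eq_comm, ← sub_eq_zero, h3]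
    abel
  rw [e.lieMap_cl h hα hx, e.capMap_cl h hβ hx, h.braMap_cl hβ hα,
    e.capMap_cl h (h.bra_closed hβ hα) hx, e.capMap_cl h hβ (e.lieD_closed h hα hx),
    e.lieMap_cl h hα (e.capL_closed h hβ hx), d2.1, d3.1, key,
    E.cl_add (add_mem d2.2 (zsmul_mem d3.2 _)) (zsmul_mem (E.exact_le _ d4) _),
    E.cl_of_exact (zsmul_mem d4 _), E.cl_add d2.2 (zsmul_mem d3.2 _), E.cl_zsmul _ d3.2, add_zero]

theorem capMap_lieMap (p q : ℤ) {α β : ⨁ p, Z p ⧸ N p}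
    (hα : α ∈ homog k (fun p => Z p ⧸ N p) p) (hβ : β ∈ homog k (fun p => Z p ⧸ N p) q)
    (x : ⨁ p, Z₂ p ⧸ N₂ p) :
    capMap h e β (lieMap h e α x) =
      capMap h e (h.braMap β α) x + sg ((p - 1) * q) • lieMap h e α (capMap h e β x) := by
  rcases D.eq_cl_of_homog hα with rfl | ⟨p, rfl, z, hz, rfl⟩
  · simp
  rcases D.eq_cl_of_homog hβ with rfl | ⟨q, rfl, w, hw, rfl⟩
  · simp
  exact LinearMap.congr_fun (f := capMap h e (D.cl q w) ∘ₗ lieMap h e (D.cl p z))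
    (g := capMap h e (h.braMap (D.cl q w) (D.cl p z)) +
      sg ((p - 1) * q : ℤ) • (lieMap h e (D.cl p z) ∘ₗ capMap h e (D.cl q w)))
    (E.hom_ext fun r y hy => e.capMap_lieMap_cl h hz hw hy) x

theorem braMap_lieMap (p q : ℤ) {α β : ⨁ p, Z p ⧸ N p}
    (hα : α ∈ homog k (fun p => Z p ⧸ N p) p) (hβ : β ∈ homog k (fun p => Z p ⧸ N p) q)
    (x : ⨁ p, Z₂ p ⧸ N₂ p) :
    lieMap h e (h.braMap α β) x = lieMap h e α (lieMap h e β x) -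
      sg ((p - 1) * (q - 1)) • lieMap h e β (lieMap h e α x) := by
  have s1 : sg (p + q - 1) = sg p * sg (q - 1) := by
    rw [← sg_add]
    exact sg_congr 0 (by ring)
  have s2 : sg ((p - 1) * (q - 1)) = sg ((q - 1) * p) * sg (q - 1) := by
    rw [← sg_add]
    exact sg_congr (1 - q) (by ring)
  have s3 : sg q = -sg (q - 1) := by
    rw [← mul_neg_one, ← sg_one, ← sg_add]
    exact sg_congr 0 (by ring)
  have m := fun y => (eq_sub_of_add_eq (e.capMap_lieMap h q p hβ hα y).symm)
  have hB : ∀ y, connesMap e (lieMap h e β y) = sg (q - 1) • lieMap h e β (connesMap e y) := by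
    intro y
    rw [e.lieMap_apply h hβ, e.lieMap_apply h hβ, map_sub, map_zsmul, connesMap_connesMap,
      connesMap_connesMap, map_zero, smul_zero, zero_sub, sub_zero, s3, neg_smul, neg_neg]
  have hL := e.lieMap_apply h (h.gerstenhaber.bracket_mem p q _ hα _ hβ) x
  have hL' : lieMap h e (h.braMap α β) x = connesMap e (capMap h e (h.braMap α β) x) -
      sg (p + q - 1) • capMap h e (h.braMap α β) (connesMap e x) := hL
  rw [hL', m, m, map_sub, map_zsmul, hB, e.lieMap_apply h hα (lieMap h e β x), hB,
    e.lieMap_apply h hα x, map_sub, map_zsmul, map_zsmul, s1, s2]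
  have s4 : sg (q - 1) * sg (q - 1) = 1 := sg_mul_self _
  simp only [smul_sub, smul_smul]
  rw [show sg p * sg (q - 1) * sg ((q - 1) * p) = sg ((q - 1) * p) * sg (q - 1) * sg p by ring]
  abel

/-- The homology of a cyclic module over an operad with multiplication is a Batalin-Vilkovisky
module. -/
noncomputable def bvModule : BVModule (fun n => Z₂ n ⧸ N₂ n) h.gerstenhaber where
  cap := capMap h e
  lie := lieMap h e
  B := connesMap e
  cap_mem p n _ hα _ hx := e.capMap_mem h p n hα hx
  lie_mem p n _ hα _ hx := e.lieMap_mem h p n hα hx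
  one_cap := e.unit_capMap h
  mul_cap := e.mulMap_capMap h
  lie_bracket p q _ hα _ hβ := e.braMap_lieMap h p q hα hβ
  mixed p q _ hα _ hβ := e.capMap_lieMap h p q hα hβ
  B_mem n _ hx := e.connesMap_mem n hx
  B_B := e.connesMap_connesMap
  homotopy _ _ hα := e.lieMap_apply h hα

end CycMod.IsHomology

end BatalinVilkovisky
end HopfCalculus

namespace HopfCalculus

theorem sum_Icc_one_eq {Z : Type*} [AddCommMonoid Z] (f : ℕ → Z) (n : ℕ) :
    ∑ i ∈ Finset.Icc 1 n, f i = ∑ i ∈ Finset.range n, f (i + 1) := by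
  induction n with
  | zero => rfl
  | succ n ih => rw [Finset.sum_Icc_succ_top (by omega), ih, Finset.sum_range_succ]

section Concrete

variable {k : Type v} {A U M : Type u} [CommRing k] [Ring A] [Algebra k A] [Ring U] [Algebra k U]
  [AddCommGroup M] [Module k M] [Module Uᵐᵒᵖ M] [IsScalarTower k Uᵐᵒᵖ M]
variable (H : LeftHopfAlgebroid k A U) (C : ModuleComodule H.toLeftBialgebroid M)

theorem app_mulCochain (y : TX M H.toLeftBialgebroid) :
    (cycMod H C).app (cycCochains H C).oper.mul (toQ H C y) =
      -toQ H C (face0T M H.toLeftBialgebroid y) := by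
  refine (appQ_of H C ⟨mulCochain H.toLeftBialgebroid, (cycCochains H C).mul_mem⟩ y).trans ?_
  have h1 : capExt H C (mulCochain H.toLeftBialgebroid) y = face0T M H.toLeftBialgebroid y :=
    (capT_mul (extT H C y)).trans (congrArg _ (face0T_extT H C y))
  rw [h1, sg_congr (a := ((2 : ℕ) - 1 : ℤ)) (b := 1) 0 (by norm_num), sg_one, neg_one_zsmul]

theorem faceT_mem_imTot {n i : ℕ} (h : i ≤ n + 1) {x : TX M H.toLeftBialgebroid}
    (hx : x ∈ gradX M H.toLeftBialgebroid (n + 1)) (hx' : x ∈ imTot H C) :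
    faceT M H.toLeftBialgebroid (n + 1) i x ∈ imTot H C := by
  obtain ⟨x, rfl⟩ := hx
  obtain ⟨y, rfl⟩ := (ofX_mem_imTot H C).mp hx'
  have h1 : ofX M H.toLeftBialgebroid (n + 1) ((1 - cycT H C (n + 1)) y) =
      ofX M H.toLeftBialgebroid (n + 1) y - perT H C (ofX M H.toLeftBialgebroid (n + 1) y) := by
    rw [perT_of, ← map_sub]
    rfl
  rw [h1, map_sub, ← perT_faceT H C h (ofX_mem _ y), ← toQ_eq_zero, map_sub, toQ_perT, sub_self]

theorem bd_toQ {n : ℕ} {x : TX M H.toLeftBialgebroid}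
    (hx : x ∈ gradX M H.toLeftBialgebroid (n + 1)) :
    (cycMod H C).bd (n + 1) (toQ H C x) = -toQ H C (bdryT M H.toLeftBialgebroid x) := by
  rw [(cycMod H C).bd_apply (toQ_mem hx), bdryT_apply hx, map_sum, ← Finset.sum_neg_distrib]
  refine Finset.sum_congr rfl fun i hi => ?_
  rw [Finset.mem_range] at hi
  obtain ⟨y, hy, hyx⟩ : ∃ y ∈ gradX M H.toLeftBialgebroid (n + 1),
      toQ H C y = (cycMod H C).rot (-i) (toQ H C x) := (cycMod H C).rot_mem (-i) (toQ_mem hx)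
  have h1 : toQ H C x = sg ((n + 1 : ℕ) * i) • toQ H C ((cycTot H C ^ i) y) := by
    rw [← rotQ_toQ H C i hy, hyx]
    refine ((cycMod H C).rot_zero _).symm.trans ?_
    refine Eq.trans ?_ ((cycMod H C).rot_rot i (-i) _).symm
    rw [add_neg_cancel]
  have h2 : toQ H C (faceT M H.toLeftBialgebroid (n + 1) i x) =
      sg ((n + 1 : ℕ) * i) •
        toQ H C (faceT M H.toLeftBialgebroid (n + 1) i ((cycTot H C ^ i) y)) := by
    rw [← map_zsmul, ← map_zsmul, ← sub_eq_zero, ← map_sub, ← map_sub, toQ_eq_zero]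
    refine faceT_mem_imTot H C (by omega) (sub_mem hx (zsmul_mem (cycTot_pow_mem H C i hy) _)) ?_
    rw [← toQ_eq_zero, map_sub, map_zsmul, ← h1, sub_self]
  have h3 := cycTot_pow_faceT H C (i := 0) i (by omega : 0 + i ≤ n + 1) hy
  rw [zero_add] at h3
  rw [← hyx, app_mulCochain, map_neg, map_zsmul, h2, ← h3, faceT_zero, smul_smul, ← sg_add]
  refine congrArg Neg.neg ((rotQ_toQ H C i (face0T_mem hy)).trans ?_)
  congr 1
  refine sg_congr (-i) ?_
  push_cast
  ring

theorem norm_toQ (n : ℕ) (x : Ch M H.η n) :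
    (cycMod H C).norm n (toQ H C (ofX M H.toLeftBialgebroid n x)) =
      toQ H C (ofX M H.toLeftBialgebroid n (normOp H C n x)) := by
  rw [CycMod.norm_apply, normOp, LinearMap.sum_apply, map_sum, map_sum]
  refine Finset.sum_congr rfl fun i _ => ?_
  rw [LinearMap.smul_apply, map_zsmul, map_zsmul, ← cycTot_pow_of, mul_comm (i : ℤ)]
  exact rotQ_toQ H C i (ofX_mem n x)

theorem app_unitCochain (y : TX M H.toLeftBialgebroid) :
    (cycMod H C).app (cycCochains H C).oper.unit (toQ H C y) = -toQ H C (extT H C y) := by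
  refine (appQ_of H C ⟨unitCochain H.toLeftBialgebroid, (cycCochains H C).unit_mem⟩ y).trans ?_
  have h1 : capExt H C (unitCochain H.toLeftBialgebroid) y = extT H C y := by
    rw [capExt_apply, insAt_unit, ← extT_extT, face0T_extT]
  rw [h1, sg_congr (a := ((0 : ℕ) - 1 : ℤ)) (b := 1) (-1) (by norm_num), sg_one, neg_one_zsmul]

theorem ofX_degLast (n : ℕ) (x : Ch M H.η n) :
    ofX M H.toLeftBialgebroid (n + 1) (degLast M H.toLeftBialgebroid n x) =
      insAt M H.toLeftBialgebroid n (unitCochain H.toLeftBialgebroid)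
        (ofX M H.toLeftBialgebroid n x) := by
  induction n with
  | zero => rw [insAt_unit, snocT_of]; rfl
  | succ n ih =>
    have : ofX M H.toLeftBialgebroid (n + 2) ∘ₗ degLast M H.toLeftBialgebroid (n + 1) =
        insAt M H.toLeftBialgebroid (n + 1) (unitCochain H.toLeftBialgebroid) ∘ₗ
          ofX M H.toLeftBialgebroid (n + 1) := Ch.hom_ext H.toLeftBialgebroid fun x u => by
      rw [LinearMap.comp_apply, LinearMap.comp_apply, ← snocT_of, insAt_snocT, ← ih, snocT_of]
      rfl
    exact LinearMap.congr_fun this x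

theorem ofX_cyc (n : ℕ) (x : Ch M H.η n) :
    ofX M H.toLeftBialgebroid n (cyc H C n x) = cycTot H C (ofX M H.toLeftBialgebroid n x) := by
  have := cycTot_pow_of H C n 1 x
  rw [pow_one, pow_one] at this
  exact this.symm

theorem connes_toQ (n : ℕ) (x : Ch M H.η n) :
    (cycMod H C).connes n (toQ H C (ofX M H.toLeftBialgebroid n x)) =
      toQ H C (ofX M H.toLeftBialgebroid (n + 1) (opB H C n x)) := by
  rw [CycMod.connes_apply, norm_toQ, app_unitCochain, neg_neg, opB, LinearMap.comp_apply, extraDeg,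
    LinearMap.comp_apply, ofX_cyc, ofX_degLast, cycTot_insAt_unit H C (ofX_mem n _)]

theorem toQ_opB' (n : ℕ) (x : Ch M H.η n) :
    toQ H C (ofX M H.toLeftBialgebroid (n + 1) (opB' H C n x)) =
      (cycMod H C).connes n (toQ H C (ofX M H.toLeftBialgebroid n x)) -
        sg (n + 1 : ℕ) • (cycMod H C).rot 1 ((cycMod H C).connes n
          (toQ H C (ofX M H.toLeftBialgebroid n x))) := by
  have h1 : opB' H C n x = opB H C n x - cyc H C (n + 1) (opB H C n x) := rfl
  have h2 : (cycMod H C).rot 1 (toQ H C (ofX M H.toLeftBialgebroid (n + 1) (opB H C n x))) =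
      sg (n + 1 : ℕ) •
        toQ H C (cycTot H C (ofX M H.toLeftBialgebroid (n + 1) (opB H C n x))) := by
    have := rotQ_toQ H C 1 (ofX_mem (n + 1) (opB H C n x))
    rw [pow_one, Nat.cast_one, mul_one] at this
    exact this
  rw [connes_toQ, h2, h1, map_sub, map_sub, ofX_cyc, sg_smul_sg_smul]

theorem capL_toQ {p : ℕ} (φ : (cycCochains H C).mem p) (x : TX M H.toLeftBialgebroid) :
    (cycMod H C).capL ((cycCochains H C).of p φ) (toQ H C x) =
      toQ H C (capT M (φ : Cochain H.toLeftBialgebroid p) x) := by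
  have h0 : (cycCochains H C).oper.comp 1 (cycCochains H C).oper.mul ((cycCochains H C).of p φ) =
      _ := (cycCochains H C).comp_of_of 1 one_lt_two
        ⟨mulCochain H.toLeftBialgebroid, (cycCochains H C).mul_mem⟩ φ
  have h1 : ∀ y, capExt H C (circAt 1 p one_lt_two (mulCochain H.toLeftBialgebroid) φ.1) y =
      capT M φ.1 y := fun y => by
    rw [capExt_apply, insAt_circAt, ← capT_apply, capT_mul_insAt_one, face0T_extT]
  have h2 : (cycMod H C).app ((cycCochains H C).of (2 - 1 + p)
      ⟨circAt 1 p one_lt_two (mulCochain H.toLeftBialgebroid) φ.1,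
        (cycCochains H C).circAt_mem 1 p one_lt_two (cycCochains H C).mul_mem φ.2⟩) (toQ H C x) =
      sg ((2 - 1 + p : ℕ) - 1 : ℤ) • toQ H C (capT M φ.1 x) :=
    (appQ_of H C _ x).trans (by rw [h1])
  rw [CycMod.capL_apply, CycMod.capD_apply, h0, map_zsmul, LinearMap.smul_apply, h2, smul_smul,
    ← sg_add, sg_congr (b := (1 : ℤ)) (p - 1) (by push_cast; ring), sg_one, neg_one_zsmul, neg_neg]

theorem ofX_cap {m p n : ℕ} (h : m + p = n) (φ : Cochain H.toLeftBialgebroid p)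
    (x : Ch M H.η n) : ofX M H.toLeftBialgebroid m (cap H h φ x) =
      capT M φ (ofX M H.toLeftBialgebroid n x) := by
  subst h
  exact (capT_of p m φ x).symm

theorem ofX_opD' {e p n : ℕ} (h : e + p = n) (φ : Cochain H.toLeftBialgebroid p)
    (x : Ch M H.η n) : ofX M H.toLeftBialgebroid (e + 1) (opD' H h φ x) =
      insAt M H.toLeftBialgebroid 0 φ (ofX M H.toLeftBialgebroid n x) := by
  subst h
  exact (insAt_of 0 φ e x).symm

theorem lieD_toQ {e p n : ℕ} (h : e + 1 + p = n + 1) (φ : (cycCochains H C).mem p)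
    (x : Ch M H.η n) :
    (cycMod H C).lieD n p ((cycCochains H C).of p φ) (toQ H C (ofX M H.toLeftBialgebroid n x)) =
      toQ H C (ofX M H.toLeftBialgebroid (e + 1)
        (lie H C h (φ : Cochain H.toLeftBialgebroid p) x)) := by
  obtain rfl : e + p = n := by omega
  have happ : ∀ y, (cycMod H C).app ((cycCochains H C).of p φ) (toQ H C y) =
      sg (p - 1 : ℤ) • toQ H C (capExt H C φ.1 y) := appQ_of H C φ
  have hrot : ∀ (i : ℕ) {l : ℕ} {y : TX M H.toLeftBialgebroid},
      y ∈ gradX M H.toLeftBialgebroid l → (cycMod H C).rot i (toQ H C y) =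
        sg (l * i) • toQ H C ((cycTot H C ^ i) y) := fun i _ _ hy => rotQ_toQ H C i hy
  have hx := ofX_mem (H := H.toLeftBialgebroid) (e + p) x
  have hG : ∀ j, capExt H C φ.1 ((cycTot H C ^ j) (ofX M H.toLeftBialgebroid (e + p) x)) ∈
      gradX M H.toLeftBialgebroid (e + 1) := fun j =>
    capExt_mem H C (by omega) φ.1 (cycTot_pow_mem H C j hx)
  have hD : ∀ a j, ofX M H.toLeftBialgebroid (e + 1) ((cyc H C (e + 1) ^ a)
      (opD' H (rfl : e + p = e + p) φ.1 ((cyc H C (e + p) ^ (j + 1)) x))) = (cycTot H C ^ (a + 1))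
        (capExt H C φ.1 ((cycTot H C ^ j) (ofX M H.toLeftBialgebroid (e + p) x))) := fun a j => by
    rw [← cycTot_pow_of, ofX_opD', ← cycTot_pow_of, pow_succ', Module.End.mul_apply,
      ← cycTot_capExt H C (by omega) φ.1 (cycTot_pow_mem H C j hx), pow_succ, Module.End.mul_apply]
  rw [CycMod.lieD_apply, CycMod.lieHead_apply, CycMod.lieTail_apply, lie, LinearMap.add_apply,
    LinearMap.sum_apply, LinearMap.sum_apply, map_add, map_add, map_sum, map_sum, map_sum, map_sum,
    sum_Icc_one_eq, sum_Icc_one_eq, ← Finset.sum_range_reflect _ (e + 1),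
    show e + p + 1 - p = e + 1 by omega]
  congr 1
  · refine Finset.sum_congr rfl fun l hl => ?_
    rw [Finset.mem_range] at hl
    obtain ⟨i, rfl⟩ : ∃ i, e = l + i := ⟨e - l, by omega⟩
    have h1 : (cycMod H C).rot (-(l + 1))
        (toQ H C (ofX M H.toLeftBialgebroid (l + i + p) x)) =
        sg ((l + i + p : ℕ) * (i + p : ℕ)) • toQ H C ((cycTot H C ^ (i + p))
          (ofX M H.toLeftBialgebroid (l + i + p) x)) := by
      rw [← hrot (i + p) hx, ← (cycMod H C).rot_add_period (toQ_mem hx)]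
      congr 2
      push_cast
      ring
    have h2 : (cycMod H C).rot (l + 1) (toQ H C (capExt H C φ.1 ((cycTot H C ^ (i + p))
        (ofX M H.toLeftBialgebroid (l + i + p) x)))) = sg ((l + i + 1 : ℕ) * (l + 1 : ℕ)) •
        toQ H C ((cycTot H C ^ (l + 1)) (capExt H C φ.1 ((cycTot H C ^ (i + p))
        (ofX M H.toLeftBialgebroid (l + i + p) x)))) := hrot (l + 1) (hG (i + p))
    rw [show l + i + 1 - 1 - l = i by omega, h1, map_zsmul, map_zsmul, happ, map_zsmul, h2,
      LinearMap.smul_apply, map_zsmul, map_zsmul, LinearMap.comp_apply, LinearMap.comp_apply,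
      show i + 1 + p = i + p + 1 by omega, hD, show l + i + 1 - (i + 1) = l by omega, smul_smul,
      smul_smul, ← sg_add, ← sg_add]
    obtain ⟨d, hd⟩ := Int.even_mul_succ_self (l + i : ℤ)
    congr 1
    refine sg_congr (d + (l + i) * p - p * l + p + l) ?_
    push_cast
    linear_combination hd
  · refine Finset.sum_congr rfl fun i _ => ?_
    rw [CycMod.appRot_apply, hrot i hx, map_zsmul, happ, LinearMap.smul_apply, map_zsmul, map_zsmul,
      LinearMap.comp_apply, LinearMap.comp_apply, hD, ← perT_apply H C (hG i), toQ_perT, smul_smul,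
      ← sg_add]
    congr 1
    refine sg_congr 0 ?_
    push_cast
    ring

end Concrete
end HopfCalculus

namespace HopfCalculus

section Classes

variable {k : Type v} {A U M : Type u} [CommRing k] [Ring A] [Algebra k A] [Ring U] [Algebra k U]
  [AddCommGroup M] [Module k M] [Module Uᵐᵒᵖ M] [IsScalarTower k Uᵐᵒᵖ M]
variable (H : LeftHopfAlgebroid k A U) (C : ModuleComodule H.toLeftBialgebroid M)

/-- The cohomology of `C_M(U)` as a subquotient of its total space. -/
noncomputable def cohomology : Subquot k (cycCochains H C).Tot (fun p => cocycles H C p)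
    (fun p => (coboundaries H C p).submoduleOf (cocycles H C p)) where
  ι p := (cycCochains H C).of p ∘ₗ Submodule.inclusion inf_le_left
  ker_le p c hc := by
    have h1 := (cycCochains H C).of_injective p (hc.trans (map_zero _).symm)
    have h2 : c = 0 := Submodule.inclusion_injective _ (h1.trans (map_zero _).symm)
    rw [h2]
    exact zero_mem _

/-- The homology of `C^{cyc}(U, M)` as a subquotient of its total space. -/
noncomputable def homology : Subquot k (QX H C) (fun n => cycles H C n)
    (fun n => (boundaries H C n).submoduleOf (cycles H C n)) where
  ι n := toQ H C ∘ₗ ofX M H.toLeftBialgebroid n ∘ₗ (cycles H C n).subtype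
  ker_le n _ hc := (le_sup_right : imT H C n ≤ boundaries H C n)
    ((ofX_mem_imTot H C).mp ((toQ_eq_zero H C).mp hc))

theorem isCohomology_cohomology : (cycCochains H C).oper.IsCohomology (cohomology H C) where
  mem_closed {p z} := by
    constructor
    · rintro ⟨c, rfl⟩
      refine ⟨(cycCochains H C).of_mem p _, ?_⟩
      refine ((cycCochains H C).of_dCochain ⟨c.1, c.2.1⟩).symm.trans ?_
      refine (congrArg _ (Subtype.ext ?_)).trans (map_zero ((cycCochains H C).of (p + 1)))
      exact c.2.2
    · rintro ⟨⟨φ, rfl⟩, h⟩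
      have h1 := (cycCochains H C).of_injective (p + 1)
        (((cycCochains H C).of_dCochain φ).trans (h.trans (map_zero _).symm))
      exact ⟨⟨φ.1, φ.2, congrArg Subtype.val h1⟩, rfl⟩
  diff_mem {p z} := by
    rintro ⟨φ, rfl⟩
    refine ⟨⟨dCochain H.toLeftBialgebroid p φ.1, (cycCochains H C).dCochain_mem φ.2,
      dCochain_dCochain p φ.1⟩, ⟨φ.1, φ.2, rfl⟩, (cycCochains H C).of_dCochain φ⟩
  cases {p z} := by
    rintro ⟨c, hc, rfl⟩
    cases p with
    | zero =>
      left
      have h1 : c = 0 := Subtype.ext hc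
      rw [h1, map_zero]
    | succ p =>
      obtain ⟨φ, hφ, hc⟩ := hc
      refine .inr ⟨p, rfl, (cycCochains H C).of p ⟨φ, hφ⟩, (cycCochains H C).of_mem p _, ?_⟩
      have h1 : Submodule.inclusion inf_le_left c = (⟨dCochain H.toLeftBialgebroid p φ,
        (cycCochains H C).dCochain_mem hφ⟩ : (cycCochains H C).mem (p + 1)) := Subtype.ext hc.symm
      exact (congrArg _ h1).trans ((cycCochains H C).of_dCochain ⟨φ, hφ⟩)

theorem mem_cycles_iff {n : ℕ} {x : Ch M H.η n} :
    x ∈ cycles H C n ↔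
      (cycMod H C).bd n (toQ H C (ofX M H.toLeftBialgebroid n x)) = 0 := by
  cases n with
  | zero => exact iff_of_true trivial ((cycMod H C).bd_zero (toQ_mem (ofX_mem 0 x)))
  | succ n =>
    rw [bd_toQ H C (ofX_mem (n + 1) x), neg_eq_zero, toQ_eq_zero, bdryT_of, ofX_mem_imTot]
    rfl

theorem isHomology_homology : (cycMod H C).IsHomology (homology H C) where
  mem_closed {n z} := by
    constructor
    · rintro ⟨c, rfl⟩
      exact ⟨toQ_mem (ofX_mem n _), (mem_cycles_iff H C).mp c.2⟩
    · rintro ⟨⟨_, ⟨x, rfl⟩, rfl⟩, h⟩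
      exact ⟨⟨x, (mem_cycles_iff H C).mpr h⟩, rfl⟩
  bd_mem {n z} := by
    rintro ⟨_, ⟨x, rfl⟩, rfl⟩
    have h1 : (cycMod H C).bd (n + 1) (toQ H C (ofX M H.toLeftBialgebroid (n + 1) x)) =
        toQ H C (ofX M H.toLeftBialgebroid n (-bdry M H.toLeftBialgebroid n x)) := by
      rw [bd_toQ H C (ofX_mem (n + 1) x), bdryT_of, map_neg, map_neg]
    have h2 : -bdry M H.toLeftBialgebroid n x ∈ cycles H C n := by
      refine neg_mem ?_
      cases n with
      | zero => trivial
      | succ n =>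
        change bdry M H.toLeftBialgebroid n (bdry M H.toLeftBialgebroid (n + 1) x) ∈ imT H C n
        rw [bdry_bdry]
        exact zero_mem _
    exact ⟨⟨_, h2⟩, le_sup_left (a := LinearMap.range (bdry M H.toLeftBialgebroid n))
      (neg_mem ⟨x, rfl⟩), h1.symm⟩
  cases {n z} := by
    rintro ⟨c, hc, rfl⟩
    obtain ⟨_, ⟨w, rfl⟩, y, hy, hc⟩ := Submodule.mem_sup.mp hc
    refine ⟨toQ H C (ofX M H.toLeftBialgebroid (n + 1) (-w)), toQ_mem (ofX_mem _ _), ?_⟩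
    have h1 : toQ H C (ofX M H.toLeftBialgebroid n y) = 0 :=
      (toQ_eq_zero H C).mpr ((ofX_mem_imTot H C).mpr hy)
    rw [bd_toQ H C (ofX_mem (n + 1) _), bdryT_of, map_neg, map_neg, map_neg, neg_neg]
    have h2 : c.1 = bdry M H.toLeftBialgebroid n w + y := hc.symm
    change toQ H C (ofX M H.toLeftBialgebroid n c.1) = _
    rw [h2, map_add, map_add, h1, add_zero]

theorem coclass_eq_cl {p : ℕ} (φ : Cochain H.toLeftBialgebroid p) (h : φ ∈ cocycles H C p) :
    coclass H C φ h = (cohomology H C).cl p ((cycCochains H C).of p ⟨φ, h.1⟩) :=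
  ((cohomology H C).cl_ι p ⟨φ, h⟩).symm

theorem of_mem_closed {p : ℕ} {φ : Cochain H.toLeftBialgebroid p} (h : φ ∈ cocycles H C p) :
    (cycCochains H C).of p ⟨φ, h.1⟩ ∈ (cohomology H C).closed p := ⟨⟨φ, h⟩, rfl⟩

theorem mem_cocycles_of_closed {p : ℕ} {φ : Cochain H.toLeftBialgebroid p} (h : φ ∈ CM H C p)
    (h' : (cycCochains H C).of p ⟨φ, h⟩ ∈ (cohomology H C).closed p) : φ ∈ cocycles H C p := by
  obtain ⟨c, hc⟩ := h'
  have h1 : c.1 = φ := congrArg Subtype.val ((cycCochains H C).of_injective p hc)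
  exact h1 ▸ c.2

theorem exists_eq_coclass {p : ℕ} {φ : Cochain H.toLeftBialgebroid p} (h : φ ∈ CM H C p)
    (h' : (cycCochains H C).of p ⟨φ, h⟩ ∈ (cohomology H C).closed p) :
    ∃ h'', (cohomology H C).cl p ((cycCochains H C).of p ⟨φ, h⟩) = coclass H C φ h'' :=
  ⟨mem_cocycles_of_closed H C h h',
    (coclass_eq_cl H C φ (mem_cocycles_of_closed H C h h')).symm⟩

theorem cycclass_eq_cl {n : ℕ} (x : Ch M H.η n) (h : x ∈ cycles H C n) :
    cycclass H C x h = (homology H C).cl n (toQ H C (ofX M H.toLeftBialgebroid n x)) :=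
  ((homology H C).cl_ι n ⟨x, h⟩).symm

theorem toQ_mem_closed {n : ℕ} {x : Ch M H.η n} (h : x ∈ cycles H C n) :
    toQ H C (ofX M H.toLeftBialgebroid n x) ∈ (homology H C).closed n := ⟨⟨x, h⟩, rfl⟩

theorem exists_eq_cycclass {n : ℕ} {x : Ch M H.η n}
    (h : toQ H C (ofX M H.toLeftBialgebroid n x) ∈ (homology H C).closed n) :
    ∃ h, (homology H C).cl n (toQ H C (ofX M H.toLeftBialgebroid n x)) = cycclass H C x h :=
  have h' := (mem_cycles_iff H C).mpr ((isHomology_homology H C).mem_closed.mp h).2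
  ⟨h', (cycclass_eq_cl H C x h').symm⟩

end Classes
end HopfCalculus

namespace HopfCalculus

section Calculus

variable {k : Type v} {A U M : Type u} [CommRing k] [Ring A] [Algebra k A] [Ring U] [Algebra k U]
  [AddCommGroup M] [Module k M] [Module Uᵐᵒᵖ M] [IsScalarTower k Uᵐᵒᵖ M]
variable (H : LeftHopfAlgebroid k A U) (C : ModuleComodule H.toLeftBialgebroid M)

/-- The Gerstenhaber algebra `H_M(U)`. -/
noncomputable def cohomologyAlgebra : GerstenhaberAlgebra k (HCo H C) :=
  (isCohomology_cohomology H C).gerstenhaber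

/-- The Batalin-Vilkovisky module `H^M(U)`. -/
noncomputable def homologyModule : BVModule (HCyc H C) (cohomologyAlgebra H C) :=
  (isHomology_homology H C).bvModule (isCohomology_cohomology H C)

theorem one_eq_coclass : ∃ h, (cohomologyAlgebra H C).one =
    coclass H C (unitCochain H.toLeftBialgebroid) h :=
  exists_eq_coclass H C (cycCochains H C).unit_mem (isCohomology_cohomology H C).unit_closed

theorem mul_coclass (p q : ℕ) (φ : Cochain H.toLeftBialgebroid p)
    (ψ : Cochain H.toLeftBialgebroid q) (hφ : φ ∈ cocycles H C p) (hψ : ψ ∈ cocycles H C q) :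
    ∃ h, (cohomologyAlgebra H C).mul (coclass H C φ hφ) (coclass H C ψ hψ) =
      coclass H C (cup H.toLeftBialgebroid p q φ ψ) h := by
  have e := (isCohomology_cohomology H C).mulMap_cl (of_mem_closed H C hφ) (of_mem_closed H C hψ)
  have c := (isCohomology_cohomology H C).cupL_closed (of_mem_closed H C hφ)
    (of_mem_closed H C hψ)
  rw [Oper.cupL_apply, ← (cycCochains H C).of_cup ⟨φ, hφ.1⟩ ⟨ψ, hψ.1⟩] at e c
  obtain ⟨h, hc⟩ := exists_eq_coclass H C ((cycCochains H C).cup_mem hφ.1 hψ.1) c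
  refine ⟨h, Eq.trans ?_ (e.trans hc)⟩
  rw [coclass_eq_cl, coclass_eq_cl]
  rfl

theorem bracket_coclass (p q n : ℕ) (hn : p + q = n + 1) (φ : Cochain H.toLeftBialgebroid p)
    (ψ : Cochain H.toLeftBialgebroid q) (hφ : φ ∈ cocycles H C p) (hψ : ψ ∈ cocycles H C q) :
    ∃ h, (cohomologyAlgebra H C).bracket (coclass H C φ hφ) (coclass H C ψ hψ) =
      coclass H C (bracket H.toLeftBialgebroid hn φ ψ) h := by
  have e := (isCohomology_cohomology H C).braMap_cl (of_mem_closed H C hφ) (of_mem_closed H C hψ)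
  have c := (isCohomology_cohomology H C).bra_closed (of_mem_closed H C hφ) (of_mem_closed H C hψ)
  rw [← (cycCochains H C).of_bracket hn ⟨φ, hφ.1⟩ ⟨ψ, hψ.1⟩, hn, Nat.add_sub_cancel] at e c
  obtain ⟨h, hc⟩ := exists_eq_coclass H C ((cycCochains H C).bracket_mem hn hφ.1 hψ.1) c
  refine ⟨h, Eq.trans ?_ (e.trans hc)⟩
  rw [coclass_eq_cl, coclass_eq_cl]
  rfl

theorem cap_cycclass (m p n : ℕ) (hn : m + p = n) (φ : Cochain H.toLeftBialgebroid p)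
    (hφ : φ ∈ cocycles H C p) (x : Ch M H.η n) (hx : x ∈ cycles H C n) :
    ∃ h, (homologyModule H C).cap (coclass H C φ hφ) (cycclass H C x hx) =
      cycclass H C (cap H hn φ x) h := by
  have e := (isHomology_homology H C).capMap_cl (isCohomology_cohomology H C)
    (of_mem_closed H C hφ) (toQ_mem_closed H C hx)
  have c := (isHomology_homology H C).capL_closed (isCohomology_cohomology H C)
    (of_mem_closed H C hφ) (toQ_mem_closed H C hx)
  have d : (cycMod H C).capL ((cycCochains H C).of p ⟨φ, hφ.1⟩)
      (toQ H C (ofX M H.toLeftBialgebroid n x)) =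
      toQ H C (ofX M H.toLeftBialgebroid m (cap H hn φ x)) :=
    (capL_toQ H C ⟨φ, hφ.1⟩ _).trans (by rw [ofX_cap])
  rw [d, show n - p = m by omega] at e c
  obtain ⟨h, hc⟩ := exists_eq_cycclass H C c
  refine ⟨h, Eq.trans ?_ (e.trans hc)⟩
  rw [coclass_eq_cl, cycclass_eq_cl]
  rfl

theorem B_cycclass (n : ℕ) (x : Ch M H.η n) (hx : x ∈ cycles H C n) :
    ∃ h, (homologyModule H C).B (cycclass H C x hx) = cycclass H C (opB H C n x) h := by
  have e := (isHomology_homology H C).connesMap_cl (toQ_mem_closed H C hx)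
  have c := (isHomology_homology H C).connes_closed (toQ_mem_closed H C hx)
  rw [connes_toQ] at e c
  obtain ⟨h, hc⟩ := exists_eq_cycclass H C c
  refine ⟨h, Eq.trans ?_ (e.trans hc)⟩
  rw [cycclass_eq_cl]
  rfl

theorem B_cycclass' (n : ℕ) (x : Ch M H.η n) (hx : x ∈ cycles H C n) :
    ∃ h, (homologyModule H C).B (cycclass H C x hx) = cycclass H C (opB' H C n x) h := by
  have e := (isHomology_homology H C).connesMap_cl (toQ_mem_closed H C hx)
  have c := (isHomology_homology H C).connes_closed (toQ_mem_closed H C hx)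
  have hx' := (isHomology_homology H C).mem_closed.mp (toQ_mem_closed H C hx)
  have d : (cycMod H C).rot 1 ((cycMod H C).connes n (toQ H C (ofX M H.toLeftBialgebroid n x))) ∈
      (homology H C).exact (n + 1) := by
    rw [← (cycMod H C).bd_conjUnit_conjUnit hx'.1 hx'.2]
    exact (isHomology_homology H C).bd_mem ((cycMod H C).conjUnit_mem
      ((cycMod H C).conjUnit_mem ((cycMod H C).norm_mem hx'.1)))
  have d' := zsmul_mem d (sg (n + 1 : ℕ))
  have c' := sub_mem c ((homology H C).exact_le _ d')
  have e' := (homology H C).cl_sub c ((homology H C).exact_le _ d')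
  rw [(homology H C).cl_of_exact d', sub_zero, ← toQ_opB'] at e'
  rw [← toQ_opB'] at c'
  obtain ⟨h, hc⟩ := exists_eq_cycclass H C c'
  refine ⟨h, Eq.trans ?_ (e.trans (e'.symm.trans hc))⟩
  rw [cycclass_eq_cl]
  rfl

theorem lie_cycclass (m p n : ℕ) (hn : m + p = n + 1) (φ : Cochain H.toLeftBialgebroid p)
    (hφ : φ ∈ cocycles H C p) (x : Ch M H.η n) (hx : x ∈ cycles H C n) :
    ∃ h, (homologyModule H C).lie (coclass H C φ hφ) (cycclass H C x hx) =
      cycclass H C (lie H C hn φ x) h := by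
  cases m with
  | zero =>
    obtain ⟨h1, e1⟩ := B_cycclass H C n x hx
    obtain ⟨h2, e2⟩ := cap_cycclass H C 0 p (n + 1) hn φ hφ _ h1
    have e3 : (homologyModule H C).cap (coclass H C φ hφ) (cycclass H C x hx) = 0 :=
      eq_zero_of_mem_homog (by omega)
        ((homologyModule H C).cap_mem p n (coclass H C φ hφ) ⟨_, rfl⟩ (cycclass H C x hx) ⟨_, rfl⟩)
    have e4 := (homologyModule H C).homotopy p (coclass H C φ hφ) ⟨_, rfl⟩ (cycclass H C x hx)
    rw [e1, e2, e3, map_zero, zero_sub] at e4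
    refine ⟨zsmul_mem h2 (sg (p - 1 : ℤ)), e4.trans ?_⟩
    have e5 : cycclass H C (lie H C hn φ x) (zsmul_mem h2 (sg (p - 1 : ℤ))) =
        sg (p - 1 : ℤ) • cycclass H C (cap H hn φ (opB H C n x)) h2 := by
      rw [cycclass_eq_cl H C _ h2, ← (homology H C).cl_zsmul _ (toQ_mem_closed H C h2),
        ← map_zsmul, ← map_zsmul]
      exact cycclass_eq_cl H C _ _
    have e6 : sg (p - 1 : ℤ) = -sg p := by
      rw [← mul_neg_one, ← sg_one, ← sg_add]
      exact sg_congr (-1) (by ring)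
    rw [e5, e6, neg_smul]
  | succ e =>
    have e1 := (isHomology_homology H C).lieMap_cl (isCohomology_cohomology H C)
      (of_mem_closed H C hφ) (toQ_mem_closed H C hx)
    have c := (isHomology_homology H C).lieD_closed (isCohomology_cohomology H C)
      (of_mem_closed H C hφ) (toQ_mem_closed H C hx)
    have d := lieD_toQ H C hn ⟨φ, hφ.1⟩ x
    rw [d, show n + 1 - p = e + 1 by omega] at e1 c
    obtain ⟨h, hc⟩ := exists_eq_cycclass H C c
    refine ⟨h, Eq.trans ?_ (e1.trans hc)⟩
    rw [coclass_eq_cl, cycclass_eq_cl]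
    rfl

end Calculus
end HopfCalculus

theorem mainTheorem1 {k : Type v} {A U M : Type u} [CommRing k] [Ring A] [Algebra k A] [Ring U]
    [Algebra k U] [AddCommGroup M] [Module k M] [Module Uᵐᵒᵖ M] [IsScalarTower k Uᵐᵒᵖ M]
    (H : HopfCalculus.LeftHopfAlgebroid k A U)
    (C : HopfCalculus.ModuleComodule H.toLeftBialgebroid M) :
    -- `C_M(U)` with `δ` is a cochain complex
    (∀ p, ∀ φ ∈ HopfCalculus.CM H C p,
      HopfCalculus.dCochain H.toLeftBialgebroid p φ ∈ HopfCalculus.CM H C (p + 1)) ∧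
    (∀ p φ, HopfCalculus.dCochain H.toLeftBialgebroid (p + 1)
      (HopfCalculus.dCochain H.toLeftBialgebroid p φ) = 0) ∧
    -- `b` induces a differential on `C^{cyc}(U, M) = C(U, M) / im(1 - T)`
    (∀ n, ∀ x ∈ HopfCalculus.imT H C (n + 1),
      HopfCalculus.bdry M H.toLeftBialgebroid n x ∈ HopfCalculus.imT H C n) ∧
    (∀ n x, HopfCalculus.bdry M H.toLeftBialgebroid n
      (HopfCalculus.bdry M H.toLeftBialgebroid (n + 1) x) = 0) ∧
    -- a Gerstenhaber algebra `G` on `H_M(U)` and a Batalin-Vilkovisky module `W` over it on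
    -- `H^M(U)`, given by the following formulas
    ∃ (G : HopfCalculus.GerstenhaberAlgebra k (HopfCalculus.HCo H C))
      (W : HopfCalculus.BVModule (HopfCalculus.HCyc H C) G),
      -- unit
      (∃ h, G.one = HopfCalculus.coclass H C
        (HopfCalculus.unitCochain H.toLeftBialgebroid) h) ∧
      -- cup product
      (∀ (p q : ℕ) (φ : HopfCalculus.Cochain H.toLeftBialgebroid p)
        (ψ : HopfCalculus.Cochain H.toLeftBialgebroid q)
        (hφ : φ ∈ HopfCalculus.cocycles H C p) (hψ : ψ ∈ HopfCalculus.cocycles H C q),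
        ∃ h, G.mul (HopfCalculus.coclass H C φ hφ) (HopfCalculus.coclass H C ψ hψ) =
          HopfCalculus.coclass H C (HopfCalculus.cup H.toLeftBialgebroid p q φ ψ) h) ∧
      -- bracket
      (∀ (p q n : ℕ) (hn : p + q = n + 1) (φ : HopfCalculus.Cochain H.toLeftBialgebroid p)
        (ψ : HopfCalculus.Cochain H.toLeftBialgebroid q)
        (hφ : φ ∈ HopfCalculus.cocycles H C p) (hψ : ψ ∈ HopfCalculus.cocycles H C q),
        ∃ h, G.bracket (HopfCalculus.coclass H C φ hφ) (HopfCalculus.coclass H C ψ hψ) =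
          HopfCalculus.coclass H C (HopfCalculus.bracket H.toLeftBialgebroid hn φ ψ) h) ∧
      -- cap product
      (∀ (m p n : ℕ) (hn : m + p = n) (φ : HopfCalculus.Cochain H.toLeftBialgebroid p)
        (hφ : φ ∈ HopfCalculus.cocycles H C p) (x : HopfCalculus.Ch M H.η n)
        (hx : x ∈ HopfCalculus.cycles H C n),
        ∃ h, W.cap (HopfCalculus.coclass H C φ hφ) (HopfCalculus.cycclass H C x hx) =
          HopfCalculus.cycclass H C (HopfCalculus.cap H hn φ x) h) ∧
      -- Lie derivative
      (∀ (m p n : ℕ) (hn : m + p = n + 1) (φ : HopfCalculus.Cochain H.toLeftBialgebroid p)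
        (hφ : φ ∈ HopfCalculus.cocycles H C p) (x : HopfCalculus.Ch M H.η n)
        (hx : x ∈ HopfCalculus.cycles H C n),
        ∃ h, W.lie (HopfCalculus.coclass H C φ hφ) (HopfCalculus.cycclass H C x hx) =
          HopfCalculus.cycclass H C (HopfCalculus.lie H C hn φ x) h) ∧
      -- the differential `B`
      (∀ (n : ℕ) (x : HopfCalculus.Ch M H.η n) (hx : x ∈ HopfCalculus.cycles H C n),
        (∃ h, W.B (HopfCalculus.cycclass H C x hx) =
          HopfCalculus.cycclass H C (HopfCalculus.opB H C n x) h) ∧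
        (∃ h, W.B (HopfCalculus.cycclass H C x hx) =
          HopfCalculus.cycclass H C (HopfCalculus.opB' H C n x) h)) :=
  ⟨fun _ _ hφ => (HopfCalculus.cycCochains H C).dCochain_mem hφ,
    HopfCalculus.dCochain_dCochain, HopfCalculus.bdry_mem_imT H C, HopfCalculus.bdry_bdry,
    HopfCalculus.cohomologyAlgebra H C, HopfCalculus.homologyModule H C,
    HopfCalculus.one_eq_coclass H C, HopfCalculus.mul_coclass H C,
    HopfCalculus.bracket_coclass H C, HopfCalculus.cap_cycclass H C, HopfCalculus.lie_cycclass H C,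
    fun n x hx => ⟨HopfCalculus.B_cycclass H C n x hx, HopfCalculus.B_cycclass' H C n x hx⟩⟩
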